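/- **Model.** Let $\psi$ be a function on a nonempty open set $\Theta\subset\mathbb R$ and $Q(t)=v_0+v_1t+v_2t^2$, with $\psi''=Q(\psi')>0$ on $\Theta$. For areas $j=1,2,\dots$ let $n_j>0$ and $x_j\in\mathbb R^p$ be known, and suppose that for each $j$ the densities $f_j(y\mid\theta)=\exp[n_j(\theta y-\psi(\theta))+c(y,n_j)]$, $\theta\in\Theta$, form a regular natural exponential family (with respect to some $\sigma$-finite dominating measure, with $\Theta$ the full natural parameter space). For $\eta=(\beta^t,\nu)^t\in\mathbb R^{p+1}$ put $m_j=\psi'(x_j^t\beta)$. The pairs $(\theta_j,y_j)$ are independent, $\theta_j$ has the Lebesgue density $\pi(\theta\mid\nu,m_j)=C(\nu,m_j)\exp[\nu(m_j\theta-\psi(\theta))]$ on $\Theta$, and $y_j\mid\theta_j\sim f_j(\cdot\mid\theta_j)$. Put $\xi_j=\psi'(\theta_j)$. **Estimator.** Put $\phi_j=(1+\nu/n_j)/(\nu-v_2)$, $g_j=(y_j-m_j,\ (y_j-m_j)^2-\phi_jQ(m_j))^t$, $\mu_{rj}=E_\eta[(y_j-m_j)^r]$, $$D_j^t=Q(m_j)\begin{pmatrix}x_j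 & Q'(m_j)\phi_jx_j\\ 0& -(1+v_2/n_j)(\nu-v_2)^{-2}\end{pmatrix},\qquad \Sigma_j=\mathrm{Cov}_\eta(g_j)=\begin{pmatrix}\mu_{2j}&\mu_{3j}\\ \mu_{3j}&\mu_{4j}-\mu_{2j}^2\end{pmatrix},$$ $s_m(\eta)=\sum_{j\le m}D_j^t\Sigma_j^{-1}g_j$ and $U_m(\eta)=\sum_{j\le m}D_j^t\Sigma_j^{-1}D_j$. Let $K\subset\mathbb R^{p+1}$ be a compact parameter set. The GT-estimator $\widehat\eta_{\rm GT}$ from $y_1,\dots,y_m$ is any measurable function of the data with values in $K$ that solves $s_m(\widehat\eta_{\rm GT})=0$ whenever this equation has a solution in $K$. The Bayes estimator is $\widehat\xi_i(y_i,\eta)=(n_iy_i+\nu m_i)/(n_i+\nu)$, the EB estimator is $\widehat\xi_i(y_i,\widehat\eta_{\rm GT})$, and ${\rm MSE}=E[\{\widehat\xi_i(y_i,\widehat\eta_{\rm GT})-\xi_i\}^2]$. **Regularity.** (a) Every point of $K$ satisfies $\nu>\max(0,3v_2)$, and the true $\eta$ is an interior point of $K$; (b) there is a compact $T\subset\Theta$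 with $x_j^t\beta\in T$ for all $j$ and all $(\beta,\nu)\in K$; (c) for some $0<a\le b$, $a\le n_j\le b$ and $a\le n_j+v_2$ for all $j$; (d) for some $c>0$, $U_m(\eta)\ge c\,m\,I$ for all large $m$; (e) for every $\varepsilon>0$ there is $\delta>0$ such that, for all large $m$, $\|E_\eta[s_m(\eta')]\|\ge\delta m$ for all $\eta'\in K$ with $\|\eta'-\eta\|\ge\varepsilon$. **Claim.** Fix an area $i$. Then, almost surely, $E[\xi_i\mid y_i]=\widehat\xi_i(y_i,\eta)$ and $$\mathrm{Var}(\xi_i\mid y_i)=T_{1i}(y_i,\eta):=\frac{Q(\widehat\xi_i(y_i,\eta))}{n_i+\nu-v_2}.$$ Let $T_{2i}(y_i,\eta)=\mathrm{tr}[P_i(y_i,\eta)U_m(\eta)^{-1}]$, where, with $g_{1i}=y_i-m_i$, $$P_i(y_i,\eta)=(n_i+\nu)^{-2}\begin{pmatrix}\nu^2Q(m_i)^2x_ix_i^t& -\frac{n_i\nu}{n_i+\nu}Q(m_i)g_{1i}x_i\\ -\frac{n_i\nu}{n_i+\nu}Q(m_i)g_{1i}x_i^t& \frac{n_i^2}{(n_i+\nu)^2}g_{1i}^2\end{pmatrix}$$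 (and $M^{-1}:=0$ for a singular matrix $M$, which can matter only for small $m$). Both $T_{1i}(y_i,\eta)$ and $T_{2i}(y_i,\eta)$ are integrable, with $$T_{1i}(\eta):=E[T_{1i}(y_i,\eta)]=\frac{\nu\,Q(m_i)}{(n_i+\nu)(\nu-v_2)},$$ $$T_{2i}(\eta):=E[T_{2i}(y_i,\eta)]=(n_i+\nu)^{-2}\,\mathrm{tr}\left[\begin{pmatrix}\nu^2Q(m_i)^2x_ix_i^t&0\\0&\frac{n_i}{n_i+\nu}\,\frac{Q(m_i)}{\nu-v_2}\end{pmatrix}U_m(\eta)^{-1}\right].$$ For every $m\ge i$ the squared error of the EB estimator is integrable, and as $m\to\infty$ $${\rm MSE}(\eta,\widehat\xi_i(y_i,\widehat\eta_{\rm GT}))=T_{1i}(\eta)+T_{2i}(\eta)+o(m^{-1}).$$ -/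

import Mathlib

open MeasureTheory ProbabilityTheory Filter Topology Asymptotics
open scoped Matrix

noncomputable section

namespace NEFQVF

/-- Index set of the parameter vector `η = (β, ν)`: `Sum.inl k` is the `k`-th regression coefficient,
`Sum.inr ()` is `ν`. -/
abbrev Idx (p : ℕ) := Fin p ⊕ Unit

/-- Parameter vectors `η = (β, ν)` with `β ∈ ℝᵖ`, `ν ∈ ℝ`. -/
abbrev Params (p : ℕ) := Idx p → ℝ

/-- The known ingredients of the area level mixed model: the cumulant function `ψ` on the natural
parameter space `Θ`, the coefficients of the variance function, and for every area `j` the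
dominating measure `base j` (Lebesgue or counting measure weighted by `exp (c (y, n j))`, in the
continuous and discrete cases), the scalar `n j` and the covariates `x j`. -/
structure AreaModel (p : ℕ) where
  ψ : ℝ → ℝ
  Θ : Set ℝ
  v₀ : ℝ
  v₁ : ℝ
  v₂ : ℝ
  base : ℕ → Measure ℝ
  n : ℕ → ℝ
  x : ℕ → Fin p → ℝ

namespace AreaModel

variable {p : ℕ} (M : AreaModel p)

/-- The quadratic variance function `Q`. -/
def Q (t : ℝ) : ℝ := M.v₀ + M.v₁ * t + M.v₂ * t ^ 2

/-- The derivative `Q'`. -/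
def Q' (t : ℝ) : ℝ := M.v₁ + 2 * M.v₂ * t

/-- For every area `j`, `exp (n j (θ y - ψ θ))`, `θ ∈ Θ`, is a regular (that is, `Θ` is the full
natural parameter space and it is open) nondegenerate natural exponential family of densities with
respect to `base j`, and the variance function is quadratic: `ψ'' = Q (ψ')`. -/
structure IsNEFQVF : Prop where
  sigmaFinite : ∀ j, SigmaFinite (M.base j)
  n_pos : ∀ j, 0 < M.n j
  isOpen : IsOpen M.Θ
  nonempty : M.Θ.Nonempty
  natural : ∀ j θ, θ ∈ M.Θ ↔ Integrable (fun y => Real.exp (M.n j * θ * y)) (M.base j)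
  cumulant : ∀ j, ∀ θ ∈ M.Θ,
    ∫ y, Real.exp (M.n j * θ * y) ∂(M.base j) = Real.exp (M.n j * M.ψ θ)
  pos : ∀ θ ∈ M.Θ, 0 < deriv (deriv M.ψ) θ
  quadratic : ∀ θ ∈ M.Θ, deriv (deriv M.ψ) θ = M.Q (deriv M.ψ θ)

/-- The hyperparameter `ν`. -/
def nu (η : Params p) : ℝ := η (Sum.inr ())

/-- The linear predictor `xⱼᵗ β`. -/
def linPred (j : ℕ) (η : Params p) : ℝ := ∑ k, M.x j k * η (Sum.inl k)

/-- The prior mean `mⱼ = ψ' (xⱼᵗ β)`. -/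
def mean (j : ℕ) (η : Params p) : ℝ := deriv M.ψ (M.linPred j η)

/-- The conditional density of `yⱼ` given `θⱼ`, with respect to `base j`. -/
def lik (j : ℕ) (θ y : ℝ) : ℝ := Real.exp (M.n j * (θ * y - M.ψ θ))

/-- The normalizing constant `C (ν, m)` of the conjugate prior. -/
def normConst (ν m : ℝ) : ℝ := (∫ θ in M.Θ, Real.exp (ν * (m * θ - M.ψ θ)))⁻¹

/-- The conjugate prior density on `Θ`, with respect to Lebesgue measure. -/
def prior (ν m θ : ℝ) : ℝ := Real.exp (ν * (m * θ - M.ψ θ)) * M.normConst ν m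

/-- The joint law of `(θⱼ, yⱼ)` under the parameter `η`. -/
def areaLaw (j : ℕ) (η : Params p) : Measure (ℝ × ℝ) :=
  ((volume.restrict M.Θ).prod (M.base j)).withDensity
    (fun z => ENNReal.ofReal (M.lik j z.1 z.2 * M.prior (nu η) (M.mean j η) z.1))

/-- The moment `μᵣⱼ = E [(yⱼ - mⱼ)ʳ]` under `η`. -/
def mu (r : ℕ) (j : ℕ) (η : Params p) : ℝ := ∫ z, (z.2 - M.mean j η) ^ r ∂(M.areaLaw j η)

/-- The factor `φⱼ = (1 + ν / nⱼ) / (ν - v₂)`. -/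
def phi (j : ℕ) (η : Params p) : ℝ := (1 + nu η / M.n j) / (nu η - M.v₂)

/-- The elementary estimating functions `gⱼ = (g₁ⱼ, g₂ⱼ)ᵗ`. -/
def g (j : ℕ) (η : Params p) (y : ℝ) : Fin 2 → ℝ :=
  ![y - M.mean j η, (y - M.mean j η) ^ 2 - M.phi j η * M.Q (M.mean j η)]

/-- The `(p + 1) × 2` matrix `Dⱼᵗ`. -/
def Dt (j : ℕ) (η : Params p) : Matrix (Idx p) (Fin 2) ℝ :=
  M.Q (M.mean j η) • Matrix.of (Sum.elim
    (fun k => ![M.x j k, M.Q' (M.mean j η) * M.phi j η * M.x j k])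
    (fun _ => ![0, -((1 + M.v₂ / M.n j) / (nu η - M.v₂) ^ 2)]))

/-- The matrix `Σⱼ = Cov (gⱼ)`. -/
def Sig (j : ℕ) (η : Params p) : Matrix (Fin 2) (Fin 2) ℝ :=
  !![M.mu 2 j η, M.mu 3 j η; M.mu 3 j η, M.mu 4 j η - M.mu 2 j η ^ 2]

/-- The estimating function `s_m = ∑ⱼ Dⱼᵗ Σⱼ⁻¹ gⱼ` from the data `y` of the first `m` areas. -/
def score (m : ℕ) (η : Params p) (y : Fin m → ℝ) : Params p :=
  ∑ j : Fin m, (M.Dt j η * (M.Sig j η)⁻¹) *ᵥ M.g j η (y j)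

/-- The matrix `U (η) = ∑ⱼ Dⱼᵗ Σⱼ⁻¹ Dⱼ`, the sum being over the first `m` areas. -/
def U (m : ℕ) (η : Params p) : Matrix (Idx p) (Idx p) ℝ :=
  ∑ j : Fin m, M.Dt j η * (M.Sig j η)⁻¹ * (M.Dt j η)ᵀ

/-- The Bayes estimator `ξ̂ⱼ (y, η) = (nⱼ y + ν mⱼ) / (nⱼ + ν)`. -/
def bayes (j : ℕ) (η : Params p) (y : ℝ) : ℝ :=
  (M.n j * y + nu η * M.mean j η) / (M.n j + nu η)

/-- `T₁ⱼ (y, η)`, the leading term of the conditional MSE. -/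
def T1cond (j : ℕ) (η : Params p) (y : ℝ) : ℝ :=
  M.Q (M.bayes j η y) / (M.n j + nu η - M.v₂)

/-- The matrix `Pⱼ (y, η)`. -/
def P (j : ℕ) (η : Params p) (y : ℝ) : Matrix (Idx p) (Idx p) ℝ :=
  let n := M.n j
  let ν := nu η
  let q := M.Q (M.mean j η)
  let g₁ := y - M.mean j η
  ((n + ν) ^ 2)⁻¹ • Matrix.fromBlocks
    ((ν ^ 2 * q ^ 2) • Matrix.vecMulVec (M.x j) (M.x j))
    (Matrix.of fun k _ => -(n * ν / (n + ν) * q * g₁ * M.x j k))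
    (Matrix.of fun _ k => -(n * ν / (n + ν) * q * g₁ * M.x j k))
    (Matrix.of fun _ _ => n ^ 2 / (n + ν) ^ 2 * g₁ ^ 2)

/-- `T₂ⱼ (y, η) = tr [Pⱼ (y, η) U (η)⁻¹]`, the second order term of the conditional MSE. -/
def T2cond (m j : ℕ) (η : Params p) (y : ℝ) : ℝ :=
  (M.P j η y * (M.U m η)⁻¹).trace

/-- `T₁ⱼ (η)`, the leading term of the unconditional MSE. -/
def T1 (j : ℕ) (η : Params p) : ℝ :=
  nu η / ((M.n j + nu η) * (nu η - M.v₂)) * M.Q (M.mean j η)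

/-- `T₂ⱼ (η)`, the second order term of the unconditional MSE. -/
def T2 (m j : ℕ) (η : Params p) : ℝ :=
  let n := M.n j
  let ν := nu η
  let q := M.Q (M.mean j η)
  ((n + ν) ^ 2)⁻¹ * (Matrix.fromBlocks
    ((ν ^ 2 * q ^ 2) • Matrix.vecMulVec (M.x j) (M.x j)) 0 0
    (Matrix.of fun (_ _ : Unit) => n / (n + ν) * q / (ν - M.v₂)) * (M.U m η)⁻¹).trace

/-- `est m` is the GT-estimator from the first `m` areas over the parameter set `K`: a measurable
function of the data with values in `K` which solves the estimating equations `s_m = 0` whenever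
they have a solution in `K`. -/
def IsGTEstimator (K : Set (Params p)) (est : (m : ℕ) → (Fin m → ℝ) → Params p) : Prop :=
  ∀ m, Measurable (est m) ∧ ∀ y, est m y ∈ K ∧
    ((∃ η ∈ K, M.score m η y = 0) → M.score m (est m y) y = 0)

variable {Ω : Type*} [MeasurableSpace Ω]

/-- The error `ξ̂ᵢ (yᵢ, η̂) - ξᵢ` of the empirical Bayes estimator, where `ξᵢ = ψ' (θᵢ)` and `η̂` is
computed from the first `m` areas. -/
def ebError (θ y : ℕ → Ω → ℝ) (est : (m : ℕ) → (Fin m → ℝ) → Params p) (m i : ℕ) (ω : Ω) : ℝ :=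
  M.bayes i (est m (fun j : Fin m => y j ω)) (y i ω) - deriv M.ψ (θ i ω)

/-- The unconditional mean squared error of the empirical Bayes estimator. -/
def MSE (μ : Measure Ω) (θ y : ℕ → Ω → ℝ) (est : (m : ℕ) → (Fin m → ℝ) → Params p)
    (m i : ℕ) : ℝ :=
  ∫ ω, M.ebError θ y est m i ω ^ 2 ∂μ

end AreaModel

end NEFQVF

end

namespace NEFQVF

/-! ### Exhaustion of an open interval and integration by parts -/

/-! The proof has two halves: exact moment identities from integration by parts in `θ`, and an
asymptotic linearization of the GT-estimator that is good enough in mean square.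

Exact identities. Put `ξ = ψ' θ`. For fixed `y` the joint density, as a function of `θ`, has
logarithmic derivative `(n + ν) (ξ̂(y) - ξ)` with `ξ̂` the Bayes estimator, and `ξ' = Q(ξ)` is a
quadratic polynomial in `ξ`. Integrating the derivative of `(ξ - m) ^ k` times the density therefore
gives polynomial relations, valid against any function of `y` (`integral_stein`). The case `k = 0`
is the posterior mean. The case `k = 1`, with `Q(ξ)` expanded about `ξ̂`, is the posterior variance.
Together with the same relations under the prior they determine all joint moments up to order four
(`jmom_values`), hence `Σ` and its determinant in closed form. Boundary terms vanish because `Θ` is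
the full natural parameter space: `ψ` cannot stay bounded above near a finite endpoint (`isSteep`).
A Lyapunov argument (`moment_weight_le`) gives moments of order `r` of `ξ` as soon as `ν > (r - 1)
v₂`. Since `ν > 3 v₂` is strict, slightly more than four moments exist, uniformly in the area. This
surplus, an exponent `q > 2` for `1 + y²`, drives the asymptotics.

Decomposition of the error. The EB error is `D + e`, where `e` is the error of the Bayes estimator
and `D` is its change when `η` is replaced by the estimate. Given `y i`, `e` has mean zero, and area
`i` is independent of the others, so `E[D e] = 0` exactly (`integral_bayes_change_mul_error`). As
`E[e²] = T₁`, it remains to show `E[D²] = T₂ + o(1/m)`.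

Linearization. Each summand of the score is a quadratic polynomial in `y j` with coefficients smooth
in the parameter. At the truth it has mean zero, covariance `H j = Dᵗ Σ⁻¹ D` and expected derivative
`-H j`. Outside exceptional events the score has a zero in a small ball about `η` and none elsewhere
in `K`, so the estimator solves the equation there and `U (η̂ - η)` is close to the score
(`SmoothScore.exists_expansion`). With `a(y)` the gradient of the Bayes estimator, `D` is then close
in mean square to `X = a(y i) · U⁻¹ s`, where `s` is the score with area `i` left out. By
independence of `s` and `y i`, `E[X²]` is the trace of `E[a aᵗ] U⁻¹ (U - H i) U⁻ᵗ`. The term with `H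
i` is of order `m⁻²`, and `a aᵗ` is the matrix `P`, so the rest is `T₂`.

Exceptional events. There only the crude bound `D² ≤ C (1 + y i ²)`, from compactness of `K`, is
available, so their probability weighted by `1 + y i ²` must be `o(1/m)` (`Negligible`). Second
moments would give only `O(1/m)`. A Rosenthal-type bound `E|S|^q ≤ C m^(q/2)` with `q > 2`
(`integral_abs_sum_rpow_le`) and Markov's inequality give `O(m^(-q/2))`. -/

theorem exists_seq_right {Θ : Set ℝ} (hΘ : IsOpen Θ) (hne : Θ.Nonempty) {p : ℕ → ℝ → Prop}
    (h : ∀ k, ∀ β₀ ∈ Θ, ∃ β ∈ Θ, β₀ < β ∧ p k β) :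
    ∃ b : ℕ → ℝ, (∀ k, b k ∈ Θ ∧ p k (b k)) ∧ ∀ θ ∈ Θ, ∀ᶠ k in atTop, θ < b k := by
  have : Nonempty Θ := hne.to_subtype
  set d := TopologicalSpace.denseSeq Θ with hd
  -- Forcing the `k`-th term beyond the first `k + 1` points of a dense sequence of `Θ` treats
  -- finite and infinite right endpoints alike.
  have hsup : ∀ k, ∃ β₀ ∈ Θ, ∀ j ≤ k, (d j : ℝ) ≤ β₀ := by
    intro k
    obtain ⟨j, hj, hmax⟩ := Finset.exists_max_image (Finset.range (k + 1)) (fun j => (d j : ℝ))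
      ⟨0, by simp⟩
    exact ⟨d j, (d j).2, fun l hl => hmax l (by simp; omega)⟩
  choose s hs hs' using hsup
  choose b hb hb' hb'' using fun k => h k (s k) (hs k)
  refine ⟨b, fun k => ⟨hb k, hb'' k⟩, fun θ hθ => ?_⟩
  obtain ⟨x, hx, hxΘ⟩ : ∃ x, θ < x ∧ x ∈ Θ := by
    have := (hΘ.mem_nhds hθ)
    have h2 : ∀ᶠ x in 𝓝[>] θ, x ∈ Θ := mem_nhdsWithin_of_mem_nhds this
    obtain ⟨x, hx, hx2⟩ := (h2.and self_mem_nhdsWithin).exists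
    exact ⟨x, hx2, hx⟩
  have hopen : IsOpen {z : Θ | θ < (z : ℝ)} := isOpen_lt continuous_const continuous_subtype_val
  obtain ⟨j, hz⟩ := (TopologicalSpace.denseRange_denseSeq Θ).exists_mem_open hopen ⟨⟨x, hxΘ⟩, hx⟩
  filter_upwards [eventually_ge_atTop j] with k hk
  exact lt_of_lt_of_le hz ((hs' k j hk).trans (hb' k).le)

theorem exists_seq_left {Θ : Set ℝ} (hΘ : IsOpen Θ) (hne : Θ.Nonempty) {p : ℕ → ℝ → Prop}
    (h : ∀ k, ∀ β₀ ∈ Θ, ∃ β ∈ Θ, β < β₀ ∧ p k β) :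
    ∃ b : ℕ → ℝ, (∀ k, b k ∈ Θ ∧ p k (b k)) ∧ ∀ θ ∈ Θ, ∀ᶠ k in atTop, b k < θ := by
  obtain ⟨b, hb, hb'⟩ := exists_seq_right (Θ := Neg.neg ⁻¹' Θ) (p := fun k x => p k (-x))
    (hΘ.preimage continuous_neg) ⟨-hne.some, by simpa using hne.some_mem⟩ (fun k β₀ h₀ => by
      obtain ⟨β, h1, h2, h3⟩ := h k (-β₀) h₀
      exact ⟨-β, by simpa using h1, by linarith, by simpa using h3⟩)
  exact ⟨fun k => -b k, hb, fun θ hθ => (hb' (-θ) (by simpa using hθ)).mono fun k hk => by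
    linarith⟩

theorem exists_gt_mem {Θ : Set ℝ} (hΘ : IsOpen Θ) {θ : ℝ} (hθ : θ ∈ Θ) : ∃ x ∈ Θ, θ < x := by
  have h2 : ∀ᶠ x in 𝓝[>] θ, x ∈ Θ := mem_nhdsWithin_of_mem_nhds (hΘ.mem_nhds hθ)
  obtain ⟨x, hx, hx2⟩ := (h2.and self_mem_nhdsWithin).exists
  exact ⟨x, hx, hx2⟩

theorem exists_lt_mem {Θ : Set ℝ} (hΘ : IsOpen Θ) {θ : ℝ} (hθ : θ ∈ Θ) : ∃ x ∈ Θ, x < θ := by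
  have h2 : ∀ᶠ x in 𝓝[<] θ, x ∈ Θ := mem_nhdsWithin_of_mem_nhds (hΘ.mem_nhds hθ)
  obtain ⟨x, hx, hx2⟩ := (h2.and self_mem_nhdsWithin).exists
  exact ⟨x, hx, hx2⟩

theorem aecover_of_seq {Θ : Set ℝ} (hΘ : IsOpen Θ) {a b : ℕ → ℝ}
    (ha : ∀ θ ∈ Θ, ∀ᶠ k in atTop, a k < θ) (hb : ∀ θ ∈ Θ, ∀ᶠ k in atTop, θ < b k) :
    AECover (volume.restrict Θ) atTop (fun k => Set.Ioc (a k) (b k)) where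
  ae_eventually_mem := by
    filter_upwards [ae_restrict_mem hΘ.measurableSet] with θ hθ
    filter_upwards [ha θ hθ, hb θ hθ] with k h1 h2 using ⟨h1, h2.le⟩
  measurableSet _ := measurableSet_Ioc

theorem setIntegral_Ioc_restrict {Θ : Set ℝ} (hc : Θ.OrdConnected) {a b : ℝ}
    (ha : a ∈ Θ) (hb : b ∈ Θ) (hab : a ≤ b) (f : ℝ → ℝ) :
    ∫ x in Set.Ioc a b, f x ∂(volume.restrict Θ) = ∫ x in a..b, f x := by
  rw [Measure.restrict_restrict measurableSet_Ioc, intervalIntegral.integral_of_le hab,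
    Set.inter_eq_left.2 (Set.Ioc_subset_Icc_self.trans (hc.out ha hb))]

/-- `ψ` has derivative `ξ` on the open interval `Θ` and is unbounded above at finite endpoints. -/
structure IsSteep (Θ : Set ℝ) (ψ ξ : ℝ → ℝ) : Prop where
  isOpen : IsOpen Θ
  ordConnected : Θ.OrdConnected
  hasDerivAt : ∀ θ ∈ Θ, HasDerivAt ψ (ξ θ) θ
  continuousOn : ContinuousOn ξ Θ
  steep : ∀ (b : ℝ) (u : ℕ → ℝ) (B : ℝ), (∀ k, u k ∈ Θ) → Tendsto u atTop (𝓝 b) →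
    (∀ k, ψ (u k) ≤ B) → b ∈ Θ

theorem IsSteep.neg {Θ : Set ℝ} {ψ ξ : ℝ → ℝ} (h : IsSteep Θ ψ ξ) :
    IsSteep (Neg.neg ⁻¹' Θ) (fun θ => ψ (-θ)) (fun θ => -ξ (-θ)) where
  isOpen := h.isOpen.preimage continuous_neg
  ordConnected := by
    constructor
    intro x hx y hy z hz
    exact h.ordConnected.out hy hx ⟨neg_le_neg hz.2, neg_le_neg hz.1⟩
  hasDerivAt θ hθ := by
    have := (h.hasDerivAt (-θ) hθ).comp θ (hasDerivAt_neg θ)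
    rw [mul_neg_one] at this
    exact this
  continuousOn := (h.continuousOn.comp continuous_neg.continuousOn fun _ hx => hx).neg
  steep b u B hu hb hB := h.steep (-b) (fun k => -u k) B hu hb.neg hB

theorem IsSteep.intervalIntegral_eq {Θ : Set ℝ} {ψ ξ : ℝ → ℝ} (h : IsSteep Θ ψ ξ) {F F' : ℝ → ℝ}
    (hF : ∀ θ ∈ Θ, HasDerivAt F (F' θ) θ) (hF' : ContinuousOn F' Θ) {a b : ℝ} (ha : a ∈ Θ)
    (hb : b ∈ Θ) (hab : a ≤ b) : ∫ x in a..b, F' x = F b - F a := by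
  have hs : Set.uIcc a b ⊆ Θ := by
    rw [Set.uIcc_of_le hab]; exact h.ordConnected.out ha hb
  exact intervalIntegral.integral_eq_sub_of_hasDerivAt (fun x hx => hF x (hs hx))
    (hF'.mono hs).intervalIntegrable

/-- If `|F| ≥ ε` held on all of `Θ` beyond `β₀`, then `1 + |ξ|` would be integrable there.
Integrability of `1` bounds this part of `Θ`, and integrability of `|ξ| = |ψ'|` bounds `ψ` above on
it. Steepness then places its supremum in the open set `Θ`, which is absurd. -/
theorem IsSteep.exists_small_right {Θ : Set ℝ} {ψ ξ F : ℝ → ℝ} (h : IsSteep Θ ψ ξ)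
    (hF : IntegrableOn (fun θ => (1 + |ξ θ|) * |F θ|) Θ) {β₀ : ℝ} (h₀ : β₀ ∈ Θ) {ε : ℝ}
    (hε : 0 < ε) : ∃ β ∈ Θ, β₀ < β ∧ |F β| < ε := by
  by_contra! hcon
  set S := Θ ∩ Set.Ioi β₀ with hS
  have hSm : MeasurableSet S := h.isOpen.measurableSet.inter measurableSet_Ioi
  have hSΘ : S ⊆ Θ := Set.inter_subset_left
  have hξS : AEStronglyMeasurable ξ (volume.restrict S) :=
    (h.continuousOn.mono hSΘ).aestronglyMeasurable hSm
  have hint : IntegrableOn (fun θ => 1 + |ξ θ|) S := by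
    refine Integrable.mono' ((hF.mono_set hSΘ).const_mul ε⁻¹)
      ((aestronglyMeasurable_const).add hξS.norm) ?_
    filter_upwards [ae_restrict_mem hSm] with θ hθ
    have h1 := hcon θ hθ.1 hθ.2
    have h2 : 0 ≤ |ξ θ| := abs_nonneg _
    rw [Real.norm_of_nonneg (by positivity), inv_mul_eq_div, le_div_iff₀ hε]
    exact mul_le_mul_of_nonneg_left h1 (by positivity)
  have hint1 : IntegrableOn (fun _ => (1 : ℝ)) S := by
    refine Integrable.mono' hint aestronglyMeasurable_const (Eventually.of_forall fun θ => ?_)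
    simp
  have hint2 : IntegrableOn (fun θ => |ξ θ|) S := by
    refine Integrable.mono' hint hξS.norm (Eventually.of_forall fun θ => ?_)
    simp
  have hbound : ∀ g : ℝ → ℝ, (∀ θ, 0 ≤ g θ) → IntegrableOn g S → ∀ β ∈ S,
      ∫ θ in β₀..β, g θ ≤ ∫ θ in S, g θ := by
    intro g hg0 hg β hβ
    rw [intervalIntegral.integral_of_le hβ.2.le]
    refine setIntegral_mono_set hg (Eventually.of_forall hg0) (LE.le.eventuallyLE ?_)
    intro x hx
    exact ⟨h.ordConnected.out h₀ hβ.1 ⟨hx.1.le, hx.2⟩, hx.1⟩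
  have hlen : ∀ β ∈ S, β ≤ β₀ + ∫ θ in S, (1 : ℝ) := by
    intro β hβ
    have := hbound _ (fun _ => zero_le_one) hint1 β hβ
    simp only [intervalIntegral.integral_const, smul_eq_mul, mul_one] at this
    linarith
  have hψ : ∀ β ∈ S, ψ β ≤ ψ β₀ + ∫ θ in S, |ξ θ| := by
    intro β hβ
    have h1 := hbound _ (fun _ => abs_nonneg _) hint2 β hβ
    have h2 := h.intervalIntegral_eq h.hasDerivAt h.continuousOn h₀ hβ.1 hβ.2.le
    have hs : Set.uIcc β₀ β ⊆ Θ := by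
      rw [Set.uIcc_of_le (le_of_lt hβ.2)]; exact h.ordConnected.out h₀ hβ.1
    have h3 : ∫ θ in β₀..β, ξ θ ≤ ∫ θ in β₀..β, |ξ θ| :=
      intervalIntegral.integral_mono_on (le_of_lt hβ.2) (h.continuousOn.mono hs).intervalIntegrable
        (h.continuousOn.mono hs).abs.intervalIntegrable fun x _ => le_abs_self _
    linarith
  have hSne : S.Nonempty := by
    obtain ⟨x, hx, hx'⟩ := exists_gt_mem h.isOpen h₀
    exact ⟨x, hx, hx'⟩
  have hSb : BddAbove S := ⟨_, hlen⟩
  obtain ⟨u, -, hu, huS⟩ := exists_seq_tendsto_sSup hSne hSb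
  have hmem : sSup S ∈ Θ := h.steep _ u _ (fun k => (huS k).1) hu fun k => hψ _ (huS k)
  obtain ⟨x, hx, hx'⟩ := exists_gt_mem h.isOpen hmem
  have : x ∈ S := ⟨hx, lt_of_lt_of_le (huS 0).2 ((le_csSup hSb (huS 0)).trans hx'.le)⟩
  exact absurd (le_csSup hSb this) (not_le.2 hx')

theorem IsSteep.exists_small_left {Θ : Set ℝ} {ψ ξ F : ℝ → ℝ} (h : IsSteep Θ ψ ξ)
    (hF : IntegrableOn (fun θ => (1 + |ξ θ|) * |F θ|) Θ) {β₀ : ℝ} (h₀ : β₀ ∈ Θ) {ε : ℝ}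
    (hε : 0 < ε) : ∃ β ∈ Θ, β < β₀ ∧ |F β| < ε := by
  have hF' : IntegrableOn (fun θ => (1 + |-ξ (-θ)|) * |F (-θ)|) (Neg.neg ⁻¹' Θ) := by
    have := (Measure.measurePreserving_neg (volume : Measure ℝ)).integrableOn_comp_preimage
      (Homeomorph.neg ℝ).measurableEmbedding (f := fun θ => (1 + |ξ θ|) * |F θ|) (s := Θ)
    simpa [Function.comp_def] using this.2 hF
  obtain ⟨β, h1, h2, h3⟩ := h.neg.exists_small_right (F := fun θ => F (-θ)) hF' (β₀ := -β₀)
    (by simpa using h₀) hε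
  exact ⟨-β, h1, by linarith, h3⟩

/-- `F` need not tend to zero at the endpoints a priori: it suffices that it is small along some
exhausting sequence of intervals, and the weight `1 + |ξ|` guarantees such a sequence. -/
theorem IsSteep.integral_deriv_eq_zero {Θ : Set ℝ} {ψ ξ F F' : ℝ → ℝ} (h : IsSteep Θ ψ ξ)
    (hF : ∀ θ ∈ Θ, HasDerivAt F (F' θ) θ) (hF' : ContinuousOn F' Θ) (hint' : IntegrableOn F' Θ)
    (hint : IntegrableOn (fun θ => (1 + |ξ θ|) * |F θ|) Θ) : ∫ θ in Θ, F' θ = 0 := by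
  rcases Θ.eq_empty_or_nonempty with rfl | hne
  · simp
  obtain ⟨b, hb, hb'⟩ := exists_seq_right (p := fun k x => |F x| < 1 / ((k : ℝ) + 1)) h.isOpen hne
    fun k β₀ h₀ => h.exists_small_right hint h₀ (by positivity)
  obtain ⟨a, ha, ha'⟩ := exists_seq_left (p := fun k x => |F x| < 1 / ((k : ℝ) + 1)) h.isOpen hne
    fun k β₀ h₀ => h.exists_small_left hint h₀ (by positivity)
  have hlim := (aecover_of_seq h.isOpen ha' hb').integral_tendsto_of_countably_generated hint'
  obtain ⟨θ₀, hθ₀⟩ := hne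
  have hzero : ∀ c : ℕ → ℝ, (∀ k, c k ∈ Θ ∧ |F (c k)| < 1 / ((k : ℝ) + 1)) →
      Tendsto (fun k => F (c k)) atTop (𝓝 0) := fun c hc =>
    squeeze_zero_norm (fun k => (hc k).2.le) tendsto_one_div_add_atTop_nhds_zero_nat
  have hlim2 : Tendsto (fun k => F (b k) - F (a k)) atTop (𝓝 0) := by
    simpa using (hzero b hb).sub (hzero a ha)
  refine tendsto_nhds_unique (hlim.congr' ?_) hlim2
  filter_upwards [ha' θ₀ hθ₀, hb' θ₀ hθ₀] with k h1 h2
  rw [setIntegral_Ioc_restrict h.ordConnected (ha k).1 (hb k).1 (h1.trans h2).le,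
    h.intervalIntegral_eq hF hF' (ha k).1 (hb k).1 (h1.trans h2).le]

/-- Nonnegative functions whose integrals over large subintervals are bounded. -/
theorem IsSteep.integrableOn_of_bounded {Θ : Set ℝ} {ψ ξ f : ℝ → ℝ} (h : IsSteep Θ ψ ξ)
    (hf : ContinuousOn f Θ) (hf0 : ∀ θ ∈ Θ, 0 ≤ f θ) {θ₀ : ℝ} (hθ₀ : θ₀ ∈ Θ) {I : ℝ}
    (hI : ∀ a ∈ Θ, ∀ b ∈ Θ, a < θ₀ → θ₀ < b → ∫ θ in a..b, f θ ≤ I) :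
    IntegrableOn f Θ ∧ ∫ θ in Θ, f θ ≤ I := by
  obtain ⟨b, hb, hb'⟩ := exists_seq_right (p := fun _ _ => True) h.isOpen ⟨θ₀, hθ₀⟩
    fun k β₀ h₀ => by simpa using exists_gt_mem h.isOpen h₀
  obtain ⟨a, ha, ha'⟩ := exists_seq_left (p := fun _ _ => True) h.isOpen ⟨θ₀, hθ₀⟩
    fun k β₀ h₀ => by simpa using exists_lt_mem h.isOpen h₀
  have hcov := aecover_of_seq h.isOpen ha' hb'
  have hev : ∀ᶠ k in atTop, ∫ x in Set.Ioc (a k) (b k), f x ∂(volume.restrict Θ) ≤ I := by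
    filter_upwards [ha' θ₀ hθ₀, hb' θ₀ hθ₀] with k h1 h2
    rw [setIntegral_Ioc_restrict h.ordConnected (ha k).1 (hb k).1 (h1.trans h2).le]
    exact hI _ (ha k).1 _ (hb k).1 h1 h2
  have hint : IntegrableOn f Θ := by
    refine hcov.integrable_of_integral_bounded_of_nonneg_ae I (fun k => ?_) ?_ hev
    · rw [IntegrableOn, Measure.restrict_restrict measurableSet_Ioc]
      have hs : Set.Icc (a k) (b k) ⊆ Θ := h.ordConnected.out (ha k).1 (hb k).1
      exact ((hf.mono hs).integrableOn_compact isCompact_Icc).mono_set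
        (Set.inter_subset_left.trans Set.Ioc_subset_Icc_self)
    · filter_upwards [ae_restrict_mem h.isOpen.measurableSet] with θ hθ using hf0 θ hθ
  exact ⟨hint, le_of_tendsto (hcov.integral_tendsto_of_countably_generated hint) hev⟩

end NEFQVF

/-! ### Analytic properties of `ψ` and integration by parts in `θ`. -/

namespace NEFQVF
namespace AreaModel

variable {p : ℕ} {M : AreaModel p}

theorem mem_Θ_iff_mem_integrableExpSet (hM : M.IsNEFQVF) (θ : ℝ) :
    θ ∈ M.Θ ↔ M.n 0 * θ ∈ integrableExpSet id (M.base 0) := by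
  rw [hM.natural 0 θ]; rfl

theorem preimage_integrableExpSet (hM : M.IsNEFQVF) :
    integrableExpSet id (M.base 0) = (fun t => (M.n 0)⁻¹ * t) ⁻¹' M.Θ := by
  ext t
  have hn := hM.n_pos 0
  rw [Set.mem_preimage, mem_Θ_iff_mem_integrableExpSet hM, mul_inv_cancel_left₀ hn.ne']

theorem ordConnected (hM : M.IsNEFQVF) : M.Θ.OrdConnected := by
  have hn := hM.n_pos 0
  have hconv : Convex ℝ (integrableExpSet id (M.base 0)) := convex_integrableExpSet
  constructor
  intro x hx y hy z hz
  rw [mem_Θ_iff_mem_integrableExpSet hM] at hx hy ⊢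
  exact hconv.ordConnected.out hx hy
    ⟨mul_le_mul_of_nonneg_left hz.1 hn.le, mul_le_mul_of_nonneg_left hz.2 hn.le⟩

theorem isOpen_integrableExpSet (hM : M.IsNEFQVF) :
    IsOpen (integrableExpSet id (M.base 0)) := by
  rw [preimage_integrableExpSet hM]
  exact hM.isOpen.preimage (by fun_prop)

theorem ψ_eq_log (hM : M.IsNEFQVF) {θ : ℝ} (hθ : θ ∈ M.Θ) :
    M.ψ θ = (M.n 0)⁻¹ * Real.log (mgf id (M.base 0) (M.n 0 * θ)) := by
  have hn := hM.n_pos 0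
  have := hM.cumulant 0 θ hθ
  rw [mgf]
  simp only [id]
  rw [this, Real.log_exp, inv_mul_cancel_left₀ hn.ne']

/-- By the cumulant identity `ψ` is a rescaled logarithm of the moment generating function of `base
0`, which is analytic in the interior of its domain. No regularity of `ψ` has to be assumed. -/
theorem analyticOnNhd_ψ (hM : M.IsNEFQVF) : AnalyticOnNhd ℝ M.ψ M.Θ := by
  intro θ hθ
  have hn := hM.n_pos 0
  have hmem : M.n 0 * θ ∈ interior (integrableExpSet id (M.base 0)) := by
    rw [(isOpen_integrableExpSet hM).interior_eq]
    exact (mem_Θ_iff_mem_integrableExpSet hM θ).1 hθ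
  have h1 : AnalyticAt ℝ (fun θ => mgf id (M.base 0) (M.n 0 * θ)) θ :=
    (analyticAt_mgf hmem).comp_of_eq (analyticAt_const.mul analyticAt_id) rfl
  have hpos : 0 < mgf id (M.base 0) (M.n 0 * θ) := by
    have := hM.cumulant 0 θ hθ
    rw [mgf]; simp only [id]; rw [this]; exact Real.exp_pos _
  have h2 : AnalyticAt ℝ (fun θ => (M.n 0)⁻¹ * Real.log (mgf id (M.base 0) (M.n 0 * θ))) θ :=
    analyticAt_const.mul (h1.log hpos)
  refine h2.congr ?_
  filter_upwards [hM.isOpen.mem_nhds hθ] with x hx using (ψ_eq_log hM hx).symm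

theorem analyticOnNhd_deriv_ψ (hM : M.IsNEFQVF) : AnalyticOnNhd ℝ (deriv M.ψ) M.Θ :=
  (analyticOnNhd_ψ hM).deriv

theorem hasDerivAt_ψ (hM : M.IsNEFQVF) {θ : ℝ} (hθ : θ ∈ M.Θ) :
    HasDerivAt M.ψ (deriv M.ψ θ) θ :=
  (analyticOnNhd_ψ hM θ hθ).differentiableAt.hasDerivAt

theorem hasDerivAt_deriv_ψ (hM : M.IsNEFQVF) {θ : ℝ} (hθ : θ ∈ M.Θ) :
    HasDerivAt (deriv M.ψ) (M.Q (deriv M.ψ θ)) θ := by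
  rw [← hM.quadratic θ hθ]
  exact (analyticOnNhd_deriv_ψ hM θ hθ).differentiableAt.hasDerivAt

theorem Q_pos (hM : M.IsNEFQVF) {θ : ℝ} (hθ : θ ∈ M.Θ) : 0 < M.Q (deriv M.ψ θ) := by
  rw [← hM.quadratic θ hθ]; exact hM.pos θ hθ

theorem continuousOn_deriv_ψ (hM : M.IsNEFQVF) : ContinuousOn (deriv M.ψ) M.Θ :=
  (analyticOnNhd_deriv_ψ hM).continuousOn

theorem continuousOn_ψ (hM : M.IsNEFQVF) : ContinuousOn M.ψ M.Θ :=
  (analyticOnNhd_ψ hM).continuousOn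

/-- If `ψ` stays bounded along points converging to `b`, Fatou's lemma makes the exponential
integral at `b` finite, and fullness of the natural parameter space puts `b` in `Θ`. -/
theorem isSteep (hM : M.IsNEFQVF) : IsSteep M.Θ M.ψ (deriv M.ψ) where
  isOpen := hM.isOpen
  ordConnected := ordConnected hM
  hasDerivAt _ hθ := hasDerivAt_ψ hM hθ
  continuousOn := continuousOn_deriv_ψ hM
  steep b u B hu hb hB := by
    have hn := hM.n_pos 0
    rw [hM.natural 0 b]
    have hfin : ∫⁻ y, ENNReal.ofReal (Real.exp (M.n 0 * b * y)) ∂(M.base 0) < ⊤ := by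
      calc ∫⁻ y, ENNReal.ofReal (Real.exp (M.n 0 * b * y)) ∂(M.base 0)
          = ∫⁻ y, liminf (fun k => ENNReal.ofReal (Real.exp (M.n 0 * u k * y))) atTop
              ∂(M.base 0) := by
            refine lintegral_congr fun y => ?_
            refine (Tendsto.liminf_eq ?_).symm
            refine ENNReal.tendsto_ofReal ((Real.continuous_exp.tendsto _).comp ?_)
            exact (hb.const_mul _).mul_const _
        _ ≤ liminf (fun k => ∫⁻ y, ENNReal.ofReal (Real.exp (M.n 0 * u k * y)) ∂(M.base 0))
              atTop := lintegral_liminf_le fun k => by fun_prop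
        _ ≤ ENNReal.ofReal (Real.exp (M.n 0 * B)) := by
            refine liminf_le_of_le (by isBoundedDefault) fun c hc => ?_
            obtain ⟨k, hk⟩ := hc.exists
            refine hk.trans ?_
            rw [← ofReal_integral_eq_lintegral_ofReal ((hM.natural 0 _).1 (hu k))
              (Eventually.of_forall fun y => (Real.exp_pos _).le), hM.cumulant 0 _ (hu k)]
            refine ENNReal.ofReal_le_ofReal (Real.exp_le_exp.2 ?_)
            exact mul_le_mul_of_nonneg_left (hB k) hn.le
        _ < ⊤ := ENNReal.ofReal_lt_top
    refine ⟨by fun_prop, ?_⟩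
    rw [hasFiniteIntegral_iff_ofReal (Eventually.of_forall fun y => (Real.exp_pos _).le)]
    exact hfin

theorem strictMonoOn_deriv_ψ (hM : M.IsNEFQVF) : StrictMonoOn (deriv M.ψ) M.Θ := by
  refine strictMonoOn_of_deriv_pos (ordConnected hM).convex (continuousOn_deriv_ψ hM) ?_
  intro x hx
  rw [hM.isOpen.interior_eq] at hx
  exact hM.pos x hx

/-- Taylor expansion of the quadratic `Q`. -/
theorem Q_eq (M : AreaModel p) (m t : ℝ) :
    M.Q t = M.Q m + M.Q' m * (t - m) + M.v₂ * (t - m) ^ 2 := by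
  simp only [Q, Q']; ring

/-! ### Integration by parts -/

/-- The integrand is the derivative of `(ξ - m) ^ k * W`. Since `Q` is quadratic, its polynomial
factor has degree `k + 1` in `ξ`, so one moment of order `k + 1` controls both the derivative and
the boundary terms. The form `W' = (A - B ξ) W` covers the prior and, for fixed `y`, the joint
density. -/
theorem integral_ibp (hM : M.IsNEFQVF) {W : ℝ → ℝ} {A B m : ℝ}
    (hW : ∀ θ ∈ M.Θ, HasDerivAt W ((A - B * deriv M.ψ θ) * W θ) θ) (k : ℕ)
    (hint : IntegrableOn (fun θ => (1 + |deriv M.ψ θ - m|) ^ (k + 1) * |W θ|) M.Θ) :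
    ∫ θ in M.Θ, (k * (deriv M.ψ θ - m) ^ (k - 1) * M.Q (deriv M.ψ θ)
      + (deriv M.ψ θ - m) ^ k * (A - B * deriv M.ψ θ)) * W θ = 0 := by
  have hs := isSteep hM
  have hξc := continuousOn_deriv_ψ hM
  have hWc : ContinuousOn W M.Θ := fun θ hθ => (hW θ hθ).continuousAt.continuousWithinAt
  have hQc : ContinuousOn (fun θ => M.Q (deriv M.ψ θ)) M.Θ := by
    unfold Q; fun_prop
  have hmeas := hM.isOpen.measurableSet
  refine hs.integral_deriv_eq_zero (F := fun θ => (deriv M.ψ θ - m) ^ k * W θ) ?_ ?_ ?_ ?_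
  · intro θ hθ
    have h1 := (((hasDerivAt_deriv_ψ hM hθ).sub_const m).fun_pow k).fun_mul (hW θ hθ)
    exact h1.congr_deriv (by ring)
  · fun_prop
  · set C : ℝ := k * (|M.Q m| + |M.Q' m| + |M.v₂|) + (|A| + |B| * (1 + |m|)) with hC
    refine Integrable.mono' (hint.const_mul C) (ContinuousOn.aestronglyMeasurable (by fun_prop) hmeas) ?_
    refine Eventually.of_forall fun θ => ?_
    set t := deriv M.ψ θ
    set a := |t - m| with ha
    have ha0 : 0 ≤ a := abs_nonneg _
    rw [norm_mul, Real.norm_eq_abs, Real.norm_eq_abs, ← mul_assoc]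
    refine mul_le_mul_of_nonneg_right ?_ (abs_nonneg _)
    have h1 : |M.Q t| ≤ (|M.Q m| + |M.Q' m| + |M.v₂|) * (1 + a) ^ 2 := by
      rw [Q_eq M m t]
      calc _ ≤ |M.Q m| + |M.Q' m| * a + |M.v₂| * a ^ 2 := by
            refine (abs_add_le _ _).trans (add_le_add ((abs_add_le _ _).trans ?_) ?_)
            · rw [abs_mul]
            · rw [abs_mul, abs_pow]
        _ ≤ _ := by
            nlinarith [abs_nonneg (M.Q m), abs_nonneg (M.Q' m), abs_nonneg M.v₂,
              mul_nonneg (abs_nonneg (M.Q m)) ha0, mul_nonneg (abs_nonneg (M.Q' m)) ha0,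
              mul_nonneg (abs_nonneg M.v₂) ha0, mul_nonneg (abs_nonneg (M.Q m)) (sq_nonneg a),
              mul_nonneg (abs_nonneg (M.Q' m)) (sq_nonneg a)]
    have h2 : |A - B * t| ≤ (|A| + |B| * (1 + |m|)) * (1 + a) := by
      have : |t| ≤ |m| + a := by
        have := abs_add_le m (t - m); simpa using this
      calc |A - B * t| ≤ |A| + |B| * |t| := by
            rw [← abs_mul]; exact abs_sub _ _
        _ ≤ |A| + |B| * (|m| + a) := by gcongr
        _ ≤ _ := by
          nlinarith [abs_nonneg A, abs_nonneg B, abs_nonneg m, mul_nonneg (abs_nonneg A) ha0,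
            mul_nonneg (mul_nonneg (abs_nonneg B) (abs_nonneg m)) ha0]
    have h3 : |k * (t - m) ^ (k - 1) * M.Q t|
        ≤ k * (|M.Q m| + |M.Q' m| + |M.v₂|) * (1 + a) ^ (k + 1) := by
      rcases k with _ | k
      · simp
      · rw [abs_mul, abs_mul, abs_pow, Nat.abs_cast, ← ha, Nat.add_sub_cancel]
        calc ((k + 1 : ℕ) : ℝ) * a ^ k * |M.Q t|
            ≤ ((k + 1 : ℕ) : ℝ) * (1 + a) ^ k *
              ((|M.Q m| + |M.Q' m| + |M.v₂|) * (1 + a) ^ 2) := by gcongr; linarith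
          _ = _ := by ring
    have h4 : |(t - m) ^ k * (A - B * t)|
        ≤ (|A| + |B| * (1 + |m|)) * (1 + a) ^ (k + 1) := by
      rw [abs_mul, abs_pow, ← ha]
      calc a ^ k * |A - B * t| ≤ (1 + a) ^ k * ((|A| + |B| * (1 + |m|)) * (1 + a)) := by
            gcongr; linarith
        _ = _ := by ring
    calc _ ≤ _ := abs_add_le _ _
      _ ≤ _ := add_le_add h3 h4
      _ = _ := by rw [hC]; ring
  · refine Integrable.mono' (hint.const_mul (1 + |m|))
      (ContinuousOn.aestronglyMeasurable (by fun_prop) hmeas) (Eventually.of_forall fun θ => ?_)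
    set t := deriv M.ψ θ
    set a := |t - m| with ha
    have ha0 : 0 ≤ a := abs_nonneg _
    have h1 : |t| ≤ |m| + a := by
      have := abs_add_le m (t - m); simpa using this
    rw [Real.norm_of_nonneg (by positivity), abs_mul, abs_pow, ← ha, ← mul_assoc, ← mul_assoc]
    refine mul_le_mul_of_nonneg_right ?_ (abs_nonneg _)
    calc (1 + |t|) * a ^ k ≤ ((1 + |m|) * (1 + a)) * (1 + a) ^ k := by
          gcongr
          · nlinarith [abs_nonneg m]
          · linarith
      _ = _ := by ring

/-! ### Moments of the conjugate prior -/

theorem continuousOn_weight (hM : M.IsNEFQVF) (ν m : ℝ) :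
    ContinuousOn (fun θ => Real.exp (ν * (m * θ - M.ψ θ))) M.Θ := by
  have := continuousOn_ψ hM
  fun_prop

theorem hasDerivAt_weight (hM : M.IsNEFQVF) (ν m : ℝ) {θ : ℝ} (hθ : θ ∈ M.Θ) :
    HasDerivAt (fun θ => Real.exp (ν * (m * θ - M.ψ θ)))
      ((ν * m - ν * deriv M.ψ θ) * Real.exp (ν * (m * θ - M.ψ θ))) θ := by
  have := ((((hasDerivAt_id' θ).const_mul m).fun_sub (hasDerivAt_ψ hM hθ)).const_mul ν).exp
  exact this.congr_deriv (by ring)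

/-- With `m = ψ' θ₀` and `ψ'` increasing, the weight `W` increases up to `θ₀` and decreases after
it. As `|ξ - m| W = |W'| / ν`, the integral is a total variation, at most `2 W(θ₀) / ν`. -/
theorem integrableOn_abs_mul_weight (hM : M.IsNEFQVF) {θ₀ ν : ℝ} (h₀ : θ₀ ∈ M.Θ) (hν : 0 < ν) :
    IntegrableOn (fun θ => |deriv M.ψ θ - deriv M.ψ θ₀| *
      Real.exp (ν * (deriv M.ψ θ₀ * θ - M.ψ θ))) M.Θ := by
  have hs := isSteep hM
  have hξc := continuousOn_deriv_ψ hM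
  set m := deriv M.ψ θ₀
  have hWc := continuousOn_weight hM ν m
  have hmono := (strictMonoOn_deriv_ψ hM).monotoneOn
  set W : ℝ → ℝ := fun θ => Real.exp (ν * (m * θ - M.ψ θ)) with hW
  have hWp : ∀ θ, 0 < W θ := fun θ => Real.exp_pos _
  refine (hs.integrableOn_of_bounded (f := fun θ => |deriv M.ψ θ - m| * W θ)
    (I := 2 / ν * W θ₀) (by fun_prop) (fun θ _ => by positivity) h₀ ?_).1
  intro a ha b hb hab hb0
  have hcont : ContinuousOn (fun θ => |deriv M.ψ θ - m| * W θ) M.Θ := by fun_prop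
  have hsub : ∀ {x y}, x ∈ M.Θ → y ∈ M.Θ → x ≤ y → Set.uIcc x y ⊆ M.Θ := fun hx hy h => by
    rw [Set.uIcc_of_le h]; exact (ordConnected hM).out hx hy
  rw [← intervalIntegral.integral_add_adjacent_intervals (b := θ₀)
    (hcont.mono (hsub ha h₀ hab.le)).intervalIntegrable
    (hcont.mono (hsub h₀ hb hb0.le)).intervalIntegrable]
  have h1 : ∫ θ in a..θ₀, |deriv M.ψ θ - m| * W θ = ν⁻¹ * W θ₀ - ν⁻¹ * W a := by
    rw [← hs.intervalIntegral_eq (F := fun θ => ν⁻¹ * W θ)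
      (F' := fun θ => (m - deriv M.ψ θ) * W θ) ?_ (by fun_prop) ha h₀ hab.le]
    · refine intervalIntegral.integral_congr fun θ hθ => ?_
      have hθ' := hsub ha h₀ hab.le hθ
      rw [Set.uIcc_of_le hab.le] at hθ
      have : deriv M.ψ θ ≤ m := hmono hθ' h₀ hθ.2
      change |deriv M.ψ θ - m| * W θ = (m - deriv M.ψ θ) * W θ
      rw [abs_of_nonpos (by linarith)]; ring
    · intro θ hθ
      refine ((hasDerivAt_weight hM ν m hθ).const_mul ν⁻¹).congr_deriv ?_
      simp only [hW]; field_simp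
  have h2 : ∫ θ in θ₀..b, |deriv M.ψ θ - m| * W θ = -ν⁻¹ * W b - -ν⁻¹ * W θ₀ := by
    rw [← hs.intervalIntegral_eq (F := fun θ => -ν⁻¹ * W θ)
      (F' := fun θ => (deriv M.ψ θ - m) * W θ) ?_ (by fun_prop) h₀ hb hb0.le]
    · refine intervalIntegral.integral_congr fun θ hθ => ?_
      have hθ' := hsub h₀ hb hb0.le hθ
      rw [Set.uIcc_of_le hb0.le] at hθ
      have : m ≤ deriv M.ψ θ := hmono h₀ hθ' hθ.1
      change |deriv M.ψ θ - m| * W θ = (deriv M.ψ θ - m) * W θ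
      rw [abs_of_nonneg (by linarith)]
    · intro θ hθ
      refine ((hasDerivAt_weight hM ν m hθ).const_mul (-ν⁻¹)).congr_deriv ?_
      simp only [hW]; field_simp; ring
  rw [h1, h2]
  have := mul_pos (inv_pos.2 hν) (hWp a)
  have := mul_pos (inv_pos.2 hν) (hWp b)
  have : 2 / ν * W θ₀ = 2 * (ν⁻¹ * W θ₀) := by ring
  linarith

/-- Outside a compact interval around `θ₀`, strict monotonicity keeps `|ξ - m|` away from zero, so
the previous integrability applies. -/
theorem integrableOn_weight (hM : M.IsNEFQVF) {θ₀ ν : ℝ} (h₀ : θ₀ ∈ M.Θ) (hν : 0 < ν) :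
    IntegrableOn (fun θ => Real.exp (ν * (deriv M.ψ θ₀ * θ - M.ψ θ))) M.Θ := by
  have hξ := strictMonoOn_deriv_ψ hM
  have hint := integrableOn_abs_mul_weight hM h₀ hν
  obtain ⟨a, ha, ha0⟩ := exists_lt_mem hM.isOpen h₀
  obtain ⟨b, hb, hb0⟩ := exists_gt_mem hM.isOpen h₀
  set m := deriv M.ψ θ₀
  set W : ℝ → ℝ := fun θ => Real.exp (ν * (m * θ - M.ψ θ)) with hW
  have hWc : ContinuousOn W M.Θ := continuousOn_weight hM ν m
  have hmeas := hM.isOpen.measurableSet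
  have hsub : Set.Icc a b ⊆ M.Θ := (ordConnected hM).out ha hb
  have h1 : IntegrableOn W (Set.Icc a b) := (hWc.mono hsub).integrableOn_compact isCompact_Icc
  set c := min (deriv M.ψ b - m) (m - deriv M.ψ a) with hc
  have hcpos : 0 < c := lt_min (sub_pos.2 (hξ h₀ hb hb0)) (sub_pos.2 (hξ ha h₀ ha0))
  have h2 : IntegrableOn W (M.Θ \ Set.Icc a b) := by
    refine Integrable.mono' ((hint.mono_set Set.sdiff_subset).const_mul c⁻¹)
      ((hWc.mono Set.sdiff_subset).aestronglyMeasurable (hmeas.diff measurableSet_Icc)) ?_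
    filter_upwards [ae_restrict_mem (hmeas.diff measurableSet_Icc)] with θ hθ
    have hWp : 0 < W θ := Real.exp_pos _
    rw [Real.norm_of_nonneg hWp.le, inv_mul_eq_div, le_div_iff₀ hcpos, mul_comm]
    refine mul_le_mul_of_nonneg_right ?_ hWp.le
    by_cases hθa : θ < a
    · have h3 := hξ hθ.1 ha hθa
      have h4 : c ≤ m - deriv M.ψ a := min_le_right _ _
      exact le_trans (by linarith) (neg_le_abs _)
    · have hθb : b < θ := by
        by_contra hcon
        exact hθ.2 ⟨not_lt.1 hθa, not_lt.1 hcon⟩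
      have h3 := hξ hb hθ.1 hθb
      have h4 : c ≤ deriv M.ψ b - m := min_le_left _ _
      exact le_trans (by linarith) (le_abs_self _)
  exact (h1.union h2).mono_set fun x hx => by
    by_cases hx' : x ∈ Set.Icc a b
    · exact Or.inl hx'
    · exact Or.inr ⟨hx, hx'⟩

/-- Young's inequality: a term linear in `|u|` is absorbed by half of the quadratic one. -/
theorem half_quadratic_le {δ K u X Y : ℝ} (hδ : 0 < δ) (h₁ : δ * u ^ 2 ≤ Y)
    (h₂ : X ≤ K * (1 + |u|)) :
    δ / 2 * (1 + u ^ 2) - (K ^ 2 / (2 * δ) + K + δ / 2) ≤ Y - X := by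
  have h5 : K * |u| ≤ δ / 2 * u ^ 2 + K ^ 2 / (2 * δ) := by
    have : 0 ≤ (δ * |u| - K) ^ 2 / (2 * δ) := by positivity
    have e : (δ * |u| - K) ^ 2 / (2 * δ) = δ / 2 * u ^ 2 + K ^ 2 / (2 * δ) - K * |u| := by
      rw [← sq_abs u]; field_simp; ring
    linarith
  linarith

/-- With `u = ξ - m`, the right-hand expression times the weight is minus the derivative of `u (1 +
u²)^(r/2 - 1)` times the weight. Its leading coefficient at infinity is `ν - (r - 1) v`, so `δ + (r
- 1) v ≤ ν` makes it dominate `(1 + u²)^(r/2)` up to a constant that depends only on `B`, `δ`, `r`,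
`v`. -/
theorem lyapunov_bound {B δ r v : ℝ} (hB : 0 ≤ B) (hδ : 0 < δ) (hr : 2 ≤ r) :
    ∃ C : ℝ, 0 ≤ C ∧ ∀ q q' ν u : ℝ, |q| ≤ B → |q'| ≤ B → δ ≤ ν → δ + (r - 1) * v ≤ ν →
      δ / 4 * (1 + u ^ 2) ^ (r / 2) - C ≤ ν * u * (u * (1 + u ^ 2) ^ (r / 2 - 1)) -
        (q + q' * u + v * u ^ 2) * ((1 + u ^ 2) ^ (r / 2 - 1) +
          u * ((r / 2 - 1) * (1 + u ^ 2) ^ (r / 2 - 2) * (2 * u))) := by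
  set K := B * (r - 1) with hK
  have hK0 : 0 ≤ K := mul_nonneg hB (by linarith)
  set C₁ := K ^ 2 / (2 * δ) + K + δ / 2 with hC₁
  have hC₁0 : 0 < C₁ := by positivity
  refine ⟨C₁ * (4 * C₁ / δ) ^ (r / 2 - 1), by positivity, ?_⟩
  intro q q' ν u hq hq' hν hν'
  set t := 1 + u ^ 2 with ht
  have ht1 : 1 ≤ t := by nlinarith [sq_nonneg u]
  have ht0 : 0 < t := by linarith
  set P := t ^ (r / 2 - 1) with hP
  have hP0 : 0 < P := Real.rpow_pos_of_pos ht0 _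
  have e1 : t ^ (r / 2) = t * P := by
    rw [hP, ← Real.rpow_one_add' ht0.le (by linarith)]; congr 1; ring
  have e2 : t ^ (r / 2 - 2) = P / t := by
    rw [hP, ← Real.rpow_sub_one ht0.ne']; congr 1; ring
  -- The derivative of `u (1 + u²)^(r/2 - 1)` in `u` is `P * s`, and `s` runs between `1` and `r -
  -- 1`.
  set s := 1 + (r - 2) * u ^ 2 / t with hs
  have hs1 : 1 ≤ s := by
    have : 0 ≤ (r - 2) * u ^ 2 / t := div_nonneg (mul_nonneg (by linarith) (sq_nonneg u)) ht0.le
    linarith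
  have hs2 : s ≤ r - 1 := by
    have : (r - 2) * u ^ 2 / t ≤ r - 2 := by
      rw [div_le_iff₀ ht0]; nlinarith [sq_nonneg u]
    linarith
  have e3 : ν * u * (u * P) - (q + q' * u + v * u ^ 2) * (P +
      u * ((r / 2 - 1) * (t ^ (r / 2 - 2)) * (2 * u)))
      = P * (ν * u ^ 2 - (q + q' * u + v * u ^ 2) * s) := by
    rw [e2, hs]; field_simp
  rw [e3, e1]
  have h1 : |q + q' * u| * s ≤ K * (1 + |u|) := by
    calc |q + q' * u| * s ≤ (B * (1 + |u|)) * (r - 1) := by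
          gcongr
          calc |q + q' * u| ≤ |q| + |q'| * |u| := by rw [← abs_mul]; exact abs_add_le _ _
            _ ≤ B + B * |u| := by gcongr
            _ = _ := by ring
      _ = _ := by rw [hK]; ring
  have h2 : δ * u ^ 2 ≤ ν * u ^ 2 - v * u ^ 2 * s := by
    -- For `v ≥ 0` the worst case is `s = r - 1`; for `v < 0` the bound `δ ≤ ν` is enough.
    have : δ ≤ ν - v * s := by
      rcases le_or_gt 0 v with hv | hv
      · nlinarith
      · nlinarith
    nlinarith [mul_le_mul_of_nonneg_right this (sq_nonneg u)]
  have h3 : δ / 2 * t - C₁ ≤ ν * u ^ 2 - (q + q' * u + v * u ^ 2) * s := by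
    have h4 : (q + q' * u) * s ≤ K * (1 + |u|) :=
      (mul_le_mul_of_nonneg_right (le_abs_self _) (by linarith)).trans h1
    rw [show ν * u ^ 2 - (q + q' * u + v * u ^ 2) * s
      = (ν * u ^ 2 - v * u ^ 2 * s) - (q + q' * u) * s by ring]
    exact half_quadratic_le hδ h2 h4
  -- Above the threshold `4 C₁ / δ` the constant is absorbed by half of the main term; below it, `P`
  -- itself is bounded.
  have h6 : δ / 4 * (t * P) - C₁ * (4 * C₁ / δ) ^ (r / 2 - 1) ≤ P * (δ / 2 * t - C₁) := by
    rcases le_or_gt (4 * C₁ / δ) t with h | h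
    · have h7 : C₁ ≤ δ / 4 * t := by
        rw [div_le_iff₀ hδ] at h; linarith
      have h8 : 0 ≤ C₁ * (4 * C₁ / δ) ^ (r / 2 - 1) := by positivity
      have h9 : P * C₁ ≤ P * (δ / 4 * t) := mul_le_mul_of_nonneg_left h7 hP0.le
      have h10 : P * (δ / 2 * t - C₁) = δ / 4 * (t * P) + (P * (δ / 4 * t) - P * C₁) := by ring
      rw [h10]; linarith only [h8, h9]
    · have h7 : P ≤ (4 * C₁ / δ) ^ (r / 2 - 1) :=
        Real.rpow_le_rpow ht0.le h.le (by linarith)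
      have h8 := mul_le_mul_of_nonneg_left h7 hC₁0.le
      have h9 : 0 ≤ δ / 4 * (t * P) := by positivity
      have h10 : P * (δ / 2 * t - C₁) = 2 * (δ / 4 * (t * P)) - C₁ * P := by ring
      rw [h10]; linarith only [h8, h9]
  exact h6.trans (mul_le_mul_of_nonneg_left h3 hP0.le)

/-- The Lyapunov bound is integrated over compact intervals around `θ₀`, where nothing has to be
integrable in advance. The constant is uniform in `θ₀` and `ν`, which later makes the moments
uniform over the areas. -/
theorem moment_weight_le (hM : M.IsNEFQVF) {B δ r : ℝ} (hB : 0 ≤ B) (hδ : 0 < δ) (hr : 2 ≤ r) :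
    ∃ C : ℝ, 0 ≤ C ∧ ∀ θ₀ ∈ M.Θ, ∀ ν, |M.Q (deriv M.ψ θ₀)| ≤ B → |M.Q' (deriv M.ψ θ₀)| ≤ B →
      δ ≤ ν → δ + (r - 1) * M.v₂ ≤ ν →
      IntegrableOn (fun θ => (1 + (deriv M.ψ θ - deriv M.ψ θ₀) ^ 2) ^ (r / 2) *
        Real.exp (ν * (deriv M.ψ θ₀ * θ - M.ψ θ))) M.Θ ∧
      ∫ θ in M.Θ, (1 + (deriv M.ψ θ - deriv M.ψ θ₀) ^ 2) ^ (r / 2) *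
        Real.exp (ν * (deriv M.ψ θ₀ * θ - M.ψ θ)) ≤
        C * ∫ θ in M.Θ, Real.exp (ν * (deriv M.ψ θ₀ * θ - M.ψ θ)) := by
  obtain ⟨C, hC0, hC⟩ := lyapunov_bound (v := M.v₂) hB hδ hr
  refine ⟨4 * C / δ, by positivity, ?_⟩
  intro θ₀ h₀ ν hq hq' hν hν'
  have hs := isSteep hM
  have hξc := continuousOn_deriv_ψ hM
  have hint := integrableOn_weight hM h₀ (hδ.trans_le hν)
  set m := deriv M.ψ θ₀ with hm
  have hmono := (strictMonoOn_deriv_ψ hM).monotoneOn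
  set W : ℝ → ℝ := fun θ => Real.exp (ν * (m * θ - M.ψ θ)) with hW
  have hWc : ContinuousOn W M.Θ := continuousOn_weight hM ν m
  have hWp : ∀ θ, 0 < W θ := fun θ => Real.exp_pos _
  have hpos : ∀ x : ℝ, 0 < 1 + (deriv M.ψ x - m) ^ 2 := fun x => by positivity
  have hpowc : ∀ s : ℝ, ContinuousOn (fun θ => (1 + (deriv M.ψ θ - m) ^ 2) ^ s) M.Θ := fun s =>
    ContinuousOn.rpow_const (by fun_prop) fun x _ => Or.inl (hpos x).ne'
  have hfc : ContinuousOn (fun θ => (1 + (deriv M.ψ θ - m) ^ 2) ^ (r / 2) * W θ) M.Θ :=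
    (hpowc _).mul hWc
  refine hs.integrableOn_of_bounded hfc (fun θ _ => by have := hWp θ; positivity) h₀ ?_
  intro a ha b hb hab hb0
  have hsub : Set.uIcc a b ⊆ M.Θ := by
    rw [Set.uIcc_of_le (hab.trans hb0).le]; exact (ordConnected hM).out ha hb
  set u : ℝ → ℝ := fun θ => deriv M.ψ θ - m with hu
  have huc : ContinuousOn u M.Θ := by fun_prop
  set L : ℝ → ℝ := fun θ => ν * u θ * (u θ * (1 + u θ ^ 2) ^ (r / 2 - 1)) -
        (M.Q m + M.Q' m * u θ + M.v₂ * u θ ^ 2) * ((1 + u θ ^ 2) ^ (r / 2 - 1) +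
          u θ * ((r / 2 - 1) * (1 + u θ ^ 2) ^ (r / 2 - 2) * (2 * u θ))) with hL
  have hLc : ContinuousOn (fun θ => -L θ * W θ) M.Θ := by
    have h1 := hpowc (r / 2 - 1)
    have h2 := hpowc (r / 2 - 2)
    simp only [hL]
    fun_prop
  have hI : ∫ θ in a..b, -L θ * W θ =
      u b * (1 + u b ^ 2) ^ (r / 2 - 1) * W b - u a * (1 + u a ^ 2) ^ (r / 2 - 1) * W a := by
    refine hs.intervalIntegral_eq (F := fun θ => u θ * (1 + u θ ^ 2) ^ (r / 2 - 1) * W θ)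
      (fun θ hθ => ?_) hLc ha hb (hab.trans hb0).le
    have hd : HasDerivAt u (M.Q m + M.Q' m * u θ + M.v₂ * u θ ^ 2) θ := by
      have := (hasDerivAt_deriv_ψ hM hθ).sub_const m
      rwa [Q_eq M m] at this
    have h1 := ((hd.fun_pow 2).const_add 1).rpow_const (p := r / 2 - 1) (Or.inl (hpos θ).ne')
    have h2 := (hd.fun_mul h1).fun_mul (hasDerivAt_weight hM ν m hθ)
    refine h2.congr_deriv ?_
    have e : r / 2 - 1 - 1 = r / 2 - 2 := by ring
    simp only [hL, hW, e, hu]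
    push_cast
    ring
  -- The boundary terms at `a < θ₀ < b` have the favourable sign and can be dropped instead of being
  -- shown to vanish.
  have hua : u a ≤ 0 := sub_nonpos.2 (hmono ha h₀ hab.le)
  have hub : 0 ≤ u b := sub_nonneg.2 (hmono h₀ hb hb0.le)
  have hIneg : 0 ≤ ∫ θ in a..b, -L θ * W θ := by
    rw [hI]
    have h1 : 0 ≤ u b * (1 + u b ^ 2) ^ (r / 2 - 1) * W b := by
      have := hWp b; positivity
    have h2 : u a * (1 + u a ^ 2) ^ (r / 2 - 1) * W a ≤ 0 := by
      have := hWp a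
      exact mul_nonpos_of_nonpos_of_nonneg (mul_nonpos_of_nonpos_of_nonneg hua (by positivity))
        this.le
    linarith
  have hcmp : ∫ θ in a..b, (1 + u θ ^ 2) ^ (r / 2) * W θ ≤
      ∫ θ in a..b, (4 * C / δ * W θ - 4 / δ * (-L θ * W θ)) := by
    refine intervalIntegral.integral_mono_on (hab.trans hb0).le
      (hfc.mono hsub).intervalIntegrable (ContinuousOn.intervalIntegrable ?_) ?_
    · exact ContinuousOn.mono (by fun_prop) hsub
    · intro θ _
      have h1 := hC (M.Q m) (M.Q' m) ν (u θ) hq hq' hν hν'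
      have h2 : (1 + u θ ^ 2) ^ (r / 2) ≤ 4 * C / δ + 4 / δ * L θ := by
        have : (1 + u θ ^ 2) ^ (r / 2) =
          4 / δ * (δ / 4 * (1 + u θ ^ 2) ^ (r / 2) - C) + 4 * C / δ := by
          field_simp; ring
        rw [this]
        have := mul_le_mul_of_nonneg_left h1 (show 0 ≤ 4 / δ by positivity)
        change _ ≤ 4 / δ * L θ at this
        linarith
      have := mul_le_mul_of_nonneg_right h2 (hWp θ).le
      linarith
  rw [intervalIntegral.integral_sub ((hWc.mono hsub).intervalIntegrable.const_mul _)
    ((hLc.mono hsub).intervalIntegrable.const_mul _), intervalIntegral.integral_const_mul,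
    intervalIntegral.integral_const_mul] at hcmp
  have h3 : ∫ θ in a..b, W θ ≤ ∫ θ in M.Θ, W θ := by
    rw [intervalIntegral.integral_of_le (hab.trans hb0).le]
    refine setIntegral_mono_set hint (Eventually.of_forall fun θ => (hWp θ).le)
      (LE.le.eventuallyLE ?_)
    exact Set.Ioc_subset_Icc_self.trans ((ordConnected hM).out ha hb)
  have h4 := mul_le_mul_of_nonneg_left h3 (show 0 ≤ 4 * C / δ by positivity)
  have h5 := mul_nonneg (show 0 ≤ 4 / δ by positivity) hIneg
  linarith

end AreaModel
end NEFQVF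

namespace NEFQVF
namespace AreaModel

variable {p : ℕ} {M : AreaModel p}

/-! ### The joint law of `(θ, y)` -/

/-- The joint density of `(θ, y)`. -/
noncomputable def dens (M : AreaModel p) (j : ℕ) (η : Params p) (z : ℝ × ℝ) : ℝ :=
  M.lik j z.1 z.2 * M.prior (nu η) (M.mean j η) z.1

theorem areaLaw_eq (M : AreaModel p) (j : ℕ) (η : Params p) :
    M.areaLaw j η = ((volume.restrict M.Θ).prod (M.base j)).withDensity
      (fun z => ENNReal.ofReal (M.dens j η z)) := rfl

theorem normConst_pos (hM : M.IsNEFQVF) {θ₀ ν : ℝ} (h₀ : θ₀ ∈ M.Θ) (hν : 0 < ν) :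
    0 < M.normConst ν (deriv M.ψ θ₀) := by
  unfold normConst
  refine inv_pos.2 ?_
  rw [integral_pos_iff_support_of_nonneg (fun θ => (Real.exp_pos _).le)
    (integrableOn_weight hM h₀ hν)]
  have : Function.support (fun θ => Real.exp (ν * (deriv M.ψ θ₀ * θ - M.ψ θ))) = Set.univ := by
    ext; simp [(Real.exp_pos _).ne']
  rw [this, Measure.restrict_apply_univ]
  exact hM.isOpen.measure_pos _ ⟨θ₀, h₀⟩

theorem prior_nonneg (hM : M.IsNEFQVF) {j : ℕ} {η : Params p} (h₀ : M.linPred j η ∈ M.Θ)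
    (hν : 0 < nu η) (θ : ℝ) : 0 ≤ M.prior (nu η) (M.mean j η) θ :=
  mul_nonneg (Real.exp_pos _).le (normConst_pos hM h₀ hν).le

theorem dens_nonneg (hM : M.IsNEFQVF) {j : ℕ} {η : Params p} (h₀ : M.linPred j η ∈ M.Θ)
    (hν : 0 < nu η) (z : ℝ × ℝ) : 0 ≤ M.dens j η z :=
  mul_nonneg (Real.exp_pos _).le (prior_nonneg hM h₀ hν _)

theorem aemeasurable_ψ (hM : M.IsNEFQVF) : AEMeasurable M.ψ (volume.restrict M.Θ) :=
  (continuousOn_ψ hM).aemeasurable hM.isOpen.measurableSet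

theorem aemeasurable_ψ_fst (hM : M.IsNEFQVF) (j : ℕ) :
    AEMeasurable (fun z : ℝ × ℝ => M.ψ z.1) ((volume.restrict M.Θ).prod (M.base j)) := by
  have := hM.sigmaFinite j
  exact (aemeasurable_ψ hM).comp_fst

theorem aemeasurable_prior (hM : M.IsNEFQVF) (ν m : ℝ) :
    AEMeasurable (M.prior ν m) (volume.restrict M.Θ) := by
  have := aemeasurable_ψ hM
  unfold prior
  fun_prop

theorem aemeasurable_dens (hM : M.IsNEFQVF) (j : ℕ) (η : Params p) :
    AEMeasurable (M.dens j η) ((volume.restrict M.Θ).prod (M.base j)) := by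
  have := aemeasurable_ψ_fst hM j
  unfold dens lik prior
  fun_prop

theorem integral_areaLaw (hM : M.IsNEFQVF) {j : ℕ} {η : Params p} (h₀ : M.linPred j η ∈ M.Θ)
    (hν : 0 < nu η) (f : ℝ × ℝ → ℝ) :
    ∫ z, f z ∂(M.areaLaw j η) =
      ∫ z, f z * M.dens j η z ∂((volume.restrict M.Θ).prod (M.base j)) := by
  rw [areaLaw_eq, integral_withDensity_eq_integral_toReal_smul₀ (aemeasurable_dens hM j η).ennreal_ofReal
    (Eventually.of_forall fun _ => ENNReal.ofReal_lt_top)]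
  refine integral_congr_ae (Eventually.of_forall fun z => ?_)
  have := dens_nonneg hM h₀ hν z
  simp only [smul_eq_mul]
  rw [ENNReal.toReal_ofReal this, mul_comm]

theorem integrable_areaLaw_iff (hM : M.IsNEFQVF) {j : ℕ} {η : Params p}
    (h₀ : M.linPred j η ∈ M.Θ) (hν : 0 < nu η) (f : ℝ × ℝ → ℝ) :
    Integrable f (M.areaLaw j η) ↔
      Integrable (fun z => f z * M.dens j η z) ((volume.restrict M.Θ).prod (M.base j)) := by
  rw [areaLaw_eq, integrable_withDensity_iff_integrable_smul₀' (aemeasurable_dens hM j η).ennreal_ofReal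
    (Eventually.of_forall fun _ => ENNReal.ofReal_lt_top)]
  refine integrable_congr (Eventually.of_forall fun z => ?_)
  have := dens_nonneg hM h₀ hν z
  simp only [smul_eq_mul]
  rw [ENNReal.toReal_ofReal this, mul_comm]

theorem lintegral_lik (hM : M.IsNEFQVF) (j : ℕ) {θ : ℝ} (hθ : θ ∈ M.Θ) :
    ∫⁻ y, ENNReal.ofReal (M.lik j θ y) ∂(M.base j) = 1 := by
  have e : ∀ y, M.lik j θ y = Real.exp (-(M.n j * M.ψ θ)) * Real.exp (M.n j * θ * y) := fun y => by
    rw [lik, ← Real.exp_add]; congr 1; ring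
  simp only [e]
  rw [← ofReal_integral_eq_lintegral_ofReal (((hM.natural j θ).1 hθ).const_mul _)
    (Eventually.of_forall fun y => by positivity), integral_const_mul, hM.cumulant j θ hθ,
    ← Real.exp_add]
  simp

/-- The marginal law of `θ` is the conjugate prior. -/
theorem map_fst_areaLaw (hM : M.IsNEFQVF) {j : ℕ} {η : Params p}
    : (M.areaLaw j η).map Prod.fst =
      (volume.restrict M.Θ).withDensity
        (fun θ => ENNReal.ofReal (M.prior (nu η) (M.mean j η) θ)) := by
  have := hM.sigmaFinite j
  ext s hs
  have hmeas := (aemeasurable_dens hM j η).ennreal_ofReal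
  rw [Measure.map_apply measurable_fst hs, areaLaw_eq, withDensity_apply _ (measurable_fst hs),
    withDensity_apply _ hs, ← lintegral_indicator (measurable_fst hs), ← lintegral_indicator hs,
    lintegral_prod _ (AEMeasurable.indicator hmeas (measurable_fst hs))]
  refine lintegral_congr_ae ?_
  filter_upwards [ae_restrict_mem hM.isOpen.measurableSet] with θ hθ
  by_cases hθs : θ ∈ s
  · have : ∀ y, (Prod.fst ⁻¹' s).indicator (fun z : ℝ × ℝ => ENNReal.ofReal (M.dens j η z)) (θ, y) = ENNReal.ofReal (M.lik j θ y) *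
          ENNReal.ofReal (M.prior (nu η) (M.mean j η) θ) := by
      intro y
      exact (Set.indicator_of_mem (by exact hθs) _).trans (ENNReal.ofReal_mul (Real.exp_pos _).le)
    simp only [this]
    rw [lintegral_mul_const' _ _ ENNReal.ofReal_ne_top, lintegral_lik hM j hθ, one_mul,
      Set.indicator_of_mem hθs]
  · have : ∀ y, (Prod.fst ⁻¹' s).indicator (fun z : ℝ × ℝ => ENNReal.ofReal (M.dens j η z)) (θ, y) = 0 := fun y =>
      Set.indicator_of_notMem (by exact hθs) _
    simp only [this, lintegral_zero, Set.indicator_of_notMem hθs]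

theorem integral_fst_areaLaw (hM : M.IsNEFQVF) {j : ℕ} {η : Params p}
    (h₀ : M.linPred j η ∈ M.Θ) (hν : 0 < nu η) {f : ℝ → ℝ} (hf : Measurable f) :
    ∫ z, f z.1 ∂(M.areaLaw j η) = M.normConst (nu η) (M.mean j η) *
      ∫ θ in M.Θ, f θ * Real.exp (nu η * (M.mean j η * θ - M.ψ θ)) := by
  have h1 := integral_map (μ := M.areaLaw j η) measurable_fst.aemeasurable
    (hf.aestronglyMeasurable (μ := (M.areaLaw j η).map Prod.fst))
  rw [← h1, map_fst_areaLaw hM, integral_withDensity_eq_integral_toReal_smul₀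
    (aemeasurable_prior hM _ _).ennreal_ofReal (Eventually.of_forall fun _ => ENNReal.ofReal_lt_top),
    ← integral_const_mul]
  refine integral_congr_ae (Eventually.of_forall fun θ => ?_)
  simp only [smul_eq_mul]
  rw [ENNReal.toReal_ofReal (prior_nonneg hM h₀ hν θ), prior]
  ring

theorem integrable_fst_areaLaw (hM : M.IsNEFQVF) {j : ℕ} {η : Params p}
    (h₀ : M.linPred j η ∈ M.Θ) (hν : 0 < nu η) {f : ℝ → ℝ} (hf : Measurable f)
    (hint : IntegrableOn (fun θ => f θ * Real.exp (nu η * (M.mean j η * θ - M.ψ θ))) M.Θ) :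
    Integrable (fun z => f z.1) (M.areaLaw j η) := by
  have h1 := integrable_map_measure (μ := M.areaLaw j η) (g := f)
    (hf.aestronglyMeasurable (μ := (M.areaLaw j η).map Prod.fst)) measurable_fst.aemeasurable
  refine h1.1 ?_
  rw [map_fst_areaLaw hM, integrable_withDensity_iff_integrable_smul₀'
    (aemeasurable_prior hM _ _).ennreal_ofReal (Eventually.of_forall fun _ => ENNReal.ofReal_lt_top)]
  refine (hint.const_mul (M.normConst (nu η) (M.mean j η))).congr
    (Eventually.of_forall fun θ => ?_)
  simp only [smul_eq_mul]
  rw [ENNReal.toReal_ofReal (prior_nonneg hM h₀ hν θ), prior]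
  ring

theorem isProbabilityMeasure_areaLaw (hM : M.IsNEFQVF) {j : ℕ} {η : Params p}
    (h₀ : M.linPred j η ∈ M.Θ) (hν : 0 < nu η) : IsProbabilityMeasure (M.areaLaw j η) := by
  have hint := integrableOn_weight hM h₀ hν
  have h : (M.areaLaw j η).map Prod.fst Set.univ = 1 := by
    rw [map_fst_areaLaw hM, withDensity_apply _ MeasurableSet.univ, setLIntegral_univ,
      ← ofReal_integral_eq_lintegral_ofReal _
        (Eventually.of_forall fun θ => prior_nonneg hM h₀ hν θ)]
    · unfold prior
      rw [integral_mul_const]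
      have := normConst_pos hM h₀ hν
      unfold mean
      have h2 : M.normConst (nu η) (deriv M.ψ (M.linPred j η)) ≠ 0 := this.ne'
      unfold normConst at h2 ⊢
      rw [mul_inv_cancel₀ fun h => h2 (by rw [h, inv_zero]), ENNReal.ofReal_one]
    · exact hint.mul_const _
  rw [Measure.map_apply measurable_fst MeasurableSet.univ] at h
  exact ⟨h⟩

/-- Conjugacy: for fixed `y` the joint density is again an exponential weight whose logarithmic
derivative is affine in `ξ`. -/
theorem hasDerivAt_dens (hM : M.IsNEFQVF) (j : ℕ) (η : Params p) (y : ℝ) {θ : ℝ}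
    (hθ : θ ∈ M.Θ) : HasDerivAt (fun θ => M.dens j η (θ, y))
      (((M.n j * y + nu η * M.mean j η) - (M.n j + nu η) * deriv M.ψ θ) * M.dens j η (θ, y)) θ := by
  have h1 : HasDerivAt (fun θ => M.lik j θ y) (M.n j * (y - deriv M.ψ θ) * M.lik j θ y) θ := by
    have := ((((hasDerivAt_id' θ).mul_const y).fun_sub (hasDerivAt_ψ hM hθ)).const_mul (M.n j)).exp
    exact this.congr_deriv (by rw [lik]; ring)
  have h2 := (hasDerivAt_weight hM (nu η) (M.mean j η) hθ).mul_const
    (M.normConst (nu η) (M.mean j η))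
  refine (h1.fun_mul h2).congr_deriv ?_
  simp only [dens, prior]
  ring

/-- Integration by parts in `θ` under the joint law of `(θ, y)`, against functions of `y`. -/
theorem integral_stein (hM : M.IsNEFQVF) {j : ℕ} {η : Params p} (h₀ : M.linPred j η ∈ M.Θ)
    (hν : 0 < nu η) (k : ℕ)
    (hint : Integrable (fun z : ℝ × ℝ => (1 + |deriv M.ψ z.1 - M.mean j η|) ^ (k + 1))
      (M.areaLaw j η)) (f : ℝ → ℝ) :
    ∫ z, f z.2 * (k * (deriv M.ψ z.1 - M.mean j η) ^ (k - 1) * M.Q (deriv M.ψ z.1)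
      + (deriv M.ψ z.1 - M.mean j η) ^ k * (M.n j * (z.2 - M.mean j η)
        - (M.n j + nu η) * (deriv M.ψ z.1 - M.mean j η))) ∂(M.areaLaw j η) = 0 := by
  have := hM.sigmaFinite j
  rw [integral_areaLaw hM h₀ hν]
  set m := M.mean j η with hm
  set F : ℝ × ℝ → ℝ := fun z => f z.2 * (k * (deriv M.ψ z.1 - m) ^ (k - 1) * M.Q (deriv M.ψ z.1)
      + (deriv M.ψ z.1 - m) ^ k * (M.n j * (z.2 - m) - (M.n j + nu η) * (deriv M.ψ z.1 - m)))
    with hF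
  by_cases hI : Integrable (fun z => F z * M.dens j η z)
      ((volume.restrict M.Θ).prod (M.base j))
  · change ∫ z, F z * M.dens j η z ∂((volume.restrict M.Θ).prod (M.base j)) = 0
    rw [integral_prod_symm _ hI]
    refine integral_eq_zero_of_ae ?_
    rw [integrable_areaLaw_iff hM h₀ hν] at hint
    -- By Fubini the moment of order `k + 1` is finite on almost every section, and the
    -- one-dimensional integration by parts applies there.
    filter_upwards [hint.prod_left_ae] with y hy
    have h1 := integral_ibp hM (W := fun θ => M.dens j η (θ, y)) (m := m)
      (A := M.n j * y + nu η * m) (B := M.n j + nu η)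
      (fun θ hθ => hasDerivAt_dens hM j η y hθ) k
      (hy.congr (Eventually.of_forall fun θ => by
        simp only [abs_of_nonneg (dens_nonneg hM h₀ hν _)]))
    have h2 : ∀ θ, F (θ, y) * M.dens j η (θ, y) = f y *
      ((k * (deriv M.ψ θ - m) ^ (k - 1) * M.Q (deriv M.ψ θ)
      + (deriv M.ψ θ - m) ^ k * (M.n j * y + nu η * m - (M.n j + nu η) * deriv M.ψ θ))
        * M.dens j η (θ, y)) := by
      intro θ; simp only [hF]; ring
    simp only [h2, integral_const_mul, h1, mul_zero, Pi.zero_apply]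
  -- If the integrand is not integrable its Bochner integral is `0` by convention, so `f` may be
  -- arbitrary, even non-measurable.
  · exact integral_undef hI

/-! ### Moments of `ξ = ψ' θ` -/

theorem integral_fst_areaLaw_le (hM : M.IsNEFQVF) {j : ℕ} {η : Params p}
    (h₀ : M.linPred j η ∈ M.Θ) (hν : 0 < nu η) {f : ℝ → ℝ} (hf : Measurable f) {C : ℝ}
    (h₁ : IntegrableOn (fun θ => f θ * Real.exp (nu η * (M.mean j η * θ - M.ψ θ))) M.Θ)
    (h₂ : ∫ θ in M.Θ, f θ * Real.exp (nu η * (M.mean j η * θ - M.ψ θ)) ≤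
      C * ∫ θ in M.Θ, Real.exp (nu η * (M.mean j η * θ - M.ψ θ))) :
    Integrable (fun z => f z.1) (M.areaLaw j η) ∧ ∫ z, f z.1 ∂(M.areaLaw j η) ≤ C := by
  have hpos : 0 < M.normConst (nu η) (M.mean j η) := normConst_pos hM h₀ hν
  refine ⟨integrable_fst_areaLaw hM h₀ hν hf h₁, ?_⟩
  rw [integral_fst_areaLaw hM h₀ hν hf]
  refine (mul_le_mul_of_nonneg_left h₂ hpos.le).trans (le_of_eq ?_)
  have h3 : (∫ θ in M.Θ, Real.exp (nu η * (M.mean j η * θ - M.ψ θ))) ≠ 0 := by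
    intro h
    rw [normConst, h, inv_zero] at hpos
    exact lt_irrefl _ hpos
  rw [normConst, mul_left_comm, inv_mul_cancel₀ h3, mul_one]

/-- The normalizing constant cancels from the weighted bound, leaving one constant for all areas and
parameters in the given range. -/
theorem moment_le (hM : M.IsNEFQVF) {B δ r : ℝ} (hB : 0 ≤ B) (hδ : 0 < δ) (hr : 2 ≤ r) :
    ∃ C : ℝ, 0 ≤ C ∧ ∀ j η, M.linPred j η ∈ M.Θ → |M.Q (M.mean j η)| ≤ B →
      |M.Q' (M.mean j η)| ≤ B → δ ≤ nu η → δ + (r - 1) * M.v₂ ≤ nu η →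
      Integrable (fun z : ℝ × ℝ => (1 + (deriv M.ψ z.1 - M.mean j η) ^ 2) ^ (r / 2))
        (M.areaLaw j η) ∧
      ∫ z : ℝ × ℝ, (1 + (deriv M.ψ z.1 - M.mean j η) ^ 2) ^ (r / 2) ∂(M.areaLaw j η) ≤ C := by
  obtain ⟨C, hC0, hC⟩ := moment_weight_le hM hB hδ hr
  refine ⟨C, hC0, fun j η h₀ hq hq' hν hν' => ?_⟩
  obtain ⟨h1, h2⟩ := hC (M.linPred j η) h₀ (nu η) hq hq' hν hν'
  have hmeas : Measurable fun x => (1 + (x - M.mean j η) ^ 2) ^ (r / 2) := by fun_prop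
  exact integral_fst_areaLaw_le hM h₀ (hδ.trans_le hν) (hmeas.comp (measurable_deriv M.ψ)) h1 h2

end AreaModel
end NEFQVF

namespace NEFQVF
namespace AreaModel

variable {p : ℕ} {M : AreaModel p}

/-! ### Moments of `y` -/

/-- A form of Young's inequality with the coefficient `1 / 2` in front of `w ^ r`, so that this term
can be absorbed on the left. It follows by comparing `w` with `2 κ u`. -/
theorem young_rpow {κ w u r : ℝ} (hκ : 0 ≤ κ) (hw : 0 ≤ w) (hu : 0 ≤ u) (hr : 1 ≤ r) :
    κ * (w ^ (r - 1) * u) ≤ 1 / 2 * w ^ r + 1 / 2 * (2 * κ) ^ r * u ^ r := by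
  rcases hw.eq_or_lt with rfl | hw0
  · rcases hr.eq_or_lt with rfl | hr'
    · simp only [sub_self, Real.rpow_zero, Real.rpow_one]; linarith
    · rw [Real.zero_rpow (by linarith), Real.zero_rpow (by linarith)]
      have : 0 ≤ (2 * κ) ^ r * u ^ r := by positivity
      linarith
  have e : w ^ r = w ^ (r - 1) * w := by
    rw [← Real.rpow_add_one hw0.ne']; congr 1; ring
  have hp : 0 ≤ w ^ (r - 1) := by positivity
  have h0 : 0 ≤ (2 * κ) ^ r * u ^ r := by positivity
  rcases le_total (2 * κ * u) w with h | h
  · have := mul_le_mul_of_nonneg_left h hp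
    have e2 : κ * (w ^ (r - 1) * u) = 1 / 2 * (w ^ (r - 1) * (2 * κ * u)) := by ring
    rw [e, e2]; linarith
  · have h1 : 0 < 2 * κ * u := hw0.trans_le h
    have h2 : w ^ (r - 1) ≤ (2 * κ * u) ^ (r - 1) := Real.rpow_le_rpow hw0.le h (by linarith)
    have h3 : (2 * κ) ^ r * u ^ r = (2 * κ * u) ^ (r - 1) * (2 * κ * u) := by
      rw [← Real.mul_rpow (by linarith) hu, ← Real.rpow_add_one h1.ne']; congr 1; ring
    have h4 := mul_le_mul_of_nonneg_right h2 h1.le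
    have e2 : κ * (w ^ (r - 1) * u) = 1 / 2 * (w ^ (r - 1) * (2 * κ * u)) := by ring
    have h5 : 0 ≤ w ^ r := by positivity
    have e3 : 1 / 2 * (2 * κ) ^ r * u ^ r = 1 / 2 * ((2 * κ) ^ r * u ^ r) := by ring
    rw [e2, e3, h3]; linarith

/-- The Stein identity with `k = 0` reads `n E[f(y) (y - m)] = (n + ν) E[f(y) (ξ - m)]`. Taking
`f(y) = sign (y - m) |y - m|^(r - 1)` and applying Young's inequality bounds the moment of `y` by
that of `ξ`. Nothing about the conditional law of `y` beyond this identity is used. -/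
theorem moment_y_le (hM : M.IsNEFQVF) {j : ℕ} {η : Params p} (h₀ : M.linPred j η ∈ M.Θ)
    (hν : 0 < nu η) {r : ℝ} (hr : 1 ≤ r)
    (h₁ : Integrable (fun z : ℝ × ℝ => 1 + |deriv M.ψ z.1 - M.mean j η|) (M.areaLaw j η))
    (hu : Integrable (fun z : ℝ × ℝ => |deriv M.ψ z.1 - M.mean j η| ^ r) (M.areaLaw j η)) :
    Integrable (fun z : ℝ × ℝ => |z.2 - M.mean j η| ^ r) (M.areaLaw j η) ∧
      ∫ z : ℝ × ℝ, |z.2 - M.mean j η| ^ r ∂(M.areaLaw j η) ≤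
        (2 * ((M.n j + nu η) / M.n j)) ^ r *
          ∫ z : ℝ × ℝ, |deriv M.ψ z.1 - M.mean j η| ^ r ∂(M.areaLaw j η) := by
  have hprob := isProbabilityMeasure_areaLaw hM h₀ hν
  have hn := hM.n_pos j
  set m := M.mean j η with hm
  set n := M.n j with hnn
  set ν := nu η with hνν
  set κ := (n + ν) / n with hκ
  have hκ0 : 0 ≤ κ := by positivity
  have hdm := measurable_deriv M.ψ
  set I := ∫ z : ℝ × ℝ, |deriv M.ψ z.1 - m| ^ r ∂(M.areaLaw j η) with hI
  -- Truncation to `|y - m| ≤ N` makes the moment finite, so that it may be absorbed; `N` tends to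
  -- infinity at the end.
  set φ : ℕ → Set (ℝ × ℝ) := fun N => {z | |z.2 - m| ≤ N} with hφ
  have hφm : ∀ N, MeasurableSet (φ N) := fun N =>
    measurableSet_le (by fun_prop) measurable_const
  have hcov : AECover (M.areaLaw j η) atTop φ :=
    ⟨Eventually.of_forall fun z => by
      filter_upwards [eventually_ge_atTop (Nat.ceil |z.2 - m|)] with N hN
      exact (Nat.le_ceil |z.2 - m|).trans (Nat.cast_le.2 hN), hφm⟩
  have hui : Integrable (fun z : ℝ × ℝ => deriv M.ψ z.1 - m) (M.areaLaw j η) := by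
    refine Integrable.mono' h₁ (Measurable.aestronglyMeasurable (by fun_prop)) (Eventually.of_forall fun z => ?_)
    rw [Real.norm_eq_abs]; linarith
  have hbdd : ∀ (g : ℝ → ℝ) (N : ℕ) (c : ℝ), Measurable g → (∀ y, |y - m| ≤ N → |g y| ≤ c) →
      Integrable (fun z : ℝ × ℝ => (φ N).indicator (fun z => g z.2) z) (M.areaLaw j η) := by
    intro g N c hg hc
    refine Integrable.mono' (integrable_const |c|)
      ((hg.comp measurable_snd).indicator (hφm N)).aestronglyMeasurable
      (Eventually.of_forall fun z => ?_)
    by_cases hz : z ∈ φ N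
    · rw [Set.indicator_of_mem hz]; exact (hc _ hz).trans (le_abs_self c)
    · rw [Set.indicator_of_notMem hz]; simp
  have key : ∀ N, ∫ z in φ N, |z.2 - m| ^ r ∂(M.areaLaw j η) ≤ (2 * κ) ^ r * I := by
    intro N
    set f : ℝ → ℝ := fun y => if |y - m| ≤ N then SignType.sign (y - m) * |y - m| ^ (r - 1) else 0
      with hf
    have hsign : Measurable fun y : ℝ => ((SignType.sign y : SignType) : ℝ) := by
      have : (fun y : ℝ => ((SignType.sign y : SignType) : ℝ)) =
        fun y => if 0 < y then 1 else if y < 0 then -1 else 0 := by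
        ext y
        rcases lt_trichotomy y 0 with h | rfl | h
        · simp [h, not_lt.2 h.le]
        · simp
        · simp [h]
      rw [this]
      exact Measurable.ite measurableSet_Ioi measurable_const
        (Measurable.ite measurableSet_Iio measurable_const measurable_const)
    have hfm : Measurable f := by
      refine Measurable.ite (measurableSet_le (by fun_prop) measurable_const) ?_ measurable_const
      exact (hsign.comp (measurable_id.sub_const m)).mul (by fun_prop)
    have hfb : ∀ y, |f y| ≤ (N : ℝ) ^ (r - 1) := by
      intro y
      simp only [hf]
      split_ifs with h
      · rw [abs_mul]
        have h1 : |((SignType.sign (y - m) : SignType) : ℝ)| ≤ 1 := by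
          cases (SignType.sign (y - m)) <;> simp
        have h2 : |y - m| ^ (r - 1) ≤ (N : ℝ) ^ (r - 1) :=
          Real.rpow_le_rpow (abs_nonneg _) h (by linarith)
        rw [abs_of_nonneg (a := |y - m| ^ (r - 1)) (by positivity)]
        calc _ ≤ 1 * |y - m| ^ (r - 1) := by gcongr
          _ ≤ _ := by rw [one_mul]; exact h2
      · rw [abs_zero]; positivity
    have hfw : ∀ z : ℝ × ℝ, f z.2 * (z.2 - m) = (φ N).indicator (fun z => |z.2 - m| ^ r) z := by
      intro z
      by_cases hz : z ∈ φ N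
      · rw [Set.indicator_of_mem hz]
        have : f z.2 = SignType.sign (z.2 - m) * |z.2 - m| ^ (r - 1) := if_pos hz
        rw [this, mul_right_comm, sign_mul_self]
        rcases eq_or_ne (z.2 - m) 0 with h | h
        · rw [h, abs_zero, zero_mul, Real.zero_rpow (by linarith)]
        · rw [mul_comm, ← Real.rpow_add_one (abs_pos.2 h).ne']; congr 1; ring
      · rw [Set.indicator_of_notMem hz]
        have : f z.2 = 0 := if_neg hz
        rw [this, zero_mul]
    have hst := integral_stein hM h₀ hν 0 (by simpa using h₁) f
    have hi1 : Integrable (fun z : ℝ × ℝ => (φ N).indicator (fun z => |z.2 - m| ^ r) z)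
        (M.areaLaw j η) := hbdd (fun y => |y - m| ^ r) N ((N : ℝ) ^ r) (by fun_prop) fun y hy => by
      rw [abs_of_nonneg (by positivity)]
      exact Real.rpow_le_rpow (abs_nonneg _) hy (by linarith)
    have hi2 : Integrable (fun z : ℝ × ℝ => f z.2 * (deriv M.ψ z.1 - m)) (M.areaLaw j η) :=
      hui.bdd_mul (hfm.comp measurable_snd).aestronglyMeasurable
        (Eventually.of_forall fun z => hfb z.2)
    have hst2 : n * ∫ z, (φ N).indicator (fun z => |z.2 - m| ^ r) z ∂(M.areaLaw j η) =
        (n + ν) * ∫ z, f z.2 * (deriv M.ψ z.1 - m) ∂(M.areaLaw j η) := by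
      rw [← sub_eq_zero, ← integral_const_mul, ← integral_const_mul,
        ← integral_sub (hi1.const_mul _) (hi2.const_mul _), ← hst]
      refine integral_congr_ae (Eventually.of_forall fun z => ?_)
      simp only
      rw [← hfw]
      simp only [hm, hnn, hνν, Nat.cast_zero, zero_mul, zero_add, pow_zero, one_mul]
      ring
    have hst3 : ∫ z, (φ N).indicator (fun z => |z.2 - m| ^ r) z ∂(M.areaLaw j η) =
        ∫ z, κ * (f z.2 * (deriv M.ψ z.1 - m)) ∂(M.areaLaw j η) := by
      rw [integral_const_mul, hκ, div_mul_eq_mul_div, eq_div_iff hn.ne', mul_comm]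
      exact hst2
    have hle : ∫ z, κ * (f z.2 * (deriv M.ψ z.1 - m)) ∂(M.areaLaw j η) ≤
        ∫ z, (1 / 2 * (φ N).indicator (fun z => |z.2 - m| ^ r) z +
          1 / 2 * (2 * κ) ^ r * |deriv M.ψ z.1 - m| ^ r) ∂(M.areaLaw j η) := by
      refine integral_mono (hi2.const_mul _) ((hi1.const_mul _).add (hu.const_mul _)) fun z => ?_
      simp only
      have h0 : 0 ≤ 1 / 2 * (2 * κ) ^ r * |deriv M.ψ z.1 - m| ^ r := by positivity
      by_cases hz : z ∈ φ N
      · rw [Set.indicator_of_mem hz]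
        refine le_trans ?_ (young_rpow hκ0 (abs_nonneg (z.2 - m))
          (abs_nonneg (deriv M.ψ z.1 - m)) hr)
        refine mul_le_mul_of_nonneg_left ?_ hκ0
        refine (le_abs_self _).trans ?_
        rw [abs_mul]
        refine mul_le_mul_of_nonneg_right ?_ (abs_nonneg _)
        have : f z.2 = SignType.sign (z.2 - m) * |z.2 - m| ^ (r - 1) := if_pos hz
        rw [this, abs_mul]
        have h1 : |((SignType.sign (z.2 - m) : SignType) : ℝ)| ≤ 1 := by
          cases (SignType.sign (z.2 - m)) <;> simp
        rw [abs_of_nonneg (a := |z.2 - m| ^ (r - 1)) (by positivity)]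
        calc _ ≤ 1 * |z.2 - m| ^ (r - 1) := by gcongr
          _ = _ := one_mul _
      · rw [Set.indicator_of_notMem hz]
        have : f z.2 = 0 := if_neg hz
        rw [this, zero_mul, mul_zero, mul_zero, zero_add]
        exact h0
    rw [integral_add (hi1.const_mul _) (hu.const_mul _), integral_const_mul, integral_const_mul,
      ← integral_const_mul, ← hst3, integral_const_mul] at hle
    rw [← integral_indicator (hφm N)]
    change ∫ z, (φ N).indicator (fun z => |z.2 - m| ^ r) z ∂(M.areaLaw j η) ≤ _
    linarith
  have hint : Integrable (fun z : ℝ × ℝ => |z.2 - m| ^ r) (M.areaLaw j η) := by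
    refine hcov.integrable_of_integral_bounded_of_nonneg_ae ((2 * κ) ^ r * I) (fun N => ?_)
      (Eventually.of_forall fun z => by positivity) (Eventually.of_forall key)
    rw [← integrable_indicator_iff (hφm N)]
    exact hbdd (fun y => |y - m| ^ r) N ((N : ℝ) ^ r) (by fun_prop) fun y hy => by
      rw [abs_of_nonneg (by positivity)]
      exact Real.rpow_le_rpow (abs_nonneg _) hy (by linarith)
  exact ⟨hint, le_of_tendsto (hcov.integral_tendsto_of_countably_generated hint)
    (Eventually.of_forall key)⟩

/-! ### The moments up to the fourth order -/

/-- The hyperparameter lies in the range where the fourth moments exist. -/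
structure Admissible (M : AreaModel p) (j : ℕ) (η : Params p) : Prop where
  mem : M.linPred j η ∈ M.Θ
  nu_pos : 0 < nu η
  nu_gt : 3 * M.v₂ < nu η

/-- The case `r = 4` of the moment bound, whose condition `(r - 1) v₂ < ν` is exactly `3 v₂ < ν`. -/
theorem integrable_moment_four (hM : M.IsNEFQVF) {j : ℕ} {η : Params p}
    (h : M.Admissible j η) :
    Integrable (fun z : ℝ × ℝ => (1 + |deriv M.ψ z.1 - M.mean j η|) ^ 4) (M.areaLaw j η) := by
  obtain ⟨C, -, hC⟩ := moment_le hM (B := max |M.Q (M.mean j η)| |M.Q' (M.mean j η)|)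
    (δ := min (nu η) (nu η - 3 * M.v₂)) (r := 4) ((abs_nonneg _).trans (le_max_left _ _))
    (lt_min h.nu_pos (sub_pos.2 h.nu_gt)) (by norm_num)
  have h1 := (hC j η h.mem (le_max_left _ _) (le_max_right _ _) (min_le_left _ _) (by
    have := min_le_right (nu η) (nu η - 3 * M.v₂); linarith)).1
  have hdm := measurable_deriv M.ψ
  refine Integrable.mono' (h1.const_mul 4) (Measurable.aestronglyMeasurable (by fun_prop)) (Eventually.of_forall fun z => ?_)
  have e : (4 : ℝ) / 2 = (2 : ℕ) := by norm_num
  rw [e, Real.rpow_natCast, Real.norm_of_nonneg (by positivity)]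
  rw [← sq_abs (deriv M.ψ z.1 - M.mean j η)]
  set t := |deriv M.ψ z.1 - M.mean j η| with ht
  have h2 : (1 + t) ^ 2 ≤ 2 * (1 + t ^ 2) := by nlinarith [sq_nonneg (1 - t)]
  calc (1 + t) ^ 4 = ((1 + t) ^ 2) ^ 2 := by ring
    _ ≤ (2 * (1 + t ^ 2)) ^ 2 := by gcongr
    _ = _ := by ring

theorem integrable_moment_pow (hM : M.IsNEFQVF) {j : ℕ} {η : Params p}
    (h : M.Admissible j η) {k : ℕ} (hk : k ≤ 4) :
    Integrable (fun z : ℝ × ℝ => (1 + |deriv M.ψ z.1 - M.mean j η|) ^ k) (M.areaLaw j η) := by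
  have hdm := measurable_deriv M.ψ
  refine Integrable.mono' (integrable_moment_four hM h) (Measurable.aestronglyMeasurable (by fun_prop))
    (Eventually.of_forall fun z => ?_)
  rw [Real.norm_of_nonneg (by positivity)]
  exact pow_le_pow_right₀ (by linarith [abs_nonneg (deriv M.ψ z.1 - M.mean j η)]) hk

theorem integrable_y_four (hM : M.IsNEFQVF) {j : ℕ} {η : Params p}
    (h : M.Admissible j η) :
    Integrable (fun z : ℝ × ℝ => |z.2 - M.mean j η| ^ 4) (M.areaLaw j η) := by
  have hdm := measurable_deriv M.ψ
  have hu : Integrable (fun z : ℝ × ℝ => |deriv M.ψ z.1 - M.mean j η| ^ (4 : ℝ))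
      (M.areaLaw j η) := by
    refine Integrable.mono' (integrable_moment_four hM h) (Measurable.aestronglyMeasurable (by fun_prop))
      (Eventually.of_forall fun z => ?_)
    rw [Real.norm_of_nonneg (by positivity)]
    have e : (4 : ℝ) = (4 : ℕ) := by norm_num
    rw [e, Real.rpow_natCast]
    gcongr
    linarith
  have h2 := (moment_y_le hM h.mem h.nu_pos (r := 4) (by norm_num)
    (by simpa using integrable_moment_pow hM h (k := 1) (by norm_num)) hu).1
  refine h2.congr (Eventually.of_forall fun z => ?_)
  have e : (4 : ℝ) = (4 : ℕ) := by norm_num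
  simp only
  rw [e, Real.rpow_natCast]

/-- The joint moments of `ξ - m` and `y - m`. -/
noncomputable def jmom (M : AreaModel p) (j : ℕ) (η : Params p) (a b : ℕ) : ℝ :=
  ∫ z, (deriv M.ψ z.1 - M.mean j η) ^ a * (z.2 - M.mean j η) ^ b ∂(M.areaLaw j η)

theorem integrable_jmom (hM : M.IsNEFQVF) {j : ℕ} {η : Params p}
    (h : M.Admissible j η) {a b : ℕ} (hab : a + b ≤ 4) :
    Integrable (fun z : ℝ × ℝ => (deriv M.ψ z.1 - M.mean j η) ^ a * (z.2 - M.mean j η) ^ b)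
      (M.areaLaw j η) := by
  have hprob := isProbabilityMeasure_areaLaw hM h.mem h.nu_pos
  have hdm := measurable_deriv M.ψ
  refine Integrable.mono' ((integrable_moment_four hM h).add
    (((integrable_y_four hM h).add (integrable_const 1)).const_mul 16)) (Measurable.aestronglyMeasurable (by fun_prop))
    (Eventually.of_forall fun z => ?_)
  simp only [Pi.add_apply]
  rw [norm_mul, norm_pow, norm_pow, Real.norm_eq_abs, Real.norm_eq_abs]
  set s := |deriv M.ψ z.1 - M.mean j η|
  set t := |z.2 - M.mean j η|
  have hs : 0 ≤ s := abs_nonneg _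
  have ht : 0 ≤ t := abs_nonneg _
  have h16 : (1 + t) ^ 4 ≤ 16 * (t ^ 4 + 1) := by
    have h1 : (1 + t) ^ 2 ≤ 2 * (1 + t ^ 2) := by nlinarith [sq_nonneg (1 - t)]
    have h2 : (1 + t ^ 2) ^ 2 ≤ 2 * (1 + t ^ 4) := by nlinarith [sq_nonneg (1 - t ^ 2)]
    calc (1 + t) ^ 4 = ((1 + t) ^ 2) ^ 2 := by ring
      _ ≤ (2 * (1 + t ^ 2)) ^ 2 := by gcongr
      _ = 4 * (1 + t ^ 2) ^ 2 := by ring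
      _ ≤ _ := by nlinarith [pow_nonneg ht 4]
  rcases le_total s t with hst | hst
  · calc s ^ a * t ^ b ≤ (1 + t) ^ a * (1 + t) ^ b := by gcongr <;> linarith
      _ = (1 + t) ^ (a + b) := by rw [pow_add]
      _ ≤ (1 + t) ^ 4 := pow_le_pow_right₀ (by linarith) hab
      _ ≤ _ := h16.trans (le_add_of_nonneg_left (by positivity))
  · calc s ^ a * t ^ b ≤ (1 + s) ^ a * (1 + s) ^ b := by gcongr <;> linarith
      _ = (1 + s) ^ (a + b) := by rw [pow_add]
      _ ≤ (1 + s) ^ 4 := pow_le_pow_right₀ (by linarith) hab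
      _ ≤ _ := le_add_of_nonneg_right (by positivity)

theorem jmom_zero_zero (hM : M.IsNEFQVF) {j : ℕ} {η : Params p} (h : M.Admissible j η) :
    M.jmom j η 0 0 = 1 := by
  have hprob := isProbabilityMeasure_areaLaw hM h.mem h.nu_pos
  simp [jmom]

/-- The Stein identity tested against `(y - m) ^ b`, with `Q(ξ)` expanded about `m`: it trades a
power of `y - m` for powers of `ξ - m`. -/
theorem jmom_succ_right (hM : M.IsNEFQVF) {j : ℕ} {η : Params p} (h : M.Admissible j η)
    {a b : ℕ} (hab : a + b ≤ 3) :
    M.n j * M.jmom j η a (b + 1) = (M.n j + nu η - a * M.v₂) * M.jmom j η (a + 1) b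
      - a * M.Q' (M.mean j η) * M.jmom j η a b
      - a * M.Q (M.mean j η) * M.jmom j η (a - 1) b := by
  have h1 := integral_stein hM h.mem h.nu_pos a
    (integrable_moment_pow hM h (by omega)) (fun y => (y - M.mean j η) ^ b)
  set q := M.Q (M.mean j η) with hq
  set q' := M.Q' (M.mean j η) with hq'
  have i1 := (integrable_jmom hM h (a := a) (b := b + 1) (by omega)).const_mul (M.n j)
  have i2 := (integrable_jmom hM h (a := a + 1) (b := b) (by omega)).const_mul
    (M.n j + nu η - a * M.v₂)
  have i3 := (integrable_jmom hM h (a := a) (b := b) (by omega)).const_mul (a * q')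
  have i4 := (integrable_jmom hM h (a := a - 1) (b := b) (by omega)).const_mul (a * q)
  have h2 : M.n j * M.jmom j η a (b + 1) + a * q' * M.jmom j η a b
      + a * q * M.jmom j η (a - 1) b - (M.n j + nu η - a * M.v₂) * M.jmom j η (a + 1) b = 0 := by
    unfold jmom
    rw [← integral_const_mul, ← integral_const_mul, ← integral_const_mul, ← integral_const_mul,
      ← integral_add i1 i3, ← integral_add (i1.fun_add i3) i4,
      ← integral_sub ((i1.fun_add i3).fun_add i4) i2, ← h1]
    refine integral_congr_ae (Eventually.of_forall fun z => ?_)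
    beta_reduce
    rw [Q_eq M (M.mean j η) (deriv M.ψ z.1), ← hq, ← hq']
    -- For `a = 0` the exponent `a - 1` is truncated to `0`, harmlessly, since its term carries the
    -- factor `a`.
    rcases a with _ | a
    · simp only [Nat.cast_zero, zero_mul, zero_add, pow_zero, sub_zero, one_mul, pow_one]
      ring
    · simp only [Nat.add_sub_cancel]
      ring
  linarith

/-- Integration by parts under the prior alone. Unlike the identities involving `y` it closes up on
the moments of `ξ`, and so starts the recursion. -/
theorem jmom_succ_left (hM : M.IsNEFQVF) {j : ℕ} {η : Params p} (h : M.Admissible j η)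
    {k : ℕ} (hk : k ≤ 3) :
    (nu η - k * M.v₂) * M.jmom j η (k + 1) 0 = k * M.Q (M.mean j η) * M.jmom j η (k - 1) 0
      + k * M.Q' (M.mean j η) * M.jmom j η k 0 := by
  have hdm := measurable_deriv M.ψ
  set q := M.Q (M.mean j η) with hq
  set q' := M.Q' (M.mean j η) with hq'
  set m := M.mean j η with hm
  have hQm : Measurable M.Q := by unfold Q; fun_prop
  set F : ℝ → ℝ := fun θ => k * (deriv M.ψ θ - m) ^ (k - 1) * M.Q (deriv M.ψ θ)
      + (deriv M.ψ θ - m) ^ k * (nu η * m - nu η * deriv M.ψ θ) with hF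
  have hFm : Measurable F := by fun_prop
  have h0 : ∫ z, F z.1 ∂(M.areaLaw j η) = 0 := by
    rw [integral_fst_areaLaw hM h.mem h.nu_pos hFm]
    have hi := integral_ibp hM (W := fun θ => Real.exp (nu η * (m * θ - M.ψ θ))) (m := m)
      (A := nu η * m) (B := nu η) (fun θ hθ => hasDerivAt_weight hM _ _ hθ) k ?_
    · rw [← hm]
      simp only [hF]
      rw [hi, mul_zero]
    -- The prior weight is unnormalized here, so the fourth moment is taken from the weighted bound
    -- directly.
    · obtain ⟨C, -, hC⟩ := moment_weight_le hM (B := max |q| |q'|)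
        (δ := min (nu η) (nu η - 3 * M.v₂)) (r := 4) ((abs_nonneg _).trans (le_max_left _ _))
        (lt_min h.nu_pos (sub_pos.2 h.nu_gt)) (by norm_num)
      have h1 := (hC (M.linPred j η) h.mem (nu η) (le_max_left _ _) (le_max_right _ _)
        (min_le_left _ _) (by
          have := min_le_right (nu η) (nu η - 3 * M.v₂); linarith)).1
      have hWc := continuousOn_weight hM (nu η) m
      have hξc := continuousOn_deriv_ψ hM
      refine Integrable.mono' (h1.const_mul 4)
        (ContinuousOn.aestronglyMeasurable (by fun_prop) hM.isOpen.measurableSet)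
        (Eventually.of_forall fun θ => ?_)
      have e : (4 : ℝ) / 2 = (2 : ℕ) := by norm_num
      rw [e, Real.rpow_natCast, Real.norm_of_nonneg (by positivity), abs_of_pos (Real.exp_pos _),
        ← mul_assoc]
      refine mul_le_mul_of_nonneg_right ?_ (Real.exp_pos _).le
      change (1 + |deriv M.ψ θ - m|) ^ (k + 1) ≤ 4 * (1 + (deriv M.ψ θ - m) ^ 2) ^ 2
      rw [← sq_abs (deriv M.ψ θ - m)]
      set t := |deriv M.ψ θ - m| with ht
      have ht0 : 0 ≤ t := abs_nonneg _
      have h2 : (1 + t) ^ 2 ≤ 2 * (1 + t ^ 2) := by nlinarith [sq_nonneg (1 - t)]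
      calc (1 + t) ^ (k + 1) ≤ (1 + t) ^ 4 := pow_le_pow_right₀ (by linarith) (by omega)
        _ = ((1 + t) ^ 2) ^ 2 := by ring
        _ ≤ (2 * (1 + t ^ 2)) ^ 2 := by gcongr
        _ = _ := by ring
  have i2 := (integrable_jmom hM h (a := k + 1) (b := 0) (by omega)).const_mul
    (nu η - k * M.v₂)
  have i3 := (integrable_jmom hM h (a := k) (b := 0) (by omega)).const_mul (k * q')
  have i4 := (integrable_jmom hM h (a := k - 1) (b := 0) (by omega)).const_mul (k * q)
  have h2 : k * q * M.jmom j η (k - 1) 0 + k * q' * M.jmom j η k 0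
      - (nu η - k * M.v₂) * M.jmom j η (k + 1) 0 = 0 := by
    unfold jmom
    rw [← integral_const_mul, ← integral_const_mul, ← integral_const_mul,
      ← integral_add i4 i3, ← integral_sub (i4.fun_add i3) i2, ← h0]
    refine integral_congr_ae (Eventually.of_forall fun z => ?_)
    simp only [hF]
    rw [Q_eq M m (deriv M.ψ z.1), ← hq, ← hq', ← hm]
    rcases k with _ | k
    · simp only [Nat.cast_zero, zero_mul, zero_add, pow_zero, sub_zero, one_mul, pow_one]
      ring
    · simp only [Nat.add_sub_cancel]
      ring
  linarith

end AreaModel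
end NEFQVF

namespace NEFQVF

/-! ### Closed forms of the moments of `y` -/

/-- The second moment of `y` as a function of `n`, `m`, `ν` (through `q = Q m`). -/
noncomputable def muTwo (v n ν q : ℝ) : ℝ := q * (n + ν) / (n * (ν - v))

/-- The third central moment of `y`, with `q = Q m` and `q' = Q' m`. -/
noncomputable def muThree (v n ν q q' : ℝ) : ℝ :=
  (n + ν) * (2 * n + ν) * q * q' / (n ^ 2 * ((ν - v) * (ν - 2 * v)))

/-- The fourth central moment of `y`, with `q = Q m` and `q' = Q' m`. -/
noncomputable def muFour (v n ν q q' : ℝ) : ℝ :=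
  (n + ν) * (q ^ 2 * (ν - 2 * v) * (3 * n ^ 2 + 3 * n * ν + 2 * ν * v) +
    q * q' ^ 2 * (6 * n ^ 2 + 6 * n * ν + ν ^ 2 + ν * v)) /
      (n ^ 3 * ((ν - v) * (ν - 2 * v) * (ν - 3 * v)))

/-- The determinant of the covariance matrix of the elementary estimating functions. -/
noncomputable def detSig (v n ν q q' : ℝ) : ℝ :=
  2 * ν * (n + v) * (n + ν - v) * (n + ν) ^ 2 * q ^ 2 *
    (q' ^ 2 * (ν - v) + q * (ν - 2 * v) ^ 2) /
      (n ^ 4 * ((ν - v) ^ 3 * (ν - 2 * v) ^ 2 * (ν - 3 * v)))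

/-- The determinant of `Σ` factors completely, which makes its positivity visible; the factor `n +
v` is the reason for the condition on `n j + v₂`. -/
theorem detSig_eq {v n ν q q' : ℝ} (hn : n ≠ 0) (h₁ : ν - v ≠ 0) (h₂ : ν - 2 * v ≠ 0)
    (h₃ : ν - 3 * v ≠ 0) :
    muTwo v n ν q * (muFour v n ν q q' - muTwo v n ν q ^ 2) - muThree v n ν q q' ^ 2 =
      detSig v n ν q q' := by
  unfold muTwo muThree muFour detSig
  obtain ⟨a, ha⟩ : ∃ a, a = ν - v := ⟨_, rfl⟩
  obtain ⟨b, hb⟩ : ∃ b, b = ν - 2 * v := ⟨_, rfl⟩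
  obtain ⟨c, hc⟩ : ∃ c, c = ν - 3 * v := ⟨_, rfl⟩
  rw [← ha] at h₁
  rw [← hb] at h₂
  rw [← hc] at h₃
  rw [← ha, ← hb, ← hc]
  field_simp
  subst ha hb hc
  ring

theorem detSig_pos {v n ν q q' : ℝ} (hn : 0 < n) (hnv : 0 < n + v) (hν : 0 < ν)
    (hν' : 3 * v < ν) (hq : 0 < q) : 0 < detSig v n ν q q' := by
  have h1 : 0 < ν - v := by linarith
  have h2 : 0 < ν - 2 * v := by linarith
  have h3 : 0 < ν - 3 * v := by linarith
  have h4 : 0 < n + ν - v := by linarith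
  unfold detSig
  positivity

namespace AreaModel

variable {p : ℕ} {M : AreaModel p}

namespace Admissible

variable {j : ℕ} {η : Params p}

theorem sub_pos_one (h : M.Admissible j η) : 0 < nu η - M.v₂ := by
  have := h.nu_pos; have := h.nu_gt; linarith

theorem sub_pos_two (h : M.Admissible j η) : 0 < nu η - 2 * M.v₂ := by
  have := h.nu_pos; have := h.nu_gt; linarith

theorem sub_pos_three (h : M.Admissible j η) : 0 < nu η - 3 * M.v₂ := by
  have := h.nu_gt; linarith

end Admissible

/-- The recursions are triangular: moments of `ξ` come first, then each extra power of `y - m` is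
obtained from moments already known. -/
theorem jmom_values (hM : M.IsNEFQVF) {j : ℕ} {η : Params p} (h : M.Admissible j η) :
    M.jmom j η 1 0 = 0 ∧ M.jmom j η 0 1 = 0 ∧
    M.mu 2 j η = muTwo M.v₂ (M.n j) (nu η) (M.Q (M.mean j η)) ∧
    M.mu 3 j η = muThree M.v₂ (M.n j) (nu η) (M.Q (M.mean j η)) (M.Q' (M.mean j η)) ∧
    M.mu 4 j η = muFour M.v₂ (M.n j) (nu η) (M.Q (M.mean j η)) (M.Q' (M.mean j η)) := by
  have hν := h.nu_pos.ne'
  have hn := (hM.n_pos j).ne'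
  have h1 := h.sub_pos_one.ne'
  have h2 := h.sub_pos_two.ne'
  have h3 := h.sub_pos_three.ne'
  have hmu : ∀ r, M.mu r j η = M.jmom j η 0 r := fun r => by simp [mu, jmom]
  have J00 := jmom_zero_zero hM h
  have r0 := jmom_succ_left hM h (k := 0) (by norm_num)
  have r1 := jmom_succ_left hM h (k := 1) (by norm_num)
  have r2 := jmom_succ_left hM h (k := 2) (by norm_num)
  have r3 := jmom_succ_left hM h (k := 3) (by norm_num)
  have s00 := jmom_succ_right hM h (a := 0) (b := 0) (by norm_num)
  have s10 := jmom_succ_right hM h (a := 1) (b := 0) (by norm_num)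
  have s20 := jmom_succ_right hM h (a := 2) (b := 0) (by norm_num)
  have s30 := jmom_succ_right hM h (a := 3) (b := 0) (by norm_num)
  have s01 := jmom_succ_right hM h (a := 0) (b := 1) (by norm_num)
  have s11 := jmom_succ_right hM h (a := 1) (b := 1) (by norm_num)
  have s21 := jmom_succ_right hM h (a := 2) (b := 1) (by norm_num)
  have s02 := jmom_succ_right hM h (a := 0) (b := 2) (by norm_num)
  have s12 := jmom_succ_right hM h (a := 1) (b := 2) (by norm_num)
  have s03 := jmom_succ_right hM h (a := 0) (b := 3) (by norm_num)
  simp only [hmu]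
  simp only [Nat.cast_zero, Nat.cast_one, Nat.cast_ofNat, zero_mul, sub_zero, one_mul, zero_add,
    Nat.reduceAdd, Nat.reduceSub, add_zero, Nat.sub_self, J00, mul_one]
    at r0 r1 r2 r3 s00 s10 s20 s30 s01 s11 s21 s02 s12 s03
  generalize M.n j = n at *
  generalize nu η = ν at *
  generalize M.Q (M.mean j η) = q at *
  generalize M.Q' (M.mean j η) = q' at *
  generalize M.v₂ = v at *
  generalize M.jmom j η = J at *
  have J10 : J 1 0 = 0 := by simpa [hν] using r0
  simp only [J10, mul_zero, add_zero, sub_zero] at r1 s00 s10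
  have J01 : J 0 1 = 0 := by simpa [hn] using s00
  simp only [J01, mul_zero, sub_zero] at s11
  -- The denominators are made opaque while fractions are cleared, and unfolded again for the
  -- polynomial identity.
  obtain ⟨a, ha⟩ : ∃ a, ν - v = a := ⟨_, rfl⟩
  obtain ⟨b, hb⟩ : ∃ b, ν - 2 * v = b := ⟨_, rfl⟩
  obtain ⟨c, hc⟩ : ∃ c, ν - 3 * v = c := ⟨_, rfl⟩
  rw [ha] at h1 r1
  rw [hb] at h2 r2
  rw [hc] at h3 r3
  have J20 : J 2 0 = q / a := by rw [eq_div_iff h1]; linear_combination r1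
  have J11 : J 1 1 = q / a := by
    apply mul_left_cancel₀ hn
    rw [s10, J20]
    field_simp
    subst ha hb hc
    ring
  have J30 : J 3 0 = 2 * q * q' / (a * b) := by
    apply mul_left_cancel₀ h2
    rw [r2, J10, J20]
    field_simp
    subst ha hb hc
    ring
  have J21 : J 2 1 = 2 * q * q' / (a * b) := by
    apply mul_left_cancel₀ hn
    rw [s20, J30, J20, J10]
    field_simp
    subst ha hb hc
    ring
  have J40 : J 4 0 = 3 * q * (q * b + 2 * q' ^ 2) /
      (a * b * c) := by
    apply mul_left_cancel₀ h3
    rw [r3, J20, J30]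
    field_simp
  have J31 : J 3 1 = 3 * q * (q * b + 2 * q' ^ 2) /
      (a * b * c) := by
    apply mul_left_cancel₀ hn
    rw [s30, J40, J20, J30]
    field_simp
    subst ha hb hc
    ring
  have J02 : J 0 2 = muTwo v n ν q := by
    apply mul_left_cancel₀ hn
    rw [s01, J11, muTwo, ha]
    field_simp
  have J12 : J 1 2 = q * q' * (2 * n + ν) / (n * (a * b)) := by
    apply mul_left_cancel₀ hn
    rw [s11, J21, J11]
    field_simp
    subst ha hb hc
    ring
  have J03 : J 0 3 = muThree v n ν q q' := by
    apply mul_left_cancel₀ hn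
    rw [s02, J12, muThree, ha, hb]
    field_simp
  have J22 : J 2 2 = (3 * n + ν) * (q ^ 2 * b + 2 * q * q' ^ 2) /
      (n * (a * b * c)) := by
    apply mul_left_cancel₀ hn
    rw [s21, J31, J21, J11]
    field_simp
    subst ha hb hc
    ring
  have J13 : J 1 3 = (q ^ 2 * b * (3 * n ^ 2 + 3 * n * ν + 2 * ν * v) +
      q * q' ^ 2 * (6 * n ^ 2 + 6 * n * ν + ν ^ 2 + ν * v)) /
      (n ^ 2 * (a * b * c)) := by
    apply mul_left_cancel₀ hn
    rw [s12, J22, J12, J02, muTwo, ha]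
    field_simp
    subst ha hb hc
    ring
  have J04 : J 0 4 = muFour v n ν q q' := by
    apply mul_left_cancel₀ hn
    rw [s03, J13, muFour, ha, hb, hc]
    field_simp
  exact ⟨J10, J01, J02, J03, J04⟩

end AreaModel
end NEFQVF

namespace NEFQVF

/-! ### A moment inequality for sums of independent variables -/

/-- By homogeneity this reduces to `|r ^ s - 1| ≤ |r - 1|` for `r = |x| / |y|`, which holds for
exponents `s ≤ 1`. -/
theorem abs_rpow_sub_mul_le {s x y : ℝ} (hs : 0 < s) (hs1 : s ≤ 1) :
    |(|x| ^ s - |y| ^ s) * y| ≤ |y| ^ s * |x - y| := by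
  have hxy : |(|x| - |y|)| ≤ |x - y| := abs_abs_sub_abs_le_abs_sub x y
  refine le_trans ?_ (mul_le_mul_of_nonneg_left hxy (by positivity))
  rcases eq_or_ne y 0 with rfl | hy
  · simp [Real.zero_rpow hs.ne']
  have hy0 : 0 < |y| := abs_pos.2 hy
  set r := |x| / |y| with hr
  have hr0 : 0 ≤ r := by positivity
  have hx : |x| = r * |y| := by rw [hr]; field_simp
  have hxs : |x| ^ s = r ^ s * |y| ^ s := by rw [hx, Real.mul_rpow hr0 hy0.le]
  have key : |r ^ s - 1| ≤ |r - 1| := by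
    rcases le_total 1 r with h | h
    · rw [abs_of_nonneg (by linarith [Real.one_le_rpow h hs.le]), abs_of_nonneg (by linarith)]
      linarith [Real.rpow_le_self_of_one_le h hs1]
    · rw [abs_of_nonpos (by linarith [Real.rpow_le_one hr0 h hs.le]),
        abs_of_nonpos (by linarith)]
      linarith [Real.self_le_rpow_of_le_one hr0 h hs1]
  have e1 : (|x| ^ s - |y| ^ s) * y = |y| ^ s * ((r ^ s - 1) * y) := by rw [hxs]; ring
  have e2 : |x| - |y| = (r - 1) * |y| := by rw [hx]; ring
  rw [e1, e2, abs_mul, abs_mul, abs_mul, abs_abs, abs_of_nonneg (a := |y| ^ s) (by positivity)]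
  gcongr

/-- A second-order expansion of `|·|^q` with explicit remainder. The bound `q ≤ 3` makes `t ↦ t^(q -
2)` subadditive, and that controls the variation of the derivative. -/
theorem abs_add_rpow_le {q a b : ℝ} (hq : 2 < q) (hq3 : q ≤ 3) :
    |a + b| ^ q ≤ |a| ^ q + q * (|a| ^ (q - 2) * a) * b
      + q * (2 * |a| ^ (q - 2) * b ^ 2 + |b| ^ q) := by
  have hd : ∀ t : ℝ, HasDerivAt (fun t => |a + t * b| ^ q)
      (q * |a + t * b| ^ (q - 2) * (a + t * b) * b) t := by
    intro t
    have h1 : HasDerivAt (fun t : ℝ => a + t * b) b t := by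
      simpa using ((hasDerivAt_id' t).mul_const b).const_add a
    exact (hasDerivAt_abs_rpow (a + t * b) (by linarith : 1 < q)).comp t h1
  -- The mean value theorem along the segment from `a` to `a + b`; the derivative is then compared
  -- with its value at `a`.
  obtain ⟨c, hc, hc'⟩ := exists_hasDerivAt_eq_slope (fun t => |a + t * b| ^ q) _ (zero_lt_one)
    (fun t _ => (hd t).continuousAt.continuousWithinAt) (fun t _ => hd t)
  simp only [one_mul, zero_mul, add_zero, sub_zero, div_one] at hc'
  have hs : 0 < q - 2 := by linarith
  have hs1 : q - 2 ≤ 1 := by linarith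
  set x := a + c * b with hx
  have hxab : |x| ^ (q - 2) ≤ |a| ^ (q - 2) + |b| ^ (q - 2) := by
    refine le_trans (Real.rpow_le_rpow (abs_nonneg _) ?_ hs.le)
      (Real.rpow_add_le_add_rpow (abs_nonneg a) (abs_nonneg b) hs.le hs1)
    refine (abs_add_le _ _).trans ?_
    rw [abs_mul, abs_of_pos hc.1]
    have := mul_le_mul_of_nonneg_right hc.2.le (abs_nonneg b)
    linarith
  have hxa : |x - a| ≤ |b| := by
    have : x - a = c * b := by rw [hx]; ring
    rw [this, abs_mul, abs_of_pos hc.1]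
    have := mul_le_mul_of_nonneg_right hc.2.le (abs_nonneg b)
    linarith
  have hφ : |(|x| ^ (q - 2) * x - |a| ^ (q - 2) * a)| ≤ (2 * |a| ^ (q - 2) + |b| ^ (q - 2)) * |b| := by
    have e : |x| ^ (q - 2) * x - |a| ^ (q - 2) * a
        = |x| ^ (q - 2) * (x - a) + (|x| ^ (q - 2) - |a| ^ (q - 2)) * a := by ring
    rw [e]
    refine (abs_add_le _ _).trans ?_
    have h1 := abs_rpow_sub_mul_le (x := x) (y := a) hs hs1
    rw [abs_mul, abs_of_nonneg (a := |x| ^ (q - 2)) (by positivity)]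
    calc _ ≤ (|a| ^ (q - 2) + |b| ^ (q - 2)) * |b| + |a| ^ (q - 2) * |b| := by
          refine add_le_add (mul_le_mul hxab hxa (abs_nonneg _) (by positivity)) (h1.trans ?_)
          gcongr
      _ = _ := by ring
  have hbq : |b| ^ q = |b| ^ (q - 2) * b ^ 2 := by
    rcases eq_or_ne b 0 with rfl | hb
    · simp [Real.zero_rpow (by linarith : q ≠ 0)]
    · rw [← sq_abs b, ← Real.rpow_natCast, ← Real.rpow_add (abs_pos.2 hb)]
      congr 1; push_cast; ring
  have hfin : q * |x| ^ (q - 2) * x * b - q * (|a| ^ (q - 2) * a) * b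
      ≤ q * (2 * |a| ^ (q - 2) * b ^ 2 + |b| ^ q) := by
    have e : q * |x| ^ (q - 2) * x * b - q * (|a| ^ (q - 2) * a) * b
        = q * ((|x| ^ (q - 2) * x - |a| ^ (q - 2) * a) * b) := by ring
    rw [e, hbq]
    refine mul_le_mul_of_nonneg_left ?_ (by linarith)
    refine (le_abs_self _).trans ?_
    rw [abs_mul]
    refine (mul_le_mul_of_nonneg_right hφ (abs_nonneg b)).trans (le_of_eq ?_)
    rw [← sq_abs b]; ring
  linarith

theorem sq_le_one_add_rpow {q x : ℝ} (hq : 2 ≤ q) : x ^ 2 ≤ 1 + |x| ^ q := by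
  rcases le_total |x| 1 with h | h
  · have : x ^ 2 ≤ 1 := by rw [← sq_abs]; exact pow_le_one₀ (abs_nonneg _) h
    linarith [Real.rpow_nonneg (abs_nonneg x) q]
  · have : x ^ 2 ≤ |x| ^ q := by
      rw [← sq_abs, ← Real.rpow_natCast]
      exact Real.rpow_le_rpow_of_exponent_le h (by exact_mod_cast hq)
    linarith

theorem rpow_le_one_add_sq {s t : ℝ} (hs : 0 < s) (hs2 : s ≤ 2) (ht : 0 ≤ t) :
    t ^ s ≤ 1 + t ^ 2 := by
  rcases le_total t 1 with h | h
  · have := Real.rpow_le_one ht h hs.le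
    nlinarith [sq_nonneg t]
  · have : t ^ s ≤ t ^ 2 := by
      rw [← Real.rpow_natCast]
      exact Real.rpow_le_rpow_of_exponent_le h (by exact_mod_cast hs2)
    linarith

section Independent

variable {Ω : Type*} [MeasurableSpace Ω] {μ : Measure Ω} [IsProbabilityMeasure μ]

theorem integrable_abs_rpow_iff {X : Ω → ℝ} (hX : Measurable X) {q : ℝ} (hq : 0 < q) :
    Integrable (fun ω => |X ω| ^ q) μ ↔ MemLp X (ENNReal.ofReal q) μ := by
  rw [← integrable_norm_rpow_iff hX.aestronglyMeasurable (by simpa using hq)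
    ENNReal.ofReal_ne_top, ENNReal.toReal_ofReal hq.le]
  rfl

theorem integrable_abs_rpow_of_le {X : Ω → ℝ} (hX : Measurable X) {q s : ℝ} (hs : 0 < s)
    (hsq : s ≤ q) (h : Integrable (fun ω => |X ω| ^ q) μ) :
    Integrable (fun ω => |X ω| ^ s) μ := by
  rw [integrable_abs_rpow_iff hX (hs.trans_le hsq)] at h
  rw [integrable_abs_rpow_iff hX hs]
  exact h.mono_exponent (ENNReal.ofReal_le_ofReal hsq)

/-- A Rosenthal-type inequality by adding one summand at a time. The linear term of the expansion
has mean zero by independence, and `E|S|^(q - 2)` is controlled by the second moment. The bound `n`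
on the number of summands stays fixed through the induction, so that every step costs the same. -/
theorem integral_abs_sum_rpow_le {q B : ℝ} (hq : 2 < q) (hq3 : q ≤ 3) {X : ℕ → Ω → ℝ}
    (hXm : ∀ j, Measurable (X j)) (hX : iIndepFun X μ) (hmean : ∀ j, ∫ ω, X j ω ∂μ = 0)
    (hint : ∀ j, Integrable (fun ω => |X j ω| ^ q) μ) (hB : ∀ j, ∫ ω, |X j ω| ^ q ∂μ ≤ B)
    {n : ℕ} (hn : 1 ≤ n) (s : Finset ℕ) (hs : s.card ≤ n) :
    Integrable (fun ω => |∑ j ∈ s, X j ω| ^ q) μ ∧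
      ∫ ω, (∑ j ∈ s, X j ω) ^ 2 ∂μ ≤ s.card * (1 + B) ∧
      ∫ ω, |∑ j ∈ s, X j ω| ^ q ∂μ ≤
        s.card * (q * (2 * ((n : ℝ) ^ ((q - 2) / 2) * (2 + B)) * (1 + B) + B)) := by
  have hq0 : 0 < q := by linarith
  have hB0 : 0 ≤ B := (integral_nonneg fun ω => by positivity).trans (hB 0)
  have hn0 : (0 : ℝ) < n := by exact_mod_cast hn
  have hXsq : ∀ j, Integrable (fun ω => X j ω ^ 2) μ := fun j =>
    Integrable.mono' ((integrable_const 1).add (hint j)) ((hXm j).pow_const 2).aestronglyMeasurable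
      (Eventually.of_forall fun ω => by
        rw [Real.norm_of_nonneg (sq_nonneg _)]; exact sq_le_one_add_rpow hq.le)
  have hXi : ∀ j, Integrable (X j) μ := fun j => by
    have := integrable_abs_rpow_of_le (hXm j) one_pos (by linarith : (1 : ℝ) ≤ q) (hint j)
    simp only [Real.rpow_one] at this
    exact (integrable_norm_iff (hXm j).aestronglyMeasurable).1 this
  have hX2 : ∀ j, ∫ ω, X j ω ^ 2 ∂μ ≤ 1 + B := fun j => by
    calc ∫ ω, X j ω ^ 2 ∂μ ≤ ∫ ω, (1 + |X j ω| ^ q) ∂μ :=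
          integral_mono (hXsq j) ((integrable_const 1).add (hint j)) fun ω =>
            sq_le_one_add_rpow hq.le
      _ = 1 + ∫ ω, |X j ω| ^ q ∂μ := by
          rw [integral_add (integrable_const 1) (hint j)]; simp
      _ ≤ _ := by linarith [hB j]
  induction s using Finset.induction_on with
  | empty => simp [Real.zero_rpow hq0.ne']
  | insert i s hi ih =>
    rw [Finset.card_insert_of_notMem hi] at hs
    obtain ⟨ih1, ih2, ih3⟩ := ih (by omega)
    set S : Ω → ℝ := fun ω => ∑ j ∈ s, X j ω with hS
    have hSm : Measurable S := Finset.measurable_fun_sum s fun j _ => hXm j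
    have hind : IndepFun S (X i) μ := by
      have := hX.indepFun_finsetSum_of_notMem hXm hi
      have e : (∑ j ∈ s, X j) = S := by ext ω; simp [hS]
      rwa [e] at this
    have e : ∀ ω, ∑ j ∈ insert i s, X j ω = S ω + X i ω := fun ω => by
      rw [Finset.sum_insert hi, add_comm]
    simp only [e]
    have hSLp := (integrable_abs_rpow_iff hSm hq0).1 ih1
    have hXLp := (integrable_abs_rpow_iff (hXm i) hq0).1 (hint i)
    have h1 : Integrable (fun ω => |S ω + X i ω| ^ q) μ :=
      (integrable_abs_rpow_iff (hSm.add (hXm i)) hq0).2 (hSLp.add hXLp)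
    have hSsq : Integrable (fun ω => S ω ^ 2) μ :=
      Integrable.mono' ((integrable_const 1).add ih1) (hSm.pow_const 2).aestronglyMeasurable
        (Eventually.of_forall fun ω => by
          rw [Real.norm_of_nonneg (sq_nonneg _)]; exact sq_le_one_add_rpow hq.le)
    have hSi : Integrable S μ := by
      have := integrable_abs_rpow_of_le hSm one_pos (by linarith : (1 : ℝ) ≤ q) ih1
      simp only [Real.rpow_one] at this
      exact (integrable_norm_iff hSm.aestronglyMeasurable).1 this
    refine ⟨h1, ?_, ?_⟩
    · have hSX : Integrable (fun ω => S ω * X i ω) μ := hind.integrable_mul hSi (hXi i)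
      have e2 : ∀ ω, (S ω + X i ω) ^ 2 = S ω ^ 2 + 2 * (S ω * X i ω) + X i ω ^ 2 := fun ω => by
        ring
      simp only [e2]
      rw [integral_add (hSsq.fun_add (hSX.const_mul 2)) (hXsq i), integral_add hSsq (hSX.const_mul 2),
        integral_const_mul, hind.integral_fun_mul_eq_mul_integral hSm.aestronglyMeasurable
          (hXm i).aestronglyMeasurable, hmean i, Finset.card_insert_of_notMem hi]
      push_cast
      linarith [hX2 i]
    · have hSs := integrable_abs_rpow_of_le hSm (by linarith : 0 < q - 2) (by linarith) ih1
      have hφm : Measurable fun x : ℝ => |x| ^ (q - 2) := by fun_prop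
      have hSφ : Integrable (fun ω => |S ω| ^ (q - 2) * S ω) μ := by
        refine Integrable.mono' ((ih1.add (integrable_const 1)))
          ((hφm.comp hSm).mul hSm).aestronglyMeasurable (Eventually.of_forall fun ω => ?_)
        rw [norm_mul, Real.norm_eq_abs, Real.norm_eq_abs, abs_of_nonneg (a := |S ω| ^ (q - 2))
          (by positivity)]
        rcases le_total |S ω| 1 with h | h
        · have h5 := Real.rpow_le_one (abs_nonneg (S ω)) h (by linarith : 0 ≤ q - 2)
          have h6 : |S ω| ^ (q - 2) * |S ω| ≤ 1 := mul_le_one₀ h5 (abs_nonneg _) h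
          have h7 : 0 ≤ |S ω| ^ q := by positivity
          simp only [Pi.add_apply]; linarith
        · have h5 : |S ω| ^ (q - 2) * |S ω| ≤ |S ω| ^ q := by
            rw [← Real.rpow_add_one (by linarith : |S ω| ≠ 0)]
            exact Real.rpow_le_rpow_of_exponent_le h (by linarith)
          simp only [Pi.add_apply]; linarith
      have hind1 : IndepFun (fun ω => |S ω| ^ (q - 2) * S ω) (X i) μ :=
        hind.comp (φ := fun x => |x| ^ (q - 2) * x) (hφm.mul measurable_id) measurable_id
      have hind2 : IndepFun (fun ω => |S ω| ^ (q - 2)) (fun ω => X i ω ^ 2) μ :=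
        hind.comp (φ := fun x => |x| ^ (q - 2)) (ψ := fun x => x ^ 2) hφm (by fun_prop)
      have i1 : Integrable (fun ω => (|S ω| ^ (q - 2) * S ω) * X i ω) μ :=
        hind1.integrable_mul hSφ (hXi i)
      have i2 : Integrable (fun ω => |S ω| ^ (q - 2) * X i ω ^ 2) μ :=
        hind2.integrable_mul hSs (hXsq i)
      have z1 : ∫ ω, (|S ω| ^ (q - 2) * S ω) * X i ω ∂μ = 0 := by
        rw [hind1.integral_fun_mul_eq_mul_integral hSφ.1 (hXm i).aestronglyMeasurable, hmean i,
          mul_zero]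
      have z2 : ∫ ω, |S ω| ^ (q - 2) * X i ω ^ 2 ∂μ ≤
          (n : ℝ) ^ ((q - 2) / 2) * (2 + B) * (1 + B) := by
        rw [hind2.integral_fun_mul_eq_mul_integral hSs.1 (hXsq i).1]
        refine mul_le_mul ?_ (hX2 i) (integral_nonneg fun ω => sq_nonneg _) (by positivity)
        -- Scaling by `√n` before using `t ^ s ≤ 1 + t²` gives the correct power of `n`.
        have hpt : ∀ ω, |S ω| ^ (q - 2) ≤ (n : ℝ) ^ ((q - 2) / 2) * (1 + S ω ^ 2 / n) := by
          intro ω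
          have h5 := rpow_le_one_add_sq (s := q - 2) (t := |S ω| / √n) (by linarith) (by linarith)
            (by positivity)
          rw [Real.div_rpow (abs_nonneg _) (Real.sqrt_nonneg _), div_pow, sq_abs,
            Real.sq_sqrt hn0.le, div_le_iff₀ (by positivity)] at h5
          refine h5.trans (le_of_eq ?_)
          rw [mul_comm, Real.sqrt_eq_rpow, ← Real.rpow_mul hn0.le]
          congr 2; ring
        calc ∫ ω, |S ω| ^ (q - 2) ∂μ
            ≤ ∫ ω, (n : ℝ) ^ ((q - 2) / 2) * (1 + S ω ^ 2 / n) ∂μ :=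
              integral_mono hSs (((integrable_const 1).add (hSsq.div_const _)).const_mul _) hpt
          _ = (n : ℝ) ^ ((q - 2) / 2) * (1 + (∫ ω, S ω ^ 2 ∂μ) / n) := by
              rw [integral_const_mul, integral_add (integrable_const 1) (hSsq.div_const _),
                integral_div]; simp
          _ ≤ (n : ℝ) ^ ((q - 2) / 2) * (2 + B) := by
              refine mul_le_mul_of_nonneg_left ?_ (by positivity)
              have : (∫ ω, S ω ^ 2 ∂μ) / n ≤ 1 + B := by
                rw [div_le_iff₀ hn0]
                refine ih2.trans ?_
                rw [mul_comm]
                refine mul_le_mul_of_nonneg_left ?_ (by linarith)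
                exact_mod_cast (by omega : s.card ≤ n)
              linarith
      have i3 : Integrable (fun ω => |S ω| ^ q + q * ((|S ω| ^ (q - 2) * S ω) * X i ω)) μ :=
        ih1.add (i1.const_mul q)
      have i4 : Integrable (fun ω => 2 * q * (|S ω| ^ (q - 2) * X i ω ^ 2) + q * |X i ω| ^ q) μ :=
        (i2.const_mul (2 * q)).add ((hint i).const_mul q)
      calc ∫ ω, |S ω + X i ω| ^ q ∂μ
          ≤ ∫ ω, ((|S ω| ^ q + q * ((|S ω| ^ (q - 2) * S ω) * X i ω)) +
              (2 * q * (|S ω| ^ (q - 2) * X i ω ^ 2) + q * |X i ω| ^ q)) ∂μ := by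
            refine integral_mono h1 (i3.add i4) fun ω => ?_
            refine (abs_add_rpow_le hq hq3).trans (le_of_eq ?_)
            ring
        _ = ∫ ω, |S ω| ^ q ∂μ + 2 * q * ∫ ω, |S ω| ^ (q - 2) * X i ω ^ 2 ∂μ
              + q * ∫ ω, |X i ω| ^ q ∂μ := by
            rw [integral_add i3 i4, integral_add ih1 (i1.const_mul q),
              integral_add (i2.const_mul (2 * q)) ((hint i).const_mul q), integral_const_mul,
              integral_const_mul, integral_const_mul, z1]
            ring
        _ ≤ _ := by
            have h5 := mul_le_mul_of_nonneg_left z2 (by linarith : 0 ≤ 2 * q)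
            have h6 := mul_le_mul_of_nonneg_left (hB i) hq0.le
            rw [Finset.card_insert_of_notMem hi]
            push_cast
            linarith

/-- The constant is chosen before the variables: it depends on `q` and `B` only. -/
theorem exists_integral_abs_sum_rpow_le {q B : ℝ} (hq : 2 < q) (hq3 : q ≤ 3) (hB0 : 0 ≤ B) :
    ∃ C : ℝ, 0 ≤ C ∧ ∀ {X : ℕ → Ω → ℝ}, (∀ j, Measurable (X j)) → iIndepFun X μ →
      (∀ j, ∫ ω, X j ω ∂μ = 0) → (∀ j, Integrable (fun ω => |X j ω| ^ q) μ) →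
      (∀ j, ∫ ω, |X j ω| ^ q ∂μ ≤ B) → ∀ n : ℕ, 1 ≤ n → ∀ s : Finset ℕ, s.card ≤ n →
      Integrable (fun ω => |∑ j ∈ s, X j ω| ^ q) μ ∧
      ∫ ω, |∑ j ∈ s, X j ω| ^ q ∂μ ≤ C * (n : ℝ) ^ (q / 2) := by
  refine ⟨q * (2 * (2 + B) * (1 + B) + B), by positivity, ?_⟩
  intro X hXm hX hmean hint hB n hn s hs
  obtain ⟨h1, -, h3⟩ := integral_abs_sum_rpow_le hq hq3 hXm hX hmean hint hB hn s hs
  refine ⟨h1, h3.trans ?_⟩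
  have hn1 : (1 : ℝ) ≤ n := by exact_mod_cast hn
  have hn0 : (0 : ℝ) < n := by linarith
  have e : (n : ℝ) ^ (q / 2) = n * (n : ℝ) ^ ((q - 2) / 2) := by
    rw [← Real.rpow_one_add' hn0.le (by linarith)]; congr 1; ring
  have hp : 1 ≤ (n : ℝ) ^ ((q - 2) / 2) := Real.one_le_rpow hn1 (by linarith)
  have hsn : (s.card : ℝ) ≤ n := by exact_mod_cast hs
  rw [e]
  calc _ ≤ (n : ℝ) * (q * (2 * ((n : ℝ) ^ ((q - 2) / 2) * (2 + B)) * (1 + B)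
        + B * (n : ℝ) ^ ((q - 2) / 2))) := by
        refine mul_le_mul hsn ?_ (by positivity) hn0.le
        gcongr
        exact le_mul_of_one_le_right hB0 hp
    _ = _ := by ring

end Independent

end NEFQVF

namespace NEFQVF

/-! ### Events that are negligible to the first order -/

/-- The events `A m` have weighted probability `o(1/m)`, where the weight is `1 + Y²`. -/
def Negligible {Ω : Type*} [MeasurableSpace Ω] (μ : Measure Ω) (Y : Ω → ℝ) (A : ℕ → Set Ω) : Prop :=
  Tendsto (fun m : ℕ => (m : ENNReal) * ∫⁻ ω in A m, ENNReal.ofReal (1 + Y ω ^ 2) ∂μ) atTop (𝓝 0)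

section Negligible

variable {Ω : Type*} [MeasurableSpace Ω] {μ : Measure Ω} {Y₀ : Ω → ℝ}

theorem Negligible.mono {A B : ℕ → Set Ω} (hB : Negligible μ Y₀ B)
    (h : ∀ᶠ m in atTop, A m ⊆ B m) : Negligible μ Y₀ A := by
  refine tendsto_of_tendsto_of_tendsto_of_le_of_le' tendsto_const_nhds hB
    (Eventually.of_forall fun m => zero_le) ?_
  filter_upwards [h] with m hm
  gcongr

theorem Negligible.union {A B : ℕ → Set Ω} (hA : Negligible μ Y₀ A) (hB : Negligible μ Y₀ B) :
    Negligible μ Y₀ (fun m => A m ∪ B m) := by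
  have h := hA.add hB
  rw [add_zero] at h
  refine tendsto_of_tendsto_of_tendsto_of_le_of_le tendsto_const_nhds h
    (fun m => zero_le) fun m => ?_
  simp only
  rw [← mul_add]
  gcongr
  exact lintegral_union_le _ _ _

theorem negligible_empty : Negligible μ Y₀ (fun _ => ∅) := by
  simp [Negligible]

theorem Negligible.iUnion {ι : Type*} (s : Finset ι) {A : ι → ℕ → Set Ω}
    (h : ∀ k ∈ s, Negligible μ Y₀ (A k)) : Negligible μ Y₀ (fun m => ⋃ k ∈ s, A k m) := by
  classical
  induction s using Finset.induction_on with
  | empty => simpa using negligible_empty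
  | insert k s hk ih =>
    simp only [Finset.set_biUnion_insert]
    exact (h k (Finset.mem_insert_self _ _)).union
      (ih fun l hl => h l (Finset.mem_insert_of_mem hl))

/-- Markov's inequality in abstract form: the weight on the event is dominated by a function with
integral `O(m^(-s))`, and `s > 1` beats the factor `m`. -/
theorem negligible_of_le {A : ℕ → Set Ω} {F : ℕ → Ω → ℝ} {C s : ℝ} (hs : 1 < s)
    (hFm : ∀ m, Measurable (F m)) (hF0 : ∀ m ω, 0 ≤ F m ω) (hF : ∀ m : ℕ, 1 ≤ m → Integrable (F m) μ ∧
      ∫ ω, F m ω ∂μ ≤ C * (m : ℝ) ^ (-s))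
    (hA : ∀ m : ℕ, 1 ≤ m → ∀ ω ∈ A m, 1 + Y₀ ω ^ 2 ≤ F m ω) : Negligible μ Y₀ A := by
  have hlim : Tendsto (fun m : ℕ => ENNReal.ofReal (C * (m : ℝ) ^ (-(s - 1)))) atTop (𝓝 0) := by
    have h := ((tendsto_rpow_neg_atTop (by linarith : 0 < s - 1)).comp
      (tendsto_natCast_atTop_atTop (R := ℝ))).const_mul C
    rw [mul_zero] at h
    simpa using ENNReal.tendsto_ofReal h
  refine tendsto_of_tendsto_of_tendsto_of_le_of_le' tendsto_const_nhds hlim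
    (Eventually.of_forall fun m => zero_le) ?_
  filter_upwards [eventually_ge_atTop 1] with m hm
  have hm0 : (0 : ℝ) < m := by exact_mod_cast hm
  obtain ⟨h1, h2⟩ := hF m hm
  have h3 : ∫⁻ ω in A m, ENNReal.ofReal (1 + Y₀ ω ^ 2) ∂μ ≤ ENNReal.ofReal (C * (m : ℝ) ^ (-s)) :=
    calc ∫⁻ ω in A m, ENNReal.ofReal (1 + Y₀ ω ^ 2) ∂μ
        ≤ ∫⁻ ω in A m, ENNReal.ofReal (F m ω) ∂μ :=
          setLIntegral_mono (hFm m).ennreal_ofReal fun ω hω =>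
            ENNReal.ofReal_le_ofReal (hA m hm ω hω)
      _ ≤ ∫⁻ ω, ENNReal.ofReal (F m ω) ∂μ := setLIntegral_le_lintegral _ _
      _ = ENNReal.ofReal (∫ ω, F m ω ∂μ) :=
          (ofReal_integral_eq_lintegral_ofReal h1 (Eventually.of_forall (hF0 m))).symm
      _ ≤ _ := ENNReal.ofReal_le_ofReal h2
  calc _ ≤ (m : ENNReal) * ENNReal.ofReal (C * (m : ℝ) ^ (-s)) := by gcongr
    _ = ENNReal.ofReal (C * (m : ℝ) ^ (-(s - 1))) := by
        rw [← ENNReal.ofReal_natCast, ← ENNReal.ofReal_mul hm0.le]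
        congr 1
        rw [mul_left_comm, ← Real.rpow_one_add' hm0.le (by linarith)]
        congr 2; ring

end Negligible

section Sums

variable {Ω : Type*} [MeasurableSpace Ω] {μ : Measure Ω} [IsProbabilityMeasure μ] {Y : ℕ → Ω → ℝ}

theorem indepFun_of_disjoint (hYm : ∀ j, Measurable (Y j)) (hY : iIndepFun Y μ) {i : ℕ}
    {s : Finset ℕ} (hi : i ∉ s) {φ : ℕ → ℝ → ℝ} (hφ : ∀ j, Measurable (φ j)) {f : ℝ → ℝ}
    (hf : Measurable f) {h : ℝ → ℝ} (hh : Measurable h) :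
    IndepFun (fun ω => h (∑ j ∈ s, φ j (Y j ω))) (fun ω => f (Y i ω)) μ := by
  have h1 := hY.indepFun_finset s {i} (by simpa using hi) hYm
  have := h1.comp (φ := fun z : s → ℝ => h (∑ j : s, φ j (z j)))
    (ψ := fun z : ({i} : Finset ℕ) → ℝ => f (z ⟨i, by simp⟩))
    (hh.comp (Finset.measurable_fun_sum _ fun j _ => (hφ j).comp (measurable_pi_apply j)))
    (hf.comp (measurable_pi_apply _))
  have e : (fun ω => h (∑ j ∈ s, φ j (Y j ω))) =
      (fun z : s → ℝ => h (∑ j : s, φ j (z j))) ∘ fun ω j => Y j ω := by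
    ext ω
    simp only [Function.comp]
    rw [← Finset.sum_coe_sort s]
  rw [e]
  exact this

/-- The moment condition under which the negligible events are found. -/
structure MomentBound (μ : Measure Ω) (Y : ℕ → Ω → ℝ) (q B : ℝ) : Prop where
  two_lt : 2 < q
  le_three : q ≤ 3
  integrable : ∀ j, Integrable (fun ω => (1 + Y j ω ^ 2) ^ q) μ
  le : ∀ j, ∫ ω, (1 + Y j ω ^ 2) ^ q ∂μ ≤ B

variable {q B : ℝ}

theorem MomentBound.integrable_sq (h : MomentBound μ Y q B) (hYm : ∀ j, Measurable (Y j)) (j : ℕ) :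
    Integrable (fun ω => (1 + Y j ω ^ 2) ^ 2) μ := by
  have hm := hYm j
  refine Integrable.mono' (h.integrable j) (Measurable.aestronglyMeasurable (by fun_prop))
    (Eventually.of_forall fun ω => ?_)
  have h1 : 1 ≤ 1 + Y j ω ^ 2 := by nlinarith [sq_nonneg (Y j ω)]
  rw [Real.norm_of_nonneg (sq_nonneg _), ← Real.rpow_natCast]
  exact Real.rpow_le_rpow_of_exponent_le h1 (by simpa using h.two_lt.le)

theorem MomentBound.integrable_of_le (h : MomentBound μ Y q B) (hYm : ∀ j, Measurable (Y j))
    (j : ℕ) {f : ℝ → ℝ} (hf : Measurable f) {L : ℝ} (hL : ∀ t, |f t| ≤ L * (1 + t ^ 2) ^ 2) :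
    Integrable (fun ω => f (Y j ω)) μ :=
  Integrable.mono' ((h.integrable_sq hYm j).const_mul L) (hf.comp (hYm j)).aestronglyMeasurable
    (Eventually.of_forall fun ω => hL (Y j ω))

/-- On the event the weight is at most `(1 + Y²)^q (τ m)^(-(q - 1))`, and `q - 1 > 1`. -/
theorem negligible_large (h : MomentBound μ Y q B) (hYm : ∀ j, Measurable (Y j))
    (i : ℕ) {τ : ℝ} (hτ : 0 < τ) :
    Negligible μ (Y i) (fun m => {ω | τ * m ≤ 1 + Y i ω ^ 2}) := by
  have hq := h.two_lt
  refine negligible_of_le (F := fun m ω => (1 + Y i ω ^ 2) ^ q * ((τ * m) ^ (-(q - 1))))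
    (C := B * τ ^ (-(q - 1))) (s := q - 1) (by linarith)
    (fun m => by have := hYm; fun_prop) (fun m ω => by positivity)
    (fun m hm => ⟨(h.integrable i).mul_const _, ?_⟩) fun m hm ω hω => ?_
  · rw [integral_mul_const, Real.mul_rpow hτ.le (Nat.cast_nonneg m), ← mul_assoc]
    have := h.le i
    gcongr
  · have hm0 : (0 : ℝ) < τ * m := mul_pos hτ (by exact_mod_cast hm)
    have h1 : 0 < 1 + Y i ω ^ 2 := by positivity
    have h2 : (τ * m) ^ (q - 1) ≤ (1 + Y i ω ^ 2) ^ (q - 1) :=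
      Real.rpow_le_rpow hm0.le hω (by linarith)
    rw [Real.rpow_neg hm0.le, ← div_eq_mul_inv, le_div_iff₀ (by positivity)]
    calc (1 + Y i ω ^ 2) * (τ * m) ^ (q - 1) ≤ (1 + Y i ω ^ 2) * (1 + Y i ω ^ 2) ^ (q - 1) := by
          gcongr
      _ = _ := by rw [← Real.rpow_one_add' h1.le (by linarith)]; congr 1; ring

theorem MomentBound.rosenthal (h : MomentBound μ Y q B) (hYm : ∀ j, Measurable (Y j))
    (hY : iIndepFun Y μ) {L : ℝ} (hL0 : 0 ≤ L) :
    ∃ C : ℝ, 0 ≤ C ∧ ∀ {φ : ℕ → ℝ → ℝ}, (∀ j, Measurable (φ j)) →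
      (∀ j t, |φ j t| ≤ L * (1 + t ^ 2)) → (∀ j, ∫ ω, φ j (Y j ω) ∂μ = 0) →
      ∀ n : ℕ, 1 ≤ n → ∀ s : Finset ℕ, s.card ≤ n →
      Integrable (fun ω => |∑ j ∈ s, φ j (Y j ω)| ^ q) μ ∧
      ∫ ω, |∑ j ∈ s, φ j (Y j ω)| ^ q ∂μ ≤ C * (n : ℝ) ^ (q / 2) := by
  have hB0 : 0 ≤ B := (integral_nonneg fun ω => by positivity).trans (h.le 0)
  have hq0 : 0 < q := by linarith [h.two_lt]
  obtain ⟨C, hC, H⟩ := exists_integral_abs_sum_rpow_le (μ := μ) h.two_lt h.le_three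
    (by positivity : 0 ≤ L ^ q * B)
  refine ⟨C, hC, fun {φ} hφm hφ hmean n hn s hs => ?_⟩
  have hpt : ∀ j ω, |φ j (Y j ω)| ^ q ≤ L ^ q * (1 + Y j ω ^ 2) ^ q := fun j ω => by
    rw [← Real.mul_rpow hL0 (by positivity)]
    exact Real.rpow_le_rpow (abs_nonneg _) (hφ j _) hq0.le
  have hint : ∀ j, Integrable (fun ω => |φ j (Y j ω)| ^ q) μ := fun j => by
    have h1 := (hφm j).comp (hYm j)
    refine Integrable.mono' ((h.integrable j).const_mul (L ^ q))
      (h1.abs.pow_const q).aestronglyMeasurable (Eventually.of_forall fun ω => ?_)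
    rw [Real.norm_of_nonneg (by positivity)]
    exact hpt j ω
  refine H (X := fun j ω => φ j (Y j ω)) (fun j => (hφm j).comp (hYm j))
    (hY.comp (fun j => φ j) hφm) hmean hint (fun j => ?_) n hn s hs
  calc _ ≤ ∫ ω, L ^ q * (1 + Y j ω ^ 2) ^ q ∂μ :=
        integral_mono (hint j) ((h.integrable j).const_mul _) (hpt j)
    _ ≤ _ := by rw [integral_const_mul]; exact mul_le_mul_of_nonneg_left (h.le j) (by positivity)

/-- Without area `i` the sum is independent of the weight `1 + Y i ²`, so the expectation factors
and Markov's inequality of order `q` gives `O(m^(-q/2))`. -/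
theorem negligible_sum_erase (h : MomentBound μ Y q B) (hYm : ∀ j, Measurable (Y j))
    (hY : iIndepFun Y μ) (i : ℕ) {L : ℝ} {φ : ℕ → ℝ → ℝ} (hφm : ∀ j, Measurable (φ j))
    (hφ : ∀ j t, |φ j t| ≤ L * (1 + t ^ 2)) (hmean : ∀ j, ∫ ω, φ j (Y j ω) ∂μ = 0)
    {τ : ℝ} (hτ : 0 < τ) :
    Negligible μ (Y i)
      (fun m => {ω | τ * m ≤ |∑ j ∈ (Finset.range m).erase i, φ j (Y j ω)|}) := by
  have hq := h.two_lt
  have hL0 : 0 ≤ L := by simpa using (abs_nonneg _).trans (hφ 0 0)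
  obtain ⟨C, hC, H⟩ := h.rosenthal hYm hY hL0
  set W : ℝ := ∫ ω, (1 + Y i ω ^ 2) ∂μ
  have hW0 : 0 ≤ W := integral_nonneg fun ω => by positivity
  have hWi : Integrable (fun ω => 1 + Y i ω ^ 2) μ :=
    h.integrable_of_le hYm i (f := fun t => 1 + t ^ 2) (L := 1) (by fun_prop) fun t => by
      rw [abs_of_nonneg (by positivity)]; nlinarith [sq_nonneg t]
  refine negligible_of_le (F := fun m ω => |∑ j ∈ (Finset.range m).erase i, φ j (Y j ω)| ^ q *
      (1 + Y i ω ^ 2) * ((τ * m) ^ (-q)))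
    (C := C * W * τ ^ (-q)) (s := q / 2) (by linarith)
    (fun m => by have := hYm; fun_prop) (fun m ω => by positivity)
    (fun m hm => ?_) fun m hm ω hω => ?_
  · have hm0 : (0 : ℝ) < m := by exact_mod_cast hm
    obtain ⟨h1, h2⟩ := H hφm hφ hmean m hm ((Finset.range m).erase i)
      (Finset.card_erase_le.trans (by simp))
    have hind := indepFun_of_disjoint hYm hY (Finset.notMem_erase i (Finset.range m)) hφm
      (f := fun t => 1 + t ^ 2) (h := fun t => |t| ^ q) (by fun_prop) (by fun_prop)
    refine ⟨(hind.integrable_mul h1 hWi).mul_const _, ?_⟩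
    rw [integral_mul_const, hind.integral_fun_mul_eq_mul_integral h1.1 hWi.1,
      Real.mul_rpow hτ.le hm0.le]
    calc _ ≤ C * (m : ℝ) ^ (q / 2) * W * (τ ^ (-q) * (m : ℝ) ^ (-q)) := by gcongr
      _ = C * W * τ ^ (-q) * ((m : ℝ) ^ (q / 2) * (m : ℝ) ^ (-q)) := by ring
      _ = _ := by rw [← Real.rpow_add hm0]; congr 2; ring
  · have hm0 : (0 : ℝ) < τ * m := mul_pos hτ (by exact_mod_cast hm)
    have h2 := Real.rpow_le_rpow hm0.le hω (by linarith : 0 ≤ q)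
    rw [Real.rpow_neg hm0.le, ← div_eq_mul_inv, le_div_iff₀ (by positivity), mul_comm]
    gcongr

/-- The remaining summand of area `i` exceeds a multiple of `m` only where `Y i` is large. -/
theorem negligible_sum (h : MomentBound μ Y q B) (hYm : ∀ j, Measurable (Y j))
    (hY : iIndepFun Y μ) (i : ℕ) {L : ℝ} {φ : ℕ → ℝ → ℝ} (hφm : ∀ j, Measurable (φ j))
    (hφ : ∀ j t, |φ j t| ≤ L * (1 + t ^ 2)) (hmean : ∀ j, ∫ ω, φ j (Y j ω) ∂μ = 0)
    {τ : ℝ} (hτ : 0 < τ) :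
    Negligible μ (Y i) (fun m => {ω | τ * m ≤ |∑ j ∈ Finset.range m, φ j (Y j ω)|}) := by
  have hL0 : 0 ≤ L := by simpa using (abs_nonneg _).trans (hφ 0 0)
  refine ((negligible_sum_erase h hYm hY i hφm hφ hmean (half_pos hτ)).union
    (negligible_large h hYm i (by positivity : 0 < τ / 2 / (L + 1)))).mono
    (Eventually.of_forall fun m ω hω => ?_)
  simp only [Set.mem_union, Set.mem_ofPred_eq] at hω ⊢
  by_contra! hcon
  obtain ⟨h1, h2⟩ := hcon
  have h3 : |φ i (Y i ω)| ≤ τ / 2 * m := by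
    refine (hφ i _).trans ?_
    rw [div_mul_eq_mul_div, lt_div_iff₀ (by positivity)] at h2
    nlinarith [sq_nonneg (Y i ω)]
  have h4 : |∑ j ∈ Finset.range m, φ j (Y j ω)| ≤
      |∑ j ∈ (Finset.range m).erase i, φ j (Y j ω)| + |φ i (Y i ω)| := by
    by_cases hi : i ∈ Finset.range m
    · rw [← Finset.sum_erase_add _ _ hi]
      exact abs_add_le _ _
    · rw [Finset.erase_eq_of_notMem hi]
      linarith [abs_nonneg (φ i (Y i ω))]
  linarith

end Sums

end NEFQVF

namespace NEFQVF

/-! ### Estimating equations that are quadratic in the data -/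

section Deterministic

variable {ι : Type*} [Fintype ι]

/-- The estimating function of the first `m` data, with coefficients `c`. -/
def scoreSum (c : ℕ → Fin 3 → (ι → ℝ) → ι → ℝ) (m : ℕ) (x : ι → ℝ) (t : ℕ → ℝ) : ι → ℝ :=
  ∑ j ∈ Finset.range m, ∑ r : Fin 3, t j ^ (r : ℕ) • c j r x

theorem abs_pow_le_one_add_sq (t : ℝ) (r : Fin 3) : |t ^ (r : ℕ)| ≤ 1 + t ^ 2 := by
  fin_cases r
  · simpa using sq_nonneg t
  · simp only [pow_one]
    nlinarith [sq_nonneg (|t| - 1), sq_abs t]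
  · simp only [abs_pow, sq_abs]
    linarith

theorem norm_sum_pow_smul_le {z : ℕ → Fin 3 → ι → ℝ} {κ : ℝ} (hz : ∀ j r, ‖z j r‖ ≤ κ)
    (m : ℕ) (t : ℕ → ℝ) :
    ‖∑ j ∈ Finset.range m, ∑ r : Fin 3, t j ^ (r : ℕ) • z j r‖ ≤
      3 * κ * ∑ j ∈ Finset.range m, (1 + t j ^ 2) := by
  rw [Finset.mul_sum]
  refine norm_sum_le_of_le _ fun j _ => (norm_sum_le_of_le _ (f := fun r : Fin 3 =>
    t j ^ (r : ℕ) • z j r) (n := fun _ => κ * (1 + t j ^ 2)) fun r _ => ?_).trans ?_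
  · rw [norm_smul, mul_comm]
    exact mul_le_mul (hz j r) (abs_pow_le_one_add_sq _ r) (norm_nonneg _)
      ((norm_nonneg _).trans (hz j r))
  · simp [mul_assoc]

theorem norm_mulVec_le_of_abs_le {T : Matrix ι ι ℝ} {κ : ℝ} (hT : ∀ a b, |T a b| ≤ κ)
    (v : ι → ℝ) : ‖T *ᵥ v‖ ≤ Fintype.card ι * κ * ‖v‖ := by
  rcases isEmpty_or_nonempty ι with h | h
  · simp [Subsingleton.elim (T *ᵥ v) 0]
  obtain ⟨a₀⟩ := h
  have hκ : 0 ≤ κ := (abs_nonneg _).trans (hT a₀ a₀)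
  refine (pi_norm_le_iff_of_nonneg (by positivity)).2 fun a => ?_
  rw [Matrix.mulVec, dotProduct]
  refine (norm_sum_le_of_le _ (n := fun _ => κ * ‖v‖) fun b _ => ?_).trans (by simp [mul_assoc])
  rw [norm_mul]
  exact mul_le_mul (hT a b) (norm_le_pi_norm v b) (norm_nonneg _) hκ

/-- Turns the bound on the quadratic form into an expansion bound for `U` in the sup norm. The `+ 1`
keeps the constant meaningful for an empty index type. -/
theorem dotProduct_mulVec_le (U : Matrix ι ι ℝ) {k : ℝ} (hk : 0 ≤ k)
    (h : ∀ u : ι → ℝ, k * (u ⬝ᵥ u) ≤ u ⬝ᵥ (U *ᵥ u)) (u : ι → ℝ) :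
    k / (Fintype.card ι + 1) * ‖u‖ ≤ ‖U *ᵥ u‖ := by
  rcases (norm_nonneg u).eq_or_lt with h0 | h0
  · rw [← h0]; simp
  have h1 : ‖u‖ ^ 2 ≤ u ⬝ᵥ u := by
    have hnn : 0 ≤ u ⬝ᵥ u := Finset.sum_nonneg fun a _ => mul_self_nonneg _
    have : ‖u‖ ≤ √(u ⬝ᵥ u) := (pi_norm_le_iff_of_nonneg (Real.sqrt_nonneg _)).2 fun a => by
      rw [Real.norm_eq_abs]
      refine Real.abs_le_sqrt ?_
      rw [sq]
      exact Finset.single_le_sum (f := fun a => u a * u a) (fun a _ => mul_self_nonneg _)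
        (Finset.mem_univ a)
    calc ‖u‖ ^ 2 ≤ √(u ⬝ᵥ u) ^ 2 := by gcongr
      _ = _ := Real.sq_sqrt hnn
  have h2 : u ⬝ᵥ (U *ᵥ u) ≤ Fintype.card ι * (‖u‖ * ‖U *ᵥ u‖) := by
    rw [dotProduct]
    calc _ ≤ ∑ _a : ι, ‖u‖ * ‖U *ᵥ u‖ := Finset.sum_le_sum fun a _ => by
          refine (le_abs_self _).trans ?_
          rw [abs_mul]
          exact mul_le_mul (norm_le_pi_norm u a) (norm_le_pi_norm (U *ᵥ u) a) (abs_nonneg _) h0.le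
      _ = _ := by simp
  have h3 : k * ‖u‖ ≤ Fintype.card ι * ‖U *ᵥ u‖ := by
    refine le_of_mul_le_mul_right ?_ h0
    calc k * ‖u‖ * ‖u‖ = k * ‖u‖ ^ 2 := by ring
      _ ≤ k * (u ⬝ᵥ u) := by gcongr
      _ ≤ _ := (h u).trans h2
      _ = _ := by ring
  rw [div_mul_eq_mul_div, div_le_iff₀ (by positivity)]
  nlinarith [norm_nonneg (U *ᵥ u)]

/-- The deviation from the linear map `-U` has two sources: the Taylor remainder of the
coefficients, weighted by `1 + t²`, and the fluctuation of the random derivative matrix around `-U`.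
-/
theorem norm_scoreSum_sub_le {c : ℕ → Fin 3 → (ι → ℝ) → ι → ℝ} {A : ℕ → Fin 3 → Matrix ι ι ℝ}
    {U : Matrix ι ι ℝ} {κ₀ κ₁ β : ℝ} {m : ℕ} {t : ℕ → ℝ} {x y : ι → ℝ} (hκ₀ : 0 ≤ κ₀)
    (hst : ∀ j r, ‖c j r x - c j r y - A j r *ᵥ (x - y)‖ ≤ κ₀ * ‖x - y‖)
    (ht : ∑ j ∈ Finset.range m, (1 + t j ^ 2) ≤ β * m)
    (hA : ∀ a b, |∑ j ∈ Finset.range m, ∑ r : Fin 3, t j ^ (r : ℕ) * A j r a b + U a b| ≤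
      κ₁ * m) :
    ‖scoreSum c m x t - scoreSum c m y t + U *ᵥ (x - y)‖ ≤
      (3 * κ₀ * β + Fintype.card ι * κ₁) * m * ‖x - y‖ := by
  have e : scoreSum c m x t - scoreSum c m y t + U *ᵥ (x - y) =
      ∑ j ∈ Finset.range m, ∑ r : Fin 3,
        t j ^ (r : ℕ) • (c j r x - c j r y - A j r *ᵥ (x - y)) +
      (∑ j ∈ Finset.range m, ∑ r : Fin 3, t j ^ (r : ℕ) • A j r + U) *ᵥ (x - y) := by
    simp only [scoreSum, smul_sub, Finset.sum_sub_distrib, Matrix.add_mulVec, Matrix.sum_mulVec,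
      Matrix.smul_mulVec]
    abel
  rw [e]
  refine (norm_add_le _ _).trans ?_
  have h1 := norm_sum_pow_smul_le hst m t
  have h2 := norm_mulVec_le_of_abs_le (T := ∑ j ∈ Finset.range m, ∑ r : Fin 3,
    t j ^ (r : ℕ) • A j r + U) (κ := κ₁ * m) (fun a b => by
      simpa [Matrix.add_apply, Matrix.sum_apply] using hA a b) (x - y)
  have h3 : 3 * (κ₀ * ‖x - y‖) * ∑ j ∈ Finset.range m, (1 + t j ^ 2) ≤
      3 * (κ₀ * ‖x - y‖) * (β * m) := mul_le_mul_of_nonneg_left ht (by positivity)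
  calc _ ≤ 3 * (κ₀ * ‖x - y‖) * (β * m) + Fintype.card ι * (κ₁ * m) * ‖x - y‖ := by linarith
    _ = _ := by ring

theorem isUnit_det_of_le [DecidableEq ι] {U : Matrix ι ι ℝ} {Λ : ℝ} (hΛ : 0 < Λ)
    (hU : ∀ u, Λ * ‖u‖ ≤ ‖U *ᵥ u‖) : IsUnit U.det := by
  rw [← Matrix.isUnit_iff_isUnit_det, ← Matrix.mulVec_injective_iff_isUnit]
  intro u v huv
  have := hU (u - v)
  rw [Matrix.mulVec_sub, huv, sub_self, norm_zero] at this
  have h0 : ‖u - v‖ ≤ 0 := by nlinarith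
  exact sub_eq_zero.1 (norm_le_zero_iff.1 h0)

theorem norm_inv_mulVec_le [DecidableEq ι] {U : Matrix ι ι ℝ} {Λ : ℝ} (hΛ : 0 < Λ)
    (hU : ∀ u, Λ * ‖u‖ ≤ ‖U *ᵥ u‖) (v : ι → ℝ) : ‖U⁻¹ *ᵥ v‖ ≤ ‖v‖ / Λ := by
  have := hU (U⁻¹ *ᵥ v)
  rw [Matrix.mulVec_mulVec, Matrix.mul_nonsing_inv _ (isUnit_det_of_le hΛ hU),
    Matrix.one_mulVec] at this
  rw [le_div_iff₀ hΛ, mul_comm]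
  exact this

/-- A quantitative inverse function theorem. The map differs from `-U` by a Lipschitz constant that
is half the expansion constant `Λ` of `U`, so the image of the `ρ`-ball contains the ball of radius
`Λ ρ / 2` about `f η`, and `0` lies in it. -/
theorem exists_zero_of_approx_linear {f : (ι → ℝ) → ι → ℝ} {U : Matrix ι ι ℝ} {η : ι → ℝ}
    {Λ ρ : ℝ} (hΛ : 0 < Λ) (hρ : 0 ≤ ρ) (hU : ∀ u, Λ * ‖u‖ ≤ ‖U *ᵥ u‖)
    (hf : ∀ x ∈ Metric.closedBall η ρ, ∀ y ∈ Metric.closedBall η ρ,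
      ‖f x - f y + U *ᵥ (x - y)‖ ≤ Λ / 2 * ‖x - y‖) (h0 : ‖f η‖ ≤ Λ / 2 * ρ) :
    ∃ x ∈ Metric.closedBall η ρ, f x = 0 := by
  classical
  set F : (ι → ℝ) →L[ℝ] (ι → ℝ) := LinearMap.toContinuousLinearMap (Matrix.mulVecLin (-U)) with hF
  have hFa : ∀ u, F u = -(U *ᵥ u) := fun u => by simp [hF]
  have happ : ApproximatesLinearOn f F (Metric.closedBall η ρ) (Λ / 2).toNNReal := by
    intro x hx y hy
    rw [hFa, sub_neg_eq_add, Real.coe_toNNReal _ (by positivity)]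
    exact hf x hx y hy
  let R : F.NonlinearRightInverse :=
    { toFun := fun v => -(U⁻¹ *ᵥ v)
      nnnorm := (Λ⁻¹).toNNReal
      bound' := fun v => by
        rw [norm_neg, Real.coe_toNNReal _ (by positivity)]
        refine (norm_inv_mulVec_le hΛ hU v).trans (le_of_eq ?_)
        rw [div_eq_inv_mul]
      right_inv' := fun v => by
        rw [hFa, Matrix.mulVec_neg, neg_neg, Matrix.mulVec_mulVec,
          Matrix.mul_nonsing_inv _ (isUnit_det_of_le hΛ hU), Matrix.one_mulVec] }
  have hR : (R.nnnorm : ℝ) = Λ⁻¹ := Real.coe_toNNReal _ (by positivity)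
  have hs := happ.surjOn_closedBall_of_nonlinearRightInverse R hρ subset_rfl
  rw [hR, inv_inv, Real.coe_toNNReal _ (by positivity)] at hs
  have hm : (0 : ι → ℝ) ∈ Metric.closedBall (f η) ((Λ - Λ / 2) * ρ) := by
    rw [Metric.mem_closedBall, dist_zero_left]
    linarith
  obtain ⟨x, hx, hx0⟩ := hs hm
  exact ⟨x, hx, hx0⟩

end Deterministic

end NEFQVF

/-! ### Linearization of the estimating equation outside negligible events. -/

namespace NEFQVF

section Expansion

variable {Ω : Type*} [MeasurableSpace Ω] {μ : Measure Ω} [IsProbabilityMeasure μ] {Y : ℕ → Ω → ℝ}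
  {ι : Type*} [Fintype ι] {q B : ℝ}

/-- The moments of order `0`, `1`, `2` of the data. -/
noncomputable def mom (μ : Measure Ω) (Y : ℕ → Ω → ℝ) (j : ℕ) (r : Fin 3) : ℝ :=
  ∫ ω, Y j ω ^ (r : ℕ) ∂μ

/-- Conditions on an unbiased estimating function with coefficients `c`, with derivatives `A` of
the coefficients at the true parameter `η`, and with informations `H`. -/
structure SmoothScore (μ : Measure Ω) (Y : ℕ → Ω → ℝ) (K : Set (ι → ℝ)) (η : ι → ℝ)
    (c : ℕ → Fin 3 → (ι → ℝ) → ι → ℝ) (A : ℕ → Fin 3 → Matrix ι ι ℝ) (H : ℕ → Matrix ι ι ℝ)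
    (L : ℝ) : Prop where
  nonneg : 0 ≤ L
  isCompact : IsCompact K
  mem_interior : η ∈ interior K
  norm_le : ∀ j r, ∀ x ∈ K, ‖c j r x‖ ≤ L
  lipschitz : ∀ j r, ∀ x ∈ K, ∀ y ∈ K, ‖c j r x - c j r y‖ ≤ L * ‖x - y‖
  abs_A_le : ∀ j r a b, |A j r a b| ≤ L
  strict : ∀ κ : ℝ, 0 < κ → ∃ ρ : ℝ, 0 < ρ ∧ ∀ j r, ∀ x ∈ Metric.closedBall η ρ,
    ∀ y ∈ Metric.closedBall η ρ, ‖c j r x - c j r y - A j r *ᵥ (x - y)‖ ≤ κ * ‖x - y‖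
  mean_eq_zero : ∀ j, ∑ r, mom μ Y j r • c j r η = 0
  deriv_eq : ∀ j a b, ∑ r, mom μ Y j r * A j r a b = -H j a b
  cov : ∀ j a b, ∫ ω, (∑ r : Fin 3, Y j ω ^ (r : ℕ) * c j r η a) *
    (∑ r : Fin 3, Y j ω ^ (r : ℕ) * c j r η b) ∂μ = H j a b
  info : ∃ k : ℝ, 0 < k ∧ ∀ᶠ m : ℕ in atTop, ∀ u : ι → ℝ,
    k * m * (u ⬝ᵥ u) ≤ u ⬝ᵥ ((∑ j ∈ Finset.range m, H j) *ᵥ u)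
  ident : ∀ ε : ℝ, 0 < ε → ∃ δ : ℝ, 0 < δ ∧ ∀ᶠ m : ℕ in atTop, ∀ x ∈ K, ε ≤ dist x η →
    δ * m ≤ ‖∑ j ∈ Finset.range m, ∑ r, mom μ Y j r • c j r x‖

variable {K : Set (ι → ℝ)} {η : ι → ℝ} {c : ℕ → Fin 3 → (ι → ℝ) → ι → ℝ}
  {A : ℕ → Fin 3 → Matrix ι ι ℝ} {H : ℕ → Matrix ι ι ℝ} {L : ℝ}

theorem MomentBound.integrable_one_add_sq (h : MomentBound μ Y q B)
    (hYm : ∀ j, Measurable (Y j)) (j : ℕ) : Integrable (fun ω => 1 + Y j ω ^ 2) μ :=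
  h.integrable_of_le hYm j (f := fun t => 1 + t ^ 2) (L := 1) (by fun_prop) fun t => by
    rw [abs_of_nonneg (by positivity)]; nlinarith [sq_nonneg t]

theorem MomentBound.integral_one_add_sq_le (h : MomentBound μ Y q B)
    (hYm : ∀ j, Measurable (Y j)) (j : ℕ) : ∫ ω, (1 + Y j ω ^ 2) ∂μ ≤ B := by
  refine le_trans (integral_mono (h.integrable_one_add_sq hYm j) (h.integrable j) fun ω => ?_)
    (h.le j)
  exact Real.self_le_rpow_of_one_le (by nlinarith [sq_nonneg (Y j ω)]) (by linarith [h.two_lt])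

theorem MomentBound.one_le (h : MomentBound μ Y q B) (hYm : ∀ j, Measurable (Y j)) : 1 ≤ B := by
  refine le_trans ?_ (h.integral_one_add_sq_le hYm 0)
  calc (1 : ℝ) = ∫ _ω, 1 ∂μ := by simp
    _ ≤ _ := integral_mono (integrable_const 1) (h.integrable_one_add_sq hYm 0) fun ω => by
        simpa using sq_nonneg (Y 0 ω)

theorem MomentBound.integrable_pow (h : MomentBound μ Y q B) (hYm : ∀ j, Measurable (Y j))
    (j : ℕ) (r : Fin 3) : Integrable (fun ω => Y j ω ^ (r : ℕ)) μ :=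
  Integrable.mono' (h.integrable_one_add_sq hYm j) ((hYm j).pow_const _).aestronglyMeasurable
    (Eventually.of_forall fun ω => abs_pow_le_one_add_sq _ r)

theorem MomentBound.abs_mom_le (h : MomentBound μ Y q B) (hYm : ∀ j, Measurable (Y j))
    (j : ℕ) (r : Fin 3) : |mom μ Y j r| ≤ B :=
  (abs_integral_le_integral_abs.trans (integral_mono (h.integrable_pow hYm j r).abs
    (h.integrable_one_add_sq hYm j) fun ω => abs_pow_le_one_add_sq _ r)).trans
    (h.integral_one_add_sq_le hYm j)

/-- The single large-deviation statement behind all exceptional events: each of them is a weighted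
sum of centred powers of the data with bounded weights. -/
theorem MomentBound.negligible_sum_mom (h : MomentBound μ Y q B) (hYm : ∀ j, Measurable (Y j))
    (hY : iIndepFun Y μ) (i : ℕ) {w : ℕ → Fin 3 → ℝ} (hL : 0 ≤ L) (hw : ∀ j r, |w j r| ≤ L) {τ : ℝ}
    (hτ : 0 < τ) :
    Negligible μ (Y i) (fun m => {ω | τ * m ≤ |∑ j ∈ Finset.range m, ∑ r : Fin 3,
      (Y j ω ^ (r : ℕ) - mom μ Y j r) * w j r|}) := by
  refine negligible_sum h hYm hY i (φ := fun j t => ∑ r : Fin 3, (t ^ (r : ℕ) - mom μ Y j r) * w j r)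
    (L := 3 * ((1 + B) * L)) (fun j => by fun_prop) (fun j t => ?_) (fun j => ?_) hτ
  · have hB := h.one_le hYm
    refine (Finset.abs_sum_le_sum_abs _ _).trans ?_
    refine (Finset.sum_le_sum (g := fun _ => (1 + B) * L * (1 + t ^ 2)) fun r _ => ?_).trans
      (le_of_eq (by simp; ring))
    rw [abs_mul]
    have h1 : |t ^ (r : ℕ) - mom μ Y j r| ≤ (1 + B) * (1 + t ^ 2) := by
      refine (abs_sub _ _).trans ?_
      have := h.abs_mom_le hYm j r
      have := abs_pow_le_one_add_sq t r
      nlinarith [sq_nonneg t]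
    calc _ ≤ (1 + B) * (1 + t ^ 2) * L := mul_le_mul h1 (hw j r) (abs_nonneg _) (by positivity)
      _ = _ := by ring
  · have hi : ∀ r : Fin 3, Integrable (fun ω => (Y j ω ^ (r : ℕ) - mom μ Y j r) * w j r) μ :=
      fun r => ((h.integrable_pow hYm j r).sub (integrable_const _)).mul_const _
    rw [integral_finsetSum _ fun r _ => hi r]
    refine Finset.sum_eq_zero fun r _ => ?_
    rw [integral_mul_const, integral_sub (h.integrable_pow hYm j r) (integrable_const _)]
    simp [mom]

/-- Outside a negligible event, the solution of the estimating equation is close to the true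
parameter, and satisfies the linearized equation. -/
theorem SmoothScore.exists_expansion (hS : SmoothScore μ Y K η c A H L)
    (h : MomentBound μ Y q B) (hYm : ∀ j, Measurable (Y j)) (hY : iIndepFun Y μ) (i : ℕ) :
    ∃ Λ : ℝ, 0 < Λ ∧
      (∀ᶠ m : ℕ in atTop, ∀ u, Λ * m * ‖u‖ ≤ ‖(∑ j ∈ Finset.range m, H j) *ᵥ u‖) ∧
      ∀ κ : ℝ, 0 < κ → ∃ N : ℕ → Set Ω, Negligible μ (Y i) N ∧ ∀ᶠ m in atTop, ∀ ω, ω ∉ N m →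
        ∀ e ∈ K, ((∃ x ∈ K, scoreSum c m x (fun j => Y j ω) = 0) →
          scoreSum c m e (fun j => Y j ω) = 0) →
        ‖(∑ j ∈ Finset.range m, H j) *ᵥ (e - η) - scoreSum c m η (fun j => Y j ω)‖ ≤
          κ * m * ‖e - η‖ ∧ ‖e - η‖ ≤ κ := by
  classical
  obtain ⟨k, hk, hinfo⟩ := hS.info
  set d : ℝ := (Fintype.card ι : ℝ) with hd
  have hd0 : 0 ≤ d := Nat.cast_nonneg _
  have hΛ : 0 < k / (d + 1) := by positivity
  have hUev : ∀ᶠ m : ℕ in atTop, ∀ u,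
      k / (d + 1) * m * ‖u‖ ≤ ‖(∑ j ∈ Finset.range m, H j) *ᵥ u‖ := by
    filter_upwards [hinfo] with m hm u
    refine le_trans (le_of_eq ?_) (dotProduct_mulVec_le _ (by positivity) hm u)
    ring
  refine ⟨k / (d + 1), hΛ, hUev, fun κ hκ => ?_⟩
  set Λ := k / (d + 1)
  have hη : η ∈ K := interior_subset hS.mem_interior
  have hB := h.one_le hYm
  have hL := hS.nonneg
  obtain ⟨κ', hκ'0, hκ'1, hκ'2⟩ : ∃ κ' : ℝ, 0 < κ' ∧ κ' ≤ κ ∧ κ' ≤ Λ / 2 :=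
    ⟨min κ (Λ / 2), lt_min hκ (half_pos hΛ), min_le_left _ _, min_le_right _ _⟩
  set β := B + 1 with hβ
  have hβ0 : 0 < β := by linarith
  -- The Taylor remainder and the fluctuation of the derivative are each allotted `κ' / 2`.
  have hκ₀ : 0 < κ' / (6 * β) := by positivity
  have hκ₁ : 0 < κ' / (2 * (d + 1)) := by positivity
  obtain ⟨ρ₀, hρ₀, hst⟩ := hS.strict _ hκ₀
  obtain ⟨ρ₁, hρ₁, hball⟩ := Metric.nhds_basis_closedBall.mem_iff.1
    (mem_interior_iff_mem_nhds.1 hS.mem_interior)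
  obtain ⟨ρ, hρ, hρa, hρb, hρc⟩ : ∃ ρ : ℝ, 0 < ρ ∧ ρ ≤ ρ₀ ∧ ρ ≤ ρ₁ ∧ ρ ≤ κ :=
    ⟨min (min ρ₀ ρ₁) κ, by positivity, (min_le_left _ _).trans (min_le_left _ _),
      (min_le_left _ _).trans (min_le_right _ _), min_le_right _ _⟩
  obtain ⟨δ, hδ, hid⟩ := hS.ident ρ hρ
  -- The mesh of a finite net in `K` over which the law of large numbers is made uniform; between
  -- net points the Lipschitz bound costs at most `δ / 4` per datum.
  have hρ₂ : 0 < δ / (12 * (L + 1) * β) := by positivity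
  obtain ⟨t, htK, htf, htc⟩ := hS.isCompact.finite_cover_balls hρ₂
  -- The exceptional events: `N₁` for the sum of squares, `N₂` for the score at the net points, `N₃`
  -- for the entries of the derivative matrix, `N₄` for the score at the truth.
  set N₁ : ℕ → Set Ω := fun m => {ω | (1 : ℝ) * m ≤ |∑ j ∈ Finset.range m, ∑ r : Fin 3,
      (Y j ω ^ (r : ℕ) - mom μ Y j r) * (if r = 2 then 1 else 0)|} with hN₁
  set N₂ : (ι → ℝ) × ι → ℕ → Set Ω := fun z m => {ω | δ / 4 * m ≤ |∑ j ∈ Finset.range m,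
      ∑ r : Fin 3, (Y j ω ^ (r : ℕ) - mom μ Y j r) * c j r z.1 z.2|} with hN₂
  set N₃ : ι × ι → ℕ → Set Ω := fun z m => {ω | κ' / (2 * (d + 1)) * m ≤ |∑ j ∈ Finset.range m,
      ∑ r : Fin 3, (Y j ω ^ (r : ℕ) - mom μ Y j r) * A j r z.1 z.2|} with hN₃
  set N₄ : ι → ℕ → Set Ω := fun a m => {ω | Λ / 2 * ρ * m ≤ |∑ j ∈ Finset.range m,
      ∑ r : Fin 3, (Y j ω ^ (r : ℕ) - mom μ Y j r) * c j r η a|} with hN₄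
  have hcoef : ∀ x ∈ K, ∀ j r a, |c j r x a| ≤ L := fun x hx j r a =>
    (norm_le_pi_norm (c j r x) a).trans (hS.norm_le j r x hx)
  refine ⟨fun m => ((N₁ m ∪ ⋃ z ∈ htf.toFinset ×ˢ Finset.univ, N₂ z m) ∪
    ⋃ z ∈ Finset.univ, N₃ z m) ∪ ⋃ a ∈ Finset.univ, N₄ a m, ?_, ?_⟩
  · refine (((h.negligible_sum_mom hYm hY i zero_le_one (fun j r => ?_) one_pos).union
      (Negligible.iUnion _ fun z hz => ?_)).union (Negligible.iUnion _ fun z _ => ?_)).union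
      (Negligible.iUnion _ fun a _ => ?_)
    · split_ifs <;> simp
    · have hz1 : z.1 ∈ K := htK (by simpa using hz)
      exact h.negligible_sum_mom hYm hY i hL (fun j r => hcoef _ hz1 j r _) (by positivity)
    · exact h.negligible_sum_mom hYm hY i hL (fun j r => hS.abs_A_le j r _ _) hκ₁
    · exact h.negligible_sum_mom hYm hY i hL (fun j r => hcoef _ hη j r _) (by positivity)
  filter_upwards [hUev, hid, eventually_ge_atTop 1] with m hU hid hm1 ω hω e he hsol
  have hm : (0 : ℝ) < m := by exact_mod_cast hm1
  simp only [Set.mem_union, not_or, Set.mem_iUnion, not_exists, Finset.mem_univ, forall_const]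
    at hω
  obtain ⟨⟨⟨h1, h2⟩, h3⟩, h4⟩ := hω
  simp only [hN₁, hN₂, hN₃, hN₄, Set.mem_ofPred_eq, not_le] at h1 h2 h3 h4
  -- the sum of the squares
  have hsum : ∑ j ∈ Finset.range m, (1 + Y j ω ^ 2) ≤ β * m := by
    have e1 : ∑ j ∈ Finset.range m, ∑ r : Fin 3,
        (Y j ω ^ (r : ℕ) - mom μ Y j r) * (if r = 2 then 1 else 0) =
        ∑ j ∈ Finset.range m, (1 + Y j ω ^ 2) - ∑ j ∈ Finset.range m, (1 + mom μ Y j 2) := by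
      rw [← Finset.sum_sub_distrib]
      refine Finset.sum_congr rfl fun j _ => ?_
      simp
    have e2 : ∑ j ∈ Finset.range m, (1 + mom μ Y j 2) ≤ B * m := by
      refine (Finset.sum_le_sum (g := fun _ => B) fun j _ => ?_).trans (by simp [mul_comm])
      have := h.integral_one_add_sq_le hYm j
      have hsq : Integrable (fun ω => Y j ω ^ 2) μ := h.integrable_pow hYm j 2
      rw [integral_add (integrable_const _) hsq] at this
      simpa [mom] using this
    rw [e1] at h1
    have := (abs_lt.1 h1).2
    rw [hβ]; linarith
  -- approximate linearity
  have hlin : ∀ x ∈ Metric.closedBall η ρ, ∀ y ∈ Metric.closedBall η ρ,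
      ‖scoreSum c m x (fun j => Y j ω) - scoreSum c m y (fun j => Y j ω) +
        (∑ j ∈ Finset.range m, H j) *ᵥ (x - y)‖ ≤ κ' * m * ‖x - y‖ := by
    intro x hx y hy
    have hsub := Metric.closedBall_subset_closedBall (x := η) hρa
    refine (norm_scoreSum_sub_le (κ₁ := κ' / (2 * (d + 1))) hκ₀.le
      (fun j r => hst j r x (hsub hx) y (hsub hy)) hsum fun a b => ?_).trans ?_
    · refine le_of_eq_of_le ?_ (h3 (a, b)).le
      congr 1
      rw [Matrix.sum_apply, ← Finset.sum_add_distrib]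
      refine Finset.sum_congr rfl fun j _ => ?_
      simp only [sub_mul, Finset.sum_sub_distrib, hS.deriv_eq]
      ring
    · have e1 : 3 * (κ' / (6 * β)) * β = κ' / 2 := by field_simp; norm_num
      have e2 : d * (κ' / (2 * (d + 1))) ≤ κ' / 2 := by
        rw [← mul_div_assoc, div_le_div_iff₀ (by positivity) (by positivity)]
        nlinarith
      gcongr
      rw [e1]; linarith
  -- the estimating function at the true parameter
  have hs0 : ‖scoreSum c m η (fun j => Y j ω)‖ ≤ Λ / 2 * ρ * m := by
    refine (pi_norm_le_iff_of_nonneg (by positivity)).2 fun a => ?_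
    refine le_of_eq_of_le ?_ (h4 a).le
    rw [Real.norm_eq_abs]
    congr 1
    simp only [scoreSum, Finset.sum_apply, Pi.smul_apply, smul_eq_mul, sub_mul,
      Finset.sum_sub_distrib]
    have : ∀ j, ∑ r : Fin 3, mom μ Y j r * c j r η a = 0 := fun j => by
      simpa using congrFun (hS.mean_eq_zero j) a
    simp [this]
  -- no solution far away
  have hfar : ∀ x ∈ K, ρ ≤ dist x η → scoreSum c m x (fun j => Y j ω) ≠ 0 := by
    intro x hx hxd hx0
    obtain ⟨z, hz, hxz⟩ : ∃ z ∈ t, x ∈ Metric.ball z (δ / (12 * (L + 1) * β)) := by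
      simpa using htc hx
    have hzK := htK hz
    have hxz' : ‖x - z‖ ≤ δ / (12 * (L + 1) * β) := by
      rw [← dist_eq_norm]; exact (Metric.mem_ball.1 hxz).le
    have hcd : ∀ j r, ‖c j r x - c j r z‖ ≤ L * (δ / (12 * (L + 1) * β)) := fun j r =>
      (hS.lipschitz j r x hx z hzK).trans (mul_le_mul_of_nonneg_left hxz' hL)
    have hLδ : 3 * (L * (δ / (12 * (L + 1) * β))) * β ≤ δ / 4 := by
      rw [← mul_div_assoc, ← mul_div_assoc, div_mul_eq_mul_div,
        div_le_div_iff₀ (by positivity) (by positivity)]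
      nlinarith [mul_pos hδ hβ0]
    have b1 : ‖scoreSum c m x (fun j => Y j ω) - scoreSum c m z (fun j => Y j ω)‖ ≤ δ / 4 * m := by
      have e1 : scoreSum c m x (fun j => Y j ω) - scoreSum c m z (fun j => Y j ω) =
          ∑ j ∈ Finset.range m, ∑ r : Fin 3, Y j ω ^ (r : ℕ) • (c j r x - c j r z) := by
        simp only [scoreSum, smul_sub, Finset.sum_sub_distrib]
      rw [e1]
      refine (norm_sum_pow_smul_le hcd m fun j => Y j ω).trans ?_
      calc _ ≤ 3 * (L * (δ / (12 * (L + 1) * β))) * (β * m) := by gcongr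
        _ = 3 * (L * (δ / (12 * (L + 1) * β))) * β * m := by ring
        _ ≤ _ := by gcongr
    have b2 : ‖∑ j ∈ Finset.range m, ∑ r, mom μ Y j r • c j r x -
        ∑ j ∈ Finset.range m, ∑ r, mom μ Y j r • c j r z‖ ≤ δ / 4 * m := by
      rw [← Finset.sum_sub_distrib]
      refine (norm_sum_le_of_le _ (n := fun _ => δ / 4) fun j _ => ?_).trans
        (by simp [mul_comm])
      rw [← Finset.sum_sub_distrib]
      refine (norm_sum_le_of_le _ (n := fun _ => B * (L * (δ / (12 * (L + 1) * β))))
        fun r _ => ?_).trans ?_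
      · rw [← smul_sub, norm_smul]
        exact mul_le_mul (h.abs_mom_le hYm j r) (hcd j r) (norm_nonneg _) (by linarith)
      · simp only [Finset.sum_const, Finset.card_univ, Fintype.card_fin, nsmul_eq_mul]
        refine le_trans ?_ hLδ
        have h0 : 0 ≤ L * (δ / (12 * (L + 1) * β)) := by positivity
        rw [hβ] at h0 ⊢
        push_cast
        nlinarith
    have b3 : ‖scoreSum c m z (fun j => Y j ω) -
        ∑ j ∈ Finset.range m, ∑ r, mom μ Y j r • c j r z‖ ≤ δ / 4 * m := by
      refine (pi_norm_le_iff_of_nonneg (by positivity)).2 fun a => ?_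
      have := (h2 (z, a) (by simp [hz])).le
      refine le_of_eq_of_le ?_ this
      rw [Real.norm_eq_abs]
      congr 1
      simp only [scoreSum, Finset.sum_apply, Pi.smul_apply, smul_eq_mul, sub_mul,
        Finset.sum_sub_distrib, Pi.sub_apply]
    have b4 := hid x hx hxd
    rw [hx0, zero_sub, norm_neg] at b1
    set a1 := scoreSum c m z (fun j => Y j ω)
    set a2 := ∑ j ∈ Finset.range m, ∑ r, mom μ Y j r • c j r z
    set a3 := ∑ j ∈ Finset.range m, ∑ r, mom μ Y j r • c j r x
    -- Two discretization errors and one fluctuation, `δ / 4` each, cannot add up to the separation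
    -- `δ`.
    have b5 : ‖a3‖ ≤ ‖a3 - a2‖ + ‖a1 - a2‖ + ‖a1‖ := by
      calc ‖a3‖ = ‖(a3 - a2) - (a1 - a2) + a1‖ := by congr 1; abel
        _ ≤ ‖(a3 - a2) - (a1 - a2)‖ + ‖a1‖ := norm_add_le _ _
        _ ≤ _ := by gcongr; exact norm_sub_le _ _
    nlinarith [mul_pos hδ hm]
  have hsub : Metric.closedBall η ρ ⊆ K := (Metric.closedBall_subset_closedBall hρb).trans hball
  -- A solution exists in the ball, hence in `K`, so the estimator is bound to solve the equation;
  -- by `hfar` it then lies in the ball, where the linearization holds.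
  obtain ⟨x, hx, hx0⟩ := exists_zero_of_approx_linear
    (f := fun x => scoreSum c m x (fun j => Y j ω)) (Λ := Λ * m) (by positivity) hρ.le hU
    (fun x hx y hy => (hlin x hx y hy).trans (by
      have : κ' * m ≤ Λ * m / 2 := by nlinarith
      gcongr)) (hs0.trans (le_of_eq (by ring)))
  have he0 := hsol ⟨x, hsub hx, hx0⟩
  have hed : dist e η < ρ := by
    by_contra! hcon
    exact hfar e he hcon he0
  have h5 := hlin e (Metric.mem_closedBall.2 hed.le) η (Metric.mem_closedBall_self hρ.le)
  rw [he0, zero_sub, neg_add_eq_sub] at h5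
  refine ⟨h5.trans (by gcongr), ?_⟩
  rw [← dist_eq_norm]
  exact hed.le.trans hρc

end Expansion

end NEFQVF

namespace NEFQVF

/-! ### Plug-in of the solution of the estimating equation -/

section PlugIn

variable {ι : Type*} [Fintype ι]

theorem abs_dotProduct_le {a v : ι → ℝ} {k : ℝ} (ha : ∀ b, |a b| ≤ k) :
    |a ⬝ᵥ v| ≤ Fintype.card ι * k * ‖v‖ := by
  rw [dotProduct]
  refine (Finset.abs_sum_le_sum_abs _ _).trans
    ((Finset.sum_le_sum (g := fun _ => k * ‖v‖) fun b _ => ?_).trans (by simp [mul_assoc]))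
  rw [abs_mul]
  exact mul_le_mul (ha b) (norm_le_pi_norm v b) (abs_nonneg _) ((abs_nonneg _).trans (ha b))

theorem one_add_abs_sq_le (y : ℝ) : (1 + |y|) ^ 2 ≤ 2 * (1 + y ^ 2) := by
  nlinarith [sq_nonneg (|y| - 1), sq_abs y]

theorem norm_rpow_le_sum {q : ℝ} (hq : 0 < q) (v : ι → ℝ) : ‖v‖ ^ q ≤ ∑ a, |v a| ^ q := by
  rcases isEmpty_or_nonempty ι with h | h
  · simp [Subsingleton.elim v 0, Real.zero_rpow hq.ne']
  · obtain ⟨a, ha⟩ : ∃ a, ‖v‖ = ‖v a‖ := by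
      obtain ⟨a, -, ha⟩ := Finset.exists_mem_eq_sup' (s := Finset.univ)
        (Finset.univ_nonempty) (fun b => ‖v b‖)
      refine ⟨a, le_antisymm ?_ (norm_le_pi_norm v a)⟩
      exact (pi_norm_le_iff_of_nonneg (norm_nonneg _)).2 fun b => by
        rw [← ha]; exact Finset.le_sup' (fun b => ‖v b‖) (Finset.mem_univ b)
    rw [ha]
    exact Finset.single_le_sum (f := fun a => |v a| ^ q) (fun b _ => by positivity)
      (Finset.mem_univ a)

/-- The error of the linearization of the plug-in on the favourable event. -/
theorem abs_plugIn_sub_le [DecidableEq ι] {U : Matrix ι ι ℝ} {d s r a : ι → ℝ}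
    {Λ κ k y D m : ℝ} (hm : 0 < m) (hΛ : 0 < Λ) (hκ : 0 < κ) (hκ1 : κ ≤ 1) (hκ2 : κ ≤ Λ / 2)
    (hk : 0 ≤ k) (hU : ∀ u, Λ * m * ‖u‖ ≤ ‖U *ᵥ u‖)
    (h1 : ‖U *ᵥ d - (s + r)‖ ≤ κ * m * ‖d‖) (hD : |D - a ⬝ᵥ d| ≤ κ * (1 + |y|) * ‖d‖)
    (ha : ∀ b, |a b| ≤ k * (1 + |y|)) :
    |D - a ⬝ᵥ (U⁻¹ *ᵥ s)| ≤
      (2 / Λ * (1 + Fintype.card ι * k / Λ) + Fintype.card ι * k / Λ) * (1 + |y|) *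
        (κ * ‖s‖ + ‖r‖) / m := by
  have hΛm : 0 < Λ * m := by positivity
  set n : ℝ := (Fintype.card ι : ℝ) with hn
  have hn0 : 0 ≤ n := Nat.cast_nonneg _
  have hy : 0 < 1 + |y| := by positivity
  -- A preliminary size bound: `κ ≤ Λ / 2` lets the linearization error be absorbed by half of the
  -- expansion of `U`.
  have hd : ‖d‖ ≤ 2 / Λ * (‖s‖ + ‖r‖) / m := by
    have e1 : ‖U *ᵥ d‖ ≤ ‖s‖ + ‖r‖ + κ * m * ‖d‖ := by
      calc ‖U *ᵥ d‖ = ‖(U *ᵥ d - (s + r)) + (s + r)‖ := by congr 1; abel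
        _ ≤ ‖U *ᵥ d - (s + r)‖ + ‖s + r‖ := norm_add_le _ _
        _ ≤ κ * m * ‖d‖ + (‖s‖ + ‖r‖) := add_le_add h1 (norm_add_le _ _)
        _ = _ := by ring
    have e2 := hU d
    have e3 : κ * m * ‖d‖ ≤ Λ / 2 * m * ‖d‖ := by gcongr
    rw [le_div_iff₀ hm, div_mul_eq_mul_div, le_div_iff₀ hΛ]
    nlinarith
  have hv : ‖d - U⁻¹ *ᵥ s‖ ≤ (κ * m * ‖d‖ + ‖r‖) / (Λ * m) := by
    have e1 : d - U⁻¹ *ᵥ s = U⁻¹ *ᵥ (U *ᵥ d - (s + r) + r) := by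
      have : U *ᵥ d - (s + r) + r = U *ᵥ d - s := by abel
      rw [this, Matrix.mulVec_sub, Matrix.mulVec_mulVec,
        Matrix.nonsing_inv_mul _ (isUnit_det_of_le hΛm hU), Matrix.one_mulVec]
    rw [e1]
    refine (norm_inv_mulVec_le hΛm hU _).trans ?_
    gcongr
    exact (norm_add_le _ _).trans (by linarith)
  have hav := abs_dotProduct_le (v := d - U⁻¹ *ᵥ s) ha
  have e2 : D - a ⬝ᵥ (U⁻¹ *ᵥ s) = (D - a ⬝ᵥ d) + a ⬝ᵥ (d - U⁻¹ *ᵥ s) := by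
    rw [dotProduct_sub]; ring
  have hs0 := norm_nonneg s
  have hr0 := norm_nonneg r
  rw [e2]
  calc _ ≤ κ * (1 + |y|) * ‖d‖ +
        n * (k * (1 + |y|)) * ((κ * m * ‖d‖ + ‖r‖) / (Λ * m)) :=
        (abs_add_le _ _).trans (add_le_add hD (hav.trans (by gcongr)))
    _ = (1 + |y|) * (κ * ‖d‖ * (1 + n * k / Λ) + n * k / Λ * ‖r‖ / m) := by
        field_simp
        ring
    _ ≤ (1 + |y|) * (κ * (2 / Λ * (‖s‖ + ‖r‖) / m) * (1 + n * k / Λ) + n * k / Λ * ‖r‖ / m) := by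
        gcongr
    _ = (1 + |y|) * (2 / Λ * (1 + n * k / Λ) * (κ * ‖s‖ + κ * ‖r‖) + n * k / Λ * ‖r‖) / m := by
        field_simp
    _ ≤ (1 + |y|) * (2 / Λ * (1 + n * k / Λ) * (κ * ‖s‖ + 1 * ‖r‖) +
          n * k / Λ * (κ * ‖s‖ + ‖r‖)) / m := by
        gcongr
        linarith [mul_nonneg hκ.le hs0]
    _ = _ := by ring

end PlugIn

/-! ### The score with one area left out. -/

section Limit

variable {Ω : Type*} [MeasurableSpace Ω] {μ : Measure Ω} [IsProbabilityMeasure μ] {Y : ℕ → Ω → ℝ}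
  {ι : Type*} [Fintype ι] {q B : ℝ}

/-- The estimating function at the true parameter, without the area `i`. -/
def scoreErase (c : ℕ → Fin 3 → (ι → ℝ) → ι → ℝ) (η : ι → ℝ) (i m : ℕ) (t : ℕ → ℝ) : ι → ℝ :=
  ∑ j ∈ (Finset.range m).erase i, ∑ r : Fin 3, t j ^ (r : ℕ) • c j r η

variable {K : Set (ι → ℝ)} {η : ι → ℝ} {c : ℕ → Fin 3 → (ι → ℝ) → ι → ℝ}
  {A : ℕ → Fin 3 → Matrix ι ι ℝ} {H : ℕ → Matrix ι ι ℝ} {L : ℝ}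

theorem measurable_scoreErase (hYm : ∀ j, Measurable (Y j)) (i m : ℕ) :
    Measurable fun ω => scoreErase c η i m (fun j => Y j ω) := by
  unfold scoreErase
  exact Finset.measurable_fun_sum _ fun j _ => Finset.measurable_fun_sum _ fun r _ =>
    ((hYm j).pow_const _).smul_const _

theorem indepFun_scoreErase (hYm : ∀ j, Measurable (Y j)) (hY : iIndepFun Y μ) (i m : ℕ) :
    IndepFun (fun ω => scoreErase c η i m (fun j => Y j ω)) (Y i) μ := by
  have h1 := hY.indepFun_finset ((Finset.range m).erase i) {i} (by simp) hYm
  have hm1 : Measurable fun z : ({i} : Finset ℕ) → ℝ => z ⟨i, Finset.mem_singleton_self i⟩ :=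
    measurable_pi_apply _
  have := h1.comp (φ := fun z : ((Finset.range m).erase i : Finset ℕ) → ℝ =>
      ∑ j : ((Finset.range m).erase i : Finset ℕ), ∑ r : Fin 3, z j ^ (r : ℕ) • c j r η)
    (ψ := fun z : ({i} : Finset ℕ) → ℝ => z ⟨i, Finset.mem_singleton_self i⟩)
    (Finset.measurable_fun_sum _ fun j _ => Finset.measurable_fun_sum _ fun r _ =>
      ((measurable_pi_apply j).pow_const _).smul_const _)
    hm1
  have e : (fun ω => scoreErase c η i m (fun j => Y j ω)) =
      (fun z : ((Finset.range m).erase i : Finset ℕ) → ℝ =>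
      ∑ j : ((Finset.range m).erase i : Finset ℕ), ∑ r : Fin 3, z j ^ (r : ℕ) • c j r η) ∘
        fun ω j => Y j ω := by
    ext1 ω
    simp only [Function.comp, scoreErase]
    rw [← Finset.sum_coe_sort ((Finset.range m).erase i)]
  rw [e]
  exact this

theorem scoreErase_apply (i m : ℕ) (t : ℕ → ℝ) (a : ι) :
    scoreErase c η i m t a =
      ∑ j ∈ (Finset.range m).erase i, ∑ r : Fin 3, t j ^ (r : ℕ) * c j r η a := by
  simp [scoreErase, Finset.sum_apply]

theorem SmoothScore.abs_summand_le (hS : SmoothScore μ Y K η c A H L) (j : ℕ) (t : ℝ) (a : ι) :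
    |∑ r : Fin 3, t ^ (r : ℕ) * c j r η a| ≤ 3 * L * (1 + t ^ 2) := by
  refine (Finset.abs_sum_le_sum_abs _ _).trans
    ((Finset.sum_le_sum (g := fun _ => L * (1 + t ^ 2)) fun r _ => ?_).trans
      (le_of_eq (by simp [mul_assoc])))
  rw [abs_mul, mul_comm]
  exact mul_le_mul ((norm_le_pi_norm _ a).trans
    (hS.norm_le j r η (interior_subset hS.mem_interior))) (abs_pow_le_one_add_sq t r)
    (abs_nonneg _) hS.nonneg

theorem SmoothScore.integral_summand (hS : SmoothScore μ Y K η c A H L)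
    (h : MomentBound μ Y q B) (hYm : ∀ j, Measurable (Y j)) (j : ℕ) (a : ι) :
    ∫ ω, ∑ r : Fin 3, Y j ω ^ (r : ℕ) * c j r η a ∂μ = 0 := by
  rw [integral_finsetSum _ fun r _ => (h.integrable_pow hYm j r).mul_const _]
  simp only [integral_mul_const]
  simpa [mom] using congrFun (hS.mean_eq_zero j) a

/-- Leaving area `i` out makes the score independent of `Y i`, so its moment of order `q` can be
taken under the weight `1 + Y i ²` at no cost in the power of `m`. -/
theorem SmoothScore.rosenthal (hS : SmoothScore μ Y K η c A H L)
    (h : MomentBound μ Y q B) (hYm : ∀ j, Measurable (Y j)) (hY : iIndepFun Y μ) (i : ℕ) :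
    ∃ C : ℝ, 0 ≤ C ∧ ∀ m : ℕ, 1 ≤ m →
      Integrable (fun ω => (1 + Y i ω ^ 2) *
        ∑ a, |scoreErase c η i m (fun j => Y j ω) a| ^ q) μ ∧
      ∫ ω, (1 + Y i ω ^ 2) * ∑ a, |scoreErase c η i m (fun j => Y j ω) a| ^ q ∂μ ≤
        C * (m : ℝ) ^ (q / 2) ∧
      ∀ a, Integrable (fun ω => |scoreErase c η i m (fun j => Y j ω) a| ^ q) μ := by
  obtain ⟨C, hC, HC⟩ := h.rosenthal hYm hY (L := 3 * L) (by linarith [hS.nonneg])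
  have hB := h.one_le hYm
  refine ⟨B * (Fintype.card ι * C), by positivity, fun m hm => ?_⟩
  have H1 : ∀ a, Integrable (fun ω => |scoreErase c η i m (fun j => Y j ω) a| ^ q) μ ∧
      ∫ ω, |scoreErase c η i m (fun j => Y j ω) a| ^ q ∂μ ≤ C * (m : ℝ) ^ (q / 2) := fun a => by
    simp only [scoreErase_apply]
    exact HC (φ := fun j t => ∑ r : Fin 3, t ^ (r : ℕ) * c j r η a) (fun j => by fun_prop)
      (fun j t => hS.abs_summand_le j t a) (fun j => hS.integral_summand h hYm j a) m hm _
      (Finset.card_erase_le.trans (by simp))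
  have hWi := h.integrable_one_add_sq hYm i
  have hind : ∀ a, IndepFun (fun ω => 1 + Y i ω ^ 2)
      (fun ω => |scoreErase c η i m (fun j => Y j ω) a| ^ q) μ := fun a =>
    ((indepFun_scoreErase hYm hY i m).comp (φ := fun v : ι → ℝ => |v a| ^ q)
      (ψ := fun y : ℝ => 1 + y ^ 2) (by fun_prop) (by fun_prop)).symm
  have hi : ∀ a, Integrable (fun ω => (1 + Y i ω ^ 2) *
      |scoreErase c η i m (fun j => Y j ω) a| ^ q) μ := fun a =>
    (hind a).integrable_mul hWi (H1 a).1
  simp only [Finset.mul_sum]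
  refine ⟨integrable_finsetSum _ fun a _ => hi a, ?_, fun a => (H1 a).1⟩
  rw [integral_finsetSum _ fun a _ => hi a]
  refine (Finset.sum_le_sum (g := fun _ => B * (C * (m : ℝ) ^ (q / 2))) fun a _ => ?_).trans
    (le_of_eq (by simp; ring))
  rw [(hind a).integral_fun_mul_eq_mul_integral hWi.1 (H1 a).1.1]
  exact mul_le_mul (h.integral_one_add_sq_le hYm i) (H1 a).2
    (integral_nonneg fun ω => by positivity) (by linarith)

end Limit

end NEFQVF

/-! ### Passage to the limit in expectations. -/

namespace NEFQVF

section Limit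

variable {Ω : Type*} [MeasurableSpace Ω] {μ : Measure Ω} [IsProbabilityMeasure μ]

/-- Integrals that are of order `κ` outside negligible events, for every `κ`, tend to zero. -/
theorem tendsto_integral_of_negligible {Y₀ : Ω → ℝ} (hY₀ : Measurable Y₀) {F V : ℕ → Ω → ℝ}
    {q C C₁ C₂ C₃ κ₀ : ℝ} (hq : 2 < q) (hκ₀ : 0 < κ₀) (hC₂ : 0 ≤ C₂) (hC₃ : 0 ≤ C₃)
    (hF : ∀ᶠ m in atTop, Integrable (F m) μ) (hF0 : ∀ m ω, 0 ≤ F m ω)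
    (hV0 : ∀ m ω, 0 ≤ V m ω) (hVm : ∀ m, Measurable (V m))
    (hV : ∀ m : ℕ, 1 ≤ m → Integrable (V m) μ ∧ ∫ ω, V m ω ∂μ ≤ C * (m : ℝ) ^ (q / 2))
    (hW : Integrable (fun ω => (1 + Y₀ ω ^ 2) ^ 2) μ) (hW' : ∫ ω, (1 + Y₀ ω ^ 2) ^ 2 ∂μ ≤ C₁)
    (hbad : ∀ᶠ m : ℕ in atTop, ∀ ω,
      F m ω ≤ C₃ * (m * (1 + Y₀ ω ^ 2) + V m ω * (m : ℝ) ^ (1 - q)))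
    (hgood : ∀ κ, 0 < κ → κ ≤ κ₀ → ∃ N : ℕ → Set Ω, Negligible μ Y₀ N ∧ ∀ᶠ m : ℕ in atTop, ∀ ω,
      ω ∉ N m → F m ω ≤ C₂ * κ * (V m ω * (m : ℝ) ^ (-(q / 2)) + 2 * (1 + Y₀ ω ^ 2) ^ 2)) :
    Tendsto (fun m => ∫ ω, F m ω ∂μ) atTop (𝓝 0) := by
  have hC : 0 ≤ C := by
    have := (integral_nonneg (hV0 1)).trans (hV 1 le_rfl).2
    simpa using this
  have hC₁ : 0 ≤ C₁ := (integral_nonneg fun ω => by positivity).trans hW'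
  have hWm : Measurable fun ω => 1 + Y₀ ω ^ 2 := by fun_prop
  refine tendsto_order.2 ⟨fun l hl => Eventually.of_forall fun m =>
    hl.trans_le (integral_nonneg (hF0 m)), fun ε hε => ?_⟩
  -- `κ * D` bounds the expectation off the exceptional event for large `m`, so `κ` is chosen with
  -- `κ * D < ε`.
  set D := C₂ * (C + 2 * C₁) with hD
  have hD0 : 0 ≤ D := by positivity
  obtain ⟨κ, hκ, hκ1, hκ2⟩ : ∃ κ : ℝ, 0 < κ ∧ κ ≤ κ₀ ∧ κ * D < ε := by
    refine ⟨min κ₀ (ε / (D + 1)), lt_min hκ₀ (by positivity), min_le_left _ _, ?_⟩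
    calc min κ₀ (ε / (D + 1)) * D ≤ ε / (D + 1) * D := by gcongr; exact min_le_right _ _
      _ < ε := by
        rw [div_mul_eq_mul_div, div_lt_iff₀ (by positivity)]
        nlinarith
  obtain ⟨N, hN, hgN⟩ := hgood κ hκ hκ1
  have hlim : Tendsto (fun m : ℕ => ENNReal.ofReal C₃ *
      ((m : ENNReal) * ∫⁻ ω in N m, ENNReal.ofReal (1 + Y₀ ω ^ 2) ∂μ) +
      ENNReal.ofReal (C₃ * (C * (m : ℝ) ^ (-(q / 2 - 1))) + κ * D)) atTop
      (𝓝 (ENNReal.ofReal (κ * D))) := by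
    have h1 : Tendsto (fun m : ℕ => C₃ * (C * (m : ℝ) ^ (-(q / 2 - 1))) + κ * D) atTop
        (𝓝 (κ * D)) := by
      simpa using (((tendsto_rpow_neg_atTop (by linarith : 0 < q / 2 - 1)).comp
        (tendsto_natCast_atTop_atTop (R := ℝ))).const_mul C |>.const_mul C₃).add_const (κ * D)
    have h2 := ENNReal.Tendsto.const_mul (a := ENNReal.ofReal C₃) hN (Or.inr ENNReal.ofReal_ne_top)
    simpa using h2.add (ENNReal.tendsto_ofReal h1)
  have hev := (tendsto_order.1 hlim).2 (ENNReal.ofReal ε) ((ENNReal.ofReal_lt_ofReal_iff hε).2 hκ2)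
  filter_upwards [hev, hF, hbad, hgN, eventually_ge_atTop 1] with m hm hFm hb hg hm1
  have hm0 : (0 : ℝ) < m := by exact_mod_cast hm1
  obtain ⟨hVi, hVl⟩ := hV m hm1
  refine (ENNReal.ofReal_lt_ofReal_iff hε).1 (lt_of_le_of_lt ?_ hm)
  rw [ofReal_integral_eq_lintegral_ofReal hFm (Eventually.of_forall (hF0 m))]
  -- On the exceptional event the part `m (1 + Y₀²)` is handled by negligibility. The part with `V`
  -- has total integral of order `m^(1 - q/2)`, which vanishes since `q > 2`.
  have e1 : ∫⁻ ω in N m, ENNReal.ofReal (F m ω) ∂μ ≤ ENNReal.ofReal C₃ *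
      ((m : ENNReal) * ∫⁻ ω in N m, ENNReal.ofReal (1 + Y₀ ω ^ 2) ∂μ) +
      ENNReal.ofReal (C₃ * (C * (m : ℝ) ^ (-(q / 2 - 1)))) := by
    calc ∫⁻ ω in N m, ENNReal.ofReal (F m ω) ∂μ
        ≤ ∫⁻ ω in N m, (ENNReal.ofReal C₃ * ((m : ENNReal) * ENNReal.ofReal (1 + Y₀ ω ^ 2)) +
            ENNReal.ofReal (C₃ * (m : ℝ) ^ (1 - q) * V m ω)) ∂μ := by
          refine lintegral_mono fun ω => ?_
          refine (ENNReal.ofReal_le_ofReal (hb ω)).trans (le_of_eq ?_)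
          rw [← ENNReal.ofReal_natCast, ← ENNReal.ofReal_mul hm0.le, ← ENNReal.ofReal_mul hC₃,
            ← ENNReal.ofReal_add (by positivity) (by have := hV0 m ω; positivity)]
          congr 1; ring
      _ = ENNReal.ofReal C₃ *
            ((m : ENNReal) * ∫⁻ ω in N m, ENNReal.ofReal (1 + Y₀ ω ^ 2) ∂μ) +
            ∫⁻ ω in N m, ENNReal.ofReal (C₃ * (m : ℝ) ^ (1 - q) * V m ω) ∂μ := by
          rw [lintegral_add_left ((hWm.ennreal_ofReal.const_mul _).const_mul _),
            lintegral_const_mul _ (hWm.ennreal_ofReal.const_mul _),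
            lintegral_const_mul _ hWm.ennreal_ofReal]
      _ ≤ _ := by
          gcongr
          refine (setLIntegral_le_lintegral _ _).trans ?_
          rw [← ofReal_integral_eq_lintegral_ofReal (hVi.const_mul _)
            (Eventually.of_forall fun ω => by have := hV0 m ω; positivity), integral_const_mul]
          refine ENNReal.ofReal_le_ofReal ?_
          calc _ ≤ C₃ * (m : ℝ) ^ (1 - q) * (C * (m : ℝ) ^ (q / 2)) := by gcongr
            _ = C₃ * (C * ((m : ℝ) ^ (1 - q) * (m : ℝ) ^ (q / 2))) := by ring
            _ = _ := by rw [← Real.rpow_add hm0]; congr 3; ring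
  have e2 : ∫⁻ ω in (N m)ᶜ, ENNReal.ofReal (F m ω) ∂μ ≤ ENNReal.ofReal (κ * D) := by
    have hi : Integrable (fun ω => C₂ * κ *
        (V m ω * (m : ℝ) ^ (-(q / 2)) + 2 * (1 + Y₀ ω ^ 2) ^ 2)) μ :=
      ((hVi.mul_const _).add (hW.const_mul 2)).const_mul _
    have hnn : ∀ ω, 0 ≤ C₂ * κ * (V m ω * (m : ℝ) ^ (-(q / 2)) + 2 * (1 + Y₀ ω ^ 2) ^ 2) :=
      fun ω => by have := hV0 m ω; positivity
    have hVmm := hVm m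
    calc _ ≤ ∫⁻ ω in (N m)ᶜ, ENNReal.ofReal (C₂ * κ *
          (V m ω * (m : ℝ) ^ (-(q / 2)) + 2 * (1 + Y₀ ω ^ 2) ^ 2)) ∂μ :=
          setLIntegral_mono (by fun_prop) fun ω hω => ENNReal.ofReal_le_ofReal (hg ω hω)
      _ ≤ _ := setLIntegral_le_lintegral _ _
      _ = _ := (ofReal_integral_eq_lintegral_ofReal hi (Eventually.of_forall hnn)).symm
      _ ≤ _ := by
          refine ENNReal.ofReal_le_ofReal ?_
          rw [integral_const_mul, integral_add (hVi.mul_const _) (hW.const_mul 2),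
            integral_mul_const, integral_const_mul]
          have e3 : (∫ ω, V m ω ∂μ) * (m : ℝ) ^ (-(q / 2)) ≤ C := by
            calc _ ≤ C * (m : ℝ) ^ (q / 2) * (m : ℝ) ^ (-(q / 2)) := by gcongr
              _ = C := by rw [mul_assoc, ← Real.rpow_add hm0]; simp
          rw [hD]
          calc _ ≤ C₂ * κ * (C + 2 * C₁) := by gcongr
            _ = _ := by ring
  calc ∫⁻ ω, ENNReal.ofReal (F m ω) ∂μ
      = ∫⁻ ω in N m ∪ (N m)ᶜ, ENNReal.ofReal (F m ω) ∂μ := by simp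
    _ ≤ _ := lintegral_union_le _ _ _
    _ ≤ _ := add_le_add e1 e2
    _ = _ := by rw [add_assoc, ENNReal.ofReal_add (by positivity) (by positivity)]

end Limit

end NEFQVF

/-! ### Mean square linearization of the plug-in estimator. -/

namespace NEFQVF

section PlugIn

variable {Ω : Type*} [MeasurableSpace Ω] {μ : Measure Ω} [IsProbabilityMeasure μ] {Y : ℕ → Ω → ℝ}
  {ι : Type*} [Fintype ι] {q B : ℝ}

/-- The functions `f 0 x + y * f 1 x` of the parameter `x` are bounded, and differentiable at `η`
with gradients `α`. -/
structure SmoothPlugIn (K : Set (ι → ℝ)) (η : ι → ℝ) (f : Fin 2 → (ι → ℝ) → ℝ) (α : Fin 2 → ι → ℝ)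
    (k : ℝ) : Prop where
  nonneg : 0 ≤ k
  measurable : ∀ r, Measurable (f r)
  bound : ∀ r, ∀ x ∈ K, |f r x - f r η| ≤ k
  grad_le : ∀ r b, |α r b| ≤ k
  diff : ∀ κ : ℝ, 0 < κ → ∃ ρ : ℝ, 0 < ρ ∧ ∀ r x, ‖x - η‖ ≤ ρ →
    |f r x - f r η - α r ⬝ᵥ (x - η)| ≤ κ * ‖x - η‖

/-- The change of the plug-in between the parameters `η` and `x`. -/
def plugDiff (f : Fin 2 → (ι → ℝ) → ℝ) (η x : ι → ℝ) (y : ℝ) : ℝ :=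
  (f 0 x - f 0 η) + y * (f 1 x - f 1 η)

/-- The gradient of the plug-in. -/
def plugGrad (α : Fin 2 → ι → ℝ) (y : ℝ) : ι → ℝ := α 0 + y • α 1

variable {K : Set (ι → ℝ)} {η : ι → ℝ} {c : ℕ → Fin 3 → (ι → ℝ) → ι → ℝ}
  {A : ℕ → Fin 3 → Matrix ι ι ℝ} {H : ℕ → Matrix ι ι ℝ} {L : ℝ}
  {f : Fin 2 → (ι → ℝ) → ℝ} {α : Fin 2 → ι → ℝ} {k : ℝ}

theorem SmoothPlugIn.abs_grad_le (hf : SmoothPlugIn K η f α k) (y : ℝ) (b : ι) :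
    |plugGrad α y b| ≤ k * (1 + |y|) := by
  simp only [plugGrad, Pi.add_apply, Pi.smul_apply, smul_eq_mul]
  refine (abs_add_le _ _).trans ?_
  rw [abs_mul]
  have h0 := hf.grad_le 0 b
  have h1 := mul_le_mul_of_nonneg_left (hf.grad_le 1 b) (abs_nonneg y)
  linarith

theorem SmoothPlugIn.sq_plugDiff_le (hf : SmoothPlugIn K η f α k) {x : ι → ℝ} (hx : x ∈ K)
    (y : ℝ) : plugDiff f η x y ^ 2 ≤ 2 * k ^ 2 * (1 + y ^ 2) := by
  have h1 : |plugDiff f η x y| ≤ k * (1 + |y|) := by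
    refine (abs_add_le _ _).trans ?_
    rw [abs_mul]
    have h0 := hf.bound 0 x hx
    have h1 := mul_le_mul_of_nonneg_left (hf.bound 1 x hx) (abs_nonneg y)
    linarith
  calc plugDiff f η x y ^ 2 = |plugDiff f η x y| ^ 2 := (sq_abs _).symm
    _ ≤ (k * (1 + |y|)) ^ 2 := by gcongr
    _ = k ^ 2 * (1 + |y|) ^ 2 := by ring
    _ ≤ k ^ 2 * (2 * (1 + y ^ 2)) := by gcongr; exact one_add_abs_sq_le y
    _ = _ := by ring

theorem SmoothPlugIn.abs_plugDiff_sub_le (hf : SmoothPlugIn K η f α k) {κ : ℝ} (hκ : 0 < κ) :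
    ∃ ρ : ℝ, 0 < ρ ∧ ∀ x y, ‖x - η‖ ≤ ρ →
      |plugDiff f η x y - plugGrad α y ⬝ᵥ (x - η)| ≤ κ * (1 + |y|) * ‖x - η‖ := by
  obtain ⟨ρ, hρ, h⟩ := hf.diff κ hκ
  refine ⟨ρ, hρ, fun x y hx => ?_⟩
  have e : plugDiff f η x y - plugGrad α y ⬝ᵥ (x - η) = (f 0 x - f 0 η - α 0 ⬝ᵥ (x - η)) +
      y * (f 1 x - f 1 η - α 1 ⬝ᵥ (x - η)) := by
    simp only [plugDiff, plugGrad, add_dotProduct, smul_dotProduct, smul_eq_mul]; ring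
  rw [e]
  refine (abs_add_le _ _).trans ?_
  rw [abs_mul]
  have h1 := mul_le_mul_of_nonneg_left (h 1 x hx) (abs_nonneg y)
  have h0 := h 0 x hx
  linarith

variable [DecidableEq ι]

theorem SmoothPlugIn.sq_linear_le (hf : SmoothPlugIn K η f α k) {U : Matrix ι ι ℝ} {Λ m : ℝ}
    (hΛ : 0 < Λ) (hm : 0 < m) (hU : ∀ u, Λ * m * ‖u‖ ≤ ‖U *ᵥ u‖) (y : ℝ) (s : ι → ℝ) :
    (plugGrad α y ⬝ᵥ (U⁻¹ *ᵥ s)) ^ 2 ≤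
      2 * (Fintype.card ι * k / Λ) ^ 2 * (1 + y ^ 2) * (‖s‖ ^ 2 / m ^ 2) := by
  have hk := hf.nonneg
  have h1 : |plugGrad α y ⬝ᵥ (U⁻¹ *ᵥ s)| ≤
      Fintype.card ι * (k * (1 + |y|)) * (‖s‖ / (Λ * m)) :=
    (abs_dotProduct_le (hf.abs_grad_le y)).trans
      (mul_le_mul_of_nonneg_left (norm_inv_mulVec_le (by positivity) hU s) (by positivity))
  calc _ = |plugGrad α y ⬝ᵥ (U⁻¹ *ᵥ s)| ^ 2 := (sq_abs _).symm
    _ ≤ (Fintype.card ι * (k * (1 + |y|)) * (‖s‖ / (Λ * m))) ^ 2 := by gcongr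
    _ = (Fintype.card ι * k / Λ) ^ 2 * (1 + |y|) ^ 2 * (‖s‖ ^ 2 / m ^ 2) := by field_simp
    _ ≤ (Fintype.card ι * k / Λ) ^ 2 * (2 * (1 + y ^ 2)) * (‖s‖ ^ 2 / m ^ 2) := by
        gcongr; exact one_add_abs_sq_le y
    _ = _ := by ring

/-- `x² ≤ 1 + |x|^q` applied to `x / √m`, the natural scale of the score; it serves on the
favourable event and for the second moment of the linear term. -/
theorem sq_div_le_add {x g m q : ℝ} (hx : 0 ≤ x) (hm : 0 < m) (hq : 2 ≤ q) (hg : x ^ q ≤ g) :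
    x ^ 2 / m ≤ 1 + g * m ^ (-(q / 2)) := by
  have h := sq_le_one_add_rpow (x := x / √m) hq
  rw [div_pow, Real.sq_sqrt hm.le, abs_of_nonneg (by positivity),
    Real.div_rpow hx (Real.sqrt_nonneg _), Real.sqrt_eq_rpow, ← Real.rpow_mul hm.le] at h
  refine h.trans ?_
  rw [Real.rpow_neg hm.le, ← div_eq_mul_inv, show 1 / 2 * q = q / 2 by ring]
  gcongr

/-- The same at the coarser scale `x / m`, used for the bound on the exceptional event: the
deterministic part grows to `m`, but the random part gets the better power `m^(1 - q)`. -/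
theorem sq_div_le_add' {x g m q : ℝ} (hx : 0 ≤ x) (hm : 0 < m) (hq : 2 ≤ q) (hg : x ^ q ≤ g) :
    x ^ 2 / m ≤ m + g * m ^ (1 - q) := by
  have h := sq_le_one_add_rpow (x := x / m) hq
  rw [div_pow, abs_of_nonneg (by positivity), Real.div_rpow hx hm.le] at h
  have e : x ^ 2 / m = m * (x ^ 2 / m ^ 2) := by field_simp
  rw [e]
  calc _ ≤ m * (1 + x ^ q / m ^ q) := by gcongr
    _ ≤ m * (1 + g / m ^ q) := by gcongr
    _ = m + g * m ^ (1 - q) := by rw [Real.rpow_sub hm, Real.rpow_one]; field_simp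

/-- One factor `κ` must come out of both error terms. The score of the other areas carries it
already; for the contribution `r` of area `i` it comes from `1 + y² ≤ κ m`. -/
theorem mul_sq_le_of_abs_le {z c₀ L κ t v r m y : ℝ} (hm : 0 < m) (hκ : 0 < κ) (hκ1 : κ ≤ 1)
    (hc₀ : 0 ≤ c₀) (hL : 0 ≤ L) (ht : 0 ≤ t) (hr : 0 ≤ r) (hrL : r ≤ 3 * L * (1 + y ^ 2))
    (hy : 1 + y ^ 2 ≤ κ * m) (hz : |z| ≤ c₀ * (1 + |y|) * (κ * t + r) / m)
    (htv : t ^ 2 / m ≤ 1 + v) (hv : 0 ≤ v) :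
    m * z ^ 2 ≤ 4 * c₀ ^ 2 * (1 + 9 * L ^ 2) * κ * ((1 + y ^ 2) * v + 2 * (1 + y ^ 2) ^ 2) := by
  have hy1 := one_add_abs_sq_le y
  have hW1 : 1 ≤ 1 + y ^ 2 := by nlinarith [sq_nonneg y]
  generalize 1 + y ^ 2 = W at *
  have h4 : z ^ 2 ≤ 4 * c₀ ^ 2 * W * (κ ^ 2 * t ^ 2 + r ^ 2) / m ^ 2 := by
    calc z ^ 2 = |z| ^ 2 := (sq_abs _).symm
      _ ≤ (c₀ * (1 + |y|) * (κ * t + r) / m) ^ 2 := by gcongr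
      _ = c₀ ^ 2 * (1 + |y|) ^ 2 * (κ * t + r) ^ 2 / m ^ 2 := by ring
      _ ≤ c₀ ^ 2 * (2 * W) * (2 * (κ ^ 2 * t ^ 2 + r ^ 2)) / m ^ 2 := by
          gcongr
          nlinarith [sq_nonneg (κ * t - r)]
      _ = _ := by ring
  have h6 : r ^ 2 / m ≤ 9 * L ^ 2 * (κ * W) := by
    rw [div_le_iff₀ hm]
    calc r ^ 2 ≤ (3 * L * W) ^ 2 := by gcongr
      _ = 9 * L ^ 2 * (W * W) := by ring
      _ ≤ 9 * L ^ 2 * (κ * m * W) := by gcongr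
      _ = _ := by ring
  calc m * z ^ 2
      ≤ m * (4 * c₀ ^ 2 * W * (κ ^ 2 * t ^ 2 + r ^ 2) / m ^ 2) := by gcongr
    _ = 4 * c₀ ^ 2 * W * (κ * (κ * (t ^ 2 / m)) + r ^ 2 / m) := by field_simp
    _ ≤ 4 * c₀ ^ 2 * W * (κ * (1 * (1 + v)) + 9 * L ^ 2 * (κ * W)) := by gcongr
    _ = 4 * c₀ ^ 2 * κ * ((W + W * v) + 9 * L ^ 2 * W ^ 2) := by ring
    _ ≤ 4 * c₀ ^ 2 * κ * ((1 + 9 * L ^ 2) * (W * v + 2 * W ^ 2)) := by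
        gcongr
        have a1 : W ≤ W ^ 2 := by nlinarith
        have a2 : 0 ≤ L ^ 2 * (W * v) := by positivity
        have a3 : 0 ≤ L ^ 2 * W ^ 2 := by positivity
        nlinarith
    _ = _ := by ring

variable {est : ℕ → Ω → ι → ℝ} {i : ℕ}

set_option maxHeartbeats 1000000 in

-- The plug-in change is replaced in mean square, up to `o(1/m)`, by a linear form in the score of
-- the other areas. The second conclusion, that the linear form has mean square `O(1/m)`, is what
-- later allows the squares themselves to be compared.
theorem SmoothScore.tendsto_plugDiff_sub (hS : SmoothScore μ Y K η c A H L)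
    (hf : SmoothPlugIn K η f α k)
    (h : MomentBound μ Y q B) (hYm : ∀ j, Measurable (Y j)) (hY : iIndepFun Y μ)
    (hem : ∀ m, Measurable (est m)) (heK : ∀ m ω, est m ω ∈ K)
    (he : ∀ m ω, (∃ x ∈ K, scoreSum c m x (fun j => Y j ω) = 0) →
      scoreSum c m (est m ω) (fun j => Y j ω) = 0) :
    (∀ᶠ m : ℕ in atTop, Integrable (fun ω => (plugDiff f η (est m ω) (Y i ω) - plugGrad α (Y i ω) ⬝ᵥ
      ((∑ j ∈ Finset.range m, H j)⁻¹ *ᵥ scoreErase c η i m (fun j => Y j ω))) ^ 2) μ ∧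
      Integrable (fun ω => (plugGrad α (Y i ω) ⬝ᵥ
      ((∑ j ∈ Finset.range m, H j)⁻¹ *ᵥ scoreErase c η i m (fun j => Y j ω))) ^ 2) μ) ∧
    (∃ C : ℝ, ∀ᶠ m : ℕ in atTop, m * ∫ ω, (plugGrad α (Y i ω) ⬝ᵥ
      ((∑ j ∈ Finset.range m, H j)⁻¹ *ᵥ scoreErase c η i m (fun j => Y j ω))) ^ 2 ∂μ ≤ C) ∧
    Tendsto (fun m : ℕ => m * ∫ ω, (plugDiff f η (est m ω) (Y i ω) - plugGrad α (Y i ω) ⬝ᵥ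
      ((∑ j ∈ Finset.range m, H j)⁻¹ *ᵥ scoreErase c η i m (fun j => Y j ω))) ^ 2 ∂μ)
      atTop (𝓝 0) := by
  obtain ⟨Λ, hΛ, hU, hexp⟩ := hS.exists_expansion h hYm hY i
  obtain ⟨C, hC, hros⟩ := hS.rosenthal h hYm hY i
  have hq := h.two_lt
  have hL := hS.nonneg
  have hk := hf.nonneg
  set n : ℝ := (Fintype.card ι : ℝ) with hn
  set s : ℕ → Ω → ι → ℝ := fun m ω => scoreErase c η i m (fun j => Y j ω) with hs
  have hsm : ∀ m, Measurable (s m) := fun m => measurable_scoreErase hYm i m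
  set U : ℕ → Matrix ι ι ℝ := fun m => ∑ j ∈ Finset.range m, H j with hUdef
  set D : ℕ → Ω → ℝ := fun m ω => plugDiff f η (est m ω) (Y i ω) with hD
  set X : ℕ → Ω → ℝ := fun m ω => plugGrad α (Y i ω) ⬝ᵥ ((U m)⁻¹ *ᵥ s m ω) with hX
  set V : ℕ → Ω → ℝ := fun m ω => (1 + Y i ω ^ 2) * ∑ a, |s m ω a| ^ q with hV
  have hV0 : ∀ m ω, 0 ≤ V m ω := fun m ω => by positivity
  have hYi := hYm i
  have hVm : ∀ m, Measurable (V m) := fun m => by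
    have := hsm m
    exact Measurable.mul (by fun_prop) (Finset.measurable_fun_sum _ fun a _ =>
      ((measurable_pi_iff.1 this a).abs.pow_const q))
  have hXm : ∀ m, Measurable (X m) := fun m => by
    simp only [hX, dotProduct, Matrix.mulVec, plugGrad, Pi.add_apply, Pi.smul_apply, smul_eq_mul]
    refine Finset.measurable_fun_sum _ fun a _ => Measurable.mul (by fun_prop)
      (Finset.measurable_fun_sum _ fun b _ => Measurable.const_mul (measurable_pi_iff.1 (hsm m) b) _)
  have hDm : ∀ m, Measurable (D m) := fun m => by
    have h0 := (hf.measurable 0).comp (hem m)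
    have h1 := (hf.measurable 1).comp (hem m)
    exact (h0.sub_const _).add (hYi.mul (h1.sub_const _))
  have hW2 := h.integrable_sq hYm i
  have hW1 := h.integrable_one_add_sq hYm i
  have hXle : ∀ m : ℕ, 1 ≤ m → (∀ u, Λ * m * ‖u‖ ≤ ‖U m *ᵥ u‖) → ∀ ω, m * X m ω ^ 2 ≤
      2 * (n * k / Λ) ^ 2 * ((1 + Y i ω ^ 2) * (‖s m ω‖ ^ 2 / m)) := fun m hm1 hUm ω => by
    have hm : (0 : ℝ) < m := by exact_mod_cast hm1
    calc m * X m ω ^ 2 ≤ m * (2 * (n * k / Λ) ^ 2 * (1 + Y i ω ^ 2) * (‖s m ω‖ ^ 2 / m ^ 2)) := by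
          gcongr; exact hf.sq_linear_le hΛ hm hUm _ _
      _ = _ := by field_simp
  have hXle' : ∀ m : ℕ, 1 ≤ m → (∀ u, Λ * m * ‖u‖ ≤ ‖U m *ᵥ u‖) → ∀ ω, m * X m ω ^ 2 ≤
      2 * (n * k / Λ) ^ 2 * ((1 + Y i ω ^ 2) + V m ω * (m : ℝ) ^ (-(q / 2))) :=
    fun m hm1 hUm ω => by
    have hm : (0 : ℝ) < m := by exact_mod_cast hm1
    refine (hXle m hm1 hUm ω).trans ?_
    have := sq_div_le_add (norm_nonneg (s m ω)) hm hq.le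
      (norm_rpow_le_sum (by linarith) (s m ω))
    calc _ ≤ 2 * (n * k / Λ) ^ 2 * ((1 + Y i ω ^ 2) *
          (1 + (∑ a, |s m ω a| ^ q) * (m : ℝ) ^ (-(q / 2)))) := by gcongr
      _ = _ := by simp only [hV]; ring
  have hXint : ∀ m : ℕ, 1 ≤ m → (∀ u, Λ * m * ‖u‖ ≤ ‖U m *ᵥ u‖) →
      Integrable (fun ω => X m ω ^ 2) μ := fun m hm1 hUm => by
    have hm : (1 : ℝ) ≤ m := by exact_mod_cast hm1
    refine Integrable.mono' (g := fun ω => 2 * (n * k / Λ) ^ 2 *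
        ((1 + Y i ω ^ 2) + V m ω * (m : ℝ) ^ (-(q / 2))))
      ((hW1.add ((hros m hm1).1.mul_const _)).const_mul _)
      ((hXm m).pow_const 2).aestronglyMeasurable (Eventually.of_forall fun ω => ?_)
    rw [Real.norm_of_nonneg (sq_nonneg _)]
    exact (le_mul_of_one_le_left (sq_nonneg _) hm).trans (hXle' m hm1 hUm ω)
  have hDint : ∀ m, Integrable (fun ω => D m ω ^ 2) μ := fun m =>
    Integrable.mono' (hW1.const_mul (2 * k ^ 2)) ((hDm m).pow_const 2).aestronglyMeasurable
      (Eventually.of_forall fun ω => by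
        rw [Real.norm_of_nonneg (sq_nonneg _)]; exact hf.sq_plugDiff_le (heK m ω) _)
  have hsq : ∀ m ω, (D m ω - X m ω) ^ 2 ≤ 2 * D m ω ^ 2 + 2 * X m ω ^ 2 := fun m ω => by
    nlinarith [sq_nonneg (D m ω + X m ω)]
  have hDXint : ∀ m : ℕ, 1 ≤ m → (∀ u, Λ * m * ‖u‖ ≤ ‖U m *ᵥ u‖) →
      Integrable (fun ω => (D m ω - X m ω) ^ 2) μ := fun m hm1 hUm =>
    Integrable.mono' (((hDint m).const_mul 2).add ((hXint m hm1 hUm).const_mul 2))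
      (((hDm m).sub (hXm m)).pow_const 2).aestronglyMeasurable (Eventually.of_forall fun ω => by
        rw [Real.norm_of_nonneg (sq_nonneg _)]; exact hsq m ω)
  refine ⟨?_, ?_, ?_⟩
  · filter_upwards [hU, eventually_ge_atTop 1] with m hUm hm1
    exact ⟨hDXint m hm1 hUm, hXint m hm1 hUm⟩
  · refine ⟨2 * (n * k / Λ) ^ 2 * (B + C), ?_⟩
    filter_upwards [hU, eventually_ge_atTop 1] with m hUm hm1
    have hm : (0 : ℝ) < m := by exact_mod_cast hm1
    have hVi : Integrable (fun ω => V m ω * (m : ℝ) ^ (-(q / 2))) μ := (hros m hm1).1.mul_const _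
    rw [← integral_const_mul]
    refine (integral_mono ((hXint m hm1 hUm).const_mul _) ((hW1.add hVi).const_mul _)
      (hXle' m hm1 hUm)).trans ?_
    simp only [Pi.add_apply]
    rw [integral_const_mul, integral_add hW1 hVi, integral_mul_const]
    have e1 : (∫ ω, V m ω ∂μ) * (m : ℝ) ^ (-(q / 2)) ≤ C := by
      calc _ ≤ C * (m : ℝ) ^ (q / 2) * (m : ℝ) ^ (-(q / 2)) := by
            gcongr; exact (hros m hm1).2.1
        _ = C := by rw [mul_assoc, ← Real.rpow_add hm]; simp
    have := h.integral_one_add_sq_le hYm i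
    gcongr
  set c₀ : ℝ := 2 / Λ * (1 + n * k / Λ) + n * k / Λ with hc₀
  have hc₀0 : 0 ≤ c₀ := by positivity
  have key := tendsto_integral_of_negligible (μ := μ) hYi (F := fun m ω => m * (D m ω - X m ω) ^ 2)
    (V := V) (q := q) (C := C) (C₁ := ∫ ω, (1 + Y i ω ^ 2) ^ 2 ∂μ)
    (C₂ := 4 * c₀ ^ 2 * (1 + 9 * L ^ 2)) (C₃ := 4 * k ^ 2 + 4 * (n * k / Λ) ^ 2)
    (κ₀ := min 1 (Λ / 2)) hq (lt_min one_pos (half_pos hΛ)) (by positivity) (by positivity)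
    ?_ (fun m ω => by positivity) hV0 hVm (fun m hm => ⟨(hros m hm).1, (hros m hm).2.1⟩) hW2 le_rfl
    ?_ ?_
  · simpa only [integral_const_mul] using key
  · filter_upwards [hU, eventually_ge_atTop 1] with m hUm hm1
    exact (hDXint m hm1 hUm).const_mul _
  · filter_upwards [hU, eventually_ge_atTop 1] with m hUm hm1 ω
    have hm : (0 : ℝ) < m := by exact_mod_cast hm1
    have h1 := mul_le_mul_of_nonneg_left (hf.sq_plugDiff_le (heK m ω) (Y i ω)) hm.le
    have h2 := hXle m hm1 hUm ω
    have h3 := sq_div_le_add' (norm_nonneg (s m ω)) hm hq.le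
      (norm_rpow_le_sum (by linarith) (s m ω))
    have h4 : m * X m ω ^ 2 ≤ 2 * (n * k / Λ) ^ 2 * (m * (1 + Y i ω ^ 2) +
        V m ω * (m : ℝ) ^ (1 - q)) := by
      refine h2.trans ?_
      calc _ ≤ 2 * (n * k / Λ) ^ 2 * ((1 + Y i ω ^ 2) *
            (m + (∑ a, |s m ω a| ^ q) * (m : ℝ) ^ (1 - q))) := by gcongr
        _ = _ := by simp only [hV]; ring
    have h5 : 0 ≤ V m ω * (m : ℝ) ^ (1 - q) := by have := hV0 m ω; positivity
    have h6 := mul_le_mul_of_nonneg_left (hsq m ω) hm.le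
    have h7 : 0 ≤ k ^ 2 * (V m ω * (m : ℝ) ^ (1 - q)) := by positivity
    simp only [hD] at h1 h6 ⊢
    nlinarith
  · intro κ hκ hκ0
    have hκ1 : κ ≤ 1 := hκ0.trans (min_le_left _ _)
    have hκ2 : κ ≤ Λ / 2 := hκ0.trans (min_le_right _ _)
    obtain ⟨ρ, hρ, hdiff⟩ := hf.abs_plugDiff_sub_le hκ
    obtain ⟨N, hN, hNe⟩ := hexp (min κ ρ) (lt_min hκ hρ)
    -- Large values of `Y i` join the exceptional event, so that the score of area `i` is small
    -- compared with `√m` elsewhere.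
    refine ⟨fun m => N m ∪ {ω | κ * m ≤ 1 + Y i ω ^ 2}, hN.union (negligible_large h hYm i hκ), ?_⟩
    filter_upwards [hU, hNe, eventually_gt_atTop i] with m hUm hNm him ω hω
    have hm : (0 : ℝ) < m := by exact_mod_cast (by omega : 0 < m)
    simp only [Set.mem_union, Set.mem_ofPred_eq, not_or, not_le] at hω
    obtain ⟨hω1, hω2⟩ := hω
    obtain ⟨h1, h2⟩ := hNm ω hω1 (est m ω) (heK m ω) (he m ω)
    -- The part of the score due to area `i`: it is split off to restore independence and only
    -- enters the error.
    set r : ι → ℝ := ∑ r : Fin 3, Y i ω ^ (r : ℕ) • c i r η with hr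
    have hsr : scoreSum c m η (fun j => Y j ω) = s m ω + r :=
      (Finset.sum_erase_add _ _ (Finset.mem_range.2 him)).symm
    have hrn : ‖r‖ ≤ 3 * L * (1 + Y i ω ^ 2) := by
      refine (pi_norm_le_iff_of_nonneg (by positivity)).2 fun a => ?_
      have := hS.abs_summand_le i (Y i ω) a
      simpa [hr, Finset.sum_apply] using this
    rw [hsr] at h1
    have h3 := abs_plugIn_sub_le (a := plugGrad α (Y i ω)) (k := k) (y := Y i ω) hm hΛ hκ hκ1 hκ2 hk
      hUm (h1.trans (by gcongr; exact min_le_left _ _))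
      (hdiff (est m ω) (Y i ω) (h2.trans (min_le_right _ _))) (hf.abs_grad_le _)
    rw [← hn, ← hc₀] at h3
    have h5 : ‖s m ω‖ ^ 2 / m ≤ 1 + (∑ a, |s m ω a| ^ q) * (m : ℝ) ^ (-(q / 2)) :=
      sq_div_le_add (norm_nonneg (s m ω)) hm hq.le (norm_rpow_le_sum (by linarith) (s m ω))
    refine (mul_sq_le_of_abs_le hm hκ hκ1 hc₀0 hL (norm_nonneg _) (norm_nonneg _) hrn hω2.le h3 h5
      (by positivity)).trans (le_of_eq ?_)
    simp only [hV]
    ring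

end PlugIn

end NEFQVF

/-! ### Second moment of the linearized plug-in. -/

namespace NEFQVF

section PlugIn

variable {Ω : Type*} [MeasurableSpace Ω] {μ : Measure Ω} [IsProbabilityMeasure μ] {Y : ℕ → Ω → ℝ}
  {ι : Type*} [Fintype ι] {q B : ℝ}
  {K : Set (ι → ℝ)} {η : ι → ℝ} {c : ℕ → Fin 3 → (ι → ℝ) → ι → ℝ}
  {A : ℕ → Fin 3 → Matrix ι ι ℝ} {H : ℕ → Matrix ι ι ℝ} {L : ℝ}
  {f : Fin 2 → (ι → ℝ) → ℝ} {α : Fin 2 → ι → ℝ} {k : ℝ} {i : ℕ}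

/-- Cross terms between different areas vanish by independence and centring, leaving the sum of the
individual covariances `H j`. -/
theorem SmoothScore.integral_scoreErase_mul (hS : SmoothScore μ Y K η c A H L)
    (h : MomentBound μ Y q B) (hYm : ∀ j, Measurable (Y j)) (hY : iIndepFun Y μ) (m : ℕ)
    (a b : ι) :
    Integrable (fun ω => scoreErase c η i m (fun j => Y j ω) a *
      scoreErase c η i m (fun j => Y j ω) b) μ ∧
    ∫ ω, scoreErase c η i m (fun j => Y j ω) a * scoreErase c η i m (fun j => Y j ω) b ∂μ =
      ∑ j ∈ (Finset.range m).erase i, H j a b := by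
  classical
  set φ : ι → ℕ → ℝ → ℝ := fun a j t => ∑ r : Fin 3, t ^ (r : ℕ) * c j r η a with hφ
  have hφm : ∀ a j, Measurable (φ a j) := fun a j => by simp only [hφ]; fun_prop
  have hφb : ∀ a j t, |φ a j t| ≤ 3 * L * (1 + t ^ 2) := fun a j t => hS.abs_summand_le j t a
  have hL := hS.nonneg
  have hφi : ∀ a j, Integrable (fun ω => φ a j (Y j ω)) μ := fun a j =>
    h.integrable_of_le hYm j (hφm a j) (L := 3 * L) fun t => (hφb a j t).trans
      (mul_le_mul_of_nonneg_left (by nlinarith [sq_nonneg t]) (by linarith))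
  have hint : ∀ j l, Integrable (fun ω => φ a j (Y j ω) * φ b l (Y l ω)) μ := fun j l => by
    rcases eq_or_ne j l with rfl | hjl
    · refine h.integrable_of_le hYm j (f := fun t => φ a j t * φ b j t) (L := (3 * L) ^ 2)
        ((hφm a j).mul (hφm b j)) fun t => ?_
      rw [abs_mul]
      refine (mul_le_mul (hφb a j t) (hφb b j t) (abs_nonneg _) (by positivity)).trans
        (le_of_eq (by ring))
    · exact ((hY.indepFun hjl).comp (hφm a j) (hφm b l)).integrable_mul (hφi a j) (hφi b l)
  have hval : ∀ j l, ∫ ω, φ a j (Y j ω) * φ b l (Y l ω) ∂μ = if j = l then H j a b else 0 := by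
    intro j l
    split_ifs with hjl
    · subst hjl
      exact hS.cov j a b
    · have := ((hY.indepFun hjl).comp (hφm a j) (hφm b l)).integral_fun_mul_eq_mul_integral
        (hφi a j).1 (hφi b l).1
      simp only [Function.comp] at this
      rw [this]
      have h0 : ∫ ω, φ a j (Y j ω) ∂μ = 0 := hS.integral_summand h hYm j a
      rw [h0, zero_mul]
  have e : ∀ ω, scoreErase c η i m (fun j => Y j ω) a * scoreErase c η i m (fun j => Y j ω) b =
      ∑ j ∈ (Finset.range m).erase i, ∑ l ∈ (Finset.range m).erase i,
        φ a j (Y j ω) * φ b l (Y l ω) := fun ω => by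
    rw [scoreErase_apply, scoreErase_apply, ← Finset.sum_mul_sum]
  simp only [e]
  refine ⟨integrable_finsetSum _ fun j _ => integrable_finsetSum _ fun l _ => hint j l, ?_⟩
  rw [integral_finsetSum _ fun j _ => integrable_finsetSum _ fun l _ => hint j l]
  refine Finset.sum_congr rfl fun j hj => ?_
  rw [integral_finsetSum _ fun l _ => hint j l, Finset.sum_congr rfl fun l _ => hval j l]
  simp only [Finset.sum_ite_eq, if_pos hj]

variable [DecidableEq ι]

/-- The second moment of the linearized plug-in. -/
theorem SmoothScore.integral_sq_linear (hS : SmoothScore μ Y K η c A H L)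
    (hf : SmoothPlugIn K η f α k) (h : MomentBound μ Y q B) (hYm : ∀ j, Measurable (Y j))
    (hY : iIndepFun Y μ) (m : ℕ) (V : Matrix ι ι ℝ) :
    ∫ ω, (plugGrad α (Y i ω) ⬝ᵥ (V *ᵥ scoreErase c η i m (fun j => Y j ω))) ^ 2 ∂μ =
      ∑ a, ∑ b, (∫ ω, plugGrad α (Y i ω) a * plugGrad α (Y i ω) b ∂μ) *
        (V * (∑ j ∈ (Finset.range m).erase i, H j) * Vᵀ) a b := by
  have hgi : ∀ a b, Integrable (fun ω => plugGrad α (Y i ω) a * plugGrad α (Y i ω) b) μ :=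
    fun a b => h.integrable_of_le hYm i (f := fun y => plugGrad α y a * plugGrad α y b)
      (L := 2 * k ^ 2) (by simp only [plugGrad, Pi.add_apply, Pi.smul_apply]; fun_prop) fun t => by
        rw [abs_mul]
        calc _ ≤ (k * (1 + |t|)) * (k * (1 + |t|)) :=
              mul_le_mul (hf.abs_grad_le t a) (hf.abs_grad_le t b) (abs_nonneg _)
                (mul_nonneg hf.nonneg (by positivity))
          _ = k ^ 2 * (1 + |t|) ^ 2 := by ring
          _ ≤ k ^ 2 * (2 * (1 + t ^ 2)) := by gcongr; exact one_add_abs_sq_le t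
          _ ≤ k ^ 2 * (2 * (1 + t ^ 2) ^ 2) := by
              gcongr
              nlinarith [sq_nonneg t]
          _ = _ := by ring
  set s : Ω → ι → ℝ := fun ω => scoreErase c η i m (fun j => Y j ω) with hs
  have hsm : Measurable s := measurable_scoreErase hYm i m
  have hind : IndepFun s (Y i) μ := indepFun_scoreErase hYm hY i m
  have hcov := fun a b => hS.integral_scoreErase_mul (i := i) h hYm hY m a b
  have e : ∀ ω, (plugGrad α (Y i ω) ⬝ᵥ (V *ᵥ s ω)) ^ 2 =
      ∑ a, ∑ b, ∑ d, ∑ l, (V a d * V b l) *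
        ((plugGrad α (Y i ω) a * plugGrad α (Y i ω) b) * (s ω d * s ω l)) := fun ω => by
    rw [sq, dotProduct, Finset.sum_mul_sum]
    refine Finset.sum_congr rfl fun a _ => Finset.sum_congr rfl fun b _ => ?_
    simp only [Matrix.mulVec, dotProduct]
    rw [mul_mul_mul_comm, Finset.sum_mul_sum, Finset.mul_sum]
    refine Finset.sum_congr rfl fun d _ => ?_
    rw [Finset.mul_sum]
    refine Finset.sum_congr rfl fun l _ => ?_
    ring
  have hind' : ∀ a b d l, IndepFun (fun ω => plugGrad α (Y i ω) a * plugGrad α (Y i ω) b)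
      (fun ω => s ω d * s ω l) μ := fun a b d l =>
    (hind.comp (φ := fun v : ι → ℝ => v d * v l)
      (ψ := fun y : ℝ => plugGrad α y a * plugGrad α y b) (by fun_prop)
      (by simp only [plugGrad, Pi.add_apply, Pi.smul_apply]; fun_prop)).symm
  have hint : ∀ a b d l, Integrable (fun ω => (V a d * V b l) *
      ((plugGrad α (Y i ω) a * plugGrad α (Y i ω) b) * (s ω d * s ω l))) μ := fun a b d l =>
    ((hind' a b d l).integrable_mul (hgi a b) (hcov d l).1).const_mul _
  set C := ∑ j ∈ (Finset.range m).erase i, H j with hC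
  have hval : ∀ a b d l, ∫ ω, (V a d * V b l) *
      ((plugGrad α (Y i ω) a * plugGrad α (Y i ω) b) * (s ω d * s ω l)) ∂μ =
      (∫ ω, plugGrad α (Y i ω) a * plugGrad α (Y i ω) b ∂μ) * (V a d * C d l * V b l) :=
    fun a b d l => by
      rw [integral_const_mul, (hind' a b d l).integral_fun_mul_eq_mul_integral (hgi a b).1
        (hcov d l).1.1, (hcov d l).2, hC, Matrix.sum_apply]
      ring
  rw [integral_congr_ae (Eventually.of_forall e)]
  rw [integral_finsetSum _ fun a _ => integrable_finsetSum _ fun b _ =>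
    integrable_finsetSum _ fun d _ => integrable_finsetSum _ fun l _ => hint a b d l]
  refine Finset.sum_congr rfl fun a _ => ?_
  rw [integral_finsetSum _ fun b _ =>
    integrable_finsetSum _ fun d _ => integrable_finsetSum _ fun l _ => hint a b d l]
  refine Finset.sum_congr rfl fun b _ => ?_
  rw [integral_finsetSum _ fun d _ => integrable_finsetSum _ fun l _ => hint a b d l]
  simp only [Matrix.mul_apply, Matrix.transpose_apply, Finset.sum_mul, Finset.mul_sum]
  simp only [integral_finsetSum _ fun l _ => hint a b _ l, hval]
  exact Finset.sum_comm

theorem abs_inv_apply_le {U : Matrix ι ι ℝ} {Λ : ℝ} (hΛ : 0 < Λ)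
    (hU : ∀ u, Λ * ‖u‖ ≤ ‖U *ᵥ u‖) (a b : ι) : |U⁻¹ a b| ≤ Λ⁻¹ := by
  have h1 := norm_inv_mulVec_le hΛ hU (Pi.single b 1)
  rw [Matrix.mulVec_single_one] at h1
  have h2 : ‖(Pi.single b 1 : ι → ℝ)‖ ≤ 1 := by
    refine (pi_norm_le_iff_of_nonneg zero_le_one).2 fun d => ?_
    rcases eq_or_ne d b with rfl | hd
    · simp
    · simp [hd]
  calc |U⁻¹ a b| ≤ ‖U⁻¹.col b‖ := norm_le_pi_norm (U⁻¹.col b) a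
    _ ≤ 1 / Λ := h1.trans (by gcongr)
    _ = Λ⁻¹ := one_div _

/-- Each entry of `U⁻¹` is `O(1/m)`, so a fixed matrix between two inverses contributes `O(m⁻²)`.
This removes the effect of leaving out area `i`. -/
theorem tendsto_mul_sum_inv {ι' : Type*} [Fintype ι'] [DecidableEq ι'] {Λ : ℝ} (hΛ : 0 < Λ)
    {U : ℕ → Matrix ι' ι' ℝ}
    (hU : ∀ᶠ m : ℕ in atTop, ∀ u, Λ * m * ‖u‖ ≤ ‖U m *ᵥ u‖) (G T : Matrix ι' ι' ℝ) :
    Tendsto (fun m : ℕ => m * ∑ a, ∑ b, G a b * ((U m)⁻¹ * T * ((U m)⁻¹)ᵀ) a b) atTop (𝓝 0) := by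
  set C := ∑ a, ∑ b, |G a b| * ∑ d, ∑ l, (Λ⁻¹ * |T l d|) * Λ⁻¹ with hC
  have hlim : Tendsto (fun m : ℕ => C * (m : ℝ)⁻¹) atTop (𝓝 0) := by
    simpa using (tendsto_inv_atTop_zero.comp (tendsto_natCast_atTop_atTop (R := ℝ))).const_mul C
  refine squeeze_zero_norm' ?_ hlim
  filter_upwards [hU, eventually_ge_atTop 1] with m hUm hm1
  have hm : (0 : ℝ) < m := by exact_mod_cast hm1
  have hV : ∀ a b, |(U m)⁻¹ a b| ≤ (Λ * m)⁻¹ := fun a b => abs_inv_apply_le (by positivity) hUm a b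
  have h1 : |∑ a, ∑ b, G a b * ((U m)⁻¹ * T * ((U m)⁻¹)ᵀ) a b| ≤
      ∑ a, ∑ b, |G a b| * ∑ d, ∑ l, ((Λ * m)⁻¹ * |T l d|) * (Λ * m)⁻¹ := by
    refine (Finset.abs_sum_le_sum_abs _ _).trans (Finset.sum_le_sum fun a _ => ?_)
    refine (Finset.abs_sum_le_sum_abs _ _).trans (Finset.sum_le_sum fun b _ => ?_)
    rw [abs_mul]
    refine mul_le_mul_of_nonneg_left ?_ (abs_nonneg _)
    simp only [Matrix.mul_apply, Matrix.transpose_apply, Finset.sum_mul]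
    refine (Finset.abs_sum_le_sum_abs _ _).trans (Finset.sum_le_sum fun d _ => ?_)
    refine (Finset.abs_sum_le_sum_abs _ _).trans (Finset.sum_le_sum fun l _ => ?_)
    rw [abs_mul, abs_mul]
    gcongr
    · exact hV a l
    · exact hV b d
  rw [Real.norm_eq_abs, abs_mul, abs_of_pos hm]
  calc _ ≤ m * ∑ a, ∑ b, |G a b| * ∑ d, ∑ l, ((Λ * m)⁻¹ * |T l d|) * (Λ * m)⁻¹ := by gcongr
    _ = C * (m : ℝ)⁻¹ := by
      simp only [hC, Finset.mul_sum, Finset.sum_mul]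
      refine Finset.sum_congr rfl fun a _ => Finset.sum_congr rfl fun b _ =>
        Finset.sum_congr rfl fun d _ => Finset.sum_congr rfl fun l _ => ?_
      field_simp

/-- `D² - X² = (D - X)² + 2 X (D - X)`, and the cross term is split by a weighted
arithmetic-geometric inequality. The boundedness of `m E[X²]` makes its share arbitrarily small. -/
theorem tendsto_mul_integral_sub {D X : ℕ → Ω → ℝ} {C : ℝ}
    (hD : ∀ᶠ m in atTop, Integrable (fun ω => D m ω ^ 2) μ)
    (hX : ∀ᶠ m in atTop, Integrable (fun ω => (D m ω - X m ω) ^ 2) μ ∧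
      Integrable (fun ω => X m ω ^ 2) μ)
    (hC : ∀ᶠ m : ℕ in atTop, m * ∫ ω, X m ω ^ 2 ∂μ ≤ C)
    (h0 : Tendsto (fun m : ℕ => m * ∫ ω, (D m ω - X m ω) ^ 2 ∂μ) atTop (𝓝 0)) :
    Tendsto (fun m : ℕ => m * (∫ ω, D m ω ^ 2 ∂μ - ∫ ω, X m ω ^ 2 ∂μ)) atTop (𝓝 0) := by
  have hC0 : 0 ≤ C := by
    obtain ⟨m, hm⟩ := hC.exists
    refine le_trans (mul_nonneg (Nat.cast_nonneg m) (integral_nonneg fun ω => sq_nonneg _)) hm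
  refine (tendsto_zero_iff_abs_tendsto_zero _).2 ?_
  refine tendsto_order.2 ⟨fun l hl => Eventually.of_forall fun m => hl.trans_le (abs_nonneg _),
    fun ε hε => ?_⟩
  set l := ε / (2 * (C + 1)) with hl
  have hl0 : 0 < l := by positivity
  have h1 : Tendsto (fun m : ℕ => (1 + l⁻¹) * (m * ∫ ω, (D m ω - X m ω) ^ 2 ∂μ)) atTop (𝓝 0) := by
    simpa using h0.const_mul (1 + l⁻¹)
  filter_upwards [hD, hX, hC, (tendsto_order.1 h1).2 (ε / 2) (by positivity)] with m hDm hXm hCm hm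
  obtain ⟨hDX, hXX⟩ := hXm
  have h2 : |∫ ω, D m ω ^ 2 ∂μ - ∫ ω, X m ω ^ 2 ∂μ| ≤
      (1 + l⁻¹) * ∫ ω, (D m ω - X m ω) ^ 2 ∂μ + l * ∫ ω, X m ω ^ 2 ∂μ := by
    rw [← integral_sub hDm hXX, ← integral_const_mul, ← integral_const_mul,
      ← integral_add (hDX.const_mul _) (hXX.const_mul _)]
    refine abs_integral_le_integral_abs.trans (integral_mono (hDm.sub hXX).abs
      ((hDX.const_mul _).add (hXX.const_mul _)) fun ω => ?_)
    have e1 : D m ω ^ 2 - X m ω ^ 2 =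
      (D m ω - X m ω) ^ 2 + 2 * (X m ω * (D m ω - X m ω)) := by ring
    have e2 : 2 * |X m ω * (D m ω - X m ω)| ≤ l⁻¹ * (D m ω - X m ω) ^ 2 + l * X m ω ^ 2 := by
      have := sq_nonneg (l * |X m ω| - |D m ω - X m ω|)
      rw [abs_mul, ← sq_abs (X m ω), ← sq_abs (D m ω - X m ω)]
      have e3 : l⁻¹ * |D m ω - X m ω| ^ 2 + l * |X m ω| ^ 2 - 2 * (|X m ω| * |D m ω - X m ω|) =
          l⁻¹ * (l * |X m ω| - |D m ω - X m ω|) ^ 2 := by field_simp; ring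
      have : 0 ≤ l⁻¹ * (l * |X m ω| - |D m ω - X m ω|) ^ 2 := by positivity
      linarith
    simp only [e1]
    refine (abs_add_le _ _).trans ?_
    rw [abs_of_nonneg (sq_nonneg _), abs_mul, abs_two]
    linarith
  have h3 : l * C ≤ ε / 2 := by
    rw [hl, div_mul_eq_mul_div, div_le_div_iff₀ (by positivity) (by positivity)]
    nlinarith
  rw [Function.comp_apply, abs_mul, Nat.abs_cast]
  calc _ ≤ m * ((1 + l⁻¹) * ∫ ω, (D m ω - X m ω) ^ 2 ∂μ + l * ∫ ω, X m ω ^ 2 ∂μ) := by gcongr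
    _ = (1 + l⁻¹) * (m * ∫ ω, (D m ω - X m ω) ^ 2 ∂μ) + l * (m * ∫ ω, X m ω ^ 2 ∂μ) := by ring
    _ ≤ (1 + l⁻¹) * (m * ∫ ω, (D m ω - X m ω) ^ 2 ∂μ) + l * C := by gcongr
    _ < ε := by linarith

/-- The mean squared change of the plug-in due to the estimation of the parameter. -/
theorem SmoothScore.tendsto_integral_sq_plugDiff (hS : SmoothScore μ Y K η c A H L)
    (hf : SmoothPlugIn K η f α k)
    (h : MomentBound μ Y q B) (hYm : ∀ j, Measurable (Y j)) (hY : iIndepFun Y μ)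
    {est : ℕ → Ω → ι → ℝ} (hem : ∀ m, Measurable (est m)) (heK : ∀ m ω, est m ω ∈ K)
    (he : ∀ m ω, (∃ x ∈ K, scoreSum c m x (fun j => Y j ω) = 0) →
      scoreSum c m (est m ω) (fun j => Y j ω) = 0) (i : ℕ) :
    (∀ m, Integrable (fun ω => plugDiff f η (est m ω) (Y i ω) ^ 2) μ) ∧
    Tendsto (fun m : ℕ => m * (∫ ω, plugDiff f η (est m ω) (Y i ω) ^ 2 ∂μ -
      ∑ a, ∑ b, (∫ ω, plugGrad α (Y i ω) a * plugGrad α (Y i ω) b ∂μ) *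
        (∑ j ∈ Finset.range m, H j)⁻¹ b a)) atTop (𝓝 0) := by
  have hDint : ∀ m, Integrable (fun ω => plugDiff f η (est m ω) (Y i ω) ^ 2) μ := fun m => by
    have hYi := hYm i
    have h0 := (hf.measurable 0).comp (hem m)
    have h1 := (hf.measurable 1).comp (hem m)
    have hDm : Measurable fun ω => plugDiff f η (est m ω) (Y i ω) :=
      (h0.sub_const _).add (hYi.mul (h1.sub_const _))
    exact Integrable.mono' ((h.integrable_one_add_sq hYm i).const_mul (2 * k ^ 2))
      (hDm.pow_const 2).aestronglyMeasurable (Eventually.of_forall fun ω => by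
        rw [Real.norm_of_nonneg (sq_nonneg _)]; exact hf.sq_plugDiff_le (heK m ω) _)
  refine ⟨hDint, ?_⟩
  obtain ⟨h1, ⟨C, h2⟩, h3⟩ := hS.tendsto_plugDiff_sub (i := i) hf h hYm hY hem heK he
  have h4 := tendsto_mul_integral_sub (Eventually.of_forall hDint) h1 h2 h3
  obtain ⟨Λ, hΛ, hU, -⟩ := hS.exists_expansion h hYm hY i
  have h5 := tendsto_mul_sum_inv hΛ hU
    (Matrix.of fun a b => ∫ ω, plugGrad α (Y i ω) a * plugGrad α (Y i ω) b ∂μ) (H i)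
  have h6 := h4.sub h5
  rw [sub_zero] at h6
  refine h6.congr' ?_
  filter_upwards [hU, eventually_gt_atTop i] with m hUm him
  have hm : (0 : ℝ) < m := by exact_mod_cast (by omega : 0 < m)
  have hdet := isUnit_det_of_le (by positivity : 0 < Λ * m) hUm
  -- With the full sum `U`, `U⁻¹ (U - H i) U⁻ᵗ = U⁻ᵗ - U⁻¹ (H i) U⁻ᵗ`. The transpose explains the
  -- order of indices in the limit, and symmetry of `U` is not needed.
  have e1 : ∑ j ∈ (Finset.range m).erase i, H j = ∑ j ∈ Finset.range m, H j - H i := by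
    rw [← Finset.sum_erase_add _ _ (Finset.mem_range.2 him)]; abel
  rw [hS.integral_sq_linear hf h hYm hY m, e1, Matrix.mul_sub, Matrix.nonsing_inv_mul _ hdet,
    Matrix.sub_mul, Matrix.one_mul]
  simp only [Matrix.sub_apply, Matrix.transpose_apply, mul_sub, Finset.sum_sub_distrib,
    Matrix.of_apply]
  ring

end PlugIn

end NEFQVF

namespace NEFQVF

/-! ### Uniform smoothness on compact sets -/

/-- All areas evaluate the same few functions of `(n, t, ν)` at points of one compact convex set, so
estimates on that set hold uniformly over the areas. The function is `C²`, so its derivative is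
Lipschitz there, which gives strict differentiability with a rate common to all base points. -/
theorem exists_uniform_bounds {Z : Type*} [NormedAddCommGroup Z] [NormedSpace ℝ Z] {O C : Set Z}
    (hO : IsOpen O) (hC : IsCompact C) (hconv : Convex ℝ C) (hCO : C ⊆ O) {V : Z → ℝ}
    (hV : ContDiffOn ℝ 2 V O) :
    ∃ L : ℝ, 0 ≤ L ∧ (∀ z ∈ C, |V z| ≤ L) ∧ (∀ z ∈ C, ∀ w ∈ C, |V z - V w| ≤ L * ‖z - w‖) ∧
      (∀ z ∈ C, ‖fderiv ℝ V z‖ ≤ L) ∧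
      ∀ ζ ∈ C, ∀ z ∈ C, ∀ w ∈ C, ∀ ε, ‖z - ζ‖ ≤ ε → ‖w - ζ‖ ≤ ε →
        |V z - V w - fderiv ℝ V ζ (z - w)| ≤ L * ε * ‖z - w‖ := by
  have hV1 : ContDiffOn ℝ 1 V C := (hV.mono hCO).of_le (by norm_num)
  have hV' : ContDiffOn ℝ 1 (fderiv ℝ V) O := hV.fderiv_of_isOpen hO (by norm_num)
  obtain ⟨L₁, hL₁⟩ := hC.exists_bound_of_continuousOn (hV.mono hCO).continuousOn
  obtain ⟨L₂, hL₂⟩ := hV1.exists_lipschitzOnWith one_ne_zero hconv hC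
  obtain ⟨L₃, hL₃⟩ := hC.exists_bound_of_continuousOn (hV'.mono hCO).continuousOn
  obtain ⟨L₄, hL₄⟩ := (hV'.mono hCO).exists_lipschitzOnWith one_ne_zero hconv hC
  have h2 : (0 : ℝ) ≤ L₂ := L₂.2
  have h4 : (0 : ℝ) ≤ L₄ := L₄.2
  have h1 := abs_nonneg L₁
  have h3 := abs_nonneg L₃
  have hL1 := le_abs_self L₁
  have hL3 := le_abs_self L₃
  refine ⟨|L₁| + L₂ + |L₃| + L₄, by positivity, fun z hz => ?_, fun z hz w hw => ?_,
    fun z hz => ?_, fun ζ hζ z hz w hw ε hzε hwε => ?_⟩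
  · have := hL₁ z hz
    rw [Real.norm_eq_abs] at this
    linarith
  · have := hL₂.norm_sub_le hz hw
    rw [Real.norm_eq_abs] at this
    exact this.trans (mul_le_mul_of_nonneg_right (by linarith) (norm_nonneg _))
  · have := hL₃ z hz
    linarith
  · have hs : Convex ℝ (C ∩ Metric.closedBall ζ ε) := hconv.inter (convex_closedBall _ _)
    have hε : 0 ≤ ε := (norm_nonneg _).trans hzε
    have := hs.norm_image_sub_le_of_norm_hasFDerivWithin_le' (f := V) (f' := fderiv ℝ V)
      (φ := fderiv ℝ V ζ) (C := L₄ * ε) (x := w) (y := z) (fun u hu =>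
        (((hV.differentiableOn (by norm_num)).differentiableAt
          (hO.mem_nhds (hCO hu.1))).hasFDerivAt).hasFDerivWithinAt) (fun u hu =>
        (hL₄.norm_sub_le hu.1 hζ).trans (mul_le_mul_of_nonneg_left
          (by rw [← dist_eq_norm]; exact hu.2) h4))
      ⟨hw, by rwa [Metric.mem_closedBall, dist_eq_norm]⟩
      ⟨hz, by rwa [Metric.mem_closedBall, dist_eq_norm]⟩
    rw [Real.norm_eq_abs] at this
    refine this.trans ?_
    gcongr
    linarith

/-! ### The coefficients of the estimating function -/

/-- The factor `φ`. -/
noncomputable def phiOf (v n ν : ℝ) : ℝ := (1 + ν / n) / (ν - v)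

/-- The first column of `Dᵗ`, without the covariates. -/
noncomputable def dOne (κ : Fin 2) (q : ℝ) : ℝ := ![q, 0] κ

/-- The second column of `Dᵗ`, without the covariates. -/
noncomputable def dTwo (κ : Fin 2) (v n ν q q' : ℝ) : ℝ :=
  ![q * (q' * phiOf v n ν), -(q * ((1 + v / n) / (ν - v) ^ 2))] κ

/-- The first column of `Dᵗ Σ⁻¹`, without the covariates. -/
noncomputable def wOne (κ : Fin 2) (v n ν q q' : ℝ) : ℝ :=
  (dOne κ q * (muFour v n ν q q' - muTwo v n ν q ^ 2) - dTwo κ v n ν q q' * muThree v n ν q q') /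
    detSig v n ν q q'

/-- The second column of `Dᵗ Σ⁻¹`, without the covariates. -/
noncomputable def wTwo (κ : Fin 2) (v n ν q q' : ℝ) : ℝ :=
  (dTwo κ v n ν q q' * muTwo v n ν q - dOne κ q * muThree v n ν q q') / detSig v n ν q q'

/-- The coefficient of `y ^ r` in the estimating function, without the covariates. -/
noncomputable def coefV (κ : Fin 2) (r : Fin 3) (v n ν m q q' : ℝ) : ℝ :=
  ![wTwo κ v n ν q q' * (m ^ 2 - phiOf v n ν * q) - wOne κ v n ν q q' * m,
    wOne κ v n ν q q' - 2 * m * wTwo κ v n ν q q', wTwo κ v n ν q q'] r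

theorem sum_coefV (κ : Fin 2) (v n ν m q q' a b : ℝ) :
    coefV κ 0 v n ν m q q' + a * coefV κ 1 v n ν m q q' + b * coefV κ 2 v n ν m q q' =
      wOne κ v n ν q q' * (a - m) +
        wTwo κ v n ν q q' * (b - 2 * a * m + m ^ 2 - phiOf v n ν * q) := by
  simp only [coefV, Matrix.cons_val_zero, Matrix.cons_val_one, Matrix.cons_val]
  ring

/-- This is the unbiasedness of the second elementary estimating function. -/
theorem muTwo_eq {v n ν q : ℝ} (hn : n ≠ 0) : muTwo v n ν q = phiOf v n ν * q := by
  unfold muTwo phiOf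
  field_simp

section Smooth

variable {Z : Type*} [NormedAddCommGroup Z] [NormedSpace ℝ Z] {v : ℝ} {n ν m q q' : Z → ℝ} {z : Z}
  {k : WithTop ℕ∞}

theorem contDiffAt_phiOf (hn : ContDiffAt ℝ k n z) (hν : ContDiffAt ℝ k ν z) (h0 : n z ≠ 0)
    (h1 : ν z - v ≠ 0) : ContDiffAt ℝ k (fun z => phiOf v (n z) (ν z)) z := by
  unfold phiOf
  exact (contDiffAt_const.add (hν.div hn h0)).div (hν.sub contDiffAt_const) h1

theorem contDiffAt_muTwo (hn : ContDiffAt ℝ k n z) (hν : ContDiffAt ℝ k ν z)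
    (hq : ContDiffAt ℝ k q z) (h0 : n z ≠ 0)
    (h1 : ν z - v ≠ 0) : ContDiffAt ℝ k (fun z => muTwo v (n z) (ν z) (q z)) z := by
  unfold muTwo
  exact ContDiffAt.div (by fun_prop) (by fun_prop) (mul_ne_zero h0 h1)

theorem contDiffAt_muThree (hn : ContDiffAt ℝ k n z) (hν : ContDiffAt ℝ k ν z)
    (hq : ContDiffAt ℝ k q z) (hq' : ContDiffAt ℝ k q' z) (h0 : n z ≠ 0)
    (h1 : ν z - v ≠ 0) (h2 : ν z - 2 * v ≠ 0) :
    ContDiffAt ℝ k (fun z => muThree v (n z) (ν z) (q z) (q' z)) z := by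
  unfold muThree
  exact ContDiffAt.div (by fun_prop) (by fun_prop)
    (mul_ne_zero (pow_ne_zero 2 h0) (mul_ne_zero h1 h2))

theorem contDiffAt_muFour (hn : ContDiffAt ℝ k n z) (hν : ContDiffAt ℝ k ν z)
    (hq : ContDiffAt ℝ k q z) (hq' : ContDiffAt ℝ k q' z) (h0 : n z ≠ 0)
    (h1 : ν z - v ≠ 0) (h2 : ν z - 2 * v ≠ 0) (h3 : ν z - 3 * v ≠ 0) :
    ContDiffAt ℝ k (fun z => muFour v (n z) (ν z) (q z) (q' z)) z := by
  unfold muFour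
  exact ContDiffAt.div (by fun_prop) (by fun_prop)
    (mul_ne_zero (pow_ne_zero 3 h0) (mul_ne_zero (mul_ne_zero h1 h2) h3))

theorem contDiffAt_detSig (hn : ContDiffAt ℝ k n z) (hν : ContDiffAt ℝ k ν z)
    (hq : ContDiffAt ℝ k q z) (hq' : ContDiffAt ℝ k q' z) (h0 : n z ≠ 0)
    (h1 : ν z - v ≠ 0) (h2 : ν z - 2 * v ≠ 0) (h3 : ν z - 3 * v ≠ 0) :
    ContDiffAt ℝ k (fun z => detSig v (n z) (ν z) (q z) (q' z)) z := by
  unfold detSig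
  exact ContDiffAt.div (by fun_prop) (by fun_prop)
    (mul_ne_zero (pow_ne_zero 4 h0) (mul_ne_zero (mul_ne_zero (pow_ne_zero 3 h1)
      (pow_ne_zero 2 h2)) h3))

theorem contDiffAt_dOne (κ : Fin 2) (hq : ContDiffAt ℝ k q z) :
    ContDiffAt ℝ k (fun z => dOne κ (q z)) z := by
  fin_cases κ
  · simpa [dOne] using hq
  · simpa [dOne] using contDiffAt_const

theorem contDiffAt_dTwo (κ : Fin 2) (hn : ContDiffAt ℝ k n z) (hν : ContDiffAt ℝ k ν z)
    (hq : ContDiffAt ℝ k q z) (hq' : ContDiffAt ℝ k q' z) (h0 : n z ≠ 0) (h1 : ν z - v ≠ 0) :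
    ContDiffAt ℝ k (fun z => dTwo κ v (n z) (ν z) (q z) (q' z)) z := by
  fin_cases κ
  · simpa [dTwo] using hq.mul (hq'.mul (contDiffAt_phiOf hn hν h0 h1))
  · have : ContDiffAt ℝ k (fun z => -(q z * ((1 + v / n z) / (ν z - v) ^ 2))) z :=
      (hq.mul ((contDiffAt_const.add (contDiffAt_const.div hn h0)).div
        ((hν.sub contDiffAt_const).pow 2) (pow_ne_zero 2 h1))).neg
    simpa [dTwo] using this

theorem contDiffAt_wOne_wTwo (κ : Fin 2) (hn : ContDiffAt ℝ k n z) (hν : ContDiffAt ℝ k ν z)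
    (hq : ContDiffAt ℝ k q z) (hq' : ContDiffAt ℝ k q' z) (h0 : 0 < n z) (h0' : 0 < n z + v)
    (h1 : 0 < ν z) (h2 : 3 * v < ν z) (h3 : 0 < q z) :
    ContDiffAt ℝ k (fun z => wOne κ v (n z) (ν z) (q z) (q' z)) z ∧
    ContDiffAt ℝ k (fun z => wTwo κ v (n z) (ν z) (q z) (q' z)) z := by
  have e1 : ν z - v ≠ 0 := by linarith
  have e2 : ν z - 2 * v ≠ 0 := by linarith
  have e3 : ν z - 3 * v ≠ 0 := by linarith
  have hdet := contDiffAt_detSig (v := v) hn hν hq hq' h0.ne' e1 e2 e3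
  have hne := (detSig_pos (q' := q' z) h0 h0' h1 h2 h3).ne'
  have hd1 := contDiffAt_dOne κ hq
  have hd2 := contDiffAt_dTwo (v := v) κ hn hν hq hq' h0.ne' e1
  have hm2 := contDiffAt_muTwo (v := v) hn hν hq h0.ne' e1
  have hm3 := contDiffAt_muThree (v := v) hn hν hq hq' h0.ne' e1 e2
  have hm4 := contDiffAt_muFour (v := v) hn hν hq hq' h0.ne' e1 e2 e3
  exact ⟨((hd1.mul (hm4.sub (hm2.pow 2))).sub (hd2.mul hm3)).div hdet hne,
    ((hd2.mul hm2).sub (hd1.mul hm3)).div hdet hne⟩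

theorem contDiffAt_coefV (κ : Fin 2) (r : Fin 3) (hn : ContDiffAt ℝ k n z)
    (hν : ContDiffAt ℝ k ν z) (hm : ContDiffAt ℝ k m z)
    (hq : ContDiffAt ℝ k q z) (hq' : ContDiffAt ℝ k q' z) (h0 : 0 < n z) (h0' : 0 < n z + v)
    (h1 : 0 < ν z) (h2 : 3 * v < ν z) (h3 : 0 < q z) :
    ContDiffAt ℝ k (fun z => coefV κ r v (n z) (ν z) (m z) (q z) (q' z)) z := by
  obtain ⟨hw1, hw2⟩ := contDiffAt_wOne_wTwo κ hn hν hq hq' h0 h0' h1 h2 h3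
  have hφ := contDiffAt_phiOf (v := v) hn hν h0.ne' (by linarith)
  fin_cases r
  · have := (hw2.mul ((hm.pow 2).sub (hφ.mul hq))).sub (hw1.mul hm)
    simpa [coefV] using this
  · have := hw1.sub ((contDiffAt_const (c := (2 : ℝ))).mul hm |>.mul hw2)
    simpa [coefV] using this
  · simpa [coefV] using hw2

end Smooth

theorem hasDerivAt_phiOf {v n ν : ℝ} (hn : n ≠ 0) (hν : ν - v ≠ 0) :
    HasDerivAt (phiOf v n) (-((1 + v / n) / (ν - v) ^ 2)) ν := by
  unfold phiOf
  refine ((((hasDerivAt_id ν).div_const n).const_add 1).div ((hasDerivAt_id ν).sub_const v)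
    hν).congr_deriv ?_
  simp only [id]
  field_simp
  ring

/-- The weights solve the linear equations that define `Dᵗ Σ⁻¹`. -/
theorem weights_mul {κ : Fin 2} {v n ν q q' : ℝ} (hn : 0 < n) (hnv : 0 < n + v) (hν : 0 < ν)
    (hν' : 3 * v < ν) (hq : 0 < q) :
    wOne κ v n ν q q' * muTwo v n ν q + wTwo κ v n ν q q' * muThree v n ν q q' = dOne κ q ∧
    wOne κ v n ν q q' * muThree v n ν q q' +
      wTwo κ v n ν q q' * (muFour v n ν q q' - muTwo v n ν q ^ 2) = dTwo κ v n ν q q' := by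
  have hdet := detSig_eq (v := v) (q := q) (q' := q') hn.ne' (by linarith : ν - v ≠ 0)
    (by linarith : ν - 2 * v ≠ 0) (by linarith : ν - 3 * v ≠ 0)
  have hne := (detSig_pos (q' := q') hn hnv hν hν' hq).ne'
  unfold wOne wTwo
  rw [← hdet] at hne ⊢
  constructor <;> · field_simp; ring

end NEFQVF

/-! ### Derivatives of the score coefficients in the parameter. -/

namespace NEFQVF
namespace AreaModel

variable {p : ℕ} (M : AreaModel p)

/-- The coefficients of the estimating function as functions of `(n, t, ν)`, where `t` is the linear
predictor. -/
noncomputable def coefAt (κ : Fin 2) (r : Fin 3) (z : ℝ × ℝ × ℝ) : ℝ :=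
  coefV κ r M.v₂ z.1 z.2.2 (deriv M.ψ z.2.1) (M.Q (deriv M.ψ z.2.1)) (M.Q' (deriv M.ψ z.2.1))

/-- The triples `(n, t, ν)` for which the estimating function is defined. -/
def domain : Set (ℝ × ℝ × ℝ) :=
  {z | 0 < z.1 ∧ 0 < z.1 + M.v₂ ∧ z.2.1 ∈ M.Θ ∧ 0 < z.2.2 ∧ 3 * M.v₂ < z.2.2}

variable {M}

theorem isOpen_domain (hM : M.IsNEFQVF) : IsOpen M.domain := by
  have h1 : Continuous fun z : ℝ × ℝ × ℝ => z.1 := by fun_prop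
  have h2 : Continuous fun z : ℝ × ℝ × ℝ => z.1 + M.v₂ := by fun_prop
  have h3 : Continuous fun z : ℝ × ℝ × ℝ => z.2.1 := by fun_prop
  have h4 : Continuous fun z : ℝ × ℝ × ℝ => z.2.2 := by fun_prop
  exact (isOpen_lt continuous_const h1).inter ((isOpen_lt continuous_const h2).inter
    ((hM.isOpen.preimage h3).inter ((isOpen_lt continuous_const h4).inter
      (isOpen_lt continuous_const h4))))

theorem contDiffAt_deriv_ψ (hM : M.IsNEFQVF) {t : ℝ} (ht : t ∈ M.Θ) {k : WithTop ℕ∞} :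
    ContDiffAt ℝ k (deriv M.ψ) t :=
  (analyticOnNhd_deriv_ψ hM t ht).contDiffAt

theorem contDiff_Q {k : WithTop ℕ∞} : ContDiff ℝ k M.Q := by
  unfold Q; fun_prop

theorem contDiff_Q' {k : WithTop ℕ∞} : ContDiff ℝ k M.Q' := by
  unfold Q'; fun_prop

theorem contDiffAt_coefAt (hM : M.IsNEFQVF) (κ : Fin 2) (r : Fin 3) {z : ℝ × ℝ × ℝ}
    (hz : z ∈ M.domain) {k : WithTop ℕ∞} : ContDiffAt ℝ k (M.coefAt κ r) z := by
  obtain ⟨h0, h0', ht, h1, h2⟩ := hz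
  have hm : ContDiffAt ℝ k (fun z : ℝ × ℝ × ℝ => deriv M.ψ z.2.1) z :=
    ContDiffAt.comp (g := deriv M.ψ) (f := fun z : ℝ × ℝ × ℝ => z.2.1) z
      (contDiffAt_deriv_ψ hM ht) (by fun_prop)
  exact contDiffAt_coefV (n := fun z : ℝ × ℝ × ℝ => z.1) (ν := fun z : ℝ × ℝ × ℝ => z.2.2) κ r
    (by fun_prop) (by fun_prop) hm (contDiff_Q.contDiffAt.comp z hm)
    (contDiff_Q'.contDiffAt.comp z hm) h0 h0' h1 h2 (Q_pos hM ht)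

theorem contDiffOn_coefAt (hM : M.IsNEFQVF) (κ : Fin 2) (r : Fin 3) {k : WithTop ℕ∞} :
    ContDiffOn ℝ k (M.coefAt κ r) M.domain := fun _ hz =>
  (contDiffAt_coefAt hM κ r hz).contDiffWithinAt

/-- The directional derivative of the expected estimating function at the true parameter. -/
theorem sum_fderiv_coefAt (hM : M.IsNEFQVF) (κ : Fin 2) {n t ν : ℝ} (hz : (n, t, ν) ∈ M.domain)
    (e : ℝ × ℝ) {m' p' : ℝ}
    (hm : HasDerivAt (fun s : ℝ => deriv M.ψ (t + s * e.1)) m' 0)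
    (hp : HasDerivAt (fun s : ℝ => phiOf M.v₂ n (ν + s * e.2) * M.Q (deriv M.ψ (t + s * e.1))) p' 0)
    {b : ℝ} (hb : b = muTwo M.v₂ n ν (M.Q (deriv M.ψ t)) + deriv M.ψ t ^ 2) :
    fderiv ℝ (M.coefAt κ 0) (n, t, ν) (0, e.1, e.2) +
      deriv M.ψ t * fderiv ℝ (M.coefAt κ 1) (n, t, ν) (0, e.1, e.2) +
      b * fderiv ℝ (M.coefAt κ 2) (n, t, ν) (0, e.1, e.2) =
    -(wOne κ M.v₂ n ν (M.Q (deriv M.ψ t)) (M.Q' (deriv M.ψ t)) * m' +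
      wTwo κ M.v₂ n ν (M.Q (deriv M.ψ t)) (M.Q' (deriv M.ψ t)) * p') := by
  have hd : ∀ r, HasDerivAt (fun s : ℝ => M.coefAt κ r ((n, t, ν) + s • (0, e.1, e.2)))
      (fderiv ℝ (M.coefAt κ r) (n, t, ν) (0, e.1, e.2)) 0 := fun r =>
    ((contDiffAt_coefAt (k := 1) hM κ r hz).differentiableAt one_ne_zero).hasFDerivAt.hasLineDerivAt _
  have h1 := ((hd 0).add ((hd 1).const_mul (deriv M.ψ t))).add ((hd 2).const_mul b)
  obtain ⟨h0, h0', ht, hν, hν'⟩ := hz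
  simp only at h0 h0' ht hν hν'
  set m : ℝ → ℝ := fun s => deriv M.ψ (t + s * e.1) with hmdef
  have hm0 : m 0 = deriv M.ψ t := by simp [hmdef]
  have hmc : ContDiffAt ℝ 1 m 0 :=
    ContDiffAt.comp (g := deriv M.ψ) (f := fun s : ℝ => t + s * e.1) 0
      (by simpa using contDiffAt_deriv_ψ hM ht) (by fun_prop)
  obtain ⟨hw1, hw2⟩ := contDiffAt_wOne_wTwo (v := M.v₂) (n := fun _ : ℝ => n)
    (ν := fun s : ℝ => ν + s * e.2) (q := fun s => M.Q (m s)) (q' := fun s => M.Q' (m s)) (z := 0) κ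
    (k := 1) contDiffAt_const (by fun_prop) (contDiff_Q.contDiffAt.comp 0 hmc)
    (contDiff_Q'.contDiffAt.comp 0 hmc) h0 h0' (by simpa using hν) (by simpa using hν')
    (by rw [hm0]; exact Q_pos hM ht)
  have hw1' := (hw1.differentiableAt one_ne_zero).hasDerivAt
  have hw2' := (hw2.differentiableAt one_ne_zero).hasDerivAt
  have ha : HasDerivAt (fun s => deriv M.ψ t - m s) (-m') 0 := hm.const_sub _
  have hbb : HasDerivAt (fun s => b - 2 * deriv M.ψ t * m s + m s ^ 2 -
      phiOf M.v₂ n (ν + s * e.2) * M.Q (m s)) (-p') 0 := by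
    refine ((((hm.const_mul (2 * deriv M.ψ t)).const_sub b).add (hm.pow 2)).sub hp).congr_deriv ?_
    rw [hm0]; push_cast; ring
  have h2 := (hw1'.mul ha).add (hw2'.mul hbb)
  have e1 : (fun s : ℝ => M.coefAt κ 0 ((n, t, ν) + s • (0, e.1, e.2)) +
      deriv M.ψ t * M.coefAt κ 1 ((n, t, ν) + s • (0, e.1, e.2)) +
      b * M.coefAt κ 2 ((n, t, ν) + s • (0, e.1, e.2))) = fun s =>
      wOne κ M.v₂ n (ν + s * e.2) (M.Q (m s)) (M.Q' (m s)) * (deriv M.ψ t - m s) +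
      wTwo κ M.v₂ n (ν + s * e.2) (M.Q (m s)) (M.Q' (m s)) * (b - 2 * deriv M.ψ t * m s + m s ^ 2 -
      phiOf M.v₂ n (ν + s * e.2) * M.Q (m s)) := by
    funext s
    -- The moments of `y` are frozen at the true parameter, so the combination is weights times the
    -- bias of the elementary estimating functions at the perturbed parameter.
    simp only [coefAt, Prod.mk_add_mk, Prod.smul_mk, smul_eq_mul, mul_zero, add_zero]
    exact sum_coefV κ _ _ _ _ _ _ _ _
  have h1' : HasDerivAt (fun s : ℝ => M.coefAt κ 0 ((n, t, ν) + s • (0, e.1, e.2)) +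
      deriv M.ψ t * M.coefAt κ 1 ((n, t, ν) + s • (0, e.1, e.2)) +
      b * M.coefAt κ 2 ((n, t, ν) + s • (0, e.1, e.2))) _ 0 := h1
  rw [e1] at h1'
  refine (h1'.unique h2).trans ?_
  -- At the truth both bias factors vanish, so the derivatives of the weights drop out and only
  -- those of the elementary functions remain.
  have hz1 : b - 2 * deriv M.ψ t * m 0 + m 0 ^ 2 - phiOf M.v₂ n (ν + 0 * e.2) * M.Q (m 0) = 0 := by
    rw [hm0, hb, muTwo_eq h0.ne', zero_mul, add_zero]; ring
  beta_reduce
  rw [hz1, hm0]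
  simp only [zero_mul, add_zero, sub_self, mul_zero, zero_add]
  ring

/-- In the direction of the linear predictor the mean moves by `Q` and `φ Q` by `φ Q' Q`: up to the
covariate, a row of `Dᵗ`. -/
theorem sum_fderiv_coefAt_t (hM : M.IsNEFQVF) (κ : Fin 2) {n t ν : ℝ} (hz : (n, t, ν) ∈ M.domain)
    {b : ℝ} (hb : b = muTwo M.v₂ n ν (M.Q (deriv M.ψ t)) + deriv M.ψ t ^ 2) :
    fderiv ℝ (M.coefAt κ 0) (n, t, ν) (0, 1, 0) +
      deriv M.ψ t * fderiv ℝ (M.coefAt κ 1) (n, t, ν) (0, 1, 0) +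
      b * fderiv ℝ (M.coefAt κ 2) (n, t, ν) (0, 1, 0) =
    -(wOne κ M.v₂ n ν (M.Q (deriv M.ψ t)) (M.Q' (deriv M.ψ t)) * dOne 0 (M.Q (deriv M.ψ t)) +
      wTwo κ M.v₂ n ν (M.Q (deriv M.ψ t)) (M.Q' (deriv M.ψ t)) *
        dTwo 0 M.v₂ n ν (M.Q (deriv M.ψ t)) (M.Q' (deriv M.ψ t))) := by
  have ht : t ∈ M.Θ := hz.2.2.1
  have h1 : HasDerivAt (fun s : ℝ => t + s * 1) 1 0 := by
    simpa using ((hasDerivAt_id (0 : ℝ)).mul_const 1).const_add t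
  have hm : HasDerivAt (fun s : ℝ => deriv M.ψ (t + s * 1)) (M.Q (deriv M.ψ t)) 0 := by
    have h2 : HasDerivAt (deriv M.ψ) (M.Q (deriv M.ψ t)) (t + 0 * 1) := by
      simpa using hasDerivAt_deriv_ψ hM ht
    exact (h2.comp (0 : ℝ) h1).congr_deriv (mul_one _)
  have hQ : HasDerivAt M.Q (M.Q' (deriv M.ψ t)) (deriv M.ψ (t + 0 * 1)) := by
    simp only [zero_mul, add_zero]
    unfold Q Q'
    exact ((((hasDerivAt_id _).const_mul M.v₁).const_add M.v₀).add
      (((hasDerivAt_id _).pow 2).const_mul M.v₂)).congr_deriv (by simp; ring)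
  refine sum_fderiv_coefAt hM κ hz (1, 0) hm (p' := dTwo 0 M.v₂ n ν (M.Q (deriv M.ψ t))
    (M.Q' (deriv M.ψ t))) ?_ hb
  simp only [mul_zero, add_zero]
  refine ((hQ.comp (0 : ℝ) hm).const_mul (phiOf M.v₂ n ν)).congr_deriv ?_
  simp [dTwo]
  ring

theorem sum_fderiv_coefAt_nu (hM : M.IsNEFQVF) (κ : Fin 2) {n t ν : ℝ} (hz : (n, t, ν) ∈ M.domain)
    {b : ℝ} (hb : b = muTwo M.v₂ n ν (M.Q (deriv M.ψ t)) + deriv M.ψ t ^ 2) :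
    fderiv ℝ (M.coefAt κ 0) (n, t, ν) (0, 0, 1) +
      deriv M.ψ t * fderiv ℝ (M.coefAt κ 1) (n, t, ν) (0, 0, 1) +
      b * fderiv ℝ (M.coefAt κ 2) (n, t, ν) (0, 0, 1) =
    -(wOne κ M.v₂ n ν (M.Q (deriv M.ψ t)) (M.Q' (deriv M.ψ t)) * dOne 1 (M.Q (deriv M.ψ t)) +
      wTwo κ M.v₂ n ν (M.Q (deriv M.ψ t)) (M.Q' (deriv M.ψ t)) *
        dTwo 1 M.v₂ n ν (M.Q (deriv M.ψ t)) (M.Q' (deriv M.ψ t))) := by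
  obtain ⟨h0, -, -, hν, hν'⟩ := id hz
  simp only at h0 hν hν'
  have h1 : HasDerivAt (fun s : ℝ => ν + s * 1) 1 0 := by
    simpa using ((hasDerivAt_id (0 : ℝ)).mul_const 1).const_add ν
  have hφ : HasDerivAt (phiOf M.v₂ n) (-((1 + M.v₂ / n) / (ν - M.v₂) ^ 2)) (ν + 0 * 1) := by
    simpa using hasDerivAt_phiOf (v := M.v₂) h0.ne' (by linarith : ν - M.v₂ ≠ 0)
  refine sum_fderiv_coefAt hM κ hz (0, 1) (m' := dOne 1 (M.Q (deriv M.ψ t)))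
    (p' := dTwo 1 M.v₂ n ν (M.Q (deriv M.ψ t)) (M.Q' (deriv M.ψ t))) ?_ ?_ hb
  · simpa [dOne] using hasDerivAt_const (0 : ℝ) (deriv M.ψ t)
  · simp only [mul_zero, add_zero]
    refine ((hφ.comp (0 : ℝ) h1).mul_const (M.Q (deriv M.ψ t))).congr_deriv ?_
    simp [dTwo]
    ring

end AreaModel
end NEFQVF

/-! ### The score as a polynomial in the data, and its information identity. -/

namespace NEFQVF
namespace AreaModel

variable {p : ℕ} {M : AreaModel p}

theorem integral_quartic (hM : M.IsNEFQVF) {j : ℕ} {η : Params p} (h : M.Admissible j η)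
    (c₀ c₁ c₂ c₃ c₄ : ℝ) :
    Integrable (fun z : ℝ × ℝ => c₀ + c₁ * (z.2 - M.mean j η) + c₂ * (z.2 - M.mean j η) ^ 2 +
      c₃ * (z.2 - M.mean j η) ^ 3 + c₄ * (z.2 - M.mean j η) ^ 4) (M.areaLaw j η) ∧
    ∫ z : ℝ × ℝ, (c₀ + c₁ * (z.2 - M.mean j η) + c₂ * (z.2 - M.mean j η) ^ 2 +
      c₃ * (z.2 - M.mean j η) ^ 3 + c₄ * (z.2 - M.mean j η) ^ 4) ∂(M.areaLaw j η) =
      c₀ + c₂ * M.mu 2 j η + c₃ * M.mu 3 j η + c₄ * M.mu 4 j η := by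
  have hprob := isProbabilityMeasure_areaLaw hM h.mem h.nu_pos
  have hi : ∀ k ≤ 4, Integrable (fun z : ℝ × ℝ => (z.2 - M.mean j η) ^ k) (M.areaLaw j η) :=
    fun k hk => by simpa using integrable_jmom hM h (a := 0) (b := k) (by omega)
  have h1 : Integrable (fun z : ℝ × ℝ => z.2 - M.mean j η) (M.areaLaw j η) := by
    simpa using hi 1 (by norm_num)
  have hz : ∫ z : ℝ × ℝ, (z.2 - M.mean j η) ∂(M.areaLaw j η) = 0 := by
    simpa [jmom] using (jmom_values hM h).2.1
  have i1 : Integrable (fun z : ℝ × ℝ => c₀ + c₁ * (z.2 - M.mean j η)) (M.areaLaw j η) :=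
    (integrable_const c₀).add (h1.const_mul c₁)
  have i2 : Integrable (fun z : ℝ × ℝ => c₀ + c₁ * (z.2 - M.mean j η) +
      c₂ * (z.2 - M.mean j η) ^ 2) (M.areaLaw j η) := i1.add ((hi 2 (by norm_num)).const_mul c₂)
  have i3 : Integrable (fun z : ℝ × ℝ => c₀ + c₁ * (z.2 - M.mean j η) +
      c₂ * (z.2 - M.mean j η) ^ 2 + c₃ * (z.2 - M.mean j η) ^ 3) (M.areaLaw j η) :=
    i2.add ((hi 3 (by norm_num)).const_mul c₃)
  refine ⟨i3.add ((hi 4 le_rfl).const_mul c₄), ?_⟩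
  rw [integral_add i3 ((hi 4 le_rfl).const_mul c₄), integral_add i2
    ((hi 3 (by norm_num)).const_mul c₃), integral_add i1 ((hi 2 (by norm_num)).const_mul c₂),
    integral_add (integrable_const c₀) (h1.const_mul c₁)]
  simp only [integral_const_mul, hz, mul_zero, add_zero, integral_const, probReal_univ, one_smul, mu]

variable (M) in
/-- The triple `(n, t, ν)` of an area. -/
def arg (j : ℕ) (η : Params p) : ℝ × ℝ × ℝ := (M.n j, M.linPred j η, nu η)

/-- The type of a parameter: regression coefficient or variance parameter. -/
def kind : Idx p → Fin 2 := Sum.elim (fun _ => 0) (fun _ => 1)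

variable (M) in
/-- The covariates of an area, with a one for the parameter `ν`. -/
def xcoef (j : ℕ) : Idx p → ℝ := Sum.elim (M.x j) (fun _ => 1)

variable (M) in
/-- The coefficients of the estimating function. -/
noncomputable def coef (j : ℕ) (r : Fin 3) (η : Params p) : Params p :=
  fun a => M.xcoef j a * M.coefAt (kind a) r (M.arg j η)

theorem admissible_of_mem {j : ℕ} {η : Params p} (h : M.arg j η ∈ M.domain) : M.Admissible j η :=
  ⟨h.2.2.1, h.2.2.2.1, h.2.2.2.2⟩

variable {j : ℕ} {η : Params p}

theorem Sig_inv (hM : M.IsNEFQVF) (h : M.arg j η ∈ M.domain) :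
    (M.Sig j η)⁻¹ = (detSig M.v₂ (M.n j) (nu η) (M.Q (M.mean j η)) (M.Q' (M.mean j η)))⁻¹ •
      !![M.mu 4 j η - M.mu 2 j η ^ 2, -M.mu 3 j η; -M.mu 3 j η, M.mu 2 j η] := by
  have ha := admissible_of_mem h
  obtain ⟨-, -, h2, h3, h4⟩ := jmom_values hM ha
  have hdet := detSig_eq (v := M.v₂) (q := M.Q (M.mean j η)) (q' := M.Q' (M.mean j η))
    (hM.n_pos j).ne' ha.sub_pos_one.ne' ha.sub_pos_two.ne' ha.sub_pos_three.ne'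
  rw [Matrix.inv_def, Sig, Matrix.det_fin_two_of, Matrix.adjugate_fin_two_of, h2, h3, h4, ← sq,
    hdet, Ring.inverse_eq_inv']

theorem Dt_apply (a : Idx p) : M.Dt j η a 0 = M.xcoef j a * dOne (kind a) (M.Q (M.mean j η)) ∧
    M.Dt j η a 1 = M.xcoef j a * dTwo (kind a) M.v₂ (M.n j) (nu η) (M.Q (M.mean j η))
      (M.Q' (M.mean j η)) := by
  rcases a with a | a
  · simp [Dt, xcoef, kind, dOne, dTwo, phi, phiOf, Matrix.smul_apply]
    constructor <;> ring
  · simp [Dt, xcoef, kind, dOne, dTwo, Matrix.smul_apply]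

theorem Dt_mul_inv_apply (hM : M.IsNEFQVF) (h : M.arg j η ∈ M.domain) (a : Idx p) :
    (M.Dt j η * (M.Sig j η)⁻¹) a 0 = M.xcoef j a * wOne (kind a) M.v₂ (M.n j) (nu η)
      (M.Q (M.mean j η)) (M.Q' (M.mean j η)) ∧
    (M.Dt j η * (M.Sig j η)⁻¹) a 1 = M.xcoef j a * wTwo (kind a) M.v₂ (M.n j) (nu η)
      (M.Q (M.mean j η)) (M.Q' (M.mean j η)) := by
  obtain ⟨-, -, h2, h3, h4⟩ := jmom_values hM (admissible_of_mem h)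
  obtain ⟨hd1, hd2⟩ := Dt_apply (M := M) (j := j) (η := η) a
  simp only [Sig_inv hM h, Matrix.mul_apply, Fin.sum_univ_two, hd1, hd2, Matrix.smul_apply,
    smul_eq_mul, Matrix.of_apply, Matrix.cons_val_zero, Matrix.cons_val_one, Matrix.cons_val',
    Matrix.cons_val_fin_one, h2, h3, h4, wOne, wTwo, div_eq_mul_inv]
  constructor <;> ring

/-- Identifies the score of the model with the abstract form that is quadratic in the data. -/
theorem score_summand (hM : M.IsNEFQVF) (h : M.arg j η ∈ M.domain) (y : ℝ) :
    (M.Dt j η * (M.Sig j η)⁻¹) *ᵥ M.g j η y = ∑ r : Fin 3, y ^ (r : ℕ) • M.coef j r η := by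
  funext a
  obtain ⟨h1, h2⟩ := Dt_mul_inv_apply hM h a
  have e := sum_coefV (kind a) M.v₂ (M.n j) (nu η) (M.mean j η) (M.Q (M.mean j η))
    (M.Q' (M.mean j η)) y (y ^ 2)
  simp only [Matrix.mulVec, dotProduct, Fin.sum_univ_two, h1, h2, Finset.sum_apply, Pi.smul_apply,
    smul_eq_mul, Fin.sum_univ_three, coef, coefAt, arg]
  simp only [mean, phi, phiOf, g, Matrix.cons_val_zero, Matrix.cons_val_one, Matrix.cons_val_fin_one]
    at e ⊢
  simp only [Fin.val_zero, Fin.val_one, Fin.val_two, pow_zero, pow_one]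
  linear_combination (-M.xcoef j a) * e

/-- The information about the parameter in one area. -/
noncomputable def info (M : AreaModel p) (j : ℕ) (η : Params p) : Matrix (Idx p) (Idx p) ℝ :=
  M.Dt j η * (M.Sig j η)⁻¹ * (M.Dt j η)ᵀ

theorem info_apply (hM : M.IsNEFQVF) (h : M.arg j η ∈ M.domain) (a b : Idx p) :
    M.info j η a b = M.xcoef j a * M.xcoef j b *
      (wOne (kind a) M.v₂ (M.n j) (nu η) (M.Q (M.mean j η)) (M.Q' (M.mean j η)) *
        dOne (kind b) (M.Q (M.mean j η)) +
      wTwo (kind a) M.v₂ (M.n j) (nu η) (M.Q (M.mean j η)) (M.Q' (M.mean j η)) *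
        dTwo (kind b) M.v₂ (M.n j) (nu η) (M.Q (M.mean j η)) (M.Q' (M.mean j η))) := by
  obtain ⟨h1, h2⟩ := Dt_mul_inv_apply hM h a
  obtain ⟨hd1, hd2⟩ := Dt_apply (M := M) (j := j) (η := η) b
  rw [info, Matrix.mul_apply, Fin.sum_univ_two, Matrix.transpose_apply, Matrix.transpose_apply, h1,
    h2, hd1, hd2]
  ring

theorem integral_pow_two (hM : M.IsNEFQVF) (h : M.Admissible j η) :
    ∫ z : ℝ × ℝ, z.2 ∂(M.areaLaw j η) = M.mean j η ∧
    ∫ z : ℝ × ℝ, z.2 ^ 2 ∂(M.areaLaw j η) =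
      muTwo M.v₂ (M.n j) (nu η) (M.Q (M.mean j η)) + M.mean j η ^ 2 := by
  have h1 := (integral_quartic hM h (M.mean j η) 1 0 0 0).2
  have h2 := (integral_quartic hM h (M.mean j η ^ 2) (2 * M.mean j η) 1 0 0).2
  rw [(jmom_values hM h).2.2.1] at h2
  constructor
  · refine Eq.trans (integral_congr_ae (Eventually.of_forall fun z => ?_)) (h1.trans (by ring))
    beta_reduce; ring
  · refine Eq.trans (integral_congr_ae (Eventually.of_forall fun z => ?_)) (h2.trans (by ring))
    beta_reduce; ring

/-- The weights `Dᵗ Σ⁻¹` are optimal: the covariance `Dᵗ Σ⁻¹ Σ Σ⁻¹ D` collapses to `Dᵗ Σ⁻¹ D`, which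
is also minus the expected derivative. This is why a single matrix `U` appears in `T₂`. -/
theorem integral_summand_mul (hM : M.IsNEFQVF) (h : M.arg j η ∈ M.domain)
    (a b : Idx p) :
    ∫ z : ℝ × ℝ, (∑ r : Fin 3, z.2 ^ (r : ℕ) * M.coef j r η a) *
      (∑ r : Fin 3, z.2 ^ (r : ℕ) * M.coef j r η b) ∂(M.areaLaw j η) = M.info j η a b := by
  have hadm := admissible_of_mem h
  obtain ⟨-, -, h2, h3, h4⟩ := jmom_values hM hadm
  obtain ⟨w1, w2⟩ := weights_mul (κ := kind b) (q := M.Q (M.mean j η))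
    (q' := M.Q' (M.mean j η)) (hM.n_pos j) h.2.1 hadm.nu_pos
    hadm.nu_gt (Q_pos hM hadm.mem)
  have hmu := muTwo_eq (v := M.v₂) (ν := nu η) (q := M.Q (M.mean j η)) (hM.n_pos j).ne'
  rw [info_apply hM h]
  have hs : ∀ (c : Idx p) (y : ℝ), ∑ r : Fin 3, y ^ (r : ℕ) * M.coef j r η c = M.xcoef j c *
      (wOne (kind c) M.v₂ (M.n j) (nu η) (M.Q (M.mean j η)) (M.Q' (M.mean j η)) *
        (y - M.mean j η) +
      wTwo (kind c) M.v₂ (M.n j) (nu η) (M.Q (M.mean j η)) (M.Q' (M.mean j η)) *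
        ((y - M.mean j η) ^ 2 - muTwo M.v₂ (M.n j) (nu η) (M.Q (M.mean j η)))) := fun c y => by
    have e := congrFun (score_summand hM h y) c
    obtain ⟨h1, h2⟩ := Dt_mul_inv_apply hM h c
    simp only [Finset.sum_apply, Pi.smul_apply, smul_eq_mul] at e
    rw [← e, Matrix.mulVec, dotProduct, Fin.sum_univ_two, h1, h2, hmu]
    simp only [g, phi, phiOf, Matrix.cons_val_zero, Matrix.cons_val_one, Matrix.cons_val_fin_one]
    ring
  simp only [hs]
  rw [← w1, ← w2]
  rw [← h2, ← h3, ← h4]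
  generalize wOne (kind a) M.v₂ (M.n j) (nu η) (M.Q (M.mean j η)) (M.Q' (M.mean j η)) = α₁
  generalize wTwo (kind a) M.v₂ (M.n j) (nu η) (M.Q (M.mean j η)) (M.Q' (M.mean j η)) = α₂
  generalize wOne (kind b) M.v₂ (M.n j) (nu η) (M.Q (M.mean j η)) (M.Q' (M.mean j η)) = β₁
  generalize wTwo (kind b) M.v₂ (M.n j) (nu η) (M.Q (M.mean j η)) (M.Q' (M.mean j η)) = β₂
  have key := (integral_quartic hM hadm
    (M.xcoef j a * M.xcoef j b * (α₂ * β₂ * M.mu 2 j η ^ 2))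
    (M.xcoef j a * M.xcoef j b * (-(α₁ * β₂ + α₂ * β₁) * M.mu 2 j η))
    (M.xcoef j a * M.xcoef j b * (α₁ * β₁ - 2 * α₂ * β₂ * M.mu 2 j η))
    (M.xcoef j a * M.xcoef j b * (α₁ * β₂ + α₂ * β₁))
    (M.xcoef j a * M.xcoef j b * (α₂ * β₂))).2
  refine Eq.trans (integral_congr_ae (Eventually.of_forall fun z => ?_)) (key.trans ?_)
  · beta_reduce; ring
  · ring

end AreaModel
end NEFQVF

/-! ### Uniform bounds over the areas. -/

namespace NEFQVF
namespace AreaModel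

variable {p : ℕ} {M : AreaModel p}

/-- The regularity conditions on the parameter set, the covariates and the scalars `n j`. -/
structure Regular (M : AreaModel p) (K : Set (Params p)) (η : Params p) : Prop where
  isCompact : IsCompact K
  nu_gt : ∀ η' ∈ K, 0 < nu η' ∧ 3 * M.v₂ < nu η'
  linPred : ∃ T : Set ℝ, IsCompact T ∧ T ⊆ M.Θ ∧ ∀ j, ∀ η' ∈ K, M.linPred j η' ∈ T
  n_le : ∃ a b : ℝ, 0 < a ∧ ∀ j, a ≤ M.n j ∧ a ≤ M.n j + M.v₂ ∧ M.n j ≤ b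
  mem_interior : η ∈ interior K

variable {K : Set (Params p)} {η : Params p}

theorem Regular.mem (h : M.Regular K η) : η ∈ K := interior_subset h.mem_interior

/-- The compact set is enlarged to an interval, still inside `Θ` because `Θ` is order-connected;
convexity is needed for mean value estimates. -/
theorem Regular.exists_Icc (h : M.Regular K η) (hM : M.IsNEFQVF) :
    ∃ t₀ t₁ : ℝ, Set.Icc t₀ t₁ ⊆ M.Θ ∧ ∀ j, ∀ η' ∈ K, M.linPred j η' ∈ Set.Icc t₀ t₁ := by
  obtain ⟨T, hT, hTΘ, hTj⟩ := h.linPred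
  have hne : T.Nonempty := ⟨_, hTj 0 η h.mem⟩
  exact ⟨sInf T, sSup T, (ordConnected hM).out (hTΘ (hT.sInf_mem hne)) (hTΘ (hT.sSup_mem hne)),
    fun j η' hη' => ⟨csInf_le hT.bddBelow (hTj j η' hη'), le_csSup hT.bddAbove (hTj j η' hη')⟩⟩

theorem Regular.exists_box (h : M.Regular K η) (hM : M.IsNEFQVF) :
    ∃ C : Set (ℝ × ℝ × ℝ), IsCompact C ∧ Convex ℝ C ∧ C ⊆ M.domain ∧
      ∀ j, ∀ η' ∈ K, M.arg j η' ∈ C := by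
  obtain ⟨t₀, t₁, htΘ, ht⟩ := h.exists_Icc hM
  obtain ⟨a, b, ha, hab⟩ := h.n_le
  have hnu : Continuous (nu : Params p → ℝ) := continuous_apply _
  obtain ⟨η₀, hη₀, hmin⟩ := h.isCompact.exists_isMinOn ⟨η, h.mem⟩ hnu.continuousOn
  obtain ⟨η₁, -, hmax⟩ := h.isCompact.exists_isMaxOn ⟨η, h.mem⟩ hnu.continuousOn
  obtain ⟨hν0, hν0'⟩ := h.nu_gt η₀ hη₀
  refine ⟨Set.Icc (max a (a - M.v₂)) b ×ˢ Set.Icc t₀ t₁ ×ˢ Set.Icc (nu η₀) (nu η₁),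
    isCompact_Icc.prod (isCompact_Icc.prod isCompact_Icc),
    (convex_Icc _ _).prod ((convex_Icc _ _).prod (convex_Icc _ _)), ?_, fun j η' hη' => ?_⟩
  · rintro ⟨n, t, ν⟩ ⟨⟨h1, -⟩, h2, ⟨h3, -⟩⟩
    simp only [max_le_iff] at h1 h3
    exact ⟨by dsimp only; linarith, by dsimp only; linarith, htΘ h2, by dsimp only; linarith,
      by dsimp only; linarith⟩
  · obtain ⟨h1, h2, h3⟩ := hab j
    exact ⟨⟨max_le h1 (by dsimp only [arg]; linarith), h3⟩, ht j η' hη', hmin hη', hmax hη'⟩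

theorem linPred_add_smul (j : ℕ) (x u : Params p) (s : ℝ) :
    M.linPred j (x + s • u) = M.linPred j x + s * M.linPred j u := by
  simp only [AreaModel.linPred, Pi.add_apply, Pi.smul_apply, smul_eq_mul, mul_add,
    Finset.sum_add_distrib, Finset.mul_sum]
  congr 1
  exact Finset.sum_congr rfl fun k _ => by ring

/-- Bounded covariates need no separate assumption: moving `η` by `ρ` in one coordinate stays in `K`
and moves the linear predictor by `ρ x`, yet the predictor remains in a fixed interval. -/
theorem Regular.exists_abs_x_le (h : M.Regular K η) (hM : M.IsNEFQVF) :
    ∃ B : ℝ, 0 ≤ B ∧ ∀ j k, |M.x j k| ≤ B := by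
  obtain ⟨t₀, t₁, -, ht⟩ := h.exists_Icc hM
  obtain ⟨ρ, hρ, hball⟩ := Metric.nhds_basis_closedBall.mem_iff.1
    (mem_interior_iff_mem_nhds.1 h.mem_interior)
  have h0 := ht 0 η h.mem
  have h01 : t₀ ≤ t₁ := h0.1.trans h0.2
  refine ⟨(t₁ - t₀) / ρ, div_nonneg (by linarith) hρ.le, fun j k => ?_⟩
  have hmem : η + ρ • Pi.single (Sum.inl k) 1 ∈ K := hball (by
    rw [Metric.mem_closedBall, dist_eq_norm, add_sub_cancel_left, norm_smul, Pi.norm_single]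
    simp [abs_of_pos hρ])
  have h1 := ht j η h.mem
  have h2 := ht j _ hmem
  have e : M.linPred j (Pi.single (Sum.inl k) 1 : Params p) = M.x j k := by
    simp [AreaModel.linPred, Pi.single_apply]
  rw [linPred_add_smul, e] at h2
  rw [le_div_iff₀ hρ, ← abs_of_pos hρ, ← abs_mul, abs_le]
  constructor <;> linarith [h1.1, h1.2, h2.1, h2.2, mul_comm (M.x j k) ρ]

/-! ### The moments of the data -/

/-- Strictness of `3 v₂ < ν` leaves room for moments of order `2 q` with `q` slightly above `2`,
first for `ξ` and then for `y`. -/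
theorem Regular.exists_moment (h : M.Regular K η) (hM : M.IsNEFQVF) :
    ∃ q B : ℝ, 2 < q ∧ q ≤ 3 ∧ ∀ j, Integrable (fun z : ℝ × ℝ => (1 + z.2 ^ 2) ^ q) (M.areaLaw j η) ∧
      ∫ z : ℝ × ℝ, (1 + z.2 ^ 2) ^ q ∂(M.areaLaw j η) ≤ B := by
  obtain ⟨t₀, t₁, htΘ, ht⟩ := h.exists_Icc hM
  obtain ⟨a, b, ha, hab⟩ := h.n_le
  obtain ⟨hν, hν3⟩ := h.nu_gt η h.mem
  have hc := (continuousOn_deriv_ψ hM).mono htΘ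
  obtain ⟨B₀, hB₀⟩ := isCompact_Icc.exists_bound_of_continuousOn hc
  obtain ⟨B₁, hB₁⟩ := isCompact_Icc.exists_bound_of_continuousOn
    ((contDiff_Q (M := M) (k := 1)).continuous.comp_continuousOn hc)
  obtain ⟨B₂, hB₂⟩ := isCompact_Icc.exists_bound_of_continuousOn
    ((contDiff_Q' (M := M) (k := 1)).continuous.comp_continuousOn hc)
  set d := nu η - 3 * M.v₂ with hd
  have hd0 : 0 < d := by linarith
  -- For order `r = 2 (2 + s)` the moment condition involves `(r - 1) v₂ = 3 v₂ + 2 s v₂`; half of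
  -- the gap `d` pays for the excess and half is left for `δ`.
  obtain ⟨s, hs0, hs1, hs2⟩ : ∃ s : ℝ, 0 < s ∧ s ≤ 1 ∧ 2 * s * M.v₂ ≤ d / 2 := by
    refine ⟨min 1 (d / (4 * (|M.v₂| + 1))), lt_min one_pos (by positivity), min_le_left _ _, ?_⟩
    calc 2 * min 1 (d / (4 * (|M.v₂| + 1))) * M.v₂
        ≤ 2 * (d / (4 * (|M.v₂| + 1))) * (|M.v₂| + 1) := by
          have h1 := min_le_right 1 (d / (4 * (|M.v₂| + 1)))
          have h2 : M.v₂ ≤ |M.v₂| + 1 := by linarith [le_abs_self M.v₂]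
          have h3 : 0 ≤ min 1 (d / (4 * (|M.v₂| + 1))) := le_min zero_le_one (by positivity)
          refine (mul_le_mul_of_nonneg_left h2 (by positivity)).trans ?_
          gcongr
      _ = d / 2 := by field_simp; norm_num
  obtain ⟨C, hC0, hC⟩ := moment_le hM (B := max B₁ B₂) (δ := min (nu η) (d / 2)) (r := 2 * (2 + s))
    (by
      have := hB₁ _ (ht 0 η h.mem)
      exact ((norm_nonneg _).trans this).trans (le_max_left _ _))
    (lt_min hν (by positivity)) (by linarith)
  have hB₀0 : 0 ≤ B₀ := (norm_nonneg _).trans (hB₀ _ (ht 0 η h.mem))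
  set r := 2 * (2 + s) with hr
  have hr0 : 0 < r := by linarith
  set c := 1 + 2 * B₀ ^ 2 with hcdef
  have hc0 : 0 < c := by positivity
  refine ⟨2 + s, (2 * c) ^ (2 + s) + 4 ^ (2 + s) * ((2 * (1 + nu η / a)) ^ r * C), by linarith,
    by linarith, fun j => ?_⟩
  have hmem : M.linPred j η ∈ M.Θ := htΘ (ht j η h.mem)
  have hprob := isProbabilityMeasure_areaLaw hM hmem hν
  obtain ⟨hj1, hj2⟩ := hC j η hmem
    ((hB₁ _ (ht j η h.mem)).trans (le_max_left _ _)) ((hB₂ _ (ht j η h.mem)).trans (le_max_right _ _))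
    (min_le_left _ _) (by
      have := min_le_right (nu η) (d / 2)
      have e : (r - 1) * M.v₂ = 3 * M.v₂ + 2 * s * M.v₂ := by rw [hr]; ring
      rw [e]; linarith)
  have hdm := measurable_deriv M.ψ
  have hpt : ∀ u : ℝ, |u| ^ r ≤ (1 + u ^ 2) ^ (r / 2) := fun u => by
    have e : |u| ^ r = (u ^ 2) ^ (r / 2) := by
      rw [← sq_abs, ← Real.rpow_natCast, ← Real.rpow_mul (abs_nonneg u)]
      congr 1; push_cast; ring
    rw [e]
    exact Real.rpow_le_rpow (sq_nonneg u) (by linarith) (by positivity)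
  have hu : Integrable (fun z : ℝ × ℝ => |deriv M.ψ z.1 - M.mean j η| ^ r) (M.areaLaw j η) := by
    refine Integrable.mono' hj1 (Measurable.aestronglyMeasurable (by fun_prop))
      (Eventually.of_forall fun z => ?_)
    rw [Real.norm_of_nonneg (by positivity)]
    exact hpt _
  have hu1 : Integrable (fun z : ℝ × ℝ => 1 + |deriv M.ψ z.1 - M.mean j η|) (M.areaLaw j η) := by
    simpa using integrable_moment_pow hM ⟨hmem, hν, hν3⟩ (k := 1) (by norm_num)
  obtain ⟨hw1, hw2⟩ := moment_y_le hM hmem hν (by linarith : 1 ≤ r) hu1 hu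
  have hmean : |M.mean j η| ≤ B₀ := hB₀ _ (ht j η h.mem)
  have hpt2 : ∀ y : ℝ, (1 + y ^ 2) ^ (2 + s) ≤
      (2 * c) ^ (2 + s) + 4 ^ (2 + s) * |y - M.mean j η| ^ r := fun y => by
    set w := y - M.mean j η with hw
    have e : |w| ^ r = (w ^ 2) ^ (2 + s) := by
      rw [← sq_abs w, ← Real.rpow_natCast, ← Real.rpow_mul (abs_nonneg w)]
      congr 1
    have h1 : 1 + y ^ 2 ≤ c + 2 * w ^ 2 := by
      have h2 : M.mean j η ^ 2 ≤ B₀ ^ 2 := by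
        rw [← sq_abs]; gcongr
      have h3 : y = w + M.mean j η := by rw [hw]; ring
      rw [h3, hcdef]
      nlinarith [sq_nonneg (w - M.mean j η)]
    rw [e, ← Real.mul_rpow (by norm_num) (sq_nonneg w)]
    rcases le_total (2 * w ^ 2) c with h4 | h4
    · have : (1 + y ^ 2) ^ (2 + s) ≤ (2 * c) ^ (2 + s) :=
        Real.rpow_le_rpow (by positivity) (by linarith) (by linarith)
      have h5 : 0 ≤ (4 * w ^ 2) ^ (2 + s) := by positivity
      linarith
    · have : (1 + y ^ 2) ^ (2 + s) ≤ (4 * w ^ 2) ^ (2 + s) :=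
        Real.rpow_le_rpow (by positivity) (by linarith) (by linarith)
      have h5 : 0 ≤ (2 * c) ^ (2 + s) := by positivity
      linarith
  have hi : Integrable (fun z : ℝ × ℝ => (2 * c) ^ (2 + s) +
      4 ^ (2 + s) * |z.2 - M.mean j η| ^ r) (M.areaLaw j η) :=
    (integrable_const _).add (hw1.const_mul _)
  have hint : Integrable (fun z : ℝ × ℝ => (1 + z.2 ^ 2) ^ (2 + s)) (M.areaLaw j η) := by
    refine Integrable.mono' hi (Measurable.aestronglyMeasurable (by fun_prop))
      (Eventually.of_forall fun z => ?_)
    rw [Real.norm_of_nonneg (by positivity)]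
    exact hpt2 z.2
  refine ⟨hint, (integral_mono hint hi fun z => hpt2 z.2).trans ?_⟩
  rw [integral_add (integrable_const _) (hw1.const_mul _), integral_const_mul]
  simp only [integral_const, probReal_univ, one_smul]
  have h6 : (M.n j + nu η) / M.n j ≤ 1 + nu η / a := by
    have hn := hM.n_pos j
    rw [add_div, div_self hn.ne']
    have := (hab j).1
    gcongr
  have h7 : ∫ z : ℝ × ℝ, |deriv M.ψ z.1 - M.mean j η| ^ r ∂(M.areaLaw j η) ≤ C :=
    (integral_mono hu hj1 fun z => hpt _).trans hj2
  have h8 : 0 ≤ (M.n j + nu η) / M.n j := by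
    have hn := hM.n_pos j; positivity
  gcongr
  refine hw2.trans ?_
  refine mul_le_mul (Real.rpow_le_rpow (by linarith) (by linarith) hr0.le) h7
    (integral_nonneg fun z => by positivity) (by positivity)

end AreaModel
end NEFQVF

/-! ### The model satisfies the abstract conditions on the estimating function. -/

namespace NEFQVF
namespace AreaModel

variable {p : ℕ} {M : AreaModel p} {K : Set (Params p)} {η : Params p}

/-- The directions of the two types of parameters in the space of the triples `(n, t, ν)`. -/
def dir (κ : Fin 2) : ℝ × ℝ × ℝ := ![(0, 1, 0), (0, 0, 1)] κ

theorem norm_dir_le (κ : Fin 2) : ‖dir κ‖ ≤ 1 := by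
  fin_cases κ <;> simp [dir, Prod.norm_def]

/-- The triple `(n, t, ν)` is affine in the parameter, so derivatives in the parameter are
directional derivatives along two fixed directions, scaled by the covariates. -/
theorem arg_sub (j : ℕ) (x y : Params p) :
    M.arg j x - M.arg j y = ∑ b, (x - y) b • (M.xcoef j b • dir (kind b)) := by
  rw [Fintype.sum_sum_type]
  simp only [arg, kind, xcoef, dir, Sum.elim_inl, Sum.elim_inr, Matrix.cons_val_zero,
    Matrix.cons_val_one, Finset.univ_unique, Finset.sum_singleton, Prod.smul_mk, smul_eq_mul,
    mul_zero, mul_one, one_smul, Pi.sub_apply]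
  refine Prod.ext ?_ (Prod.ext ?_ ?_)
  · simp [Prod.fst_sum]
  · simp only [Prod.snd_add, Prod.fst_add, Prod.snd_sub, Prod.fst_sub, Prod.snd_sum, Prod.fst_sum,
      AreaModel.linPred, ← Finset.sum_sub_distrib, add_zero]
    exact Finset.sum_congr rfl fun k _ => by ring
  · simp [Prod.snd_sum, nu]

variable (M) in
/-- The derivatives of the coefficients of the estimating function. -/
noncomputable def coefDeriv (η : Params p) (j : ℕ) (r : Fin 3) : Matrix (Idx p) (Idx p) ℝ :=
  Matrix.of fun a b => M.xcoef j a *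
    (M.xcoef j b * fderiv ℝ (M.coefAt (kind a) r) (M.arg j η) (dir (kind b)))

theorem coefDeriv_mulVec (η : Params p) (j : ℕ) (r : Fin 3) (x y : Params p) (a : Idx p) :
    (M.coefDeriv η j r *ᵥ (x - y)) a = M.xcoef j a *
      fderiv ℝ (M.coefAt (kind a) r) (M.arg j η) (M.arg j x - M.arg j y) := by
  rw [arg_sub, map_sum, Finset.mul_sum, Matrix.mulVec, dotProduct]
  refine Finset.sum_congr rfl fun b _ => ?_
  rw [map_smul, map_smul, coefDeriv, Matrix.of_apply]
  simp only [smul_eq_mul]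
  ring

theorem integral_comp_y {Ω : Type*} [MeasurableSpace Ω] {μ : Measure Ω} {θ Y : Ω → ℝ} {j : ℕ}
    (hθ : Measurable θ) (hY : Measurable Y)
    (hlaw : μ.map (fun ω => (θ ω, Y ω)) = M.areaLaw j η) {f : ℝ × ℝ → ℝ} (hf : Measurable f) :
    ∫ ω, f (θ ω, Y ω) ∂μ = ∫ z, f z ∂(M.areaLaw j η) := by
  rw [← hlaw, integral_map (hθ.prodMk hY).aemeasurable hf.aestronglyMeasurable]

theorem integrable_comp_y {Ω : Type*} [MeasurableSpace Ω] {μ : Measure Ω} {θ Y : Ω → ℝ} {j : ℕ}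
    (hθ : Measurable θ) (hY : Measurable Y)
    (hlaw : μ.map (fun ω => (θ ω, Y ω)) = M.areaLaw j η) {f : ℝ × ℝ → ℝ} (hf : Measurable f)
    (hi : Integrable f (M.areaLaw j η)) : Integrable (fun ω => f (θ ω, Y ω)) μ := by
  rw [← hlaw] at hi
  exact (integrable_map_measure hf.aestronglyMeasurable (hθ.prodMk hY).aemeasurable).1 hi

section Data

variable {Ω : Type*} [MeasurableSpace Ω] {μ : Measure Ω} [IsProbabilityMeasure μ] {θ Y : ℕ → Ω → ℝ}

theorem Regular.exists_momentBound (h : M.Regular K η) (hM : M.IsNEFQVF)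
    (hθm : ∀ j, Measurable (θ j)) (hYm : ∀ j, Measurable (Y j))
    (hlaw : ∀ j, μ.map (fun ω => (θ j ω, Y j ω)) = M.areaLaw j η) :
    ∃ q B : ℝ, MomentBound μ Y q B := by
  obtain ⟨q, B, hq, hq3, hB⟩ := h.exists_moment hM
  have hf : Measurable fun z : ℝ × ℝ => (1 + z.2 ^ 2) ^ q := by fun_prop
  refine ⟨q, B, hq, hq3, fun j => integrable_comp_y (hθm j) (hYm j) (hlaw j) hf (hB j).1,
    fun j => ?_⟩
  rw [integral_comp_y (f := fun z : ℝ × ℝ => (1 + z.2 ^ 2) ^ q) (hθm j) (hYm j) (hlaw j) hf]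
  exact (hB j).2

theorem mom_eq (hM : M.IsNEFQVF) (hθm : ∀ j, Measurable (θ j)) (hYm : ∀ j, Measurable (Y j))
    (hlaw : ∀ j, μ.map (fun ω => (θ j ω, Y j ω)) = M.areaLaw j η) {j : ℕ}
    (hadm : M.Admissible j η) : mom μ Y j 0 = 1 ∧ mom μ Y j 1 = M.mean j η ∧
      mom μ Y j 2 = muTwo M.v₂ (M.n j) (nu η) (M.Q (M.mean j η)) + M.mean j η ^ 2 := by
  obtain ⟨h1, h2⟩ := integral_pow_two hM hadm
  refine ⟨by simp [mom], ?_, ?_⟩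
  · rw [← h1, ← integral_comp_y (f := fun z => z.2) (hθm j) (hYm j) (hlaw j) measurable_snd]
    simp [mom]
  · rw [← h2, ← integral_comp_y (f := fun z => z.2 ^ 2) (hθm j) (hYm j) (hlaw j)
      (measurable_snd.pow_const 2)]
    simp [mom]

/-- Smoothness is transferred from functions on the box of triples through an affine map with
uniformly bounded coefficients; the moment conditions are the identities for the score established
above. -/
theorem Regular.exists_smoothScore (h : M.Regular K η) (hM : M.IsNEFQVF) {q B : ℝ}
    (hmb : MomentBound μ Y q B)
    (hθm : ∀ j, Measurable (θ j)) (hYm : ∀ j, Measurable (Y j))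
    (hlaw : ∀ j, μ.map (fun ω => (θ j ω, Y j ω)) = M.areaLaw j η)
    (hU : ∃ c : ℝ, 0 < c ∧ ∀ᶠ m : ℕ in atTop, ∀ u : Params p,
      c * m * (u ⬝ᵥ u) ≤ u ⬝ᵥ (M.U m η *ᵥ u))
    (hident : ∀ ε : ℝ, 0 < ε → ∃ δ : ℝ, 0 < δ ∧ ∀ᶠ m : ℕ in atTop, ∀ η' ∈ K, ε ≤ dist η' η →
      δ * m ≤ ‖∫ ω, M.score m η' (fun j : Fin m => Y j ω) ∂μ‖) :
    ∃ L : ℝ, SmoothScore μ Y K η M.coef (M.coefDeriv η) (fun j => M.info j η) L := by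
  obtain ⟨C, hC, hconv, hCdom, hCarg⟩ := h.exists_box hM
  obtain ⟨Bx, hBx0, hBx⟩ := h.exists_abs_x_le hM
  have hη := h.mem
  have hdom : ∀ j, M.arg j η ∈ M.domain := fun j => hCdom (hCarg j η hη)
  have hbd := fun κ r => exists_uniform_bounds (isOpen_domain hM) hC hconv hCdom
    (contDiffOn_coefAt hM κ r)
  choose l hl0 hl1 hl2 hl3 hl4 using hbd
  set L₀ := ∑ κ, ∑ r, l κ r with hL₀
  have hlL : ∀ κ r, l κ r ≤ L₀ := fun κ r =>
    (Finset.single_le_sum (f := fun r => l κ r) (fun r _ => hl0 κ r) (Finset.mem_univ r)).trans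
      (Finset.single_le_sum (f := fun κ => ∑ r, l κ r)
        (fun κ _ => Finset.sum_nonneg fun r _ => hl0 κ r) (Finset.mem_univ κ))
  have hL₀0 : 0 ≤ L₀ := (hl0 0 0).trans (hlL 0 0)
  set B₁ := Bx + 1 with hB₁
  have hB₁0 : 1 ≤ B₁ := by linarith
  have hxc : ∀ j a, |M.xcoef j a| ≤ B₁ := fun j a => by
    rcases a with a | a
    · exact (hBx j a).trans (by linarith)
    · simp only [xcoef, Sum.elim_inr, abs_one]; linarith
  set B₂ := (Fintype.card (Idx p) : ℝ) * B₁ with hB₂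
  have hB₂0 : 0 ≤ B₂ := by positivity
  have harg : ∀ j x y, ‖M.arg j x - M.arg j y‖ ≤ B₂ * ‖x - y‖ := fun j x y => by
    rw [arg_sub]
    refine (norm_sum_le_of_le _ (n := fun _ => B₁ * ‖x - y‖) fun b _ => ?_).trans
      (by simp [hB₂, mul_assoc])
    rw [norm_smul, norm_smul, mul_comm]
    refine mul_le_mul ?_ (norm_le_pi_norm (x - y) b) (norm_nonneg _) (by linarith)
    exact (mul_le_of_le_one_right (norm_nonneg _) (norm_dir_le _)).trans (hxc j b)
  set L := B₁ * L₀ * (1 + B₁ + B₂) with hL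
  have hBL : 0 ≤ B₁ * L₀ := by positivity
  have hmom := fun j => mom_eq hM hθm hYm hlaw (admissible_of_mem (hdom j))
  refine ⟨L, by positivity, h.isCompact, h.mem_interior, ?_, ?_, ?_, ?_, ?_, ?_, ?_, ?_, ?_⟩
  · intro j r x hx
    refine (pi_norm_le_iff_of_nonneg (by positivity)).2 fun a => ?_
    rw [coef, norm_mul]
    calc _ ≤ B₁ * L₀ := mul_le_mul (hxc j a) ((hl1 _ r _ (hCarg j x hx)).trans (hlL _ r))
          (abs_nonneg _) (by linarith)
      _ ≤ _ := by rw [hL]; exact le_mul_of_one_le_right hBL (by linarith)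
  · intro j r x hx y hy
    refine (pi_norm_le_iff_of_nonneg (by positivity)).2 fun a => ?_
    rw [Pi.sub_apply, coef, coef, ← mul_sub, norm_mul]
    calc _ ≤ B₁ * (L₀ * (B₂ * ‖x - y‖)) := mul_le_mul (hxc j a)
          ((hl2 _ r _ (hCarg j x hx) _ (hCarg j y hy)).trans (mul_le_mul (hlL _ r) (harg j x y)
            (norm_nonneg _) hL₀0)) (abs_nonneg _) (by linarith)
      _ = B₁ * L₀ * B₂ * ‖x - y‖ := by ring
      _ ≤ _ := by rw [hL]; gcongr; linarith
  · intro j r a b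
    rw [coefDeriv, Matrix.of_apply, abs_mul, abs_mul]
    have h1 : |fderiv ℝ (M.coefAt (kind a) r) (M.arg j η) (dir (kind b))| ≤ L₀ := by
      rw [← Real.norm_eq_abs]
      refine (ContinuousLinearMap.le_opNorm _ _).trans ?_
      calc _ ≤ L₀ * 1 := mul_le_mul ((hl3 _ r _ (hCarg j η hη)).trans (hlL _ r)) (norm_dir_le _)
            (norm_nonneg _) hL₀0
        _ = L₀ := mul_one _
    calc _ ≤ B₁ * (B₁ * L₀) := by
          gcongr
          · exact hxc j a
          · exact hxc j b
      _ = B₁ * L₀ * B₁ := by ring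
      _ ≤ _ := by rw [hL]; gcongr; linarith
  · intro κ hκ
    obtain ⟨ρ₁, hρ₁, hball⟩ := Metric.nhds_basis_closedBall.mem_iff.1
      (mem_interior_iff_mem_nhds.1 h.mem_interior)
    -- One factor `B₂` comes from the radius of the ball in the space of triples, the other from the
    -- increment.
    set D := B₁ * L₀ * B₂ * B₂ with hD
    have hD0 : 0 ≤ D := by positivity
    refine ⟨min ρ₁ (κ / (D + 1)), lt_min hρ₁ (by positivity), fun j r x hx y hy => ?_⟩
    set ρ := min ρ₁ (κ / (D + 1)) with hρ
    have hρ0 : 0 ≤ ρ := le_min hρ₁.le (by positivity)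
    have hsub : Metric.closedBall η ρ ⊆ K :=
      (Metric.closedBall_subset_closedBall (min_le_left _ _)).trans hball
    have hDρ : D * ρ ≤ κ := by
      calc D * ρ ≤ D * (κ / (D + 1)) := by gcongr; exact min_le_right _ _
        _ ≤ κ := by
          rw [← mul_div_assoc, div_le_iff₀ (by positivity)]
          nlinarith
    refine (pi_norm_le_iff_of_nonneg (by positivity)).2 fun a => ?_
    rw [Pi.sub_apply, Pi.sub_apply, coefDeriv_mulVec, coef, coef, ← mul_sub, ← mul_sub, norm_mul]
    have h1 : ∀ w ∈ Metric.closedBall η ρ, ‖M.arg j w - M.arg j η‖ ≤ B₂ * ρ := fun w hw =>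
      (harg j w η).trans (mul_le_mul_of_nonneg_left (by rwa [← dist_eq_norm]) hB₂0)
    have h2 := hl4 (kind a) r _ (hCarg j η hη) _ (hCarg j x (hsub hx)) _ (hCarg j y (hsub hy))
      (B₂ * ρ) (h1 x hx) (h1 y hy)
    calc _ ≤ B₁ * (L₀ * (B₂ * ρ) * (B₂ * ‖x - y‖)) := by
          refine mul_le_mul (hxc j a) (h2.trans ?_) (abs_nonneg _) (by linarith)
          gcongr
          · exact hlL _ r
          · exact harg j x y
      _ = D * ρ * ‖x - y‖ := by rw [hD]; ring
      _ ≤ _ := by gcongr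
  · intro j
    obtain ⟨m0, m1, m2⟩ := hmom j
    funext a
    have e := sum_coefV (kind a) M.v₂ (M.n j) (nu η) (M.mean j η) (M.Q (M.mean j η))
      (M.Q' (M.mean j η)) (M.mean j η)
      (muTwo M.v₂ (M.n j) (nu η) (M.Q (M.mean j η)) + M.mean j η ^ 2)
    rw [muTwo_eq (hM.n_pos j).ne'] at e m2
    simp only [Fin.sum_univ_three, m0, m1, m2, Pi.add_apply, Pi.smul_apply, smul_eq_mul, coef,
      coefAt, arg, Pi.zero_apply]
    simp only [mean] at e ⊢
    linear_combination (M.xcoef j a) * e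
  · intro j a b
    obtain ⟨m0, m1, m2⟩ := hmom j
    rw [info_apply hM (hdom j)]
    simp only [Fin.sum_univ_three, m0, m1, m2, coefDeriv, Matrix.of_apply]
    have e : fderiv ℝ (M.coefAt (kind a) 0) (M.arg j η) (dir (kind b)) +
        M.mean j η * fderiv ℝ (M.coefAt (kind a) 1) (M.arg j η) (dir (kind b)) +
        (muTwo M.v₂ (M.n j) (nu η) (M.Q (M.mean j η)) + M.mean j η ^ 2) *
          fderiv ℝ (M.coefAt (kind a) 2) (M.arg j η) (dir (kind b)) =
        -(wOne (kind a) M.v₂ (M.n j) (nu η) (M.Q (M.mean j η)) (M.Q' (M.mean j η)) *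
        dOne (kind b) (M.Q (M.mean j η)) +
      wTwo (kind a) M.v₂ (M.n j) (nu η) (M.Q (M.mean j η)) (M.Q' (M.mean j η)) *
        dTwo (kind b) M.v₂ (M.n j) (nu η) (M.Q (M.mean j η)) (M.Q' (M.mean j η))) := by
      rcases b with b | b
      · exact sum_fderiv_coefAt_t hM (kind a) (hdom j) rfl
      · exact sum_fderiv_coefAt_nu hM (kind a) (hdom j) rfl
    linear_combination (M.xcoef j a * M.xcoef j b) * e
  · intro j a b
    rw [← integral_summand_mul hM (hdom j) a b]
    exact integral_comp_y (f := fun z => (∑ r : Fin 3, z.2 ^ (r : ℕ) * M.coef j r η a) *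
      (∑ r : Fin 3, z.2 ^ (r : ℕ) * M.coef j r η b)) (hθm j) (hYm j) (hlaw j) (by fun_prop)
  · obtain ⟨c, hc, hc'⟩ := hU
    refine ⟨c, hc, hc'.mono fun m hm u => ?_⟩
    have e : ∑ j ∈ Finset.range m, M.info j η = M.U m η := by
      rw [U, Finset.sum_range]; rfl
    rw [e]
    exact hm u
  · intro ε hε
    obtain ⟨δ, hδ, hev⟩ := hident ε hε
    refine ⟨δ, hδ, hev.mono fun m hm x hx hxd => ?_⟩
    refine (hm x hx hxd).trans (le_of_eq ?_)
    congr 1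
    have e : ∀ ω, M.score m x (fun j : Fin m => Y j ω) =
        ∑ j ∈ Finset.range m, ∑ r : Fin 3, Y j ω ^ (r : ℕ) • M.coef j r x := fun ω => by
      rw [score, Finset.sum_range]
      exact Finset.sum_congr rfl fun j _ => score_summand hM (hCdom (hCarg j x hx)) _
    simp only [e]
    have hi : ∀ j (r : Fin 3), Integrable (fun ω => Y j ω ^ (r : ℕ) • M.coef j r x) μ :=
      fun j r => (hmb.integrable_pow hYm j r).smul_const _
    rw [integral_finsetSum _ fun j _ => integrable_finsetSum _ fun r _ => hi j r]
    refine Finset.sum_congr rfl fun j _ => ?_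
    rw [integral_finsetSum _ fun r _ => hi j r]
    refine Finset.sum_congr rfl fun r _ => ?_
    rw [integral_smul_const, mom]

end Data

end AreaModel
end NEFQVF

namespace NEFQVF
namespace AreaModel

variable {p : ℕ} {M : AreaModel p} {K : Set (Params p)} {η : Params p} {i : ℕ}

/-! ### The posterior mean and variance -/

theorem bayes_sub_mean (hM : M.IsNEFQVF) (hν : 0 < nu η) (y : ℝ) :
    M.bayes i η y - M.mean i η = M.n i / (M.n i + nu η) * (y - M.mean i η) := by
  have hn := hM.n_pos i
  have : M.n i + nu η ≠ 0 := by positivity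
  unfold bayes
  field_simp
  ring

/-- The Stein identity with `k = 0` divided by `n + ν`: the Bayes error is orthogonal to every
function of `y`. -/
theorem integral_mul_bayes_sub (hM : M.IsNEFQVF) (h : M.Admissible i η) (f : ℝ → ℝ) :
    ∫ z : ℝ × ℝ, f z.2 * (M.bayes i η z.2 - deriv M.ψ z.1) ∂(M.areaLaw i η) = 0 := by
  have hn := hM.n_pos i
  have hν := h.nu_pos
  have h1 := integral_stein hM h.mem h.nu_pos 0 (integrable_moment_pow hM h (by norm_num))
    (fun y => (M.n i + nu η)⁻¹ * f y)
  refine Eq.trans (integral_congr_ae (Eventually.of_forall fun z => ?_)) h1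
  have hne : M.n i + nu η ≠ 0 := by positivity
  have e : M.bayes i η z.2 = M.mean i η + M.n i / (M.n i + nu η) * (z.2 - M.mean i η) := by
    rw [← bayes_sub_mean hM hν]; ring
  simp only [Nat.cast_zero, zero_mul, pow_zero, one_mul, zero_add, e]
  field_simp
  ring

theorem integrable_bayes_error (hM : M.IsNEFQVF) (h : M.Admissible i η) :
    Integrable (fun z : ℝ × ℝ => (M.bayes i η z.2 - deriv M.ψ z.1) ^ 2) (M.areaLaw i η) ∧
    Integrable (fun z : ℝ × ℝ => M.bayes i η z.2 - deriv M.ψ z.1) (M.areaLaw i η) := by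
  have hj := fun a b (hab : a + b ≤ 4) => integrable_jmom (a := a) (b := b) hM h hab
  set k := M.n i / (M.n i + nu η) with hk
  have e : ∀ z : ℝ × ℝ, M.bayes i η z.2 - deriv M.ψ z.1 =
      k * (z.2 - M.mean i η) - (deriv M.ψ z.1 - M.mean i η) := fun z => by
    rw [← bayes_sub_mean hM h.nu_pos]; ring
  constructor
  · refine (((hj 0 2 (by norm_num)).const_mul (k ^ 2)).add (((hj 1 1 (by norm_num)).const_mul
      (-2 * k)).add (hj 2 0 (by norm_num)))).congr (Eventually.of_forall fun z => ?_)
    simp only [Pi.add_apply, e]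
    ring
  · refine (((hj 0 1 (by norm_num)).const_mul k).add ((hj 1 0 (by norm_num)).const_mul (-1))).congr
      (Eventually.of_forall fun z => ?_)
    simp only [Pi.add_apply, e]
    ring

theorem measurable_bayes : Measurable (M.bayes i η) := by
  unfold bayes; fun_prop

theorem continuous_T1cond : Continuous (M.T1cond i η) := by
  unfold T1cond bayes Q; fun_prop

/-- The second moments of the error of the Bayes estimator, weighted by a function of `y`. -/
theorem integral_mul_sq_bayes_sub (hM : M.IsNEFQVF) (h : M.Admissible i η)
    {f : ℝ → ℝ} (hf : Measurable f) {C : ℝ} (hC : ∀ y, |f y| ≤ C) :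
    Integrable (fun z : ℝ × ℝ => f z.2 * M.T1cond i η z.2) (M.areaLaw i η) ∧
    ∫ z : ℝ × ℝ, f z.2 * M.T1cond i η z.2 ∂(M.areaLaw i η) =
      ∫ z : ℝ × ℝ, f z.2 * (deriv M.ψ z.1 - M.bayes i η z.2) ^ 2 ∂(M.areaLaw i η) := by
  have hn := hM.n_pos i
  have hν := h.nu_pos
  have hν3 := h.nu_gt
  have hdm := measurable_deriv M.ψ
  have hD : 0 < M.n i + nu η - M.v₂ := by
    have := h.sub_pos_one; linarith
  have hbm := measurable_bayes (M := M) (i := i) (η := η)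
  have hj := fun a b (hab : a + b ≤ 4) => integrable_jmom (a := a) (b := b) hM h hab
  have hbdd : ∀ {g : ℝ × ℝ → ℝ}, Integrable g (M.areaLaw i η) →
      Integrable (fun z : ℝ × ℝ => f z.2 * g z) (M.areaLaw i η) := fun hg =>
    hg.bdd_mul (c := C) (hf.comp measurable_snd).aestronglyMeasurable
      (Eventually.of_forall fun z => hC z.2)
  -- With `k = 1` and `Q(ξ)` expanded about the Bayes estimator, the quadratic term combines with `n
  -- + ν` into `n + ν - v₂`, the denominator of the posterior variance.
  have h1 := integral_stein hM h.mem h.nu_pos 1 (integrable_moment_pow hM h (by norm_num)) f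
  set k := M.n i / (M.n i + nu η) with hk
  have eb : ∀ y, M.bayes i η y = M.mean i η + k * (y - M.mean i η) := fun y => by
    rw [← bayes_sub_mean hM hν]; ring
  have hne : M.n i + nu η ≠ 0 := by positivity
  have hnk : M.n i = k * (M.n i + nu η) := by rw [hk]; field_simp
  -- the coefficient of the linear term
  set g : ℝ → ℝ := fun y => M.Q' (M.bayes i η y) - (M.n i + nu η) * (M.bayes i η y - M.mean i η)
    with hg
  -- What is linear in the Bayes error integrates to zero.
  have z1 := integral_mul_bayes_sub hM h (fun y => f y * g y)
  obtain ⟨i2, i1⟩ := integrable_bayes_error hM h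
  have iQ : Integrable (fun z : ℝ × ℝ => M.Q (M.bayes i η z.2)) (M.areaLaw i η) := by
    have := (integral_quartic hM h (M.Q (M.mean i η)) (M.Q' (M.mean i η) * k) (M.v₂ * k ^ 2) 0 0).1
    refine this.congr (Eventually.of_forall fun z => ?_)
    beta_reduce
    rw [Q_eq M (M.mean i η) (M.bayes i η z.2), eb]
    ring
  have ilin : Integrable (fun z : ℝ × ℝ => g z.2 * (M.bayes i η z.2 - deriv M.ψ z.1))
      (M.areaLaw i η) := by
    have hgl : ∀ y, g y = M.Q' (M.mean i η) + (2 * M.v₂ * k - (M.n i + nu η) * k) *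
        (y - M.mean i η) := fun y => by
      simp only [hg, eb, Q']; ring
    have a1 := i1.const_mul (M.Q' (M.mean i η))
    have a2 := ((hj 0 2 (by norm_num)).const_mul k).add ((hj 1 1 (by norm_num)).const_mul (-1))
    refine (a1.add (a2.const_mul (2 * M.v₂ * k - (M.n i + nu η) * k))).congr
      (Eventually.of_forall fun z => ?_)
    simp only [Pi.add_apply, hgl, eb]
    ring
  have e2 : ∀ z : ℝ × ℝ, f z.2 * (((1 : ℕ) : ℝ) * (deriv M.ψ z.1 - M.mean i η) ^ (1 - 1) *
      M.Q (deriv M.ψ z.1) + (deriv M.ψ z.1 - M.mean i η) ^ 1 * (M.n i * (z.2 - M.mean i η)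
        - (M.n i + nu η) * (deriv M.ψ z.1 - M.mean i η))) =
      (f z.2 * M.Q (M.bayes i η z.2) - (M.n i + nu η - M.v₂) *
        (f z.2 * (M.bayes i η z.2 - deriv M.ψ z.1) ^ 2)) +
      (-1) * (f z.2 * (g z.2 * (M.bayes i η z.2 - deriv M.ψ z.1))) := fun z => by
    rw [Q_eq M (M.bayes i η z.2) (deriv M.ψ z.1)]
    have e3 : M.n i * (z.2 - M.mean i η) - (M.n i + nu η) * (deriv M.ψ z.1 - M.mean i η) =
        (M.n i + nu η) * (M.bayes i η z.2 - deriv M.ψ z.1) := by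
      rw [eb]; nth_rewrite 1 [hnk]; ring
    rw [e3]
    simp only [hg]
    push_cast
    ring
  have i3 : Integrable (fun z : ℝ × ℝ => f z.2 * M.Q (M.bayes i η z.2) -
      (M.n i + nu η - M.v₂) * (f z.2 * (M.bayes i η z.2 - deriv M.ψ z.1) ^ 2)) (M.areaLaw i η) :=
    (hbdd iQ).sub ((hbdd i2).const_mul _)
  rw [integral_congr_ae (Eventually.of_forall e2), integral_add i3 ((hbdd ilin).const_mul _),
    integral_sub (hbdd iQ) ((hbdd i2).const_mul _), integral_const_mul, integral_const_mul] at h1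
  simp only [mul_assoc] at z1
  rw [z1, mul_zero, add_zero] at h1
  refine ⟨?_, ?_⟩
  · refine ((hbdd iQ).mul_const (M.n i + nu η - M.v₂)⁻¹).congr (Eventually.of_forall fun z => ?_)
    simp only [T1cond]; ring
  · have e4 : ∀ z : ℝ × ℝ, f z.2 * M.T1cond i η z.2 =
        (M.n i + nu η - M.v₂)⁻¹ * (f z.2 * M.Q (M.bayes i η z.2)) := fun z => by
      simp only [T1cond]; ring
    have e5 : ∀ z : ℝ × ℝ, f z.2 * (deriv M.ψ z.1 - M.bayes i η z.2) ^ 2 =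
        f z.2 * (M.bayes i η z.2 - deriv M.ψ z.1) ^ 2 := fun z => by ring
    simp only [e4, e5]
    rw [integral_const_mul, inv_mul_eq_iff_eq_mul₀ hD.ne']
    linarith

theorem integral_T1cond (hM : M.IsNEFQVF) (h : M.Admissible i η) :
    Integrable (fun z : ℝ × ℝ => M.T1cond i η z.2) (M.areaLaw i η) ∧
    ∫ z : ℝ × ℝ, M.T1cond i η z.2 ∂(M.areaLaw i η) = M.T1 i η := by
  have hn := hM.n_pos i
  have hν := h.nu_pos
  have h1 := h.sub_pos_one
  have hD : 0 < M.n i + nu η - M.v₂ := by linarith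
  set k := M.n i / (M.n i + nu η) with hk
  have eb : ∀ y, M.bayes i η y = M.mean i η + k * (y - M.mean i η) := fun y => by
    rw [← bayes_sub_mean hM hν]; ring
  obtain ⟨q1, q2⟩ := integral_quartic hM h (M.Q (M.mean i η) / (M.n i + nu η - M.v₂))
    (M.Q' (M.mean i η) * k / (M.n i + nu η - M.v₂)) (M.v₂ * k ^ 2 / (M.n i + nu η - M.v₂)) 0 0
  have e : ∀ z : ℝ × ℝ, M.Q (M.mean i η) / (M.n i + nu η - M.v₂) +
      M.Q' (M.mean i η) * k / (M.n i + nu η - M.v₂) * (z.2 - M.mean i η) +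
      M.v₂ * k ^ 2 / (M.n i + nu η - M.v₂) * (z.2 - M.mean i η) ^ 2 +
      0 * (z.2 - M.mean i η) ^ 3 + 0 * (z.2 - M.mean i η) ^ 4 = M.T1cond i η z.2 := fun z => by
    rw [T1cond, Q_eq M (M.mean i η) (M.bayes i η z.2), eb]
    ring
  simp only [e] at q1 q2
  refine ⟨q1, q2.trans ?_⟩
  rw [(jmom_values hM h).2.2.1, T1, muTwo, hk]
  have h2 : M.n i + nu η ≠ 0 := by positivity
  generalize M.Q (M.mean i η) = q at *
  generalize M.n i = n at *
  generalize nu η = ν at *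
  generalize M.v₂ = v at *
  obtain ⟨a, ha⟩ : ∃ a, ν - v = a := ⟨_, rfl⟩
  obtain ⟨b, hb⟩ : ∃ b, n + ν - v = b := ⟨_, rfl⟩
  rw [ha] at h1 ⊢
  rw [hb] at hD ⊢
  field_simp
  subst ha hb
  ring

/-! ### The Bayes estimator as a function of the parameter -/

variable (M) in
/-- The coefficients of `1` and `y` in the Bayes estimator. -/
noncomputable def bayesCoef (i : ℕ) (r : Fin 2) (η : Params p) : ℝ :=
  ![nu η / (M.n i + nu η) * M.mean i η, M.n i / (M.n i + nu η)] r

variable (M) in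
/-- The gradients of the coefficients of the Bayes estimator. -/
noncomputable def bayesGrad (i : ℕ) (η : Params p) (r : Fin 2) : Params p :=
  ![Sum.elim (fun k => nu η / (M.n i + nu η) * (M.Q (M.mean i η) * M.x i k))
      (fun _ => M.mean i η * (M.n i / (M.n i + nu η) ^ 2)),
    Sum.elim (fun _ => 0) (fun _ => -(M.n i / (M.n i + nu η) ^ 2))] r

theorem plugDiff_bayes (x : Params p) (y : ℝ) :
    plugDiff (M.bayesCoef i) η x y = M.bayes i x y - M.bayes i η y := by
  simp only [plugDiff, bayesCoef, Matrix.cons_val_zero, Matrix.cons_val_one,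
    Matrix.cons_val_fin_one, bayes]
  ring

theorem measurable_linPred : Measurable (M.linPred i) := by
  unfold AreaModel.linPred; fun_prop

theorem measurable_nu : Measurable (nu : Params p → ℝ) := measurable_pi_apply _

theorem measurable_bayesCoef (r : Fin 2) : Measurable (M.bayesCoef i r) := by
  have h1 : Measurable (M.mean i) := (measurable_deriv M.ψ).comp measurable_linPred
  have h2 := measurable_nu (p := p)
  fin_cases r
  · exact (h2.div (h2.const_add _)).mul h1
  · exact measurable_const.div (h2.const_add _)

theorem hasFDerivAt_bayesCoef (hM : M.IsNEFQVF) (h : M.Admissible i η) (r : Fin 2) :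
    ∃ φ : Params p →L[ℝ] ℝ, HasFDerivAt (M.bayesCoef i r) φ η ∧
      ∀ u, φ u = M.bayesGrad i η r ⬝ᵥ u := by
  have hn := hM.n_pos i
  have hν := h.nu_pos
  have hne : M.n i + nu η ≠ 0 := by positivity
  have hnu : HasFDerivAt (nu : Params p → ℝ) (ContinuousLinearMap.proj (Sum.inr ())) η :=
    (ContinuousLinearMap.proj (R := ℝ) (φ := fun _ : Idx p => ℝ) (Sum.inr ())).hasFDerivAt
  have hlin : HasFDerivAt (M.linPred i)
      (∑ k, M.x i k • ContinuousLinearMap.proj (R := ℝ) (φ := fun _ : Idx p => ℝ) (Sum.inl k)) η := by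
    have := HasFDerivAt.fun_sum (u := Finset.univ) (fun k _ =>
      ((ContinuousLinearMap.proj (R := ℝ) (φ := fun _ : Idx p => ℝ)
        (Sum.inl k : Idx p)).hasFDerivAt (x := η)).const_mul (M.x i k))
    exact this
  have hmean : HasFDerivAt (M.mean i) _ η := (hasDerivAt_deriv_ψ hM h.mem).comp_hasFDerivAt η hlin
  have h1 : HasDerivAt (fun s : ℝ => s / (M.n i + s)) (M.n i / (M.n i + nu η) ^ 2) (nu η) := by
    refine ((hasDerivAt_id (nu η)).div ((hasDerivAt_id (nu η)).const_add (M.n i))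
      hne).congr_deriv ?_
    simp
  have h2 : HasDerivAt (fun s : ℝ => M.n i / (M.n i + s)) (-(M.n i / (M.n i + nu η) ^ 2))
      (nu η) := by
    refine ((hasDerivAt_const (nu η) (M.n i)).div ((hasDerivAt_id (nu η)).const_add (M.n i))
      hne).congr_deriv ?_
    simp [neg_div]
  fin_cases r
  · refine ⟨_, (h1.comp_hasFDerivAt η hnu).mul hmean, fun u => ?_⟩
    simp only [bayesGrad, dotProduct, Fintype.sum_sum_type]
    simp [Finset.mul_sum, mul_assoc, mean]
  · refine ⟨_, h2.comp_hasFDerivAt η hnu, fun u => ?_⟩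
    simp only [bayesGrad, dotProduct, Fintype.sum_sum_type]
    simp

/-- The Bayes estimator is affine in `y` with coefficients differentiable in the parameter, so
compactness of `K` and differentiability at `η` of two functions suffice. -/
theorem Regular.exists_smoothPlugIn (h : M.Regular K η) (hM : M.IsNEFQVF) (i : ℕ) :
    ∃ k : ℝ, SmoothPlugIn K η (M.bayesCoef i) (M.bayesGrad i η) k := by
  obtain ⟨C, hC, hconv, hCdom, hCarg⟩ := h.exists_box hM
  have hadm : ∀ x ∈ K, M.Admissible i x := fun x hx => admissible_of_mem (hCdom (hCarg i x hx))
  have hcont : ∀ r, ContinuousOn (fun x => M.bayesCoef i r x - M.bayesCoef i r η) K := fun r x hx => by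
    obtain ⟨φ, hφ, -⟩ := hasFDerivAt_bayesCoef hM (hadm x hx) r
    exact (hφ.continuousAt.sub continuousAt_const).continuousWithinAt
  choose k hk using fun r => h.isCompact.exists_bound_of_continuousOn (hcont r)
  set S := ∑ r, ∑ b, |M.bayesGrad i η r b| with hS
  have hS0 : 0 ≤ S := by positivity
  have hk0 := fun r => abs_nonneg (k r)
  refine ⟨|k 0| + |k 1| + S, by positivity, measurable_bayesCoef, fun r x hx => ?_, fun r b => ?_,
    fun κ hκ => ?_⟩
  · have := hk r x hx
    rw [Real.norm_eq_abs] at this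
    have h0 := hk0 0
    have h1 := hk0 1
    fin_cases r
    · exact this.trans (by have := le_abs_self (k 0); simp only [Fin.zero_eta]; linarith)
    · exact this.trans (by have := le_abs_self (k 1); simp only [Fin.mk_one]; linarith)
  · have h1 : |M.bayesGrad i η r b| ≤ S :=
      (Finset.single_le_sum (f := fun b => |M.bayesGrad i η r b|) (fun _ _ => abs_nonneg _)
        (Finset.mem_univ b)).trans (Finset.single_le_sum
        (f := fun r => ∑ b, |M.bayesGrad i η r b|) (fun _ _ => by positivity) (Finset.mem_univ r))
    linarith [hk0 0, hk0 1]
  · have hev : ∀ r, ∀ᶠ x in 𝓝 η, |M.bayesCoef i r x - M.bayesCoef i r η -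
        M.bayesGrad i η r ⬝ᵥ (x - η)| ≤ κ * ‖x - η‖ := fun r => by
      obtain ⟨φ, hφ, hφu⟩ := hasFDerivAt_bayesCoef hM (hadm η h.mem) r
      filter_upwards [hφ.isLittleO.def hκ] with x hx
      rwa [hφu, Real.norm_eq_abs] at hx
    obtain ⟨ρ, hρ, hball⟩ := Metric.nhds_basis_closedBall.eventually_iff.1
      (eventually_all.2 hev)
    exact ⟨ρ, hρ, fun r x hx => hball (by rwa [Metric.mem_closedBall, dist_eq_norm]) r⟩

/-- `P` is the outer product of the gradient of the Bayes estimator with respect to the parameter.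
-/
theorem P_apply (hM : M.IsNEFQVF) (h : M.Admissible i η) (y : ℝ) (a b : Idx p) :
    M.P i η y a b = plugGrad (M.bayesGrad i η) y a * plugGrad (M.bayesGrad i η) y b := by
  have hn := hM.n_pos i
  have hν := h.nu_pos
  have hne : M.n i + nu η ≠ 0 := by positivity
  simp only [P, plugGrad, bayesGrad, Matrix.cons_val_zero, Matrix.cons_val_one,
    Matrix.cons_val_fin_one, Pi.add_apply, Pi.smul_apply, smul_eq_mul, Matrix.smul_apply]
  rcases a with a | a <;> rcases b with b | b
  all_goals
    simp only [Matrix.fromBlocks_apply₁₁, Matrix.fromBlocks_apply₁₂, Matrix.fromBlocks_apply₂₁,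
      Matrix.fromBlocks_apply₂₂, Matrix.smul_apply, Matrix.vecMulVec_apply, Matrix.of_apply,
      smul_eq_mul, Sum.elim_inl, Sum.elim_inr]
    field_simp
    ring

variable (M) in
/-- The mean of the matrix `P`. -/
noncomputable def meanP (i : ℕ) (η : Params p) : Matrix (Idx p) (Idx p) ℝ :=
  ((M.n i + nu η) ^ 2)⁻¹ • Matrix.fromBlocks
    ((nu η ^ 2 * M.Q (M.mean i η) ^ 2) • Matrix.vecMulVec (M.x i) (M.x i)) 0 0
    (Matrix.of fun (_ _ : Unit) => M.n i / (M.n i + nu η) * M.Q (M.mean i η) / (nu η - M.v₂))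

theorem integral_P (hM : M.IsNEFQVF) (h : M.Admissible i η) (a b : Idx p) :
    Integrable (fun z : ℝ × ℝ => M.P i η z.2 a b) (M.areaLaw i η) ∧
    ∫ z : ℝ × ℝ, M.P i η z.2 a b ∂(M.areaLaw i η) = M.meanP i η a b := by
  have hn := hM.n_pos i
  have hν := h.nu_pos
  have h1 := h.sub_pos_one
  have hne : M.n i + nu η ≠ 0 := by positivity
  have key : ∃ c₀ c₁ c₂ : ℝ, (∀ y, M.P i η y a b = c₀ + c₁ * (y - M.mean i η) +
      c₂ * (y - M.mean i η) ^ 2) ∧ c₀ + c₂ * M.mu 2 i η = M.meanP i η a b := by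
    rw [(jmom_values hM h).2.2.1]
    simp only [P, meanP, Matrix.smul_apply, smul_eq_mul]
    rcases a with a | a <;> rcases b with b | b <;>
      simp only [Matrix.fromBlocks_apply₁₁, Matrix.fromBlocks_apply₁₂, Matrix.fromBlocks_apply₂₁,
        Matrix.fromBlocks_apply₂₂, Matrix.smul_apply, Matrix.vecMulVec_apply, Matrix.of_apply,
        smul_eq_mul, Matrix.zero_apply]
    · exact ⟨_, 0, 0, fun y => by rw [zero_mul, zero_mul, add_zero, add_zero], by ring⟩
    · exact ⟨0, -(((M.n i + nu η) ^ 2)⁻¹ *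
        (M.n i * nu η / (M.n i + nu η) * M.Q (M.mean i η) * M.x i a)), 0,
        fun y => by ring, by ring⟩
    · exact ⟨0, -(((M.n i + nu η) ^ 2)⁻¹ *
        (M.n i * nu η / (M.n i + nu η) * M.Q (M.mean i η) * M.x i b)), 0,
        fun y => by ring, by ring⟩
    · refine ⟨0, 0, ((M.n i + nu η) ^ 2)⁻¹ * (M.n i ^ 2 / (M.n i + nu η) ^ 2),
        fun y => by ring, ?_⟩
      unfold muTwo
      field_simp
      ring
  obtain ⟨c₀, c₁, c₂, hP, hc⟩ := key
  obtain ⟨q1, q2⟩ := integral_quartic hM h c₀ c₁ c₂ 0 0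
  simp only [zero_mul, add_zero] at q1 q2
  simp only [hP]
  exact ⟨q1, q2.trans hc⟩

theorem T2cond_eq (m : ℕ) (y : ℝ) :
    M.T2cond m i η y = ∑ a, ∑ b, M.P i η y a b * (M.U m η)⁻¹ b a := by
  simp [T2cond, Matrix.trace, Matrix.mul_apply]

theorem T2_eq (m : ℕ) : M.T2 m i η = ∑ a, ∑ b, M.meanP i η a b * (M.U m η)⁻¹ b a := by
  have : M.T2 m i η = (M.meanP i η * (M.U m η)⁻¹).trace := by
    rw [T2, meanP, Matrix.smul_mul, Matrix.trace_smul, smul_eq_mul]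
  rw [this]
  simp [Matrix.trace, Matrix.mul_apply]

theorem integral_T2cond (hM : M.IsNEFQVF) (h : M.Admissible i η) (m : ℕ) :
    Integrable (fun z : ℝ × ℝ => M.T2cond m i η z.2) (M.areaLaw i η) ∧
    ∫ z : ℝ × ℝ, M.T2cond m i η z.2 ∂(M.areaLaw i η) = M.T2 m i η := by
  have hi := fun a b => (integral_P hM h a b).1.mul_const ((M.U m η)⁻¹ b a)
  simp only [T2cond_eq, T2_eq]
  refine ⟨integrable_finsetSum _ fun a _ => integrable_finsetSum _ fun b _ => hi a b, ?_⟩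
  rw [integral_finsetSum _ fun a _ => integrable_finsetSum _ fun b _ => hi a b]
  refine Finset.sum_congr rfl fun a _ => ?_
  rw [integral_finsetSum _ fun b _ => hi a b]
  refine Finset.sum_congr rfl fun b _ => ?_
  rw [integral_mul_const, (integral_P hM h a b).2]

end AreaModel
end NEFQVF

/-! ### Posterior moments and the expansion of the mean squared error. -/

namespace NEFQVF

/-- A product is centred if one factor is, given an independent variable and the second component
of the other one. -/
theorem integral_mul_eq_zero_of_indepFun {Ω E : Type*} [MeasurableSpace Ω] [MeasurableSpace E]
    {μ : Measure Ω} [IsProbabilityMeasure μ] {Z : Ω → ℝ × ℝ} {W : Ω → E} (hZ : Measurable Z)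
    (hW : Measurable W) (hind : IndepFun Z W μ) {h : E → ℝ → ℝ}
    (hh : Measurable (Function.uncurry h)) {e : ℝ × ℝ → ℝ} (he : Measurable e)
    (hint : Integrable (fun ω => h (W ω) (Z ω).2 * e (Z ω)) μ)
    (hzero : ∀ f : ℝ → ℝ, ∫ z, f z.2 * e z ∂(μ.map Z) = 0) :
    ∫ ω, h (W ω) (Z ω).2 * e (Z ω) ∂μ = 0 := by
  have hp := (indepFun_iff_map_prod_eq_prod_map_map hZ.aemeasurable hW.aemeasurable).1 hind
  have := Measure.isProbabilityMeasure_map (μ := μ) hZ.aemeasurable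
  have := Measure.isProbabilityMeasure_map (μ := μ) hW.aemeasurable
  have hF : Measurable fun q : (ℝ × ℝ) × E => h q.2 q.1.2 * e q.1 :=
    (hh.comp (measurable_snd.prodMk (measurable_snd.comp measurable_fst))).mul
      (he.comp measurable_fst)
  have hint' : Integrable (fun q : (ℝ × ℝ) × E => h q.2 q.1.2 * e q.1)
      ((μ.map Z).prod (μ.map W)) := by
    rw [← hp]
    exact (integrable_map_measure hF.aestronglyMeasurable (hZ.prodMk hW).aemeasurable).2 hint
  have e1 : ∫ ω, h (W ω) (Z ω).2 * e (Z ω) ∂μ =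
      ∫ q, h q.2 q.1.2 * e q.1 ∂((μ.map Z).prod (μ.map W)) := by
    rw [← hp, integral_map (hZ.prodMk hW).aemeasurable hF.aestronglyMeasurable]
  rw [e1, integral_prod_symm _ hint']
  simp only [hzero, integral_zero]

namespace AreaModel

variable {p : ℕ} {M : AreaModel p} {K : Set (Params p)} {η : Params p}

theorem Regular.admissible (h : M.Regular K η) (hM : M.IsNEFQVF) (i : ℕ) : M.Admissible i η := by
  obtain ⟨C, -, -, hCdom, hCarg⟩ := h.exists_box hM
  exact admissible_of_mem (hCdom (hCarg i η h.mem))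

section Posterior

variable {Ω : Type*} [MeasurableSpace Ω] {μ : Measure Ω} [IsProbabilityMeasure μ] {θ Y : Ω → ℝ}
  {i : ℕ}

theorem integrable_deriv_comp (hM : M.IsNEFQVF) (h : M.Admissible i η) (hθ : Measurable θ)
    (hY : Measurable Y) (hlaw : μ.map (fun ω => (θ ω, Y ω)) = M.areaLaw i η) :
    Integrable (fun ω => deriv M.ψ (θ ω)) μ ∧ Integrable (fun ω => M.bayes i η (Y ω)) μ := by
  have hdm := measurable_deriv M.ψ
  have hbm := measurable_bayes (M := M) (i := i) (η := η)
  obtain ⟨-, i1⟩ := integrable_bayes_error hM h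
  have ib : Integrable (fun z : ℝ × ℝ => M.bayes i η z.2) (M.areaLaw i η) := by
    refine (integral_quartic hM h (M.mean i η) (M.n i / (M.n i + nu η)) 0 0 0).1.congr
      (Eventually.of_forall fun z => ?_)
    beta_reduce
    rw [← bayes_sub_mean hM h.nu_pos]
    ring
  have iξ : Integrable (fun z : ℝ × ℝ => deriv M.ψ z.1) (M.areaLaw i η) :=
    (ib.sub i1).congr (Eventually.of_forall fun z => by simp)
  exact ⟨integrable_comp_y hθ hY hlaw (hdm.comp measurable_fst) iξ,
    integrable_comp_y hθ hY hlaw (hbm.comp measurable_snd) ib⟩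

theorem setIntegral_preimage (hY : Measurable Y) {B : Set ℝ} (hB : MeasurableSet B) (g : Ω → ℝ) :
    ∫ ω in Y ⁻¹' B, g ω ∂μ = ∫ ω, B.indicator 1 (Y ω) * g ω ∂μ := by
  rw [← integral_indicator (hY hB)]
  congr 1
  funext ω
  by_cases hω : Y ω ∈ B <;> simp [Set.indicator, hω]

/-- Events generated by `Y` are preimages, and testing against their indicators is the orthogonality
of the Bayes error to functions of `y`. -/
theorem condExp_deriv_ae_eq (hM : M.IsNEFQVF) (h : M.Admissible i η) (hθ : Measurable θ)
    (hY : Measurable Y) (hlaw : μ.map (fun ω => (θ ω, Y ω)) = M.areaLaw i η) :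
    μ[fun ω => deriv M.ψ (θ ω) | MeasurableSpace.comap Y inferInstance]
      =ᵐ[μ] fun ω => M.bayes i η (Y ω) := by
  have hdm := measurable_deriv M.ψ
  have hbm := measurable_bayes (M := M) (i := i) (η := η)
  obtain ⟨iξ, ib⟩ := integrable_deriv_comp hM h hθ hY hlaw
  symm
  refine ae_eq_condExp_of_forall_setIntegral_eq hY.comap_le iξ
    (fun s _ _ => ib.integrableOn) ?_ (hbm.comp (comap_measurable Y)).aestronglyMeasurable
  rintro s ⟨B, hB, rfl⟩ -
  have hBm : Measurable (B.indicator (1 : ℝ → ℝ)) := measurable_one.indicator hB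
  have hbd : ∀ y, |B.indicator (1 : ℝ → ℝ) y| ≤ 1 := fun y => by
    by_cases hy : y ∈ B <;> simp [hy]
  have hmul : ∀ {g : Ω → ℝ}, Integrable g μ →
      Integrable (fun ω => B.indicator (1 : ℝ → ℝ) (Y ω) * g ω) μ := fun hg =>
    hg.bdd_mul (c := 1) (hBm.comp hY).aestronglyMeasurable (Eventually.of_forall fun ω => hbd _)
  rw [setIntegral_preimage hY hB, setIntegral_preimage hY hB, ← sub_eq_zero,
    ← integral_sub (hmul ib) (hmul iξ),
    ← integral_mul_bayes_sub hM h (B.indicator (1 : ℝ → ℝ)),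
    ← integral_comp_y (f := fun z => B.indicator (1 : ℝ → ℝ) z.2 *
      (M.bayes i η z.2 - deriv M.ψ z.1)) hθ hY hlaw
      ((hBm.comp measurable_snd).mul ((hbm.comp measurable_snd).sub (hdm.comp measurable_fst)))]
  simp only [mul_sub]

theorem integrable_sq_bayes_error (hM : M.IsNEFQVF) (h : M.Admissible i η) (hθ : Measurable θ)
    (hY : Measurable Y) (hlaw : μ.map (fun ω => (θ ω, Y ω)) = M.areaLaw i η) :
    Integrable (fun ω => (M.bayes i η (Y ω) - deriv M.ψ (θ ω)) ^ 2) μ := by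
  have hdm := measurable_deriv M.ψ
  have hbm := measurable_bayes (M := M) (i := i) (η := η)
  exact integrable_comp_y hθ hY hlaw
    (((hbm.comp measurable_snd).sub (hdm.comp measurable_fst)).pow_const 2)
    (integrable_bayes_error hM h).1

theorem integral_T1cond_comp (hM : M.IsNEFQVF) (h : M.Admissible i η) (hθ : Measurable θ)
    (hY : Measurable Y) (hlaw : μ.map (fun ω => (θ ω, Y ω)) = M.areaLaw i η) :
    Integrable (fun ω => M.T1cond i η (Y ω)) μ ∧ ∫ ω, M.T1cond i η (Y ω) ∂μ = M.T1 i η := by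
  have hm : Measurable fun z : ℝ × ℝ => M.T1cond i η z.2 :=
    (continuous_T1cond (M := M) (i := i) (η := η)).measurable.comp measurable_snd
  obtain ⟨h1, h2⟩ := integral_T1cond hM h
  exact ⟨integrable_comp_y hθ hY hlaw hm h1,
    (integral_comp_y (f := fun z => M.T1cond i η z.2) hθ hY hlaw hm).trans h2⟩

theorem integral_sq_bayes_error (hM : M.IsNEFQVF) (h : M.Admissible i η) (hθ : Measurable θ)
    (hY : Measurable Y) (hlaw : μ.map (fun ω => (θ ω, Y ω)) = M.areaLaw i η) {f : ℝ → ℝ}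
    (hf : Measurable f) {C : ℝ} (hC : ∀ y, |f y| ≤ C) :
    ∫ ω, f (Y ω) * M.T1cond i η (Y ω) ∂μ =
      ∫ ω, f (Y ω) * (deriv M.ψ (θ ω) - M.bayes i η (Y ω)) ^ 2 ∂μ := by
  have hdm := measurable_deriv M.ψ
  have hbm := measurable_bayes (M := M) (i := i) (η := η)
  have hTm := (continuous_T1cond (M := M) (i := i) (η := η)).measurable
  rw [integral_comp_y (f := fun z => f z.2 * M.T1cond i η z.2) hθ hY hlaw
      ((hf.comp measurable_snd).mul (hTm.comp measurable_snd)),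
    integral_comp_y (f := fun z => f z.2 * (deriv M.ψ z.1 - M.bayes i η z.2) ^ 2) hθ hY hlaw
      ((hf.comp measurable_snd).mul
        (((hdm.comp measurable_fst).sub (hbm.comp measurable_snd)).pow_const 2))]
  exact (integral_mul_sq_bayes_sub hM h hf hC).2

theorem condVar_deriv_ae_eq (hM : M.IsNEFQVF) (h : M.Admissible i η) (hθ : Measurable θ)
    (hY : Measurable Y) (hlaw : μ.map (fun ω => (θ ω, Y ω)) = M.areaLaw i η) :
    condVar (MeasurableSpace.comap Y inferInstance) (fun ω => deriv M.ψ (θ ω)) μ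
      =ᵐ[μ] fun ω => M.T1cond i η (Y ω) := by
  have hTm := (continuous_T1cond (M := M) (i := i) (η := η)).measurable
  have iT := (integral_T1cond_comp hM h hθ hY hlaw).1
  have ie : Integrable (fun ω => (deriv M.ψ (θ ω) - M.bayes i η (Y ω)) ^ 2) μ :=
    (integrable_sq_bayes_error hM h hθ hY hlaw).congr
      (Eventually.of_forall fun ω => by beta_reduce; ring)
  have e1 : condVar (MeasurableSpace.comap Y inferInstance) (fun ω => deriv M.ψ (θ ω)) μ =ᵐ[μ]
      μ[fun ω => (deriv M.ψ (θ ω) - M.bayes i η (Y ω)) ^ 2 |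
        MeasurableSpace.comap Y inferInstance] := by
    refine condExp_congr_ae ?_
    filter_upwards [condExp_deriv_ae_eq hM h hθ hY hlaw] with ω hω
    simp only [Pi.pow_apply, Pi.sub_apply, hω]
  refine e1.trans (ae_eq_condExp_of_forall_setIntegral_eq hY.comap_le ie
    (fun s _ _ => iT.integrableOn) ?_
    (hTm.comp (comap_measurable Y)).aestronglyMeasurable).symm
  rintro s ⟨B, hB, rfl⟩ -
  rw [setIntegral_preimage hY hB, setIntegral_preimage hY hB]
  exact integral_sq_bayes_error hM h hθ hY hlaw (measurable_one.indicator hB) (C := 1)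
    fun y => by by_cases hy : y ∈ B <;> simp [hy]

theorem integral_T2cond_comp (hM : M.IsNEFQVF) (h : M.Admissible i η) (hθ : Measurable θ)
    (hY : Measurable Y) (hlaw : μ.map (fun ω => (θ ω, Y ω)) = M.areaLaw i η) (m : ℕ) :
    Integrable (fun ω => M.T2cond m i η (Y ω)) μ ∧ ∫ ω, M.T2cond m i η (Y ω) ∂μ = M.T2 m i η := by
  have hm : Measurable fun z : ℝ × ℝ => M.T2cond m i η z.2 := by
    simp only [T2cond_eq, P_apply hM h, plugGrad, Pi.add_apply, Pi.smul_apply, smul_eq_mul]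
    fun_prop
  obtain ⟨h1, h2⟩ := integral_T2cond hM h m
  exact ⟨integrable_comp_y hθ hY hlaw hm h1,
    (integral_comp_y (f := fun z => M.T2cond m i η z.2) hθ hY hlaw hm).trans h2⟩

end Posterior

section MeanSquaredError

variable {Ω : Type*} [MeasurableSpace Ω] {μ : Measure Ω} [IsProbabilityMeasure μ] {θ Y : ℕ → Ω → ℝ}
  {est : (m : ℕ) → (Fin m → ℝ) → Params p}

/-- The change of the Bayes estimator due to the estimation of the parameter is uncorrelated with
the error of the Bayes estimator. -/
theorem integral_bayes_change_mul_error (hM : M.IsNEFQVF) {i m : ℕ} (h : M.Admissible i η)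
    (hθm : ∀ j, Measurable (θ j)) (hYm : ∀ j, Measurable (Y j))
    (hindep : iIndepFun (fun j ω => (θ j ω, Y j ω)) μ)
    (hlaw : μ.map (fun ω => (θ i ω, Y i ω)) = M.areaLaw i η) (hest : Measurable (est m))
    (hint : Integrable (fun ω => plugDiff (M.bayesCoef i) η (est m fun j : Fin m => Y j ω) (Y i ω) *
      (M.bayes i η (Y i ω) - deriv M.ψ (θ i ω))) μ) :
    ∫ ω, plugDiff (M.bayesCoef i) η (est m fun j : Fin m => Y j ω) (Y i ω) *
      (M.bayes i η (Y i ω) - deriv M.ψ (θ i ω)) ∂μ = 0 := by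
  have hdm := measurable_deriv M.ψ
  have hbm := measurable_bayes (M := M) (i := i) (η := η)
  have hZm : ∀ j, Measurable fun ω => (θ j ω, Y j ω) := fun j => (hθm j).prodMk (hYm j)
  set S := (Finset.range m).erase i with hS
  have hI := hindep.indepFun_finset {i} S (by simp [hS]) hZm
  have hproj : Measurable fun v : ({i} : Finset ℕ) → ℝ × ℝ => v ⟨i, Finset.mem_singleton_self i⟩ :=
    measurable_pi_apply _
  have hI2 : IndepFun (fun ω => (θ i ω, Y i ω)) (fun ω (j : S) => (θ j ω, Y j ω)) μ :=
    hI.comp hproj measurable_id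
  have hWm : Measurable fun ω (j : S) => (θ j ω, Y j ω) :=
    measurable_pi_lambda _ fun j => hZm j
  -- Rebuilds the data vector from the other areas and the value of area `i`, so that the plug-in
  -- change is a function of an independent variable and of `y i` only.
  let data : (S → ℝ × ℝ) → ℝ → Fin m → ℝ := fun w t j =>
    if hj : (j : ℕ) = i then t else
      (w ⟨j, Finset.mem_erase.2 ⟨hj, Finset.mem_range.2 j.2⟩⟩).2
  have hdata : ∀ ω, data (fun j : S => (θ j ω, Y j ω)) (Y i ω) = fun j : Fin m => Y j ω :=
    fun ω => by
      funext j
      by_cases hj : (j : ℕ) = i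
      · simp [data, hj]
      · simp [data, hj]
  have hdatam : Measurable (Function.uncurry data) := by
    refine measurable_pi_lambda _ fun j => ?_
    by_cases hj : (j : ℕ) = i
    · simp only [Function.uncurry_def, data, hj, dite_true]
      exact measurable_snd
    · simp only [Function.uncurry_def, data, hj, dite_false]
      have h1 : Measurable fun w : S → ℝ × ℝ =>
        w ⟨j, Finset.mem_erase.2 ⟨hj, Finset.mem_range.2 j.2⟩⟩ := measurable_pi_apply _
      exact measurable_snd.comp (h1.comp measurable_fst)
  have hh : Measurable (Function.uncurry fun w t =>
      plugDiff (M.bayesCoef i) η (est m (data w t)) t) := by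
    have h0 := (measurable_bayesCoef (M := M) (i := i) 0).comp (hest.comp hdatam)
    have h1 := (measurable_bayesCoef (M := M) (i := i) 1).comp (hest.comp hdatam)
    exact (h0.sub_const _).add (measurable_snd.mul (h1.sub_const _))
  have key := integral_mul_eq_zero_of_indepFun (hZm i) hWm hI2 hh
    (e := fun z => M.bayes i η z.2 - deriv M.ψ z.1)
    ((hbm.comp measurable_snd).sub (hdm.comp measurable_fst))
  simp only [hdata] at key
  exact key hint fun f => by rw [hlaw]; exact integral_mul_bayes_sub hM h f

/-- Orthogonality makes the squared error split exactly into `T₁` and the mean square of the plug-in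
change, so the only approximation is the one for the latter. -/
theorem Regular.mse_expansion (h : M.Regular K η) (hM : M.IsNEFQVF)
    (hθm : ∀ j, Measurable (θ j)) (hYm : ∀ j, Measurable (Y j))
    (hindep : iIndepFun (fun j ω => (θ j ω, Y j ω)) μ)
    (hlaw : ∀ j, μ.map (fun ω => (θ j ω, Y j ω)) = M.areaLaw j η)
    (hU : ∃ c : ℝ, 0 < c ∧ ∀ᶠ m : ℕ in atTop, ∀ u : Params p,
      c * m * (u ⬝ᵥ u) ≤ u ⬝ᵥ (M.U m η *ᵥ u))
    (hident : ∀ ε : ℝ, 0 < ε → ∃ δ : ℝ, 0 < δ ∧ ∀ᶠ m : ℕ in atTop, ∀ η' ∈ K, ε ≤ dist η' η →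
      δ * m ≤ ‖∫ ω, M.score m η' (fun j : Fin m => Y j ω) ∂μ‖)
    (hest : M.IsGTEstimator K est) (i : ℕ) :
    (∀ m, Integrable (fun ω => M.ebError θ Y est m i ω ^ 2) μ) ∧
    (fun m : ℕ => M.MSE μ θ Y est m i - (M.T1 i η + M.T2 m i η)) =o[atTop]
      fun m : ℕ => (m : ℝ)⁻¹ := by
  have hdm := measurable_deriv M.ψ
  have hbm := measurable_bayes (M := M) (i := i) (η := η)
  have hadm := h.admissible hM i
  obtain ⟨C, -, -, hCdom, hCarg⟩ := h.exists_box hM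
  obtain ⟨q, B, hmb⟩ := h.exists_momentBound hM hθm hYm hlaw
  obtain ⟨L, hS⟩ := h.exists_smoothScore hM hmb hθm hYm hlaw hU hident
  obtain ⟨k, hf⟩ := h.exists_smoothPlugIn hM i
  have hY : iIndepFun Y μ := hindep.comp (fun _ z => z.2) fun _ => measurable_snd
  have hdata : ∀ m, Measurable fun ω (j : Fin m) => Y j ω := fun m =>
    measurable_pi_lambda _ fun j => hYm j
  have hscore : ∀ m, ∀ x ∈ K, ∀ ω, M.score m x (fun j : Fin m => Y j ω) =
      scoreSum M.coef m x (fun j => Y j ω) := fun m x hx ω => by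
    rw [score, scoreSum, Finset.sum_range]
    exact Finset.sum_congr rfl fun j _ => score_summand hM (hCdom (hCarg j x hx)) _
  set D : ℕ → Ω → ℝ := fun m ω =>
    plugDiff (M.bayesCoef i) η (est m fun j : Fin m => Y j ω) (Y i ω) with hD
  set e : Ω → ℝ := fun ω => M.bayes i η (Y i ω) - deriv M.ψ (θ i ω) with he
  obtain ⟨iD, hlim⟩ := hS.tendsto_integral_sq_plugDiff hf hmb hYm hY
    (est := fun m ω => est m fun j : Fin m => Y j ω) (fun m => (hest m).1.comp (hdata m))
    (fun m ω => ((hest m).2 _).1) (fun m ω hex => by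
      obtain ⟨x, hx, hx0⟩ := hex
      have := ((hest m).2 (fun j : Fin m => Y j ω)).2 ⟨x, hx, by rw [hscore m x hx, hx0]⟩
      rwa [hscore m _ ((hest m).2 _).1] at this) i
  have ie : Integrable (fun ω => e ω ^ 2) μ :=
    integrable_sq_bayes_error hM hadm (hθm i) (hYm i) (hlaw i)
  have hem : Measurable e := (hbm.comp (hYm i)).sub (hdm.comp (hθm i))
  have hDm : ∀ m, Measurable (D m) := fun m => by
    have h0 := (hf.measurable 0).comp ((hest m).1.comp (hdata m))
    have h1 := (hf.measurable 1).comp ((hest m).1.comp (hdata m))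
    exact (h0.sub_const _).add ((hYm i).mul (h1.sub_const _))
  have iDe : ∀ m, Integrable (fun ω => D m ω * e ω) μ := fun m => by
    refine Integrable.mono' ((iD m).add ie) ((hDm m).mul hem).aestronglyMeasurable
      (Eventually.of_forall fun ω => ?_)
    rw [Real.norm_eq_abs, abs_le]
    simp only [Pi.add_apply]
    constructor <;> nlinarith [sq_nonneg (D m ω + e ω), sq_nonneg (D m ω - e ω)]
  have herr : ∀ m ω, M.ebError θ Y est m i ω ^ 2 = D m ω ^ 2 + 2 * (D m ω * e ω) + e ω ^ 2 :=
    fun m ω => by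
      simp only [ebError, hD, he, plugDiff_bayes]
      ring
  have i1 : ∀ m, Integrable (fun ω => D m ω ^ 2 + 2 * (D m ω * e ω)) μ := fun m =>
    (iD m).add ((iDe m).const_mul 2)
  have he2 : ∫ ω, e ω ^ 2 ∂μ = M.T1 i η := by
    have h1 := integral_sq_bayes_error hM hadm (hθm i) (hYm i) (hlaw i) (f := fun _ => 1)
      measurable_const (C := 1) (by simp)
    simp only [one_mul] at h1
    rw [← (integral_T1cond_comp hM hadm (hθm i) (hYm i) (hlaw i)).2, h1]
    refine integral_congr_ae (Eventually.of_forall fun ω => ?_)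
    simp only [he]
    ring
  have hT2 : ∀ m, ∑ a, ∑ b, (∫ ω, plugGrad (M.bayesGrad i η) (Y i ω) a *
      plugGrad (M.bayesGrad i η) (Y i ω) b ∂μ) * (∑ j ∈ Finset.range m, M.info j η)⁻¹ b a =
      M.T2 m i η := fun m => by
    have eU : ∑ j ∈ Finset.range m, M.info j η = M.U m η := by
      rw [U, Finset.sum_range]; rfl
    rw [eU, T2_eq]
    refine Finset.sum_congr rfl fun a _ => Finset.sum_congr rfl fun b _ => ?_
    have hm : Measurable fun z : ℝ × ℝ => M.P i η z.2 a b := by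
      simp only [P_apply hM hadm, plugGrad, Pi.add_apply, Pi.smul_apply, smul_eq_mul]
      fun_prop
    rw [← (integral_P hM hadm a b).2,
      ← integral_comp_y (f := fun z => M.P i η z.2 a b) (hθm i) (hYm i) (hlaw i) hm]
    simp only [P_apply hM hadm]
  refine ⟨fun m => ?_, ?_⟩
  · simp only [herr]
    exact (i1 m).add ie
  · have hmse : ∀ m, M.MSE μ θ Y est m i - (M.T1 i η + M.T2 m i η) =
        ∫ ω, D m ω ^ 2 ∂μ - M.T2 m i η := fun m => by
      have hz := integral_bayes_change_mul_error hM hadm hθm hYm hindep (hlaw i) (hest m).1 (iDe m)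
      rw [MSE]
      simp only [herr]
      rw [integral_add (i1 m) ie, integral_add (iD m) ((iDe m).const_mul 2), integral_const_mul,
        he2, hz]
      ring
    simp only [hT2] at hlim
    refine (isLittleO_iff_tendsto' ?_).2 ?_
    -- At `m = 0` the comparison function `m⁻¹` is `0`; only positive `m` matter.
    · filter_upwards [eventually_gt_atTop 0] with m hm h0
      exact absurd h0 (by positivity)
    · refine hlim.congr fun m => ?_
      rw [hmse, div_inv_eq_mul, mul_comm]

end MeanSquaredError

end AreaModel
end NEFQVF

theorem mainTheorem7 {p : ℕ} (M : NEFQVF.AreaModel p) (hM : M.IsNEFQVF)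
    -- the parameter set `K` and the true parameter `η`
    (K : Set (NEFQVF.Params p)) (hK : IsCompact K)
    (hν : ∀ η' ∈ K, 0 < NEFQVF.AreaModel.nu η' ∧ 3 * M.v₂ < NEFQVF.AreaModel.nu η')
    (hx : ∃ T : Set ℝ, IsCompact T ∧ T ⊆ M.Θ ∧ ∀ j, ∀ η' ∈ K, M.linPred j η' ∈ T)
    (hn : ∃ a b : ℝ, 0 < a ∧ ∀ j, a ≤ M.n j ∧ a ≤ M.n j + M.v₂ ∧ M.n j ≤ b)
    (η : NEFQVF.Params p) (hη : η ∈ interior K)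
    -- the areas `(θ j, y j)` are independent and follow the mixed model with parameter `η`
    {Ω : Type*} [MeasurableSpace Ω] (μ : Measure Ω) [IsProbabilityMeasure μ]
    (θ y : ℕ → Ω → ℝ) (hθ_meas : ∀ j, Measurable (θ j)) (hy_meas : ∀ j, Measurable (y j))
    (hindep : iIndepFun (fun j ω => (θ j ω, y j ω)) μ)
    (hlaw : ∀ j, μ.map (fun ω => (θ j ω, y j ω)) = M.areaLaw j η)
    -- the information matrix grows linearly
    (hU : ∃ c : ℝ, 0 < c ∧ ∀ᶠ m : ℕ in atTop, ∀ u : NEFQVF.Params p,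
      c * m * (u ⬝ᵥ u) ≤ u ⬝ᵥ (M.U m η *ᵥ u))
    -- the true parameter is the well separated zero in `K` of the expected estimating function
    (hident : ∀ ε : ℝ, 0 < ε → ∃ δ : ℝ, 0 < δ ∧ ∀ᶠ m : ℕ in atTop, ∀ η' ∈ K, ε ≤ dist η' η →
      δ * m ≤ ‖∫ ω, M.score m η' (fun j : Fin m => y j ω) ∂μ‖)
    (est : (m : ℕ) → (Fin m → ℝ) → NEFQVF.Params p) (hest : M.IsGTEstimator K est)
    (i : ℕ) :
    -- the Bayes estimator and the posterior variance
    (μ[fun ω => deriv M.ψ (θ i ω) | MeasurableSpace.comap (y i) inferInstance]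
      =ᵐ[μ] fun ω => M.bayes i η (y i ω)) ∧
    (condVar (MeasurableSpace.comap (y i) inferInstance) (fun ω => deriv M.ψ (θ i ω)) μ
      =ᵐ[μ] fun ω => M.T1cond i η (y i ω)) ∧
    -- averages of the two terms of the conditional approximation
    (Integrable (fun ω => M.T1cond i η (y i ω)) μ ∧
      ∫ ω, M.T1cond i η (y i ω) ∂μ = M.T1 i η) ∧
    (∀ m, Integrable (fun ω => M.T2cond m i η (y i ω)) μ ∧
      ∫ ω, M.T2cond m i η (y i ω) ∂μ = M.T2 m i η) ∧
    -- the approximation of the unconditional MSE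
    (∀ m, i < m → Integrable (fun ω => M.ebError θ y est m i ω ^ 2) μ) ∧
    ((fun m : ℕ => M.MSE μ θ y est m i - (M.T1 i η + M.T2 m i η))
      =o[atTop] fun m : ℕ => (m : ℝ)⁻¹) := by
  have h : M.Regular K η := ⟨hK, hν, hx, hn, hη⟩
  have hadm := h.admissible hM i
  have hmse := h.mse_expansion hM hθ_meas hy_meas hindep hlaw hU hident hest i
  exact ⟨NEFQVF.AreaModel.condExp_deriv_ae_eq hM hadm (hθ_meas i) (hy_meas i) (hlaw i),
    NEFQVF.AreaModel.condVar_deriv_ae_eq hM hadm (hθ_meas i) (hy_meas i) (hlaw i),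
    NEFQVF.AreaModel.integral_T1cond_comp hM hadm (hθ_meas i) (hy_meas i) (hlaw i),
    NEFQVF.AreaModel.integral_T2cond_comp hM hadm (hθ_meas i) (hy_meas i) (hlaw i),
    fun m _ => hmse.1 m, hmse.2⟩
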